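/- Conventions. All $2$-categories are strict $2$-categories whose hom-categories have objects and arrows in one fixed universe, and $\mathsf{Cat}$ is the $2$-category of categories in that universe. $\mathcal X^{\mathrm{op}}$ reverses $1$-cells only. A *pseudomonad* $\mathcal T=(\mathcal T,m,\eta,\mu,\iota,\tau)$ on a $2$-category $\mathfrak B$ consists of a pseudofunctor $\mathcal T:\mathfrak B\to\mathfrak B$, pseudonatural transformations $m:\mathcal T^2\to\mathcal T$, $\eta:\mathrm{Id}\to\mathcal T$ and invertible modifications $\mu:m\cdot\mathcal Tm\Rightarrow m\cdot m\mathcal T$, $\iota:m\cdot\eta\mathcal T\Rightarrow\mathrm{id}_{\mathcal T}$, $\tau:\mathrm{id}_{\mathcal T}\Rightarrow m\cdot\mathcal T\eta$ satisfying the usual associativity and identity coherence equations (below, the constraints of $\mathcal T$ are suppressed). A *lax $\mathcal T$-algebra* is $\mathtt y=(Y,a,\overline{\mathtt y},\overline{\mathtt y}_0)$ with $a:\mathcal TY\to Y$ and $2$-cells $\overline{\mathtt y}:a\,\mathcal T(a)\Rightarrow a\,m_Y$, $\overline{\mathtt y}_0:\mathrm{id}_Y\Rightarrow a\,\eta_Y$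 such that $(a\ast\mu_Y)(\overline{\mathtt y}\ast\mathcal Tm_Y)(a\ast\mathcal T\overline{\mathtt y})=(\overline{\mathtt y}\ast m_{\mathcal TY})(a\ast m_a)(\overline{\mathtt y}\ast\mathcal T^2a)$, $(a\ast\iota_Y)(\overline{\mathtt y}\ast\eta_{\mathcal TY})(a\ast\eta_a)(\overline{\mathtt y}_0\ast a)=\mathrm{id}_a$ and $(a\ast\tau_Y^{-1})(\overline{\mathtt y}\ast\mathcal T\eta_Y)(a\ast\mathcal T\overline{\mathtt y}_0)=\mathrm{id}_a$; it is a *pseudoalgebra* if $\overline{\mathtt y},\overline{\mathtt y}_0$ are invertible. A *lax $\mathcal T$-morphism* $(Y,a,\overline{\mathtt y},\overline{\mathtt y}_0)\to(Z,b,\overline{\mathtt z},\overline{\mathtt z}_0)$ is a $1$-cell $f:Y\to Z$ with a $2$-cell $\langle\overline f\rangle:b\,\mathcal T(f)\Rightarrow f\,a$ such that $(f\ast\overline{\mathtt y})(\langle\overline f\rangle\ast\mathcal Ta)(b\ast\mathcal T\langle\overline f\rangle)=(\langle\overline f\rangle\ast m_Y)(b\ast m_f)(\overline{\mathtt z}\ast\mathcal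 T^2f)$ and $(\langle\overline f\rangle\ast\eta_Y)(b\ast\eta_f)(\overline{\mathtt z}_0\ast f)=f\ast\overline{\mathtt y}_0$; it is a *pseudomorphism* if $\langle\overline f\rangle$ is invertible. A *$\mathcal T$-transformation* $f\Rightarrow g$ is a $2$-cell $x:f\Rightarrow g$ with $\langle\overline g\rangle(b\ast\mathcal Tx)=(x\ast a)\langle\overline f\rangle$. With $\mathcal T$-transformations as $2$-cells, $\mathsf{Lax}\text{-}\mathcal T\text{-}\mathsf{Alg}_\ell$ is the $2$-category of lax algebras and lax morphisms, $\mathsf{Lax}\text{-}\mathcal T\text{-}\mathsf{Alg}$ that of lax algebras and pseudomorphisms, and $\mathsf{Ps}\text{-}\mathcal T\text{-}\mathsf{Alg}$ that of pseudoalgebras and pseudomorphisms. Let $\Delta_\ell$ be the $2$-category freely generated by objects $\mathsf 1,\mathsf 2,\mathsf 3$, $1$-cells $d^0,d^1:\mathsf 1\to\mathsf 2$, $s^0:\mathsf 2\to\mathsf 1$, $\partial^0,\partial^1,\partial^2:\mathsf 2\to\mathsf 3$ and $2$-cells $\sigma_{00}:\partial^0d^0\Rightarrow\partial^1d^0$,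 $\sigma_{20}:\partial^2d^0\Rightarrow\partial^0d^1$, $\sigma_{21}:\partial^2d^1\Rightarrow\partial^1d^1$, $n_0:\mathrm{id}_{\mathsf 1}\Rightarrow s^0d^0$, $n_1:\mathrm{id}_{\mathsf 1}\Rightarrow s^0d^1$. Let $\dot\Delta_\ell$ be obtained from $\Delta_\ell$ by freely adjoining an object $\mathsf 0$, a $1$-cell $d:\mathsf 0\to\mathsf 1$ and a $2$-cell $\vartheta:d^1d\Rightarrow d^0d$ subject to $(\sigma_{00}\ast d)(\partial^0\ast\vartheta)(\sigma_{20}\ast d)(\partial^2\ast\vartheta)=(\partial^1\ast\vartheta)(\sigma_{21}\ast d)$ and $(s^0\ast\vartheta)(n_1\ast d)=n_0\ast d$, and let $\dot\Delta$ be obtained from $\dot\Delta_\ell$ by freely adjoining an inverse of $\vartheta$; let $\mathrm t:\Delta_\ell\to\dot\Delta_\ell$ and $\mathrm j:\Delta_\ell\to\dot\Delta$ be the inclusions. The *lax codescent object* (resp. *codescent object*) of a $2$-functor $\mathcal A:\Delta_\ell^{\mathrm{op}}\to\mathfrak A$ is its weighted bicolimit with weight $\mathcal W=\dot\Delta_\ell(\mathsf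 0,\mathrm t-)$ (resp. $\mathcal W=\dot\Delta(\mathsf 0,\mathrm j-)$), i.e. an object $C$ with a pseudonatural transformation $\mathcal W\to\mathfrak A(\mathcal A-,C)$ inducing, for each $X$, an equivalence between $\mathfrak A(C,X)$ and the category of pseudonatural transformations $\mathcal W\to\mathfrak A(\mathcal A-,X)$ and modifications. The $2$-category $\mathfrak A$ *has (lax) codescent objects* if every such $\mathcal A$ has one. A pseudofunctor $R:\mathfrak A\to\mathfrak C$ *has a left biadjoint* if there are a pseudofunctor $E:\mathfrak C\to\mathfrak A$, pseudonatural transformations $\rho:\mathrm{Id}\to RE$, $\varepsilon:ER\to\mathrm{Id}$ and invertible modifications $v:\mathrm{id}_E\Rightarrow(\varepsilon E)(E\rho)$, $w:(R\varepsilon)(\rho R)\Rightarrow\mathrm{id}_R$ satisfying the two swallowtail (triangle coherence) equations. **Theorem.** Let $\mathcal T=(\mathcal T,m,\eta,\mu,\iota,\tau)$ be a pseudomonad on a $2$-category $\mathfrak B$. 1. If $\mathsf{Ps}\text{-}\mathcal T\text{-}\mathsf{Alg}$ has lax codescent objects, then the inclusion $\mathsf{Ps}\text{-}\mathcal T\text{-}\mathsf{Alg}\to\mathsf{Lax}\text{-}\mathcal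 T\text{-}\mathsf{Alg}_\ell$ has a left biadjoint. 2. If $\mathsf{Ps}\text{-}\mathcal T\text{-}\mathsf{Alg}$ has codescent objects, then the inclusion $\mathsf{Ps}\text{-}\mathcal T\text{-}\mathsf{Alg}\to\mathsf{Lax}\text{-}\mathcal T\text{-}\mathsf{Alg}$ has a left biadjoint. -/

import Mathlib

universe w v u w₁ v₁ u₁ w₂ v₂ u₂

namespace LaxCoh

open CategoryTheory Bicategory

section Squares

variable {B : Type u} [Bicategory.{w, v} B]

/-- Vertical pasting of two squares filled by 2-cells. -/
def vpaste {a b c a' b' c' : B} {f : a ⟶ a'} {g : b ⟶ b'} {h : c ⟶ c'}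
    {k : a ⟶ b} {k' : a' ⟶ b'} {l : b ⟶ c} {l' : b' ⟶ c'}
    (σ : f ≫ k' ⟶ k ≫ g) (τ : g ≫ l' ⟶ l ≫ h) : f ≫ (k' ≫ l') ⟶ (k ≫ l) ≫ h :=
  (α_ f k' l').inv ≫ σ ▷ l' ≫ (α_ k g l').hom ≫ k ◁ τ ≫ (α_ k l h).inv

/-- Horizontal pasting of two squares filled by 2-cells. -/
def hpaste {a b c a' b' c' : B} {f : a ⟶ b} {g : b ⟶ c} {f' : a' ⟶ b'} {g' : b' ⟶ c'}
    {k : a ⟶ a'} {l : b ⟶ b'} {n : c ⟶ c'}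
    (σ : f ≫ l ⟶ k ≫ f') (τ : g ≫ n ⟶ l ≫ g') : (f ≫ g) ≫ n ⟶ k ≫ (f' ≫ g') :=
  (α_ f g n).hom ≫ f ◁ τ ≫ (α_ f l g').inv ≫ σ ▷ g' ≫ (α_ k f' g').hom

theorem vpaste_hpaste {a b c a' b' c' a'' b'' c'' : B}
    {f : a ⟶ b} {g : b ⟶ c} {f' : a' ⟶ b'} {g' : b' ⟶ c'} {f'' : a'' ⟶ b''} {g'' : b'' ⟶ c''}
    {k : a ⟶ a'} {l : b ⟶ b'} {n : c ⟶ c'} {k' : a' ⟶ a''} {l' : b' ⟶ b''} {n' : c' ⟶ c''}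
    (σ₁ : f ≫ l ⟶ k ≫ f') (σ₂ : g ≫ n ⟶ l ≫ g')
    (τ₁ : f' ≫ l' ⟶ k' ≫ f'') (τ₂ : g' ≫ n' ⟶ l' ≫ g'') :
    vpaste (hpaste σ₁ σ₂) (hpaste τ₁ τ₂) = hpaste (vpaste σ₁ τ₁) (vpaste σ₂ τ₂) := by
  simp only [vpaste, hpaste]
  calc _ = 𝟙 _ ⊗≫ f ◁ σ₂ ▷ n' ⊗≫ (σ₁ ▷ (g' ≫ n') ≫ (k ≫ f') ◁ τ₂) ⊗≫ k ◁ τ₁ ▷ g'' ⊗≫ 𝟙 _ := by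
        bicategory
    _ = 𝟙 _ ⊗≫ f ◁ σ₂ ▷ n' ⊗≫ ((f ≫ l) ◁ τ₂ ≫ σ₁ ▷ (l' ≫ g'')) ⊗≫ k ◁ τ₁ ▷ g'' ⊗≫ 𝟙 _ := by
        rw [whisker_exchange]
    _ = _ := by bicategory

variable {C : Type u₁} [Bicategory.{w₁, v₁} C]

/-- The image of a filled square under a pseudofunctor, conjugated by the composition constraints. -/
def mapSq (F : B ⥤ᵖ C) {a b a' b' : B} {f : a ⟶ b} {k : a ⟶ a'} {l : b ⟶ b'} {f' : a' ⟶ b'}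
    (σ : f ≫ l ⟶ k ≫ f') : F.map f ≫ F.map l ⟶ F.map k ≫ F.map f' :=
  (F.mapComp f l).inv ≫ F.map₂ σ ≫ (F.mapComp k f').hom

theorem mapSq_hpaste (F : B ⥤ᵖ C) {a b c a' b' c' : B} {f : a ⟶ b} {g : b ⟶ c} {f' : a' ⟶ b'}
    {g' : b' ⟶ c'} {k : a ⟶ a'} {l : b ⟶ b'} {n : c ⟶ c'}
    (σ : f ≫ l ⟶ k ≫ f') (τ : g ≫ n ⟶ l ≫ g') :
    mapSq F (hpaste σ τ) = (F.mapComp f g).hom ▷ F.map n ≫ hpaste (mapSq F σ) (mapSq F τ) ≫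
      F.map k ◁ (F.mapComp f' g').inv := by
  have h : (F.mapComp f (l ≫ g')).inv ≫ F.map₂ (α_ f l g').inv ≫ (F.mapComp (f ≫ l) g').hom =
      F.map f ◁ (F.mapComp l g').hom ≫ (α_ (F.map f) (F.map l) (F.map g')).inv ≫
        (F.mapComp f l).inv ▷ F.map g' := by
    rw [Iso.inv_comp_eq, F.mapComp_assoc_right_hom_assoc]
    simp
  simp [mapSq, hpaste, reassoc_of% h]

theorem vpaste_whisker {a b c a' b' c' : B} {f f₁ : a ⟶ a'} {g g₁ : b ⟶ b'} {h h₁ : c ⟶ c'}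
    {k : a ⟶ b} {k' : a' ⟶ b'} {l : b ⟶ c} {l' : b' ⟶ c'}
    (x : f ⟶ f₁) (y : g ⟶ g₁) (z : h ⟶ h₁)
    {σ : f ≫ k' ⟶ k ≫ g} {σ₁ : f₁ ≫ k' ⟶ k ≫ g₁} {τ : g ≫ l' ⟶ l ≫ h} {τ₁ : g₁ ≫ l' ⟶ l ≫ h₁}
    (e : x ▷ k' ≫ σ₁ = σ ≫ k ◁ y) (e' : y ▷ l' ≫ τ₁ = τ ≫ l ◁ z) :
    x ▷ (k' ≫ l') ≫ vpaste σ₁ τ₁ = vpaste σ τ ≫ (k ≫ l) ◁ z := by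
  have h1 : x ▷ k' ▷ l' ≫ σ₁ ▷ l' = σ ▷ l' ≫ (k ◁ y) ▷ l' := by
    rw [← comp_whiskerRight, e, comp_whiskerRight]
  have h2 : k ◁ y ▷ l' ≫ k ◁ τ₁ = k ◁ τ ≫ k ◁ l ◁ z := by
    rw [← whiskerLeft_comp, e', whiskerLeft_comp]
  simp only [vpaste, whiskerRight_comp, Category.assoc, Iso.hom_inv_id_assoc, comp_whiskerLeft,
    Iso.inv_hom_id_assoc]
  rw [reassoc_of% h1]
  simp only [whisker_assoc, Category.assoc, Iso.inv_hom_id_assoc]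
  rw [reassoc_of% h2]

theorem hpaste_whisker {a b c a' b' c' : B} {f : a ⟶ b} {g : b ⟶ c} {f' : a' ⟶ b'} {g' : b' ⟶ c'}
    {k k₁ : a ⟶ a'} {l l₁ : b ⟶ b'} {n n₁ : c ⟶ c'}
    (p : k ⟶ k₁) (q : l ⟶ l₁) (r : n ⟶ n₁)
    {σ : f ≫ l ⟶ k ≫ f'} {σ₁ : f ≫ l₁ ⟶ k₁ ≫ f'} {τ : g ≫ n ⟶ l ≫ g'} {τ₁ : g ≫ n₁ ⟶ l₁ ≫ g'}
    (e : f ◁ q ≫ σ₁ = σ ≫ p ▷ f') (e' : g ◁ r ≫ τ₁ = τ ≫ q ▷ g') :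
    (f ≫ g) ◁ r ≫ hpaste σ₁ τ₁ = hpaste σ τ ≫ p ▷ (f' ≫ g') := by
  have h1 : (f ◁ q) ▷ g' ≫ σ₁ ▷ g' = σ ▷ g' ≫ p ▷ f' ▷ g' := by
    rw [← comp_whiskerRight, e, comp_whiskerRight]
  have h2 : f ◁ g ◁ r ≫ f ◁ τ₁ = f ◁ τ ≫ f ◁ q ▷ g' := by
    rw [← whiskerLeft_comp, e', whiskerLeft_comp]
  simp only [whisker_assoc, Category.assoc] at h1
  simp only [hpaste, whiskerRight_comp, Category.assoc, comp_whiskerLeft, Iso.inv_hom_id_assoc,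
    Iso.hom_inv_id_assoc]
  rw [reassoc_of% h2, ← reassoc_of% h1]
  simp only [Iso.inv_hom_id_assoc]

theorem mapSq_whisker (F : B ⥤ᵖ C) {a b a' b' : B} {f f₁ : a ⟶ b} {k : a ⟶ a'} {l : b ⟶ b'}
    {f' : a' ⟶ b'} (x : f ⟶ f₁) (σ : f₁ ≫ l ⟶ k ≫ f') :
    mapSq F (x ▷ l ≫ σ) = F.map₂ x ▷ F.map l ≫ mapSq F σ := by
  simp [mapSq]

theorem mapSq_unitors (F : B ⥤ᵖ C) {a b : B} (k : a ⟶ b) :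
    mapSq F ((λ_ k).hom ≫ (ρ_ k).inv) ≫ F.map k ◁ (F.mapId b).hom =
      (F.mapId a).hom ▷ F.map k ≫ (λ_ (F.map k)).hom ≫ (ρ_ (F.map k)).inv := by
  have h : F.map₂ (ρ_ k).inv ≫ (F.mapComp k (𝟙 b)).hom ≫ F.map k ◁ (F.mapId b).hom =
      (ρ_ (F.map k)).inv := by
    rw [F.mapComp_id_right_hom, Category.assoc, Category.assoc, ← F.map₂_comp_assoc]
    simp [-Pseudofunctor.map₂_right_unitor]
  simp [mapSq, h]

theorem vpaste_unitors {a b c : B} (k : a ⟶ b) (l : b ⟶ c) :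
    vpaste ((λ_ k).hom ≫ (ρ_ k).inv) ((λ_ l).hom ≫ (ρ_ l).inv) =
      (λ_ (k ≫ l)).hom ≫ (ρ_ (k ≫ l)).inv := by
  simp only [vpaste]
  bicategory

theorem hpaste_unitors {a b c : B} (f : a ⟶ b) (g : b ⟶ c) :
    hpaste ((ρ_ f).hom ≫ (λ_ f).inv) ((ρ_ g).hom ≫ (λ_ g).inv) =
      (ρ_ (f ≫ g)).hom ≫ (λ_ (f ≫ g)).inv := by
  simp only [hpaste]
  bicategory

variable (F : B ⥤ᵖ B) {X Y Z W : B} {x : F.obj X ⟶ X} {y : F.obj Y ⟶ Y} {z : F.obj Z ⟶ Z}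
  {t : F.obj W ⟶ W}

theorem cell_whiskerLeft {f : X ⟶ Y} {g h : Y ⟶ Z} (fc : F.map f ≫ y ⟶ x ≫ f)
    {gc : F.map g ≫ z ⟶ y ≫ g} {hc : F.map h ≫ z ⟶ y ≫ h} {p : g ⟶ h}
    (e : F.map₂ p ▷ z ≫ hc = gc ≫ y ◁ p) :
    F.map₂ (f ◁ p) ▷ z ≫ (F.mapComp f h).hom ▷ z ≫ hpaste fc hc =
      ((F.mapComp f g).hom ▷ z ≫ hpaste fc gc) ≫ x ◁ f ◁ p := by
  have e' : F.map f ◁ F.map₂ p ▷ z ≫ F.map f ◁ hc = F.map f ◁ gc ≫ F.map f ◁ y ◁ p := by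
    rw [← whiskerLeft_comp, e, whiskerLeft_comp]
  have e'' : (F.map f ≫ y) ◁ p ≫ fc ▷ h = fc ▷ g ≫ (x ≫ f) ◁ p := whisker_exchange _ _
  simp only [comp_whiskerLeft, Category.assoc] at e''
  rw [← Iso.eq_inv_comp] at e''
  simp [hpaste, reassoc_of% e', reassoc_of% e'']

theorem cell_whiskerRight {f g : X ⟶ Y} {h : Y ⟶ Z} {fc : F.map f ≫ y ⟶ x ≫ f}
    {gc : F.map g ≫ y ⟶ x ≫ g} (hc : F.map h ≫ z ⟶ y ≫ h) {p : f ⟶ g}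
    (e : F.map₂ p ▷ y ≫ gc = fc ≫ x ◁ p) :
    F.map₂ (p ▷ h) ▷ z ≫ (F.mapComp g h).hom ▷ z ≫ hpaste gc hc =
      ((F.mapComp f h).hom ▷ z ≫ hpaste fc hc) ≫ x ◁ p ▷ h := by
  have e' : F.map₂ p ▷ y ▷ h ≫ gc ▷ h = fc ▷ h ≫ (x ◁ p) ▷ h := by
    rw [← comp_whiskerRight, e, comp_whiskerRight]
  have e'' : F.map f ◁ hc ≫ F.map₂ p ▷ (y ≫ h) = F.map₂ p ▷ (F.map h ≫ z) ≫ F.map g ◁ hc :=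
    whisker_exchange _ _
  simp only [whiskerRight_comp, Category.assoc] at e''
  rw [Iso.eq_inv_comp] at e''
  simp [hpaste, ← reassoc_of% e'', reassoc_of% e']

theorem cell_associator {f : X ⟶ Y} {g : Y ⟶ Z} {h : Z ⟶ W} (fc : F.map f ≫ y ⟶ x ≫ f)
    (gc : F.map g ≫ z ⟶ y ≫ g) (hc : F.map h ≫ t ⟶ z ≫ h) :
    F.map₂ (α_ f g h).hom ▷ t ≫ (F.mapComp f (g ≫ h)).hom ▷ t ≫
        hpaste fc ((F.mapComp g h).hom ▷ t ≫ hpaste gc hc) =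
      ((F.mapComp (f ≫ g) h).hom ▷ t ≫
        hpaste ((F.mapComp f g).hom ▷ z ≫ hpaste fc gc) hc) ≫ x ◁ (α_ f g h).hom := by
  have e : F.map (f ≫ g) ◁ hc ≫ (F.mapComp f g).hom ▷ (z ≫ h) =
      (F.mapComp f g).hom ▷ (F.map h ≫ t) ≫ (F.map f ≫ F.map g) ◁ hc := whisker_exchange _ _
  simp only [whiskerRight_comp, comp_whiskerLeft, Category.assoc] at e
  rw [Iso.eq_inv_comp] at e
  simp only [← Category.assoc] at e
  rw [← Iso.eq_comp_inv] at e
  simp only [Category.assoc] at e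
  simp [hpaste, reassoc_of% e]

theorem cell_leftUnitor {f : X ⟶ Y} (fc : F.map f ≫ y ⟶ x ≫ f) :
    F.map₂ (λ_ f).hom ▷ y ≫ fc = ((F.mapComp (𝟙 X) f).hom ▷ y ≫
      hpaste ((F.mapId X).hom ▷ x ≫ (λ_ x).hom ≫ (ρ_ x).inv) fc) ≫ x ◁ (λ_ f).hom := by
  have e : F.map (𝟙 X) ◁ fc ≫ (F.mapId X).hom ▷ (x ≫ f) =
      (F.mapId X).hom ▷ (F.map f ≫ y) ≫ 𝟙 _ ◁ fc := whisker_exchange _ _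
  simp only [whiskerRight_comp, id_whiskerLeft, Category.assoc] at e
  rw [Iso.eq_inv_comp] at e
  simp [hpaste, reassoc_of% e]

theorem cell_rightUnitor {f : X ⟶ Y} (fc : F.map f ≫ y ⟶ x ≫ f) :
    F.map₂ (ρ_ f).hom ▷ y ≫ fc = ((F.mapComp f (𝟙 Y)).hom ▷ y ≫
      hpaste fc ((F.mapId Y).hom ▷ y ≫ (λ_ y).hom ≫ (ρ_ y).inv)) ≫ x ◁ (ρ_ f).hom := by
  simp [hpaste]

end Squares

section Pseudomonads

variable (B : Type u) [Bicategory.{w, v} B]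

/-- The underlying pseudofunctor, multiplication and unit of a pseudomonad. -/
structure PseudomonadData where
  /-- The endo-pseudofunctor. -/
  T : B ⥤ᵖ B
  /-- The multiplication `T² ⟶ T`. -/
  m : Pseudofunctor.StrongTrans (T.comp T) T
  /-- The unit `Id ⟶ T`. -/
  η : Pseudofunctor.StrongTrans (Pseudofunctor.id B) T

variable {B}

namespace PseudomonadData

variable (D : PseudomonadData B)

/-- The component `T (T X) ⟶ T X` of the multiplication. -/
def mApp (X : B) : D.T.obj (D.T.obj X) ⟶ D.T.obj X := D.m.app X

/-- The pseudonaturality constraint of the multiplication at a 1-cell. -/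
def mNat {X Y : B} (f : X ⟶ Y) : D.T.map (D.T.map f) ≫ D.mApp Y ≅ D.mApp X ≫ D.T.map f :=
  D.m.naturality f

/-- The component `X ⟶ T X` of the unit. -/
def ηApp (X : B) : X ⟶ D.T.obj X := D.η.app X

/-- The pseudonaturality constraint of the unit at a 1-cell. -/
def ηNat {X Y : B} (f : X ⟶ Y) : f ≫ D.ηApp Y ≅ D.ηApp X ≫ D.T.map f :=
  D.η.naturality f

theorem mNat_naturality {X Y : B} {f g : X ⟶ Y} (x : f ⟶ g) :
    D.T.map₂ (D.T.map₂ x) ▷ D.mApp Y ≫ (D.mNat g).hom = (D.mNat f).hom ≫ D.mApp X ◁ D.T.map₂ x :=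
  D.m.naturality_naturality x

theorem ηNat_naturality {X Y : B} {f g : X ⟶ Y} (x : f ⟶ g) :
    x ▷ D.ηApp Y ≫ (D.ηNat g).hom = (D.ηNat f).hom ≫ D.ηApp X ◁ D.T.map₂ x :=
  D.η.naturality_naturality x

theorem mNat_id (X : B) :
    (D.mNat (𝟙 X)).hom ≫ D.mApp X ◁ (D.T.mapId X).hom =
      (D.T.map₂ (D.T.mapId X).hom ≫ (D.T.mapId _).hom) ▷ D.mApp X ≫
        (λ_ (D.mApp X)).hom ≫ (ρ_ (D.mApp X)).inv :=
  D.m.naturality_id X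

theorem ηNat_id (X : B) :
    (D.ηNat (𝟙 X)).hom ≫ D.ηApp X ◁ (D.T.mapId X).hom =
      (λ_ (D.ηApp X)).hom ≫ (ρ_ (D.ηApp X)).inv := by
  refine (D.η.naturality_id X).trans ?_
  change 𝟙 _ ▷ _ ≫ _ = _
  rw [id_whiskerRight]
  exact Category.id_comp _

theorem mNat_comp {X Y Z : B} (f : X ⟶ Y) (g : Y ⟶ Z) :
    (D.mNat (f ≫ g)).hom ≫ D.mApp X ◁ (D.T.mapComp f g).hom =
      (D.T.map₂ (D.T.mapComp f g).hom ≫ (D.T.mapComp _ _).hom) ▷ D.mApp Z ≫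
        hpaste (D.mNat f).hom (D.mNat g).hom :=
  D.m.naturality_comp f g

theorem ηNat_comp {X Y Z : B} (f : X ⟶ Y) (g : Y ⟶ Z) :
    (D.ηNat (f ≫ g)).hom ≫ D.ηApp X ◁ (D.T.mapComp f g).hom =
      hpaste (D.ηNat f).hom (D.ηNat g).hom := by
  refine (D.η.naturality_comp f g).trans ?_
  change 𝟙 _ ▷ _ ≫ _ = _
  rw [id_whiskerRight]
  exact Category.id_comp _

end PseudomonadData

variable (B) in
/-- A pseudomonad: the multiplication and unit together with invertible modifications
`μ : m ∘ Tm ⇒ m ∘ mT`, `ι : m ∘ ηT ⇒ id`, `τ : id ⇒ m ∘ Tη` subject to the associativity and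
identity coherence equations. The modification axioms are the fields `_naturality`. -/
structure Pseudomonad extends PseudomonadData B where
  /-- The associativity modification. -/
  μ (X : B) : T.map (toPseudomonadData.mApp X) ≫ toPseudomonadData.mApp X ≅
    toPseudomonadData.mApp (T.obj X) ≫ toPseudomonadData.mApp X
  μ_naturality {X Y : B} (f : X ⟶ Y) :
    T.map (T.map (T.map f)) ◁ (μ Y).hom ≫
        vpaste (toPseudomonadData.mNat (T.map f)).hom (toPseudomonadData.mNat f).hom =
      vpaste (mapSq T (toPseudomonadData.mNat f).hom) (toPseudomonadData.mNat f).hom ≫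
        (μ X).hom ▷ T.map f
  /-- The left identity modification. -/
  ι (X : B) : toPseudomonadData.ηApp (T.obj X) ≫ toPseudomonadData.mApp X ≅ 𝟙 (T.obj X)
  ι_naturality {X Y : B} (f : X ⟶ Y) :
    T.map f ◁ (ι Y).hom ≫ (ρ_ (T.map f)).hom ≫ (λ_ (T.map f)).inv =
      vpaste (toPseudomonadData.ηNat (T.map f)).hom (toPseudomonadData.mNat f).hom ≫
        (ι X).hom ▷ T.map f
  /-- The right identity modification. -/
  τ (X : B) : 𝟙 (T.obj X) ≅ T.map (toPseudomonadData.ηApp X) ≫ toPseudomonadData.mApp X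
  τ_naturality {X Y : B} (f : X ⟶ Y) :
    T.map f ◁ (τ Y).hom ≫
        vpaste (mapSq T (toPseudomonadData.ηNat f).hom) (toPseudomonadData.mNat f).hom =
      (ρ_ (T.map f)).hom ≫ (λ_ (T.map f)).inv ≫ (τ X).hom ▷ T.map f
  associativity (X : B) :
    vpaste (mapSq T (μ X).hom) (μ X).hom ≫ (μ (T.obj X)).hom ▷ toPseudomonadData.mApp X =
      T.map (T.map (toPseudomonadData.mApp X)) ◁ (μ X).hom ≫
        vpaste (toPseudomonadData.mNat (toPseudomonadData.mApp X)).hom (μ X).hom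
  identity (X : B) :
    T.map (toPseudomonadData.ηApp (T.obj X)) ◁ (μ X).hom =
      (α_ _ _ _).inv ≫ ((T.mapComp _ _).inv ≫ T.map₂ (ι X).hom ≫ (T.mapId _).hom) ▷
        toPseudomonadData.mApp X ≫ (τ (T.obj X)).hom ▷ toPseudomonadData.mApp X ≫ (α_ _ _ _).hom

variable (T : Pseudomonad B)

/-- A lax `T`-algebra. -/
structure LaxAlg where
  /-- The underlying object. -/
  carrier : B
  /-- The structure 1-cell. -/
  act : T.T.obj carrier ⟶ carrier
  /-- The multiplication constraint. -/
  mult : T.T.map act ≫ act ⟶ T.mApp carrier ≫ act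
  /-- The unit constraint. -/
  unit : 𝟙 carrier ⟶ T.ηApp carrier ≫ act
  associativity :
    vpaste (mapSq T.T mult) mult ≫ (T.μ carrier).hom ▷ act =
      T.T.map (T.T.map act) ◁ mult ≫ vpaste (T.mNat act).hom mult
  identity_left :
    act ◁ unit ≫ vpaste (T.ηNat act).hom mult ≫ (T.ι carrier).hom ▷ act =
      (ρ_ act).hom ≫ (λ_ act).inv
  identity_right :
    (λ_ act).inv ≫ ((T.T.mapId _).inv ≫ T.T.map₂ unit ≫ (T.T.mapComp _ _).hom) ▷ act ≫
      (α_ _ _ _).hom ≫ T.T.map (T.ηApp carrier) ◁ mult ≫ (α_ _ _ _).inv ≫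
        (T.τ carrier).inv ▷ act ≫ (λ_ act).hom = 𝟙 act

variable {T}

namespace LaxAlg

/-- A lax `T`-morphism between lax `T`-algebras. -/
structure Hom (y z : LaxAlg T) where
  /-- The underlying 1-cell. -/
  base : y.carrier ⟶ z.carrier
  /-- The structure 2-cell. -/
  cell : T.T.map base ≫ z.act ⟶ y.act ≫ base
  map_mult :
    T.T.map (T.T.map base) ◁ z.mult ≫ vpaste (T.mNat base).hom cell =
      vpaste (mapSq T.T cell) cell ≫ y.mult ▷ base
  map_unit :
    base ◁ z.unit ≫ vpaste (T.ηNat base).hom cell =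
      (ρ_ base).hom ≫ (λ_ base).inv ≫ y.unit ▷ base

/-- A `T`-transformation between lax `T`-morphisms. -/
@[ext]
structure Hom₂ {y z : LaxAlg T} (f g : Hom y z) where
  /-- The underlying 2-cell. -/
  base : f.base ⟶ g.base
  comm : T.T.map₂ base ▷ z.act ≫ g.cell = f.cell ≫ y.act ◁ base

/-- The identity lax morphism. -/
def Hom.id (y : LaxAlg T) : Hom y y where
  base := 𝟙 y.carrier
  cell := (T.T.mapId y.carrier).hom ▷ y.act ≫ (λ_ y.act).hom ≫ (ρ_ y.act).inv
  map_mult := by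
    have h1 := vpaste_whisker (T.T.map₂ (T.T.mapId y.carrier).hom ≫ (T.T.mapId _).hom)
      (T.T.mapId y.carrier).hom (𝟙 (𝟙 y.carrier)) (T.mNat_id y.carrier).symm
      (σ₁ := (λ_ (T.mApp y.carrier)).hom ≫ (ρ_ (T.mApp y.carrier)).inv)
      (τ := (T.T.mapId y.carrier).hom ▷ y.act ≫ (λ_ y.act).hom ≫ (ρ_ y.act).inv)
      (τ₁ := (λ_ y.act).hom ≫ (ρ_ y.act).inv) (by simp)
    have h2 := vpaste_whisker (T.T.map₂ (T.T.mapId y.carrier).hom ≫ (T.T.mapId _).hom)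
      (T.T.mapId y.carrier).hom (𝟙 (𝟙 y.carrier))
      (σ := mapSq T.T ((T.T.mapId y.carrier).hom ▷ y.act ≫ (λ_ y.act).hom ≫ (ρ_ y.act).inv))
      (σ₁ := (λ_ (T.T.map y.act)).hom ≫ (ρ_ (T.T.map y.act)).inv)
      (τ := (T.T.mapId y.carrier).hom ▷ y.act ≫ (λ_ y.act).hom ≫ (ρ_ y.act).inv)
      (τ₁ := (λ_ y.act).hom ≫ (ρ_ y.act).inv)
      (by rw [mapSq_whisker, Category.assoc, mapSq_unitors]; simp) (by simp)
    rw [whiskerLeft_id, Category.comp_id, vpaste_unitors] at h1 h2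
    rw [← h1, ← h2, whisker_exchange_assoc]
    simp
  map_unit := by
    have h1 := vpaste_whisker (𝟙 (𝟙 y.carrier)) (T.T.mapId y.carrier).hom (𝟙 (𝟙 y.carrier))
      (σ := (T.ηNat (𝟙 y.carrier)).hom)
      (σ₁ := (λ_ (T.ηApp y.carrier)).hom ≫ (ρ_ (T.ηApp y.carrier)).inv)
      (τ := (T.T.mapId y.carrier).hom ▷ y.act ≫ (λ_ y.act).hom ≫ (ρ_ y.act).inv)
      (τ₁ := (λ_ y.act).hom ≫ (ρ_ y.act).inv)
      (by rw [T.ηNat_id, id_whiskerRight, Category.id_comp]) (by simp)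
    rw [whiskerLeft_id, Category.comp_id, vpaste_unitors, id_whiskerRight, Category.id_comp] at h1
    rw [← h1]
    simp [unitors_equal]

/-- Composition of lax morphisms. -/
def Hom.comp {x y z : LaxAlg T} (f : Hom x y) (g : Hom y z) : Hom x z where
  base := f.base ≫ g.base
  cell := (T.T.mapComp f.base g.base).hom ▷ z.act ≫ hpaste f.cell g.cell
  map_mult := by
    have h1 := vpaste_whisker
      (T.T.map₂ (T.T.mapComp f.base g.base).hom ≫ (T.T.mapComp _ _).hom)
      (T.T.mapComp f.base g.base).hom (𝟙 (f.base ≫ g.base)) (T.mNat_comp f.base g.base).symm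
      (τ := (T.T.mapComp f.base g.base).hom ▷ z.act ≫ hpaste f.cell g.cell)
      (τ₁ := hpaste f.cell g.cell) (by simp)
    have h2 := vpaste_whisker
      (T.T.map₂ (T.T.mapComp f.base g.base).hom ≫ (T.T.mapComp _ _).hom)
      (T.T.mapComp f.base g.base).hom (𝟙 (f.base ≫ g.base))
      (σ := mapSq T.T ((T.T.mapComp f.base g.base).hom ▷ z.act ≫ hpaste f.cell g.cell))
      (σ₁ := hpaste (mapSq T.T f.cell) (mapSq T.T g.cell))
      (τ := (T.T.mapComp f.base g.base).hom ▷ z.act ≫ hpaste f.cell g.cell)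
      (τ₁ := hpaste f.cell g.cell)
      (by rw [mapSq_whisker, mapSq_hpaste]; simp) (by simp)
    rw [whiskerLeft_id, Category.comp_id, vpaste_hpaste] at h1 h2
    rw [← h1, ← h2, whisker_exchange_assoc, Category.assoc]
    rw [hpaste_whisker x.mult y.mult z.mult f.map_mult g.map_mult]
  map_unit := by
    have h1 := vpaste_whisker (𝟙 (f.base ≫ g.base)) (T.T.mapComp f.base g.base).hom
      (𝟙 (f.base ≫ g.base)) (σ := (T.ηNat (f.base ≫ g.base)).hom)
      (σ₁ := hpaste (T.ηNat f.base).hom (T.ηNat g.base).hom)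
      (τ := (T.T.mapComp f.base g.base).hom ▷ z.act ≫ hpaste f.cell g.cell)
      (τ₁ := hpaste f.cell g.cell)
      (by rw [T.ηNat_comp, id_whiskerRight, Category.id_comp]) (by simp)
    rw [whiskerLeft_id, Category.comp_id, vpaste_hpaste, id_whiskerRight, Category.id_comp] at h1
    rw [← h1, hpaste_whisker x.unit y.unit z.unit
      (σ := (ρ_ f.base).hom ≫ (λ_ f.base).inv) (τ := (ρ_ g.base).hom ≫ (λ_ g.base).inv)
      (by rw [f.map_unit, Category.assoc]) (by rw [g.map_unit, Category.assoc]),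
      hpaste_unitors, Category.assoc]

instance : CategoryStruct (LaxAlg T) where
  Hom := Hom
  id := Hom.id
  comp := Hom.comp

instance (y z : LaxAlg T) : Category (y ⟶ z) where
  Hom f g := Hom₂ f g
  id f := ⟨𝟙 f.base, by simp⟩
  comp x x' := ⟨x.base ≫ x'.base, by simp [x'.comm, reassoc_of% x.comm]⟩
  id_comp _ := Hom₂.ext (Category.id_comp _)
  comp_id _ := Hom₂.ext (Category.comp_id _)
  assoc _ _ _ := Hom₂.ext (Category.assoc _ _ _)

theorem hom₂_ext {y z : LaxAlg T} {f g : y ⟶ z} {x x' : f ⟶ g} (h : x.base = x'.base) : x = x' :=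
  Hom₂.ext h

/-- An invertible `T`-transformation from an invertible 2-cell. -/
def isoMk {y z : LaxAlg T} {f g : y ⟶ z} (e : f.base ≅ g.base)
    (h : T.T.map₂ e.hom ▷ z.act ≫ g.cell = f.cell ≫ y.act ◁ e.hom) : f ≅ g where
  hom := ⟨e.hom, h⟩
  inv := ⟨e.inv, by
    rw [← cancel_epi (T.T.map₂ e.hom ▷ z.act), reassoc_of% h, ← comp_whiskerRight_assoc,
      ← T.T.map₂_comp]
    simp⟩
  hom_inv_id := hom₂_ext e.hom_inv_id
  inv_hom_id := hom₂_ext e.inv_hom_id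

/-- Left whiskering of a `T`-transformation. -/
def Hom₂.whiskerLeft {x y z : LaxAlg T} (f : x ⟶ y) {g h : y ⟶ z} (t : g ⟶ h) :
    f ≫ g ⟶ f ≫ h :=
  ⟨Hom.base f ◁ t.base, cell_whiskerLeft T.T (Hom.cell f) t.comm⟩

/-- Right whiskering of a `T`-transformation. -/
def Hom₂.whiskerRight {x y z : LaxAlg T} {f g : x ⟶ y} (t : f ⟶ g) (h : y ⟶ z) :
    f ≫ h ⟶ g ≫ h :=
  ⟨t.base ▷ Hom.base h, cell_whiskerRight T.T (Hom.cell h) t.comm⟩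

/-- The associator of lax morphisms. -/
def assocIso {x y z t : LaxAlg T} (f : x ⟶ y) (g : y ⟶ z) (h : z ⟶ t) :
    (f ≫ g) ≫ h ≅ f ≫ g ≫ h :=
  isoMk (α_ (Hom.base f) (Hom.base g) (Hom.base h))
    (cell_associator T.T (Hom.cell f) (Hom.cell g) (Hom.cell h))

/-- The left unitor of lax morphisms. -/
def leftUnitorIso {x y : LaxAlg T} (f : x ⟶ y) : 𝟙 x ≫ f ≅ f :=
  isoMk (λ_ (Hom.base f)) (cell_leftUnitor T.T (Hom.cell f))

/-- The right unitor of lax morphisms. -/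
def rightUnitorIso {x y : LaxAlg T} (f : x ⟶ y) : f ≫ 𝟙 y ≅ f :=
  isoMk (ρ_ (Hom.base f)) (cell_rightUnitor T.T (Hom.cell f))

instance : Bicategory (LaxAlg T) where
  whiskerLeft f _ _ t := Hom₂.whiskerLeft f t
  whiskerRight t h := Hom₂.whiskerRight t h
  associator f g h := assocIso f g h
  leftUnitor f := leftUnitorIso f
  rightUnitor f := rightUnitorIso f
  whiskerLeft_id _ _ := hom₂_ext (whiskerLeft_id _ _)
  whiskerLeft_comp _ _ _ _ _ _ := hom₂_ext (whiskerLeft_comp _ _ _)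
  id_whiskerLeft _ := hom₂_ext (id_whiskerLeft _)
  comp_whiskerLeft _ _ _ _ _ := hom₂_ext (comp_whiskerLeft _ _ _)
  id_whiskerRight _ _ := hom₂_ext (id_whiskerRight _ _)
  comp_whiskerRight _ _ _ := hom₂_ext (comp_whiskerRight _ _ _)
  whiskerRight_id _ := hom₂_ext (whiskerRight_id _)
  whiskerRight_comp _ _ _ := hom₂_ext (whiskerRight_comp _ _ _)
  whisker_assoc _ _ _ _ _ := hom₂_ext (whisker_assoc _ _ _)
  whisker_exchange _ _ := hom₂_ext (whisker_exchange _ _)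
  pentagon _ _ _ _ := hom₂_ext (pentagon _ _ _ _)
  triangle _ _ := hom₂_ext (triangle _ _)

end LaxAlg

end Pseudomonads

section SubTwoCategories

variable (C : Type u) [Bicategory.{w, v} C]

/-- Data of a locally full sub-2-category: a class of objects, and a class of 1-cells closed under
identities and composition; all 2-cells between such 1-cells are kept. -/
structure LocallyFull where
  /-- The objects of the sub-2-category. -/
  objProp : C → Prop
  /-- The 1-cells of the sub-2-category. -/
  homProp : ∀ {a b : C}, (a ⟶ b) → Prop
  id_mem (a : C) : homProp (𝟙 a)
  comp_mem {a b c : C} (f : a ⟶ b) (g : b ⟶ c) : homProp f → homProp g → homProp (f ≫ g)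

variable {C}

namespace LocallyFull

/-- The objects of the sub-2-category. -/
structure Obj (S : LocallyFull C) where
  /-- The underlying object. -/
  obj : C
  property : S.objProp obj

variable {S S' : LocallyFull C}

/-- The 1-cells of the sub-2-category. -/
@[ext]
structure Hom (X Y : S.Obj) where
  /-- The underlying 1-cell. -/
  hom : X.obj ⟶ Y.obj
  property : S.homProp hom

instance : CategoryStruct S.Obj where
  Hom X Y := Hom X Y
  id X := ⟨𝟙 X.obj, S.id_mem _⟩
  comp f g := ⟨f.hom ≫ g.hom, S.comp_mem _ _ f.property g.property⟩

/-- The underlying 1-cell. -/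
def un {X Y : S.Obj} (f : X ⟶ Y) : X.obj ⟶ Y.obj := Hom.hom f

/-- The 2-cells of the sub-2-category. -/
@[ext]
structure Hom₂ {X Y : S.Obj} (f g : X ⟶ Y) where
  /-- The underlying 2-cell. -/
  hom : un f ⟶ un g

instance homCat (X Y : S.Obj) : Category (X ⟶ Y) where
  Hom f g := Hom₂ f g
  id f := ⟨𝟙 (un f)⟩
  comp s t := ⟨s.hom ≫ t.hom⟩
  id_comp _ := Hom₂.ext (Category.id_comp _)
  comp_id _ := Hom₂.ext (Category.comp_id _)
  assoc _ _ _ := Hom₂.ext (Category.assoc _ _ _)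

/-- The underlying 2-cell. -/
def un₂ {X Y : S.Obj} {f g : X ⟶ Y} (s : f ⟶ g) : un f ⟶ un g := Hom₂.hom s

/-- 2-cells of the sub-2-category from 2-cells of the ambient one. -/
def mk₂ {X Y : S.Obj} (f g : X ⟶ Y) (s : un f ⟶ un g) : f ⟶ g := Hom₂.mk s

theorem hom₂_ext {X Y : S.Obj} {f g : X ⟶ Y} {s t : f ⟶ g} (h : un₂ s = un₂ t) : s = t :=
  Hom₂.ext h

/-- Invertible 2-cells of the sub-2-category. -/
def isoMk {X Y : S.Obj} (f g : X ⟶ Y) (e : un f ≅ un g) : f ≅ g where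
  hom := mk₂ f g e.hom
  inv := mk₂ g f e.inv
  hom_inv_id := hom₂_ext e.hom_inv_id
  inv_hom_id := hom₂_ext e.inv_hom_id

instance bicategory : Bicategory S.Obj where
  homCategory := homCat
  whiskerLeft f g h s := mk₂ (f ≫ g) (f ≫ h) (un f ◁ un₂ s)
  whiskerRight {_ _ _} f g s h := mk₂ (f ≫ h) (g ≫ h) (un₂ s ▷ un h)
  associator f g h := isoMk ((f ≫ g) ≫ h) (f ≫ g ≫ h) (α_ (un f) (un g) (un h))
  leftUnitor {X _} f := isoMk (𝟙 X ≫ f) f (λ_ (un f))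
  rightUnitor {_ Y} f := isoMk (f ≫ 𝟙 Y) f (ρ_ (un f))
  whiskerLeft_id _ _ := hom₂_ext (whiskerLeft_id _ _)
  whiskerLeft_comp _ _ _ _ _ _ := hom₂_ext (whiskerLeft_comp _ _ _)
  id_whiskerLeft _ := hom₂_ext (id_whiskerLeft _)
  comp_whiskerLeft _ _ _ _ _ := hom₂_ext (comp_whiskerLeft _ _ _)
  id_whiskerRight _ _ := hom₂_ext (id_whiskerRight _ _)
  comp_whiskerRight _ _ _ := hom₂_ext (comp_whiskerRight _ _ _)
  whiskerRight_id _ := hom₂_ext (whiskerRight_id _)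
  whiskerRight_comp _ _ _ := hom₂_ext (whiskerRight_comp _ _ _)
  whisker_assoc _ _ _ _ _ := hom₂_ext (whisker_assoc _ _ _)
  whisker_exchange _ _ := hom₂_ext (whisker_exchange _ _)
  pentagon _ _ _ _ := hom₂_ext (pentagon _ _ _ _)
  triangle _ _ := hom₂_ext (triangle _ _)

theorem un_inj {X Y : S.Obj} {f g : X ⟶ Y} (h : un f = un g) : f = g := Hom.ext h

theorem un₂_eqToIso {X Y : S.Obj} {f g : X ⟶ Y} (h : f = g) :
    un₂ (eqToIso h).hom = (eqToIso (congrArg un h)).hom := by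
  subst h
  rfl

instance [Strict C] : Strict S.Obj where
  id_comp f := un_inj (Strict.id_comp (un f))
  comp_id f := un_inj (Strict.comp_id (un f))
  assoc f g h := un_inj (Strict.assoc (un f) (un g) (un h))
  leftUnitor_eqToIso f := Iso.ext (hom₂_ext
    ((congrArg Iso.hom (Strict.leftUnitor_eqToIso (un f))).trans
      (un₂_eqToIso (f := 𝟙 _ ≫ f) (g := f) _).symm))
  rightUnitor_eqToIso f := Iso.ext (hom₂_ext
    ((congrArg Iso.hom (Strict.rightUnitor_eqToIso (un f))).trans
      (un₂_eqToIso (f := f ≫ 𝟙 _) (g := f) _).symm))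
  associator_eqToIso f g h := Iso.ext (hom₂_ext
    ((congrArg Iso.hom (Strict.associator_eqToIso (un f) (un g) (un h))).trans
      (un₂_eqToIso (f := (f ≫ g) ≫ h) (g := f ≫ g ≫ h) _).symm))

/-- The inclusion of a locally full sub-2-category. -/
def incl (S : LocallyFull C) : S.Obj ⥤ᵖ C where
  obj X := X.obj
  map f := un f
  map₂ s := un₂ s
  map₂_id _ := rfl
  map₂_comp _ _ := rfl
  mapId _ := Iso.refl _
  mapComp _ _ := Iso.refl _
  map₂_whisker_left f _ _ s := by
    change un f ◁ un₂ s = 𝟙 _ ≫ un f ◁ un₂ s ≫ 𝟙 _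
    simp
  map₂_whisker_right s h := by
    change un₂ s ▷ un h = 𝟙 _ ≫ un₂ s ▷ un h ≫ 𝟙 _
    simp
  map₂_associator f g h := by
    change (α_ (un f) (un g) (un h)).hom =
      𝟙 _ ≫ 𝟙 (un f ≫ un g) ▷ _ ≫ (α_ (un f) (un g) (un h)).hom ≫ _ ◁ 𝟙 (un g ≫ un h) ≫ 𝟙 _
    simp
  map₂_left_unitor {X _} f := by
    change (λ_ (un f)).hom = 𝟙 _ ≫ 𝟙 (𝟙 X.obj) ▷ _ ≫ (λ_ (un f)).hom
    simp
  map₂_right_unitor {_ Y} f := by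
    change (ρ_ (un f)).hom = 𝟙 _ ≫ _ ◁ 𝟙 (𝟙 Y.obj) ≫ (ρ_ (un f)).hom
    simp

/-- The inclusion between two locally full sub-2-categories. -/
def inclOfLE (S S' : LocallyFull C) (ho : ∀ X, S.objProp X → S'.objProp X)
    (hh : ∀ {X Y : C} (f : X ⟶ Y), S.homProp f → S'.homProp f) : S.Obj ⥤ᵖ S'.Obj where
  obj X := ⟨X.obj, ho _ X.property⟩
  map f := Hom.mk (un (S := S) f) (hh _ (Hom.property f))
  map₂ s := Hom₂.mk (un₂ (S := S) s)
  map₂_id _ := rfl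
  map₂_comp _ _ := rfl
  mapId _ := isoMk _ _ (Iso.refl _)
  mapComp _ _ := isoMk _ _ (Iso.refl _)
  map₂_whisker_left f _ _ s := hom₂_ext (S.incl.map₂_whisker_left f s)
  map₂_whisker_right s h := hom₂_ext (S.incl.map₂_whisker_right s h)
  map₂_associator f g h := hom₂_ext (S.incl.map₂_associator f g h)
  map₂_left_unitor f := hom₂_ext (S.incl.map₂_left_unitor f)
  map₂_right_unitor f := hom₂_ext (S.incl.map₂_right_unitor f)

end LocallyFull

end SubTwoCategories

section Algebras

variable {B : Type u} [Bicategory.{w, v} B] (T : Pseudomonad B)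

namespace LaxAlg

theorem Hom.eq_of_base_eq {y z : LaxAlg T} {f g : y ⟶ z} (h : f.base = g.base)
    (e : T.T.map₂ (eqToHom h) ▷ z.act ≫ g.cell = f.cell ≫ y.act ◁ eqToHom h) : f = g := by
  obtain ⟨f, fc, _, _⟩ := f
  obtain ⟨g, gc, _, _⟩ := g
  dsimp only at h e
  subst h
  simp at e
  subst e
  rfl

theorem eqToIso_base {y z : LaxAlg T} {f g : y ⟶ z} (h : f = g) :
    (eqToIso h).hom.base = (eqToIso (congrArg Hom.base h)).hom := by
  subst h
  rfl

theorem Hom.eq_of_iso {y z : LaxAlg T} {f g : y ⟶ z} (e : f ≅ g) (h : f.base = g.base)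
    (he : e.hom.base = eqToHom h) : f = g :=
  Hom.eq_of_base_eq T h (he ▸ e.hom.comm)

instance [Strict B] : Strict (LaxAlg T) where
  id_comp f := Hom.eq_of_iso T (λ_ f) (Strict.id_comp (Hom.base f))
    (congrArg Iso.hom (Strict.leftUnitor_eqToIso (Hom.base f)))
  comp_id f := Hom.eq_of_iso T (ρ_ f) (Strict.comp_id (Hom.base f))
    (congrArg Iso.hom (Strict.rightUnitor_eqToIso (Hom.base f)))
  assoc f g h := Hom.eq_of_iso T (α_ f g h)
    (Strict.assoc (Hom.base f) (Hom.base g) (Hom.base h))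
    (congrArg Iso.hom (Strict.associator_eqToIso (Hom.base f) (Hom.base g) (Hom.base h)))
  leftUnitor_eqToIso f := Iso.ext (hom₂_ext
    ((congrArg Iso.hom (Strict.leftUnitor_eqToIso (Hom.base f))).trans
      (eqToIso_base T (f := 𝟙 _ ≫ f) (g := f) _).symm))
  rightUnitor_eqToIso f := Iso.ext (hom₂_ext
    ((congrArg Iso.hom (Strict.rightUnitor_eqToIso (Hom.base f))).trans
      (eqToIso_base T (f := f ≫ 𝟙 _) (g := f) _).symm))
  associator_eqToIso f g h := Iso.ext (hom₂_ext
    ((congrArg Iso.hom (Strict.associator_eqToIso (Hom.base f) (Hom.base g) (Hom.base h))).trans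
      (eqToIso_base T (f := (f ≫ g) ≫ h) (g := f ≫ g ≫ h) _).symm))

/-- A lax algebra is a pseudoalgebra when both of its constraints are invertible. -/
def IsPseudoAlg (y : LaxAlg T) : Prop := IsIso y.mult ∧ IsIso y.unit

/-- A lax morphism is a pseudomorphism when its structure 2-cell is invertible. -/
def IsPseudoMor {y z : LaxAlg T} (f : y ⟶ z) : Prop := IsIso (Hom.cell f)

theorem isPseudoMor_id (y : LaxAlg T) : IsPseudoMor T (𝟙 y) := by
  change IsIso ((T.T.mapId y.carrier).hom ▷ y.act ≫ (λ_ y.act).hom ≫ (ρ_ y.act).inv)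
  exact IsIso.comp_isIso' inferInstance (IsIso.comp_isIso' inferInstance inferInstance)

theorem isPseudoMor_comp {x y z : LaxAlg T} (f : x ⟶ y) (g : y ⟶ z) (hf : IsPseudoMor T f)
    (hg : IsPseudoMor T g) : IsPseudoMor T (f ≫ g) := by
  have : IsIso (Hom.cell f) := hf
  have : IsIso (Hom.cell g) := hg
  change IsIso ((T.T.mapComp (Hom.base f) (Hom.base g)).hom ▷ z.act ≫
    hpaste (Hom.cell f) (Hom.cell g))
  unfold hpaste
  infer_instance

end LaxAlg

/-- The sub-2-category of lax algebras and pseudomorphisms. -/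
def laxSub : LocallyFull (LaxAlg T) where
  objProp _ := True
  homProp f := LaxAlg.IsPseudoMor T f
  id_mem := LaxAlg.isPseudoMor_id T
  comp_mem := LaxAlg.isPseudoMor_comp T

/-- The sub-2-category of pseudoalgebras and pseudomorphisms. -/
def psSub : LocallyFull (LaxAlg T) where
  objProp y := LaxAlg.IsPseudoAlg T y
  homProp f := LaxAlg.IsPseudoMor T f
  id_mem := LaxAlg.isPseudoMor_id T
  comp_mem := LaxAlg.isPseudoMor_comp T

/-- `Lax-T-Alg_ℓ`: lax algebras, lax morphisms, `T`-transformations. -/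
abbrev LaxTAlgLax := LaxAlg T

/-- `Lax-T-Alg`: lax algebras, pseudomorphisms, `T`-transformations. -/
abbrev LaxTAlg := (laxSub T).Obj

/-- `Ps-T-Alg`: pseudoalgebras, pseudomorphisms, `T`-transformations. -/
abbrev PsTAlg := (psSub T).Obj

/-- The inclusion `Ps-T-Alg ⟶ Lax-T-Alg_ℓ`. -/
def psToLaxLax : PsTAlg T ⥤ᵖ LaxTAlgLax T := (psSub T).incl

/-- The inclusion `Ps-T-Alg ⟶ Lax-T-Alg`. -/
def psToLax : PsTAlg T ⥤ᵖ LaxTAlg T :=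
  LocallyFull.inclOfLE (psSub T) (laxSub T) (fun _ _ => trivial) (fun _ h => h)

end Algebras

section Biadjunctions

variable {A : Type u₁} [Bicategory.{w₁, v₁} A] {C : Type u₂} [Bicategory.{w₂, v₂} C]

/-- A pseudonatural unit `ρ : Id ⟶ RE` and counit `ε : ER ⟶ Id`. -/
structure BiadjunctionData (E : C ⥤ᵖ A) (R : A ⥤ᵖ C) where
  /-- The unit. -/
  unit : Pseudofunctor.StrongTrans (Pseudofunctor.id C) (E.comp R)
  /-- The counit. -/
  counit : Pseudofunctor.StrongTrans (R.comp E) (Pseudofunctor.id A)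

namespace BiadjunctionData

variable {E : C ⥤ᵖ A} {R : A ⥤ᵖ C} (D : BiadjunctionData E R)

/-- The components of the unit. -/
def unitApp (X : C) : X ⟶ R.obj (E.obj X) := D.unit.app X

/-- The pseudonaturality constraints of the unit. -/
def unitNat {X Y : C} (f : X ⟶ Y) : f ≫ D.unitApp Y ≅ D.unitApp X ≫ R.map (E.map f) := D.unit.naturality f

/-- The components of the counit. -/
def counitApp (a : A) : E.obj (R.obj a) ⟶ a := D.counit.app a

/-- The pseudonaturality constraints of the counit. -/
def counitNat {a b : A} (g : a ⟶ b) : E.map (R.map g) ≫ D.counitApp b ≅ D.counitApp a ≫ g := D.counit.naturality g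

end BiadjunctionData

/-- `E` is left biadjoint to `R`: a pseudonatural unit `ρ : Id ⟶ RE` and counit `ε : ER ⟶ Id`,
invertible modifications `v : id_E ⇒ εE ∘ Eρ` and `w : Rε ∘ ρR ⇒ id_R` (whose modification axioms
are `v_naturality`, `w_naturality`), subject to the two swallowtail equations. -/
structure Biadjunction (E : C ⥤ᵖ A) (R : A ⥤ᵖ C) extends BiadjunctionData E R where
  /-- The first triangle modification. -/
  v (X : C) : 𝟙 (E.obj X) ≅
    E.map (toBiadjunctionData.unitApp X) ≫ toBiadjunctionData.counitApp (E.obj X)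
  v_naturality {X Y : C} (f : X ⟶ Y) :
    E.map f ◁ (v Y).hom ≫ vpaste (mapSq E (toBiadjunctionData.unitNat f).hom)
        (toBiadjunctionData.counitNat (E.map f)).hom =
      (ρ_ (E.map f)).hom ≫ (λ_ (E.map f)).inv ≫ (v X).hom ▷ E.map f
  /-- The second triangle modification. -/
  w (a : A) : toBiadjunctionData.unitApp (R.obj a) ≫ R.map (toBiadjunctionData.counitApp a) ≅ 𝟙 (R.obj a)
  w_naturality {a b : A} (g : a ⟶ b) :
    R.map g ◁ (w b).hom ≫ (ρ_ (R.map g)).hom ≫ (λ_ (R.map g)).inv =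
      vpaste (toBiadjunctionData.unitNat (R.map g)).hom (mapSq R (toBiadjunctionData.counitNat g).hom) ≫
        (w a).hom ▷ R.map g
  swallowtail_unit (X : C) :
    (ρ_ (toBiadjunctionData.unitApp X)).inv ≫
      toBiadjunctionData.unitApp X ◁
        ((R.mapId _).inv ≫ R.map₂ (v X).hom ≫ (R.mapComp _ _).hom) ≫
      (α_ _ _ _).inv ≫
      (toBiadjunctionData.unitNat (toBiadjunctionData.unitApp X)).inv ▷
        R.map (toBiadjunctionData.counitApp (E.obj X)) ≫
      (α_ _ _ _).hom ≫
      toBiadjunctionData.unitApp X ◁ (w (E.obj X)).hom ≫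
      (ρ_ (toBiadjunctionData.unitApp X)).hom = 𝟙 (toBiadjunctionData.unitApp X)
  swallowtail_counit (a : A) :
    (λ_ (toBiadjunctionData.counitApp a)).inv ≫
      (v (R.obj a)).hom ▷ toBiadjunctionData.counitApp a ≫
      (α_ _ _ _).hom ≫
      E.map (toBiadjunctionData.unitApp (R.obj a)) ◁
        (toBiadjunctionData.counitNat (toBiadjunctionData.counitApp a)).inv ≫
      (α_ _ _ _).inv ≫
      ((E.mapComp _ _).inv ≫ E.map₂ (w a).hom ≫ (E.mapId _).hom) ▷ toBiadjunctionData.counitApp a ≫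
      (λ_ (toBiadjunctionData.counitApp a)).hom = 𝟙 (toBiadjunctionData.counitApp a)

/-- A pseudofunctor has a left biadjoint. -/
def HasLeftBiadjoint (R : A ⥤ᵖ C) : Prop :=
  ∃ E : C ⥤ᵖ A, Nonempty (Biadjunction E R)

end Biadjunctions

section WeightedBicolimits

open Opposite Bicategory.Opposite
open scoped Pseudofunctor.StrongTrans

section Aux

variable {C : Type u} [Bicategory.{w, v} C]

theorem corep_aux₁ {a b c d : C} (x : a ⟶ b) (f : b ⟶ c) {g h : c ⟶ d} (t : g ⟶ h) :
    x ◁ (f ◁ t) = (α_ x f g).inv ≫ (x ≫ f) ◁ t ≫ (α_ x f h).hom := by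
  simp

theorem corep_aux₂ {a b c d : C} (x : a ⟶ b) {f g : b ⟶ c} (t : f ⟶ g) (h : c ⟶ d) :
    x ◁ (t ▷ h) = (α_ x f h).inv ≫ (x ◁ t) ▷ h ≫ (α_ x g h).hom := by
  simp

theorem corep_aux₃ {a b c d e : C} (x : a ⟶ b) (f : b ⟶ c) (g : c ⟶ d) (h : d ⟶ e) :
    x ◁ (α_ f g h).hom = (α_ x (f ≫ g) h).inv ≫ (α_ x f g).inv ▷ h ≫ 𝟙 _ ≫
      (α_ (x ≫ f) g h).hom ≫ (α_ x f (g ≫ h)).hom := by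
  simp

theorem corep_aux₄ {a b c : C} (x : a ⟶ b) (f : b ⟶ c) :
    x ◁ (λ_ f).hom = (α_ x (𝟙 _) f).inv ≫ (ρ_ x).hom ▷ f ≫ 𝟙 _ := by
  simp

theorem corep_aux₅ {a b c : C} (x : a ⟶ b) (f : b ⟶ c) :
    x ◁ (ρ_ f).hom = (α_ x f (𝟙 _)).inv ≫ (ρ_ (x ≫ f)).hom ≫ 𝟙 _ := by
  simp

theorem square_comp {a b c d : C} {f f' f'' : a ⟶ b} {p : b ⟶ d} {q : a ⟶ c}
    {g g' g'' : c ⟶ d} {n : f ≫ p ⟶ q ≫ g} {n' : f' ≫ p ⟶ q ≫ g'} {r : f'' ≫ p ⟶ q ≫ g''}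
    {x : f ⟶ f'} {x' : f' ⟶ f''} {y : g ⟶ g'} {y' : g' ⟶ g''}
    (h₁ : x ▷ p ≫ n' = n ≫ q ◁ y) (h₂ : n' ≫ q ◁ y' = x' ▷ p ≫ r) :
    n ≫ q ◁ (y ≫ y') = (x ≫ x') ▷ p ≫ r := by
  rw [whiskerLeft_comp, comp_whiskerRight, Category.assoc, ← h₂, reassoc_of% h₁]

end Aux

/-- The covariant representable pseudofunctor `C(c, -)`. -/
def corep {C : Type u} [Bicategory.{w, v} C] (c : C) : C ⥤ᵖ Cat.{w, v} where
  toPrelaxFunctor := PrelaxFunctor.mkOfHomFunctors (fun X => Cat.of (c ⟶ X))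
    (fun X Y => postcomposingCat c X Y)
  mapId X := rightUnitorNatIsoCat c X
  mapComp f g := (associatorNatIsoLeftCat c f g).symm
  map₂_whisker_left f g h t := by
    ext x
    exact corep_aux₁ x f t
  map₂_whisker_right t h := by
    ext x
    exact corep_aux₂ x t h
  map₂_associator f g h := by
    ext x
    exact corep_aux₃ x f g h
  map₂_left_unitor f := by
    ext x
    exact corep_aux₄ x f
  map₂_right_unitor f := by
    ext x
    exact corep_aux₅ x f

variable {S : Type u₂} [Bicategory.{w₂, v₂} S] {A : Type u} [Bicategory.{w, v} A]

/-- For a diagram `D : Sᵒᵖ ⥤ A`, given as a pseudofunctor `S ⥤ᵖ Aᵒᵖ`, the pseudofunctor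
`A(D -, X) : S ⥤ᵖ Cat`. -/
abbrev homInto (D : S ⥤ᵖ Aᵒᵖ) (X : A) : S ⥤ᵖ Cat.{w, v} := D.comp (yoneda₀ X)

/-- Postcomposition with `h : X ⟶ Y`, as a pseudonatural transformation `A(D -, X) ⟶ A(D -, Y)`. -/
def homIntoMap (D : S ⥤ᵖ Aᵒᵖ) {X Y : A} (h : X ⟶ Y) : homInto D X ⟶ homInto D Y where
  app s := (postcomp₂ h).app (D.obj s)
  naturality f := (postcomp₂ h).naturality (D.map f)
  naturality_naturality t := (postcomp₂ h).naturality_naturality (D.map₂ t)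
  naturality_id s :=
    square_comp ((postcomp₂ h).naturality_naturality (D.mapId s).hom)
      ((postcomp₂ h).naturality_id (D.obj s))
  naturality_comp f g :=
    square_comp ((postcomp₂ h).naturality_naturality (D.mapComp f g).hom)
      ((postcomp₂ h).naturality_comp (D.map f) (D.map g))

/-- Postcomposition with a 2-cell, as a modification. -/
def homIntoMap₂ (D : S ⥤ᵖ Aᵒᵖ) {X Y : A} {h k : X ⟶ Y} (t : h ⟶ k) :
    homIntoMap D h ⟶ homIntoMap D k where
  as :=
    { app s := ((postcomposing₂ X Y).map t).as.app (D.obj s)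
      naturality f := ((postcomposing₂ X Y).map t).as.naturality (D.map f) }

theorem homIntoMap₂_id (D : S ⥤ᵖ Aᵒᵖ) {X Y : A} (h : X ⟶ Y) : homIntoMap₂ D (𝟙 h) = 𝟙 _ := by
  ext s : 1
  exact congrArg (fun t => t.as.app (D.obj s)) ((postcomposing₂ X Y).map_id h)

theorem homIntoMap₂_comp (D : S ⥤ᵖ Aᵒᵖ) {X Y : A} {h k j : X ⟶ Y} (s : h ⟶ k) (t : k ⟶ j) :
    homIntoMap₂ D (s ≫ t) = homIntoMap₂ D s ≫ homIntoMap₂ D t := by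
  ext i : 1
  exact congrArg (fun t => t.as.app (D.obj i)) ((postcomposing₂ X Y).map_comp s t)

/-- Given a cocone `l : W ⟶ A(D -, C)`, the comparison functor `A(C, X) ⥤ [S, Cat](W, A(D -, X))`
sending `h` to the composite of `l` with postcomposition by `h`. -/
def comparison (W : S ⥤ᵖ Cat.{w, v}) (D : S ⥤ᵖ Aᵒᵖ) {C : A} (l : W ⟶ homInto D C) (X : A) :
    (C ⟶ X) ⥤ (W ⟶ homInto D X) where
  obj h := l ≫ homIntoMap D h
  map t := l ◁ homIntoMap₂ D t
  map_id h := (congrArg (l ◁ ·) (homIntoMap₂_id D h)).trans (whiskerLeft_id _ _)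
  map_comp s t := (congrArg (l ◁ ·) (homIntoMap₂_comp D s t)).trans (whiskerLeft_comp _ _ _)

/-- The weighted bicolimit `W * D` exists: there are an object `C` and a `W`-weighted cocone
`l : W ⟶ A(D -, C)` such that composition with `l` is an equivalence of categories
`A(C, X) ≃ [S, Cat]_PS(W, A(D -, X))` for each `X`. -/
def HasWeightedBicolimit (W : S ⥤ᵖ Cat.{w, v}) (D : S ⥤ᵖ Aᵒᵖ) : Prop :=
  ∃ (C : A) (l : W ⟶ homInto D C), ∀ X : A, (comparison W D l X).IsEquivalence

end WeightedBicolimits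

section Computads

open Quiver (Path)

/-- A computad on a graph `O`: a family of generating 2-cells between parallel paths. Paths are
written in the order of composition, so `(Path.nil.cons f).cons g` is `f` followed by `g`. -/
structure Computad (O : Type u) [Quiver.{v} O] where
  /-- The generating 2-cells. -/
  Cell : ∀ {a b : O}, Path a b → Path a b → Type w

variable {O : Type u} [Quiver.{v} O]

/-- Formal pasting composites of generating 2-cells of a computad. -/
inductive Formal (c : Computad.{w} O) : ∀ {a b : O}, Path a b → Path a b → Type (max u v w)
  | gen {a b : O} {p q : Path a b} (x : c.Cell p q) : Formal c p q
  | id {a b : O} (p : Path a b) : Formal c p p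
  | vcomp {a b : O} {p q r : Path a b} (x : Formal c p q) (y : Formal c q r) : Formal c p r
  | whiskerLeft {a b d : O} (p : Path a b) {q r : Path b d} (x : Formal c q r) :
      Formal c (p.comp q) (p.comp r)
  | whiskerRight {a b d : O} {p q : Path a b} (x : Formal c p q) (r : Path b d) :
      Formal c (p.comp r) (q.comp r)

namespace Formal

variable {c : Computad.{w} O}

/-- The identity 2-cell between two equal paths. -/
def ofEq {a b : O} {p q : Path a b} (h : p = q) : Formal c p q := h ▸ Formal.id p

/-- Conjugation of a formal 2-cell by identities between equal paths. -/
def conj {a b : O} {p q p' q' : Path a b} (h : p' = p) (x : Formal c p q) (h' : q = q') :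
    Formal c p' q' :=
  vcomp (ofEq h) (vcomp x (ofEq h'))

end Formal

/-- A family of relations between formal 2-cells. -/
abbrev Relations (c : Computad.{w} O) :=
  ∀ {a b : O} {p q : Path a b}, Formal c p q → Formal c p q → Prop

/-- The congruence on formal 2-cells generated by the laws of a 2-category and by the relations
`R`. -/
inductive Congr (c : Computad.{w} O) (R : Relations c) :
    ∀ {a b : O} {p q : Path a b}, Formal c p q → Formal c p q → Prop
  | of {a b : O} {p q : Path a b} {x y : Formal c p q} : R x y → Congr c R x y
  | refl {a b : O} {p q : Path a b} (x : Formal c p q) : Congr c R x x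
  | symm {a b : O} {p q : Path a b} {x y : Formal c p q} : Congr c R x y → Congr c R y x
  | trans {a b : O} {p q : Path a b} {x y z : Formal c p q} :
      Congr c R x y → Congr c R y z → Congr c R x z
  | vcomp {a b : O} {p q r : Path a b} {x x' : Formal c p q} {y y' : Formal c q r} :
      Congr c R x x' → Congr c R y y' → Congr c R (x.vcomp y) (x'.vcomp y')
  | whiskerLeft {a b d : O} (p : Path a b) {q r : Path b d} {x y : Formal c q r} :
      Congr c R x y → Congr c R (x.whiskerLeft p) (y.whiskerLeft p)
  | whiskerRight {a b d : O} {p q : Path a b} {x y : Formal c p q} (r : Path b d) :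
      Congr c R x y → Congr c R (x.whiskerRight r) (y.whiskerRight r)
  | id_vcomp {a b : O} {p q : Path a b} (x : Formal c p q) :
      Congr c R ((Formal.id p).vcomp x) x
  | vcomp_id {a b : O} {p q : Path a b} (x : Formal c p q) :
      Congr c R (x.vcomp (Formal.id q)) x
  | assoc {a b : O} {p q r s : Path a b} (x : Formal c p q) (y : Formal c q r)
      (z : Formal c r s) : Congr c R ((x.vcomp y).vcomp z) (x.vcomp (y.vcomp z))
  | whiskerLeft_id {a b d : O} (p : Path a b) (q : Path b d) :
      Congr c R ((Formal.id q).whiskerLeft p) (Formal.id (p.comp q))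
  | whiskerLeft_vcomp {a b d : O} (p : Path a b) {q r s : Path b d} (x : Formal c q r)
      (y : Formal c r s) :
      Congr c R ((x.vcomp y).whiskerLeft p) ((x.whiskerLeft p).vcomp (y.whiskerLeft p))
  | id_whiskerRight {a b d : O} (p : Path a b) (q : Path b d) :
      Congr c R ((Formal.id p).whiskerRight q) (Formal.id (p.comp q))
  | vcomp_whiskerRight {a b d : O} {p q r : Path a b} (x : Formal c p q) (y : Formal c q r)
      (s : Path b d) :
      Congr c R ((x.vcomp y).whiskerRight s) ((x.whiskerRight s).vcomp (y.whiskerRight s))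
  | nil_whiskerLeft {a b : O} {p q : Path a b} (x : Formal c p q) :
      Congr c R (x.whiskerLeft Path.nil) (x.conj (Path.nil_comp p) (Path.nil_comp q).symm)
  | comp_whiskerLeft {a b d e : O} (p : Path a b) (q : Path b d) {r s : Path d e}
      (x : Formal c r s) :
      Congr c R (x.whiskerLeft (p.comp q))
        (((x.whiskerLeft q).whiskerLeft p).conj (Path.comp_assoc p q r)
          (Path.comp_assoc p q s).symm)
  | whiskerRight_nil {a b : O} {p q : Path a b} (x : Formal c p q) :
      Congr c R (x.whiskerRight Path.nil) (x.conj (Path.comp_nil p) (Path.comp_nil q).symm)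
  | whiskerRight_comp {a b d e : O} {p q : Path a b} (x : Formal c p q) (r : Path b d)
      (s : Path d e) :
      Congr c R (x.whiskerRight (r.comp s))
        (((x.whiskerRight r).whiskerRight s).conj (Path.comp_assoc p r s).symm
          (Path.comp_assoc q r s))
  | whisker_assoc {a b d e : O} (p : Path a b) {q r : Path b d} (x : Formal c q r)
      (s : Path d e) :
      Congr c R ((x.whiskerLeft p).whiskerRight s)
        (((x.whiskerRight s).whiskerLeft p).conj (Path.comp_assoc p q s)
          (Path.comp_assoc p r s).symm)
  | exchange {a b d : O} {p q : Path a b} {r s : Path b d} (x : Formal c p q)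
      (y : Formal c r s) :
      Congr c R ((y.whiskerLeft p).vcomp (x.whiskerRight s))
        ((x.whiskerRight r).vcomp (y.whiskerLeft q))

/-- The 2-category presented by a computad `c` and relations `R` between formal 2-cells: its
underlying category is the free category on the graph, and its 2-cells are formal composites
modulo the congruence generated by `R`. For the empty family of relations, this is the 2-category
freely generated by `c`. -/
@[ext]
structure Presented (c : Computad.{w} O) (R : Relations c) where
  /-- The underlying vertex. -/
  vertex : O

namespace Presented

variable {c : Computad.{w} O} {R : Relations c}

instance : CategoryStruct (Presented c R) where
  Hom X Y := Path X.vertex Y.vertex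
  id _ := Path.nil
  comp p q := p.comp q

/-- The underlying path of a 1-cell. -/
def path {X Y : Presented c R} (p : X ⟶ Y) : Path X.vertex Y.vertex := p

instance homCat (X Y : Presented c R) : Category (X ⟶ Y) where
  Hom p q := Quot (Congr c R (p := path p) (q := path q))
  id p := Quot.mk _ (Formal.id (path p))
  comp := Quot.map₂ Formal.vcomp (fun _ _ _ h => .vcomp (.refl _) h)
    (fun _ _ _ h => .vcomp h (.refl _))
  id_comp := by
    rintro _ _ ⟨x⟩
    exact Quot.sound (.id_vcomp x)
  comp_id := by
    rintro _ _ ⟨x⟩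
    exact Quot.sound (.vcomp_id x)
  assoc := by
    rintro _ _ _ _ ⟨x⟩ ⟨y⟩ ⟨z⟩
    exact Quot.sound (.assoc x y z)

/-- The 2-cell represented by a formal 2-cell. -/
def cellMk {X Y : Presented c R} (p q : X ⟶ Y) (x : Formal c (path p) (path q)) : p ⟶ q :=
  Quot.mk _ x

/-- Left whiskering. -/
def wl {X Y Z : Presented c R} (p : X ⟶ Y) {q r : Y ⟶ Z} : (q ⟶ r) → (p ≫ q ⟶ p ≫ r) :=
  Quot.map (Formal.whiskerLeft (path p)) (fun _ _ h => .whiskerLeft _ h)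

/-- Right whiskering. -/
def wr {X Y Z : Presented c R} {p q : X ⟶ Y} (x : p ⟶ q) (r : Y ⟶ Z) : p ≫ r ⟶ q ≫ r :=
  Quot.map (fun y => Formal.whiskerRight y (path r)) (fun _ _ h => .whiskerRight _ h) x

theorem cellMk_ofEq {X Y : Presented c R} {p q : X ⟶ Y} (h : p = q) :
    cellMk p q (Formal.ofEq h) = eqToHom h := by
  subst h
  rfl

theorem cellMk_conj {X Y : Presented c R} {p q p' q' : X ⟶ Y} (h : p' = p)
    (x : Formal c (path p) (path q)) (h' : q = q') :
    cellMk p' q' (Formal.conj h x h') = eqToHom h ≫ cellMk p q x ≫ eqToHom h' := by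
  rw [← cellMk_ofEq h, ← cellMk_ofEq h']
  rfl

theorem wl_eqToHom {X Y Z : Presented c R} (p : X ⟶ Y) {q r : Y ⟶ Z} (h : q = r) :
    wl p (eqToHom h) = eqToHom (congrArg (p ≫ ·) h) := by
  subst h
  exact Quot.sound (.whiskerLeft_id _ _)

theorem wr_eqToHom {X Y Z : Presented c R} {p q : X ⟶ Y} (h : p = q) (r : Y ⟶ Z) :
    wr (eqToHom h) r = eqToHom (congrArg (· ≫ r) h) := by
  subst h
  exact Quot.sound (.id_whiskerRight _ _)

theorem assoc' {X Y Z W : Presented c R} (p : X ⟶ Y) (q : Y ⟶ Z) (r : Z ⟶ W) :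
    (p ≫ q) ≫ r = p ≫ q ≫ r := Path.comp_assoc _ _ _

theorem id_comp' {X Y : Presented c R} (p : X ⟶ Y) : 𝟙 X ≫ p = p := Path.nil_comp _

theorem comp_id' {X Y : Presented c R} (p : X ⟶ Y) : p ≫ 𝟙 Y = p := Path.comp_nil _

instance : Bicategory (Presented c R) where
  homCategory := homCat
  whiskerLeft p _ _ x := wl p x
  whiskerRight x r := wr x r
  associator p q r := eqToIso (assoc' p q r)
  leftUnitor p := eqToIso (id_comp' p)
  rightUnitor p := eqToIso (comp_id' p)
  whiskerLeft_id _ _ := Quot.sound (.whiskerLeft_id _ _)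
  whiskerLeft_comp := by
    rintro _ _ _ p _ _ _ ⟨x⟩ ⟨y⟩
    exact Quot.sound (.whiskerLeft_vcomp _ x y)
  id_whiskerLeft := by
    rintro _ _ p q ⟨x⟩
    exact (Quot.sound (.nil_whiskerLeft x)).trans (cellMk_conj _ x _)
  comp_whiskerLeft := by
    rintro _ _ _ _ p q r s ⟨x⟩
    exact (Quot.sound (.comp_whiskerLeft (path p) (path q) x)).trans
      (cellMk_conj (assoc' p q r) (x.whiskerLeft _ |>.whiskerLeft _) (assoc' p q s).symm)
  id_whiskerRight _ _ := Quot.sound (.id_whiskerRight _ _)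
  comp_whiskerRight := by
    rintro _ _ _ _ _ _ ⟨x⟩ ⟨y⟩ r
    exact Quot.sound (.vcomp_whiskerRight x y _)
  whiskerRight_id := by
    rintro _ _ p q ⟨x⟩
    exact (Quot.sound (.whiskerRight_nil x)).trans (cellMk_conj (comp_id' p) x (comp_id' q).symm)
  whiskerRight_comp := by
    rintro _ _ _ _ p q ⟨x⟩ r s
    exact (Quot.sound (.whiskerRight_comp x (path r) (path s))).trans
      (cellMk_conj (assoc' p r s).symm (x.whiskerRight _ |>.whiskerRight _) (assoc' q r s))
  whisker_assoc := by
    rintro _ _ _ _ p q r ⟨x⟩ s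
    exact (Quot.sound (.whisker_assoc (path p) x (path s))).trans
      (cellMk_conj (assoc' p q s) (x.whiskerRight _ |>.whiskerLeft _) (assoc' p r s).symm)
  whisker_exchange := by
    rintro _ _ _ _ _ _ _ ⟨x⟩ ⟨y⟩
    exact Quot.sound (.exchange x y)
  pentagon p q r s := by
    simp only [eqToIso.hom, wl_eqToHom, wr_eqToHom, eqToHom_trans]
  triangle p q := by
    simp only [eqToIso.hom, wl_eqToHom, wr_eqToHom, eqToHom_trans]

instance : Strict (Presented c R) where
  id_comp p := id_comp' p
  comp_id p := comp_id' p
  assoc p q r := assoc' p q r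
  leftUnitor_eqToIso _ := rfl
  rightUnitor_eqToIso _ := rfl
  associator_eqToIso _ _ _ := rfl

end Presented

section Lift

variable {D : Type u₁} [Bicategory.{w₁, v₁} D]

/-- The extension of a graph morphism to paths. -/
def mapPath (obj : O → D) (map : ∀ {a b : O}, (a ⟶ b) → (obj a ⟶ obj b)) {a : O} :
    ∀ {b : O}, Path a b → (obj a ⟶ obj b)
  | _, .nil => 𝟙 (obj a)
  | _, .cons p e => mapPath obj map p ≫ map e

/-- A map from a computad to the underlying computad of a 2-category. -/
structure Computad.Map (c : Computad.{w} O) (D : Type u₁) [Bicategory.{w₁, v₁} D] where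
  /-- The action on vertices. -/
  obj : O → D
  /-- The action on generating 1-cells. -/
  map : ∀ {a b : O}, (a ⟶ b) → (obj a ⟶ obj b)
  /-- The action on generating 2-cells. -/
  cell : ∀ {a b : O} {p q : Path a b}, c.Cell p q → (mapPath obj map p ⟶ mapPath obj map q)

namespace Computad.Map

variable [Strict D] {c : Computad.{w} O} (F : c.Map D)

theorem mapPath_comp {a b : O} (p : Path a b) : ∀ {d : O} (q : Path b d),
    mapPath F.obj F.map (p.comp q) = mapPath F.obj F.map p ≫ mapPath F.obj F.map q
  | _, .nil => (Strict.comp_id _).symm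
  | _, .cons q e => by
    change mapPath F.obj F.map (p.comp q) ≫ F.map e =
      mapPath F.obj F.map p ≫ mapPath F.obj F.map q ≫ F.map e
    rw [mapPath_comp p q, Strict.assoc]

/-- The interpretation of formal 2-cells. -/
def ev {a b : O} {p q : Path a b} :
    Formal c p q → (mapPath F.obj F.map p ⟶ mapPath F.obj F.map q)
  | .gen x => F.cell x
  | .id _ => 𝟙 _
  | .vcomp x y => ev x ≫ ev y
  | .whiskerLeft p x => eqToHom (F.mapPath_comp p _) ≫ mapPath F.obj F.map p ◁ ev x ≫
      eqToHom (F.mapPath_comp p _).symm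
  | .whiskerRight x r => eqToHom (F.mapPath_comp _ r) ≫ ev x ▷ mapPath F.obj F.map r ≫
      eqToHom (F.mapPath_comp _ r).symm

theorem ev_ofEq {a b : O} {p q : Path a b} (h : p = q) :
    F.ev (Formal.ofEq h) = eqToHom (congrArg _ h) := by
  subst h
  rfl

theorem ev_conj {a b : O} {p q p' q' : Path a b} (h : p' = p) (x : Formal c p q) (h' : q = q') :
    F.ev (x.conj h h') = eqToHom (congrArg _ h) ≫ F.ev x ≫ eqToHom (congrArg _ h') := by
  rw [← ev_ofEq, ← ev_ofEq]
  rfl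

theorem whiskerLeft_congr {a b d : D} {f f' : a ⟶ b} (h : f = f') {g k : b ⟶ d} (x : g ⟶ k) :
    f ◁ x = eqToHom (congrArg (· ≫ g) h) ≫ f' ◁ x ≫ eqToHom (congrArg (· ≫ k) h.symm) := by
  subst h
  simp

theorem whiskerRight_congr {a b d : D} {f f' : b ⟶ d} (h : f = f') {g k : a ⟶ b} (x : g ⟶ k) :
    x ▷ f = eqToHom (congrArg (g ≫ ·) h) ≫ x ▷ f' ≫ eqToHom (congrArg (k ≫ ·) h.symm) := by
  subst h
  simp

theorem eqToHom_conj_conj {K : Type u} [Category.{v} K] {a b d a' b' d' : K} (h₁ : a = b)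
    (h₂ : b = d) (x : d ⟶ d') (h₂' : d' = b') (h₁' : b' = a') (h : a = d) (h' : d' = a') :
    eqToHom h₁ ≫ (eqToHom h₂ ≫ x ≫ eqToHom h₂') ≫ eqToHom h₁' = eqToHom h ≫ x ≫ eqToHom h' := by
  simp

theorem ev_congr {R : Relations c}
    (hR : ∀ {a b : O} {p q : Path a b} (x y : Formal c p q), R x y → F.ev x = F.ev y)
    {a b : O} {p q : Path a b} {x y : Formal c p q} (h : Congr c R x y) : F.ev x = F.ev y := by
  induction h with
  | of h => exact hR _ _ h
  | refl => rfl
  | symm _ ih => exact ih.symm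
  | trans _ _ ih ih' => exact ih.trans ih'
  | vcomp _ _ ih ih' => simp only [ev, ih, ih']
  | whiskerLeft _ _ ih => simp only [ev, ih]
  | whiskerRight _ _ ih => simp only [ev, ih]
  | id_vcomp => simp only [ev, Category.id_comp]
  | vcomp_id => simp only [ev, Category.comp_id]
  | assoc => simp only [ev, Category.assoc]
  | whiskerLeft_id => simp [ev]
  | whiskerLeft_vcomp => simp [ev]
  | id_whiskerRight => simp [ev]
  | vcomp_whiskerRight => simp [ev]
  | nil_whiskerLeft x =>
    rw [ev_conj]
    simp only [ev, mapPath, id_whiskerLeft, Strict.leftUnitor_eqToIso]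
    exact eqToHom_conj_conj _ (Strict.id_comp _) _ (Strict.id_comp _).symm _ _ _
  | comp_whiskerLeft p q x =>
    rw [ev_conj]
    simp only [ev]
    rw [whiskerLeft_congr (F.mapPath_comp p q)]
    simp [Strict.associator_eqToIso, whiskerLeft_eqToHom]
  | whiskerRight_nil x =>
    rw [ev_conj]
    simp only [ev, mapPath, whiskerRight_id, Strict.rightUnitor_eqToIso]
    exact eqToHom_conj_conj _ (Strict.comp_id _) _ (Strict.comp_id _).symm _ _ _
  | whiskerRight_comp x r s =>
    rw [ev_conj]
    simp only [ev]
    rw [whiskerRight_congr (F.mapPath_comp r s)]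
    simp [Strict.associator_eqToIso, eqToHom_whiskerRight]
  | whisker_assoc p x s =>
    rw [ev_conj]
    simp [ev, Strict.associator_eqToIso, eqToHom_whiskerRight, whiskerLeft_eqToHom]
  | exchange x y =>
    simp [ev, whisker_exchange_assoc]

/-- The 2-functor induced by a map of computads satisfying the relations. -/
def lift (R : Relations c)
    (hR : ∀ {a b : O} {p q : Path a b} (x y : Formal c p q), R x y → F.ev x = F.ev y) :
    StrictPseudofunctor (Presented c R) D :=
  StrictPseudofunctor.mk''
    { obj X := F.obj X.vertex
      map p := mapPath F.obj F.map (Presented.path p)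
      map₂ x := Quot.lift F.ev (fun _ _ h => F.ev_congr hR h) x
      map₂_id _ := rfl
      map₂_comp := by
        rintro _ _ _ _ _ ⟨x⟩ ⟨y⟩
        rfl
      map_id _ := rfl
      map_comp p q := F.mapPath_comp (Presented.path p) (Presented.path q)
      map₂_whisker_left := by
        rintro _ _ _ p q r ⟨x⟩
        rfl
      map₂_whisker_right := by
        rintro _ _ _ p q ⟨x⟩ r
        rfl }

end Computad.Map

end Lift

end Computads

section Descent

open Quiver (Path)

/-- The objects `1`, `2`, `3` of `Δ_ℓ`. -/
inductive DeltaObj : Type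
  | one | two | three

/-- The generating 1-cells of `Δ_ℓ`. -/
inductive DeltaArr : DeltaObj → DeltaObj → Type v
  | d0 : DeltaArr .one .two
  | d1 : DeltaArr .one .two
  | s0 : DeltaArr .two .one
  | e0 : DeltaArr .two .three
  | e1 : DeltaArr .two .three
  | e2 : DeltaArr .two .three

instance : Quiver.{v} DeltaObj := ⟨DeltaArr⟩

/-- The composite of two consecutive arrows of a graph, `f` being applied first. -/
abbrev path₂ {O : Type u} [Quiver.{v} O] {a b c : O} (f : a ⟶ b) (g : b ⟶ c) : Path a c :=
  (Path.nil.cons f).cons g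

/-- The generating 2-cells of `Δ_ℓ`, where `e0`, `e1`, `e2` stand for `∂⁰`, `∂¹`, `∂²`. -/
inductive DeltaCell : ∀ {a b : DeltaObj}, Path.{v} a b → Path.{v} a b → Type v
  | σ00 : DeltaCell (path₂ DeltaArr.d0 DeltaArr.e0) (path₂ DeltaArr.d0 DeltaArr.e1)
  | σ20 : DeltaCell (path₂ DeltaArr.d0 DeltaArr.e2) (path₂ DeltaArr.d1 DeltaArr.e0)
  | σ21 : DeltaCell (path₂ DeltaArr.d1 DeltaArr.e2) (path₂ DeltaArr.d1 DeltaArr.e1)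
  | n0 : DeltaCell (Path.nil : Path DeltaObj.one .one) (path₂ DeltaArr.d0 DeltaArr.s0)
  | n1 : DeltaCell (Path.nil : Path DeltaObj.one .one) (path₂ DeltaArr.d1 DeltaArr.s0)

/-- The generating computad of `Δ_ℓ`. -/
def deltaComputad : Computad.{v} DeltaObj := ⟨DeltaCell⟩

/-- `Δ_ℓ`: the 2-category freely generated by its computad. -/
abbrev DeltaL := Presented deltaComputad.{v} (fun _ _ => False)

/-- The objects of `Δ̇_ℓ` and `Δ̇`: those of `Δ_ℓ` and a new object `0`. -/
inductive DotObj : Type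
  | zero
  | up (x : DeltaObj)

/-- The generating 1-cells of `Δ̇_ℓ` and `Δ̇`: those of `Δ_ℓ` and `d : 0 ⟶ 1`. -/
inductive DotArr : DotObj → DotObj → Type v
  | d : DotArr .zero (.up .one)
  | up {x y : DeltaObj} (f : DeltaArr.{v} x y) : DotArr (.up x) (.up y)

instance : Quiver.{v} DotObj := ⟨DotArr⟩

/-- The inclusion of graphs. -/
def upGraph : DeltaObj ⥤q DotObj where
  obj := .up
  map f := DotArr.up f

/-- The generating 2-cells of `Δ̇_ℓ` (for `inv = false`) and `Δ̇` (for `inv = true`): those of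
`Δ_ℓ`, the 2-cell `ϑ : d¹ d ⇒ d⁰ d` and, for `inv = true`, a 2-cell `d⁰ d ⇒ d¹ d`. -/
inductive DotCell (inv : Bool) : ∀ {a b : DotObj}, Path.{v} a b → Path.{v} a b → Type v
  | up {x y : DeltaObj} {p q : Path.{v} x y} (c : DeltaCell p q) :
      DotCell inv (upGraph.mapPath p) (upGraph.mapPath q)
  | ϑ : DotCell inv (path₂ DotArr.d (DotArr.up DeltaArr.d1)) (path₂ DotArr.d (DotArr.up DeltaArr.d0))
  | ϑInv (h : inv = true) :
      DotCell inv (path₂ DotArr.d (DotArr.up DeltaArr.d0)) (path₂ DotArr.d (DotArr.up DeltaArr.d1))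

/-- The generating computad of `Δ̇_ℓ` (for `inv = false`) and `Δ̇` (for `inv = true`). -/
def dotComputad (inv : Bool) : Computad.{v} DotObj := ⟨DotCell inv⟩

section Relations

variable (inv : Bool)

/-- The 1-cell `d : 0 ⟶ 1`, as a path. -/
abbrev dPath : Path DotObj.zero (.up .one) := Path.nil.cons DotArr.d.{v}

/-- A generating 1-cell of `Δ_ℓ`, as a path. -/
abbrev upPath {x y : DeltaObj} (f : DeltaArr.{v} x y) : Path (DotObj.up x) (.up y) :=
  Path.nil.cons (DotArr.up f)

/-- The 1-cell `0 ⟶ 1 ⟶ x` given by `d` and `f`. -/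
abbrev dPath₁ {x : DeltaObj} (f : DeltaArr.{v} .one x) : Path DotObj.zero (.up x) :=
  dPath.cons (DotArr.up f)

/-- The 1-cell `0 ⟶ 1 ⟶ x ⟶ y` given by `d`, `f` and `g`. -/
abbrev dPath₂ {x y : DeltaObj} (f : DeltaArr.{v} .one x) (g : DeltaArr.{v} x y) :
    Path DotObj.zero (.up y) :=
  (dPath₁ f).cons (DotArr.up g)

/-- `ϑ : d¹ d ⇒ d⁰ d`. -/
def theta : Formal (dotComputad.{v} inv) (dPath₁ .d1) (dPath₁ .d0) := .gen .ϑ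

/-- The whiskering `g ϑ : g d¹ d ⇒ g d⁰ d`. -/
def thetaThen {x : DeltaObj} (g : DeltaArr.{v} .two x) :
    Formal (dotComputad.{v} inv) (dPath₂ .d1 g) (dPath₂ .d0 g) :=
  (theta inv).whiskerRight (upPath g)

/-- The whiskering `x d` of a generating 2-cell `x` of `Δ_ℓ`. -/
def dThen {y : DeltaObj} {p q : Path.{v} .one y} (x : DeltaCell p q) :
    Formal (dotComputad.{v} inv) (dPath.comp (upGraph.mapPath p))
      (dPath.comp (upGraph.mapPath q)) :=
  .whiskerLeft dPath (.gen (.up x))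

/-- The defining relations of `Δ̇_ℓ` and `Δ̇`: the associativity equation
`(σ₀₀ d)(∂⁰ ϑ)(σ₂₀ d)(∂² ϑ) = (∂¹ ϑ)(σ₂₁ d)` between 2-cells `∂² d¹ d ⇒ ∂¹ d⁰ d`, the identity
equation `(s⁰ ϑ)(n₁ d) = n₀ d` between 2-cells `d ⇒ s⁰ d⁰ d`, and the equations stating that the
additional 2-cell of `Δ̇` is inverse to `ϑ`. -/
inductive DotRel : ∀ {a b : DotObj} {p q : Path a b},
    Formal (dotComputad.{v} inv) p q → Formal (dotComputad.{v} inv) p q → Prop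
  | associativity :
      DotRel (p := dPath₂ .d1 .e2) (q := dPath₂ .d0 .e1)
        ((thetaThen inv .e2).vcomp ((dThen inv .σ20).vcomp
          ((thetaThen inv .e0).vcomp (dThen inv .σ00))))
        ((dThen inv .σ21).vcomp (thetaThen inv .e1))
  | identity :
      DotRel (p := dPath) (q := dPath₂ .d0 .s0)
        ((dThen inv .n1).vcomp (thetaThen inv .s0)) (dThen inv .n0)
  | hom_inv (h : inv = true) :
      DotRel (p := dPath₁ .d1) (q := dPath₁ .d1)
        ((theta inv).vcomp (.gen (.ϑInv h))) (.id _)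
  | inv_hom (h : inv = true) :
      DotRel (p := dPath₁ .d0) (q := dPath₁ .d0)
        (.vcomp (.gen (.ϑInv h)) (theta inv)) (.id _)

end Relations

/-- `Δ̇_ℓ` (for `inv = false`) and `Δ̇` (for `inv = true`). -/
abbrev Dot (inv : Bool) := Presented (dotComputad.{v} inv) (DotRel inv)

/-- `Δ̇_ℓ`. -/
abbrev DotDeltaL := Dot.{v} false

/-- `Δ̇`. -/
abbrev DotDelta := Dot.{v} true

/-- The inclusion of the generators of `Δ_ℓ`. -/
def dotMap (inv : Bool) : deltaComputad.{v}.Map (Dot.{v} inv) where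
  obj x := ⟨.up x⟩
  map f := upPath f
  cell
    | .σ00 => Quot.mk _ (.gen (.up .σ00))
    | .σ20 => Quot.mk _ (.gen (.up .σ20))
    | .σ21 => Quot.mk _ (.gen (.up .σ21))
    | .n0 => Quot.mk _ (.gen (.up .n0))
    | .n1 => Quot.mk _ (.gen (.up .n1))

/-- The inclusions `t : Δ_ℓ ⟶ Δ̇_ℓ` (for `inv = false`) and `j : Δ_ℓ ⟶ Δ̇` (for `inv = true`). -/
def dotIncl (inv : Bool) : StrictPseudofunctor DeltaL.{v} (Dot.{v} inv) :=
  (dotMap inv).lift _ (fun _ _ h => h.elim)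

/-- The weight `Δ̇_ℓ(0, t -)` of lax codescent objects. -/
def laxWeight : DeltaL.{v} ⥤ᵖ Cat.{v, v} :=
  (dotIncl false).toPseudofunctor.comp (corep (⟨.zero⟩ : DotDeltaL.{v}))

/-- The weight `Δ̇(0, j -)` of codescent objects. -/
def psWeight : DeltaL.{v} ⥤ᵖ Cat.{v, v} :=
  (dotIncl true).toPseudofunctor.comp (corep (⟨.zero⟩ : DotDelta.{v}))

variable (A : Type u) [Bicategory.{v, v} A]

/-- `A` has lax codescent objects: every 2-functor `Δ_ℓᵒᵖ ⟶ A` (given as `Δ_ℓ ⟶ Aᵒᵖ`) has a lax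
codescent object, i.e. a bicolimit weighted by `Δ̇_ℓ(0, t -)`. -/
def HasLaxCodescentObjects : Prop :=
  ∀ D : StrictPseudofunctor DeltaL.{v} Aᵒᵖ, HasWeightedBicolimit laxWeight D.toPseudofunctor

/-- `A` has codescent objects: every 2-functor `Δ_ℓᵒᵖ ⟶ A` (given as `Δ_ℓ ⟶ Aᵒᵖ`) has a codescent
object, i.e. a bicolimit weighted by `Δ̇(0, j -)`. -/
def HasCodescentObjects : Prop :=
  ∀ D : StrictPseudofunctor DeltaL.{v} Aᵒᵖ, HasWeightedBicolimit psWeight D.toPseudofunctor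

end Descent

end LaxCoh

/-! Let `y` be a lax algebra with structure map `a : TY ⟶ Y`, and `z` a pseudoalgebra. Up to
isomorphism, a lax morphism `y ⟶ z` is the same as a pseudomorphism `F` from the free algebra on `Y`
to `z` together with a `T`-transformation `ϑ : m ≫ F ⟶ T a ≫ F` satisfying an associativity and an
identity equation. From `(F, ϑ)` one gets the lax morphism by restricting `F` along `η`
(`LaxAlg.lower`). From `f` one gets `F` as `T f` followed by the structure map of `z`
(`LaxAlg.exists_iso_lower`). Under this correspondence `T`-transformations become 2-cells compatible
with `ϑ`, and pseudomorphisms correspond to invertible `ϑ`.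

The correspondence rests on one fact about free algebras: if `f, g : TX ⟶ z` and `f` is a
pseudomorphism, then `T`-transformations `f ⟶ g` are the same as 2-cells between the restrictions
along `η` (`LaxAlg.free_hom₂_ext`, `LaxAlg.exists_free_hom₂`). Equations between `T`-transformations
are therefore tested after whiskering with `η`, where they become pasting identities. These use
three consequences of the pseudomonad axioms which are not axioms themselves: the left identity law
of free algebras, the compatibility of `τ` with multiplication, and the agreement of `ι` with `τ`
along `η`.

A pair `(F, ϑ)` is also exactly a cocone on the resolution of `y` by the free algebras on `Y`, `TY`
and `T²Y`. Since the 2-categories obtained by adjoining `0` are presented by generators and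
relations, a pseudonatural transformation out of the weight amounts, up to isomorphism, to its
1-cell at `d` and its 2-cell at `ϑ`, subject to the two relations (`DotCocone.isDescent`,
`CoherenceData.exists_cocone`), and modifications are the compatible 2-cells at `d`. So a lax
codescent object of the resolution represents lax morphisms out of `y`, and a codescent object
represents pseudomorphisms: it carries a bicategorical universal arrow from `y`
(`exists_universal`).

Finally, universal arrows chosen objectwise give a biadjunction
(`Comma.hasLeftBiadjoint_of_isUniversal`). In the pseudo-comma bicategory of the inclusion, a 2-cell
out of a universal arrow is determined by its first component, so most of the required coherence is
checked on first components, and the rest is the compatibility condition built into a 2-cell. -/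

namespace LaxCoh
open CategoryTheory Bicategory

/-! ### Redundant coherence laws of a pseudomonad. -/

section Coherence
variable {B : Type u} [Bicategory.{w, v} B] {C : Type u₁} [Bicategory.{w₁, v₁} C]

/-- The image under a pseudofunctor of a 2-cell from a composite to an identity. -/
def mapCounit (F : B ⥤ᵖ C) {a b : B} {f : a ⟶ b} {g : b ⟶ a} (σ : f ≫ g ⟶ 𝟙 a) :
    F.map f ≫ F.map g ⟶ 𝟙 (F.obj a) :=
  (F.mapComp f g).inv ≫ F.map₂ σ ≫ (F.mapId a).hom

/-- The image under a pseudofunctor of a 2-cell from an identity to a composite. -/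
def mapUnit (F : B ⥤ᵖ C) {a b : B} {f : a ⟶ b} {g : b ⟶ a} (σ : 𝟙 a ⟶ f ≫ g) :
    𝟙 (F.obj a) ⟶ F.map f ≫ F.map g :=
  (F.mapId a).inv ≫ F.map₂ σ ≫ (F.mapComp f g).hom

instance (F : B ⥤ᵖ C) {a b : B} {f : a ⟶ b} {g : b ⟶ a} (σ : f ≫ g ⟶ 𝟙 a) [IsIso σ] :
    IsIso (mapCounit F σ) := by
  unfold mapCounit; infer_instance

theorem mapSq_vpaste (F : B ⥤ᵖ C) {a b c a' b' c' : B} {f : a ⟶ a'} {g : b ⟶ b'} {h : c ⟶ c'}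
    {k : a ⟶ b} {k' : a' ⟶ b'} {l : b ⟶ c} {l' : b' ⟶ c'}
    (σ : f ≫ k' ⟶ k ≫ g) (τ : g ≫ l' ⟶ l ≫ h) :
    F.map₂ (vpaste σ τ) = (F.mapComp f (k' ≫ l')).hom ≫ F.map f ◁ (F.mapComp k' l').hom ≫
      vpaste (mapSq F σ) (mapSq F τ) ≫ (F.mapComp k l).inv ▷ F.map h ≫
        (F.mapComp (k ≫ l) h).inv := by
  have h1 := F.mapComp_assoc_right_hom f k' l'
  have h2 := F.mapComp_assoc_left_inv k l h
  simp only [vpaste, mapSq, F.map₂_comp, Category.assoc, h2]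
  rw [reassoc_of% h1]
  simp

theorem map₂_whiskerRight_leftUnitor (F : B ⥤ᵖ C) {a b : B} {f : a ⟶ b} {g : b ⟶ a} {c : B}
   (σ : f ≫ g ⟶ 𝟙 a) (h : a ⟶ c) : F.map₂ (σ ▷ h ≫ (λ_ h).hom) =
    (F.mapComp (f ≫ g) h).hom ≫ (F.mapComp f g).hom ▷ F.map h ≫ mapCounit F σ ▷ F.map h ≫
        (λ_ _).hom := by
  simp [mapCounit]

theorem map₂_whiskerLeft_rightUnitor (F : B ⥤ᵖ C) {a b : B} {f : a ⟶ b} {g : b ⟶ a} {c : B}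
   (σ : f ≫ g ⟶ 𝟙 a) (h : c ⟶ a) : F.map₂ (h ◁ σ ≫ (ρ_ h).hom) =
    (F.mapComp h (f ≫ g)).hom ≫ F.map h ◁ (F.mapComp f g).hom ≫ F.map h ◁ mapCounit F σ ≫
        (ρ_ _).hom := by
  simp [mapCounit]

/-- Whiskering with a 1-cell that has a retraction up to isomorphism is injective on 2-cells. -/
theorem whiskerRight_cancel {a b c : B} {f : b ⟶ c} {g : c ⟶ b} (e : 𝟙 b ≅ f ≫ g) {h k : a ⟶ b}
    {p q : h ⟶ k}
    (H : p ▷ f ▷ g = q ▷ f ▷ g) : p = q := by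
  -- Conjugation by `e` recovers a 2-cell from its whiskering with `f` and `g`.
  have key (r : h ⟶ k) : r = 𝟙 _ ⊗≫ h ◁ e.hom ⊗≫ r ▷ f ▷ g ⊗≫ k ◁ e.inv ⊗≫ 𝟙 _ := by
    calc r = 𝟙 _ ⊗≫ (r ▷ 𝟙 b ≫ k ◁ (e.hom ≫ e.inv)) ⊗≫ 𝟙 _ := by
          rw [Iso.hom_inv_id, whiskerLeft_id, Category.comp_id]; bicategory
      _ = 𝟙 _ ⊗≫ (r ▷ 𝟙 b ≫ k ◁ e.hom) ⊗≫ k ◁ e.inv ⊗≫ 𝟙 _ := by bicategory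
      _ = _ := by rw [← whisker_exchange]; bicategory
  rw [key p, key q, H]
-- Here `tm`, `ttm`, `n` stand for `T m`, `T² m`, `T m_T`, the cells `k`, `l` for `m_T`, `m_{T²}`,
-- the cells `e`, `e'` for `T η_T`, `T η_{T²}`, and `s` for `T` of the naturality of `η` at `m`. As
-- for the redundant unit laws of a monoidal category, the identity equation trades `T ι` followed
-- by `τ` for `μ` whiskered with `T η`, the pentagon carries this `μ` across, and the identity
-- equation is used once more in the other direction.
theorem pasting_leftUnit {a b c d : B} {tm : c ⟶ b} {e : b ⟶ c} {m : b ⟶ a} {ttm : d ⟶ c}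
    {e' : c ⟶ d}
    {n : d ⟶ c} {k : c ⟶ b} {l : d ⟶ c} (μ : tm ≫ m ≅ k ≫ m) (tμ : ttm ≫ tm ⟶ n ≫ tm)
    (μT : n ≫ k ⟶ l ≫ k) (s : tm ≫ e ⟶ e' ≫ ttm) (mN : ttm ≫ k ⟶ l ≫ tm) (tι : e ≫ tm ⟶ 𝟙 b)
    (tιT : e' ≫ n ⟶ 𝟙 c) (τT : 𝟙 b ⟶ e ≫ k) (τTT : 𝟙 c ≅ e' ≫ l)
    (identity : e ◁ μ.hom = 𝟙 _ ⊗≫ tι ▷ m ⊗≫ τT ▷ m ⊗≫ 𝟙 _)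
    (identityT : e' ◁ μT = 𝟙 _ ⊗≫ tιT ▷ k ⊗≫ τTT.hom ▷ k ⊗≫ 𝟙 _)
    (pentagon : 𝟙 (ttm ≫ tm ≫ m) ⊗≫ tμ ▷ m ⊗≫ n ◁ μ.hom ⊗≫ μT ▷ m ⊗≫ 𝟙 (l ≫ k ≫ m) =
      𝟙 _ ⊗≫ ttm ◁ μ.hom ⊗≫ mN ▷ m ⊗≫ l ◁ μ.hom ⊗≫ 𝟙 _)
    (nat : 𝟙 tm ⊗≫ tm ◁ τT ⊗≫ s ▷ k ⊗≫ e' ◁ mN ⊗≫ 𝟙 (e' ≫ l ≫ tm) = 𝟙 _ ⊗≫ τTT.hom ▷ tm ⊗≫ 𝟙 _) :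
    (vpaste s tμ ≫ tιT ▷ tm ≫ (λ_ tm).hom) ▷ m = (tm ◁ tι ≫ (ρ_ tm).hom) ▷ m := by
  -- Composing with the invertible `μ` and `τTT` creates the composites to which the identity
  -- equation applies.
  rw [← cancel_mono (μ.hom ≫ (λ_ (k ≫ m)).inv ≫ τTT.hom ▷ (k ≫ m))]
  calc _ = 𝟙 _ ⊗≫ s ▷ (tm ≫ m) ⊗≫ e' ◁ tμ ▷ m ⊗≫ (tιT ▷ (tm ≫ m) ≫ 𝟙 c ◁ μ.hom) ⊗≫
        τTT.hom ▷ (k ≫ m) ⊗≫ 𝟙 _ := by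
        simp only [vpaste]; bicategory
    _ = 𝟙 _ ⊗≫ s ▷ (tm ≫ m) ⊗≫ e' ◁ (tμ ▷ m ⊗≫ n ◁ μ.hom) ⊗≫
        (𝟙 (e' ≫ n ≫ k) ⊗≫ tιT ▷ k ⊗≫ τTT.hom ▷ k ⊗≫ 𝟙 (e' ≫ l ≫ k)) ▷ m ⊗≫ 𝟙 _ := by
      rw [← whisker_exchange]; bicategory
    _ = 𝟙 _ ⊗≫ s ▷ (tm ≫ m) ⊗≫ e' ◁ (𝟙 (ttm ≫ tm ≫ m) ⊗≫ tμ ▷ m ⊗≫ n ◁ μ.hom ⊗≫ μT ▷ m ⊗≫ 𝟙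
        (l ≫ k ≫ m)) ⊗≫ 𝟙 _ := by
      rw [← identityT]; bicategory
    _ = 𝟙 _ ⊗≫ (s ▷ (tm ≫ m) ≫ (e' ≫ ttm) ◁ μ.hom) ⊗≫ e' ◁ mN ▷ m ⊗≫ (e' ≫ l) ◁ μ.hom ⊗≫ 𝟙 _ := by
      rw [pentagon]; bicategory
    _ = 𝟙 _ ⊗≫ tm ◁ (e ◁ μ.hom) ⊗≫ s ▷ (k ≫ m) ⊗≫ e' ◁ mN ▷ m ⊗≫ (e' ≫ l) ◁ μ.hom ⊗≫ 𝟙 _ := by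
      rw [← whisker_exchange]; bicategory
    _ = 𝟙 _ ⊗≫ tm ◁ tι ▷ m ⊗≫ (𝟙 tm ⊗≫ tm ◁ τT ⊗≫ s ▷ k ⊗≫ e' ◁ mN ⊗≫ 𝟙 (e' ≫ l ≫ tm)) ▷ m ⊗≫
        (e' ≫ l) ◁ μ.hom ⊗≫ 𝟙 _ := by
      rw [identity]; bicategory
    _ = 𝟙 _ ⊗≫ tm ◁ tι ▷ m ⊗≫ (τTT.hom ▷ (tm ≫ m) ≫ (e' ≫ l) ◁ μ.hom) ⊗≫ 𝟙 _ := by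
      rw [nat]; bicategory
    _ = _ := by rw [← whisker_exchange]; bicategory

/-- The pasting for the right unit, with `ttι = T²ι`, `tτ = Tτ_T`, `e = Tη_T` and `f = T²η_T`. -/
theorem pasting_rightUnit {a b c d : B} {tm : c ⟶ b} {e : b ⟶ c} {m : b ⟶ a} {ttm : d ⟶ c}
    {f : c ⟶ d}
    {n : d ⟶ c} {k : c ⟶ b} {l : d ⟶ c} (μ : tm ≫ m ≅ k ≫ m) (tμ : ttm ≫ tm ⟶ n ≫ tm)
    (μT : n ≫ k ⟶ l ≫ k) (mN : ttm ≫ k ⟶ l ≫ tm) (mN' : f ≫ l ⟶ k ≫ e) (tι : e ≫ tm ⟶ 𝟙 b)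
    (ttι : f ≫ ttm ≅ 𝟙 c) (τT : 𝟙 b ⟶ e ≫ k) (tτ : 𝟙 c ⟶ f ≫ n)
    (identity : e ◁ μ.hom = 𝟙 _ ⊗≫ tι ▷ m ⊗≫ τT ▷ m ⊗≫ 𝟙 _)
    (map_identity : f ◁ tμ = 𝟙 _ ⊗≫ ttι.hom ▷ tm ⊗≫ tτ ▷ tm ⊗≫ 𝟙 _)
    (pentagon : 𝟙 (ttm ≫ tm ≫ m) ⊗≫ tμ ▷ m ⊗≫ n ◁ μ.hom ⊗≫ μT ▷ m ⊗≫ 𝟙 (l ≫ k ≫ m) =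
      𝟙 _ ⊗≫ ttm ◁ μ.hom ⊗≫ mN ▷ m ⊗≫ l ◁ μ.hom ⊗≫ 𝟙 _)
    (nat : 𝟙 (f ≫ ttm ≫ k) ⊗≫ f ◁ mN ⊗≫ mN' ▷ tm ⊗≫ k ◁ tι ⊗≫ 𝟙 k = 𝟙 _ ⊗≫ ttι.hom ▷ k ⊗≫ 𝟙 _) :
    (tτ ▷ k ≫ hpaste mN' μT) ▷ m = ((λ_ k).hom ≫ (ρ_ k).inv ≫ k ◁ τT) ▷ m := by
  -- Composing with the invertible `T²ι` and `μ` makes `map_identity` applicable, after which the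
  -- pentagon can be used under `f`.
  rw [← cancel_epi (ttι.hom ▷ (tm ≫ m) ≫ (λ_ _).hom ≫ μ.hom ≫ (λ_ k).inv ▷ m)]
  calc _ = 𝟙 _ ⊗≫ ttι.hom ▷ (tm ≫ m) ⊗≫ (𝟙 c ◁ μ.hom ≫ tτ ▷ (k ≫ m)) ⊗≫ f ◁ μT ▷ m ⊗≫ mN' ▷
      (k ≫ m) ⊗≫ 𝟙 _ := by
        simp only [hpaste]; bicategory
    _ = 𝟙 _ ⊗≫ (𝟙 (f ≫ ttm ≫ tm) ⊗≫ ttι.hom ▷ tm ⊗≫ tτ ▷ tm ⊗≫ 𝟙 (f ≫ n ≫ tm)) ▷ m ⊗≫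
        (f ≫ n) ◁ μ.hom ⊗≫ f ◁ μT ▷ m ⊗≫
        mN' ▷ (k ≫ m) ⊗≫ 𝟙 _ := by rw [whisker_exchange]; bicategory
    _ = 𝟙 _ ⊗≫ f ◁ (𝟙 (ttm ≫ tm ≫ m) ⊗≫ tμ ▷ m ⊗≫ n ◁ μ.hom ⊗≫ μT ▷ m ⊗≫ 𝟙 (l ≫ k ≫ m)) ⊗≫ mN' ▷
        (k ≫ m) ⊗≫ 𝟙 _ := by
      rw [← map_identity]; bicategory
    _ = 𝟙 _ ⊗≫ (f ≫ ttm) ◁ μ.hom ⊗≫ f ◁ mN ▷ m ⊗≫ ((f ≫ l) ◁ μ.hom ≫ mN' ▷ (k ≫ m)) ⊗≫ 𝟙 _ := by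
      rw [pentagon]; bicategory
    _ = 𝟙 _ ⊗≫ (f ≫ ttm) ◁ μ.hom ⊗≫ f ◁ mN ▷ m ⊗≫ mN' ▷ (tm ≫ m) ⊗≫ k ◁ (e ◁ μ.hom) ⊗≫ 𝟙 _ := by
      rw [whisker_exchange]; bicategory
    _ = 𝟙 _ ⊗≫ (f ≫ ttm) ◁ μ.hom ⊗≫ (𝟙 (f ≫ ttm ≫ k) ⊗≫ f ◁ mN ⊗≫ mN' ▷ tm ⊗≫ k ◁ tι ⊗≫ 𝟙 k) ▷ m ⊗≫
        k ◁ τT ▷ m ⊗≫ 𝟙 _ := by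
      rw [identity]; bicategory
    _ = 𝟙 _ ⊗≫ ((f ≫ ttm) ◁ μ.hom ≫ ttι.hom ▷ (k ≫ m)) ⊗≫ k ◁ τT ▷ m ⊗≫ 𝟙 _ := by
      rw [nat]; bicategory
    _ = _ := by rw [whisker_exchange]; bicategory

/-- The pasting for two units, with `e = η_T`, `e2 = η_{T²}` and `te = Tη_T`. -/
theorem pasting_unit_unit {a b c : B} {e : a ⟶ b} {m : b ⟶ a} {e2 te : b ⟶ c} {tm k : c ⟶ b}
    (μ : tm ≫ m ⟶ k ≫ m) (ι : e ≫ m ≅ 𝟙 a) (ιT : e2 ≫ k ≅ 𝟙 b) (tι : te ≫ tm ⟶ 𝟙 b)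
        (τT : 𝟙 b ⟶ te ≫ k)
    (N : m ≫ e ⟶ e2 ≫ tm) (N' : e ≫ e2 ⟶ e ≫ te)
    (identity : te ◁ μ = 𝟙 _ ⊗≫ tι ▷ m ⊗≫ τT ▷ m ⊗≫ 𝟙 _)
    (leftUnit : 𝟙 (m ≫ e ≫ m) ⊗≫ N ▷ m ⊗≫ e2 ◁ μ ⊗≫ ιT.hom ▷ m ⊗≫ 𝟙 m = 𝟙 _ ⊗≫ m ◁ ι.hom ⊗≫ 𝟙 _)
    (nat : 𝟙 (e ≫ m ≫ e) ⊗≫ e ◁ N ⊗≫ N' ▷ tm ⊗≫ e ◁ tι ⊗≫ 𝟙 e = 𝟙 _ ⊗≫ ι.hom ▷ e ⊗≫ 𝟙 _) :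
    (e ◁ ιT.inv ≫ (α_ _ _ _).inv ≫ N' ▷ k ≫ (α_ _ _ _).hom) ▷ m = (e ◁ τT) ▷ m := by
  rw [← cancel_epi ((ρ_ e).inv ▷ m)]
  have hι : ι.hom ▷ (e ≫ m) ≫ 𝟙 a ◁ ι.hom = (e ≫ m) ◁ ι.hom ≫ ι.hom ▷ 𝟙 a :=
      (whisker_exchange _ _).symm
  -- The two ways of contracting one factor of `(e ≫ m) ≫ (e ≫ m)` by `ι` agree after a further `ι`,
  -- by interchange, hence agree because `ι` is invertible.
  have hι' : 𝟙 ((e ≫ m) ≫ e ≫ m) ⊗≫ ι.hom ▷ (e ≫ m) ⊗≫ 𝟙 (e ≫ m) = 𝟙 _ ⊗≫ (e ≫ m) ◁ ι.hom ⊗≫ 𝟙 _ :=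
      by
    rw [← cancel_mono ι.hom]
    calc _ = 𝟙 _ ⊗≫ (ι.hom ▷ (e ≫ m) ≫ 𝟙 a ◁ ι.hom) ⊗≫ 𝟙 _ := by bicategory
      _ = _ := by rw [hι]; bicategory
  have : IsIso (𝟙 ((e ≫ m) ≫ e ≫ m) ⊗≫ ι.hom ▷ (e ≫ m) ⊗≫ 𝟙 (e ≫ m)) := by
    simp only [bicategoricalComp]; infer_instance
  rw [← cancel_epi (𝟙 ((e ≫ m) ≫ e ≫ m) ⊗≫ ι.hom ▷ (e ≫ m) ⊗≫ 𝟙 (e ≫ m))]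
  calc _ = (𝟙 ((e ≫ m) ≫ e ≫ m) ⊗≫ (e ≫ m) ◁ ι.hom ⊗≫ 𝟙 (e ≫ m)) ⊗≫ (e ◁ ιT.inv ⊗≫ N' ▷ k) ▷ m ⊗≫
      𝟙 _ := by
        rw [hι']; bicategory
    _ = 𝟙 _ ⊗≫ e ◁ (𝟙 (m ≫ e ≫ m) ⊗≫ m ◁ ι.hom ⊗≫ 𝟙 m) ⊗≫ (e ◁ ιT.inv ⊗≫ N' ▷ k) ▷ m ⊗≫ 𝟙 _ := by
        bicategory
    _ = 𝟙 _ ⊗≫ e ◁ N ▷ m ⊗≫ (e ≫ e2) ◁ μ ⊗≫ e ◁ (ιT.hom ≫ ιT.inv) ▷ m ⊗≫ N' ▷ k ▷ m ⊗≫ 𝟙 _ := by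
      rw [← leftUnit]; bicategory
    _ = 𝟙 _ ⊗≫ e ◁ N ▷ m ⊗≫ ((e ≫ e2) ◁ μ ≫ N' ▷ (k ≫ m)) ⊗≫ 𝟙 _ := by
      rw [Iso.hom_inv_id]; bicategory
    _ = 𝟙 _ ⊗≫ e ◁ N ▷ m ⊗≫ N' ▷ (tm ≫ m) ⊗≫ e ◁ (te ◁ μ) ⊗≫ 𝟙 _ := by
      rw [whisker_exchange]; bicategory
    _ = 𝟙 _ ⊗≫ (𝟙 (e ≫ m ≫ e) ⊗≫ e ◁ N ⊗≫ N' ▷ tm ⊗≫ e ◁ tι ⊗≫ 𝟙 e) ▷ m ⊗≫ e ◁ τT ▷ m ⊗≫ 𝟙 _ := by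
      rw [identity]; bicategory
    _ = _ := by rw [nat]; bicategory


/-- Brings the equation `HT`, known one power of `T` higher and only after whiskering with `m`, down
to the equation itself. The 1-cell `g = T η` has the retraction `m`, up to `τ`, so the conclusion
may be whiskered with `g` and then `m`; naturality along `η` turns the result into `HT`. -/
theorem pasting_rightUnit_naturality {a b c d : B} {g : a ⟶ b} {g1 g2 : b ⟶ c} {h1 h2 : c ⟶ d}
    {m : b ⟶ a}
    {k n : c ⟶ b} {l n1 : d ⟶ c}
    (τT : 𝟙 b ⟶ g1 ≫ k) (τ : 𝟙 a ≅ g ≫ m)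
    (tτ : 𝟙 b ⟶ g2 ≫ n) (tτT : 𝟙 c ⟶ h1 ≫ n1) (μ : n ≫ m ⟶ k ≫ m) (μT : n1 ≫ k ⟶ l ≫ k)
    (q : g2 ≫ k ≅ m ≫ g) (qT : h1 ≫ l ⟶ k ≫ g1) (q2 : h2 ≫ l ⟶ k ≫ g2)
    (s : g ≫ g1 ⟶ g ≫ g2) (ts : g2 ≫ h1 ⟶ g2 ≫ h2) (tq : h2 ≫ n1 ⟶ n ≫ g2)
    (τnat : 𝟙 g ⊗≫ g ◁ τT ⊗≫ s ▷ k ⊗≫ g ◁ q.hom ⊗≫ 𝟙 (g ≫ m ≫ g) = 𝟙 _ ⊗≫ τ.hom ▷ g ⊗≫ 𝟙 _)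
    (tτnat : 𝟙 g2 ⊗≫ g2 ◁ tτT ⊗≫ ts ▷ n1 ⊗≫ g2 ◁ tq ⊗≫ 𝟙 (g2 ≫ n ≫ g2) = 𝟙 _ ⊗≫ tτ ▷ g2 ⊗≫ 𝟙 _)
    (μnat : 𝟙 (h2 ≫ n1 ≫ k) ⊗≫ h2 ◁ μT ⊗≫ q2 ▷ k ⊗≫ k ◁ q.hom ⊗≫ 𝟙 (k ≫ m ≫ g) =
      𝟙 _ ⊗≫ tq ▷ k ⊗≫ n ◁ q.hom ⊗≫ μ ▷ g ⊗≫ 𝟙 _)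
    (mnat : 𝟙 (g2 ≫ h1 ≫ l) ⊗≫ g2 ◁ qT ⊗≫ q.hom ▷ g1 ⊗≫ m ◁ s ⊗≫ 𝟙 (m ≫ g ≫ g2) =
      𝟙 _ ⊗≫ ts ▷ l ⊗≫ g2 ◁ q2 ⊗≫ q.hom ▷ g2 ⊗≫ 𝟙 _)
    (HT : (tτT ▷ k ≫ hpaste qT μT) ▷ m = ((λ_ k).hom ≫ (ρ_ k).inv ≫ k ◁ τT) ▷ m) :
    tτ ▷ m ≫ hpaste q.hom μ = (λ_ m).hom ≫ (ρ_ m).inv ≫ m ◁ τ.hom := by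
  -- Up to the invertible `q`, the desired left side whiskered with `g` contains the unwhiskered
  -- left side of `HT`.
  have key : 𝟙 (g2 ≫ k) ⊗≫ g2 ◁ (tτT ▷ k ⊗≫ h1 ◁ μT ⊗≫ qT ▷ k) ⊗≫ q.hom ▷ (g1 ≫ k) ⊗≫ m ◁ s ▷ k ⊗≫
      (m ≫ g) ◁ q.hom ⊗≫ 𝟙 (m ≫ g ≫ m ≫ g) = 𝟙 _ ⊗≫ q.hom ⊗≫ (tτ ▷ m ⊗≫ g2 ◁ μ ⊗≫ q.hom ▷ m) ▷ g ⊗≫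
          𝟙 _ := by
    calc _ = 𝟙 _ ⊗≫ g2 ◁ tτT ▷ k ⊗≫ (g2 ≫ h1) ◁ μT ⊗≫
          (𝟙 (g2 ≫ h1 ≫ l) ⊗≫ g2 ◁ qT ⊗≫ q.hom ▷ g1 ⊗≫ m ◁ s ⊗≫ 𝟙 (m ≫ g ≫ g2)) ▷ k ⊗≫
          (m ≫ g) ◁ q.hom ⊗≫ 𝟙 _ := by bicategory
      _ = 𝟙 _ ⊗≫ g2 ◁ tτT ▷ k ⊗≫ ((g2 ≫ h1) ◁ μT ≫ ts ▷ (l ≫ k)) ⊗≫ g2 ◁ q2 ▷ k ⊗≫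
          (q.hom ▷ (g2 ≫ k) ≫ (m ≫ g) ◁ q.hom) ⊗≫ 𝟙 _ := by rw [mnat]; bicategory
      _ = 𝟙 _ ⊗≫ g2 ◁ tτT ▷ k ⊗≫ ts ▷ (n1 ≫ k) ⊗≫
          g2 ◁ (𝟙 (h2 ≫ n1 ≫ k) ⊗≫ h2 ◁ μT ⊗≫ q2 ▷ k ⊗≫ k ◁ q.hom ⊗≫ 𝟙 (k ≫ m ≫ g)) ⊗≫ q.hom ▷
              (m ≫ g) ⊗≫ 𝟙 _ := by
        rw [whisker_exchange, ← whisker_exchange q.hom]; bicategory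
      _ = 𝟙 _ ⊗≫ (𝟙 g2 ⊗≫ g2 ◁ tτT ⊗≫ ts ▷ n1 ⊗≫ g2 ◁ tq ⊗≫ 𝟙 (g2 ≫ n ≫ g2)) ▷ k ⊗≫
          (g2 ≫ n) ◁ q.hom ⊗≫ g2 ◁ μ ▷ g ⊗≫ q.hom ▷ (m ≫ g) ⊗≫ 𝟙 _ := by rw [μnat]; bicategory
      _ = 𝟙 _ ⊗≫ (tτ ▷ (g2 ≫ k) ≫ (g2 ≫ n) ◁ q.hom) ⊗≫ g2 ◁ μ ▷ g ⊗≫ q.hom ▷ (m ≫ g) ⊗≫ 𝟙 _ := by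
        rw [tτnat]; bicategory
      _ = _ := by rw [← whisker_exchange]; bicategory
  apply whiskerRight_cancel τ
  rw [← cancel_epi (q.hom ▷ m ≫ (λ_ m).inv ▷ g ▷ m), ← cancel_mono (α_ _ _ _).hom]
  calc _ = 𝟙 _ ⊗≫ (𝟙 (g2 ≫ k) ⊗≫ q.hom ⊗≫ (tτ ▷ m ⊗≫ g2 ◁ μ ⊗≫ q.hom ▷ m) ▷ g ⊗≫
        𝟙 (m ≫ g ≫ m ≫ g)) ▷ m ⊗≫ 𝟙 _ := by simp only [hpaste]; bicategory
    _ = 𝟙 _ ⊗≫ g2 ◁ ((tτT ▷ k ≫ hpaste qT μT) ▷ m) ⊗≫ q.hom ▷ (g1 ≫ k ≫ m) ⊗≫ m ◁ s ▷ (k ≫ m) ⊗≫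
      (m ≫ g) ◁ q.hom ▷ m ⊗≫ 𝟙 _ := by rw [← key]; simp only [hpaste]; bicategory
    _ = 𝟙 _ ⊗≫ ((g2 ≫ k) ◁ τT ≫ q.hom ▷ (g1 ≫ k)) ▷ m ⊗≫ m ◁ s ▷ (k ≫ m) ⊗≫
      (m ≫ g) ◁ q.hom ▷ m ⊗≫ 𝟙 _ := by rw [HT]; bicategory
    _ = 𝟙 _ ⊗≫ q.hom ▷ m ⊗≫ m ◁ (𝟙 g ⊗≫ g ◁ τT ⊗≫ s ▷ k ⊗≫ g ◁ q.hom ⊗≫ 𝟙 (g ≫ m ≫ g)) ▷ m ⊗≫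
        𝟙 _ := by
      rw [whisker_exchange]; bicategory
    _ = _ := by rw [τnat]; bicategory

/-- The same descent along `T η` as in `pasting_rightUnit_naturality`, now for the comparison of `ι`
with `τ`. -/
theorem pasting_unit_unit_naturality {x a b c : B} {e : x ⟶ a} {e1 g : a ⟶ b} {e2 g1 g2 : b ⟶ c}
    {m : b ⟶ a} {k : c ⟶ b} (ι : e1 ≫ m ≅ 𝟙 a) (ιT : e2 ≫ k ≅ 𝟙 b)
    (N : e ≫ e1 ≅ e ≫ g) (τ : 𝟙 a ≅ g ≫ m) (τT : 𝟙 b ⟶ g1 ≫ k) (N1 : e1 ≫ e2 ⟶ e1 ≫ g1)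
        (Ng : g ≫ e2 ⟶ e1 ≫ g2) (s : g ≫ g1 ⟶ g ≫ g2)
    (q : g2 ≫ k ⟶ m ≫ g)
    (ηnat : 𝟙 (e ≫ e1 ≫ e2) ⊗≫ e ◁ N1 ⊗≫ N.hom ▷ g1 ⊗≫ e ◁ s ⊗≫ 𝟙 (e ≫ g ≫ g2) =
      𝟙 _ ⊗≫ N.hom ▷ e2 ⊗≫ e ◁ Ng ⊗≫ N.hom ▷ g2 ⊗≫ 𝟙 _)
    (ιnat : 𝟙 (g ≫ e2 ≫ k) ⊗≫ Ng ▷ k ⊗≫ e1 ◁ q ⊗≫ ι.hom ▷ g ⊗≫ 𝟙 g = 𝟙 _ ⊗≫ g ◁ ιT.hom ⊗≫ 𝟙 _)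
    (τnat : 𝟙 g ⊗≫ g ◁ τT ⊗≫ s ▷ k ⊗≫ g ◁ q ⊗≫ 𝟙 (g ≫ m ≫ g) = 𝟙 _ ⊗≫ τ.hom ▷ g ⊗≫ 𝟙 _)
    (HT : (e1 ◁ ιT.inv ≫ (α_ _ _ _).inv ≫ N1 ▷ k ≫ (α_ _ _ _).hom) ▷ m = (e1 ◁ τT) ▷ m) :
    e ◁ ι.inv ≫ (α_ _ _ _).inv ≫ N.hom ▷ m ≫ (α_ _ _ _).hom = e ◁ τ.hom := by
  have key : 𝟙 (e ≫ e1) ⊗≫ e ◁ (e1 ◁ ιT.inv ⊗≫ N1 ▷ k) ⊗≫ N.hom ▷ (g1 ≫ k) ⊗≫ e ◁ s ▷ k ⊗≫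
      (e ≫ g) ◁ q ⊗≫
      𝟙 (e ≫ g ≫ m ≫ g) = 𝟙 _ ⊗≫ N.hom ⊗≫ (e ◁ ι.inv ⊗≫ N.hom ▷ m) ▷ g ⊗≫ 𝟙 _ := by
    have ιnat' : 𝟙 g ⊗≫ g ◁ ιT.inv ⊗≫ Ng ▷ k ⊗≫ e1 ◁ q ⊗≫ 𝟙 (e1 ≫ m ≫ g) = 𝟙 _ ⊗≫ ι.inv ▷ g ⊗≫
        𝟙 _ := by
      calc _ = 𝟙 _ ⊗≫ g ◁ ιT.inv ⊗≫ Ng ▷ k ⊗≫ e1 ◁ q ⊗≫ (ι.hom ≫ ι.inv) ▷ g ⊗≫ 𝟙 _ := by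
            rw [Iso.hom_inv_id]; bicategory
        _ = 𝟙 _ ⊗≫ g ◁ ιT.inv ⊗≫ (𝟙 (g ≫ e2 ≫ k) ⊗≫ Ng ▷ k ⊗≫ e1 ◁ q ⊗≫ ι.hom ▷ g ⊗≫ 𝟙 g) ⊗≫
            ι.inv ▷ g ⊗≫ 𝟙 _ := by
          bicategory
        _ = 𝟙 _ ⊗≫ g ◁ (ιT.inv ≫ ιT.hom) ⊗≫ ι.inv ▷ g ⊗≫ 𝟙 _ := by rw [ιnat]; bicategory
        _ = _ := by rw [Iso.inv_hom_id]; bicategory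
    calc _ = 𝟙 _ ⊗≫ (e ≫ e1) ◁ ιT.inv ⊗≫
          (𝟙 (e ≫ e1 ≫ e2) ⊗≫ e ◁ N1 ⊗≫ N.hom ▷ g1 ⊗≫ e ◁ s ⊗≫ 𝟙 (e ≫ g ≫ g2)) ▷ k ⊗≫
              (e ≫ g) ◁ q ⊗≫ 𝟙 _ := by
          bicategory
      _ = 𝟙 _ ⊗≫ ((e ≫ e1) ◁ ιT.inv ≫ N.hom ▷ (e2 ≫ k)) ⊗≫ e ◁ Ng ▷ k ⊗≫
          (N.hom ▷ (g2 ≫ k) ≫ (e ≫ g) ◁ q) ⊗≫ 𝟙 _ := by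
        rw [ηnat]; bicategory
      _ = 𝟙 _ ⊗≫ N.hom ⊗≫ e ◁ (𝟙 g ⊗≫ g ◁ ιT.inv ⊗≫ Ng ▷ k ⊗≫ e1 ◁ q ⊗≫ 𝟙 (e1 ≫ m ≫ g)) ⊗≫ N.hom ▷
          (m ≫ g) ⊗≫ 𝟙 _ := by
        rw [whisker_exchange, ← whisker_exchange N.hom q]; bicategory
      _ = _ := by rw [ιnat']; bicategory
  apply whiskerRight_cancel τ
  rw [← cancel_epi (N.hom ▷ m ≫ (ρ_ e).inv ▷ g ▷ m), ← cancel_mono (α_ _ _ _).hom]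
  calc _ = 𝟙 _ ⊗≫ (𝟙 (e ≫ e1) ⊗≫ N.hom ⊗≫ (e ◁ ι.inv ⊗≫ N.hom ▷ m) ▷ g ⊗≫ 𝟙 (e ≫ g ≫ m ≫ g)) ▷ m ⊗≫
      𝟙 _ := by
        bicategory
    _ = 𝟙 _ ⊗≫ e ◁ (e1 ◁ ιT.inv ≫ (α_ _ _ _).inv ≫ N1 ▷ k ≫ (α_ _ _ _).hom) ▷ m ⊗≫ N.hom ▷
        (g1 ≫ k ≫ m) ⊗≫
        e ◁ s ▷ (k ≫ m) ⊗≫ (e ≫ g) ◁ q ▷ m ⊗≫ 𝟙 _ := by rw [← key]; bicategory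
    _ = 𝟙 _ ⊗≫ ((e ≫ e1) ◁ τT ≫ N.hom ▷ (g1 ≫ k)) ▷ m ⊗≫ e ◁ s ▷ (k ≫ m) ⊗≫ (e ≫ g) ◁ q ▷ m ⊗≫
        𝟙 _ := by
      rw [HT]; bicategory
    _ = 𝟙 _ ⊗≫ N.hom ▷ m ⊗≫ e ◁ (𝟙 g ⊗≫ g ◁ τT ⊗≫ s ▷ k ⊗≫ g ◁ q ⊗≫ 𝟙 (g ≫ m ≫ g)) ▷ m ⊗≫ 𝟙 _ := by
      rw [whisker_exchange]; bicategory
    _ = _ := by rw [τnat]; bicategory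

namespace Pseudomonad
variable (T : Pseudomonad B)

theorem identity' (X : B) :
    T.T.map (T.ηApp (T.T.obj X)) ◁ (T.μ X).hom = 𝟙 _ ⊗≫ mapCounit T.T (T.ι X).hom ▷ T.mApp X
      ⊗≫ (T.τ (T.T.obj X)).hom ▷ T.mApp X ⊗≫ 𝟙 _ := by
  rw [T.identity]
  simp only [mapCounit]
  bicategory


theorem associativity' (X : B) :
    𝟙 (T.T.map (T.T.map (T.mApp X)) ≫ T.T.map (T.mApp X) ≫ T.mApp X) ⊗≫
      mapSq T.T (T.μ X).hom ▷ T.mApp X ⊗≫ T.T.map (T.mApp (T.T.obj X)) ◁ (T.μ X).hom ⊗≫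
      (T.μ (T.T.obj X)).hom ▷ T.mApp X ⊗≫
        𝟙 (T.mApp (T.T.obj (T.T.obj X)) ≫ T.mApp (T.T.obj X) ≫ T.mApp X) =
    𝟙 _ ⊗≫ T.T.map (T.T.map (T.mApp X)) ◁ (T.μ X).hom ⊗≫ (T.mNat (T.mApp X)).hom ▷ T.mApp X ⊗≫
      T.mApp _ ◁ (T.μ X).hom ⊗≫ 𝟙 _ := by
  have := T.associativity X =≫ (α_ _ _ _).hom
  simp only [vpaste] at this
  convert this using 1 <;> bicategory

/-- Through `ι`, whiskering with `η` and then `m` changes nothing up to isomorphism, while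
naturality of `η` replaces `r ▷ η` by `η ◁ T r`. Hence a 2-cell `r` between 1-cells into `TX` is
recovered from `T r` whiskered with `m`. -/
theorem eq_of_map₂_whiskerRight {S X : B} {f g : S ⟶ T.T.obj X} {p q : f ⟶ g}
    (h : T.T.map₂ p ▷ T.mApp X = T.T.map₂ q ▷ T.mApp X) : p = q := by
  have key (r : f ⟶ g) : r = 𝟙 _ ⊗≫ f ◁ (T.ι X).inv ⊗≫ (T.ηNat f).hom ▷ T.mApp X ⊗≫
      T.ηApp S ◁ (T.T.map₂ r ▷ T.mApp X) ⊗≫ (T.ηNat g).inv ▷ T.mApp X ⊗≫ g ◁ (T.ι X).hom ⊗≫ 𝟙 _ :=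
          by
    calc r = 𝟙 _ ⊗≫ f ◁ (T.ι X).inv ⊗≫ (r ▷ (T.ηApp _ ≫ T.mApp X) ≫ g ◁ (T.ι X).hom) ⊗≫ 𝟙 _ := by
          rw [← whisker_exchange]
          have : f ◁ (T.ι X).inv ≫ f ◁ (T.ι X).hom = 𝟙 _ := by simp [← whiskerLeft_comp]
          calc r = 𝟙 _ ⊗≫ r ⊗≫ 𝟙 _ := by bicategory
            _ = 𝟙 _ ⊗≫ (f ◁ (T.ι X).inv ≫ f ◁ (T.ι X).hom) ⊗≫ r ⊗≫ 𝟙 _ := by rw [this]; bicategory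
            _ = _ := by bicategory
      _ = 𝟙 _ ⊗≫ f ◁ (T.ι X).inv ⊗≫ ((r ▷ T.ηApp _ ≫ (T.ηNat g).hom) ≫ (T.ηNat g).inv) ▷ T.mApp X ⊗≫
            g ◁ (T.ι X).hom ⊗≫ 𝟙 _ := by rw [Category.assoc, Iso.hom_inv_id]; bicategory
      _ = _ := by rw [T.ηNat_naturality]; bicategory
  rw [key p, key q, h]


/-- Naturality of `m` with respect to filled squares, combining naturality in 2-cells with
compatibility with composition. The analogues below treat `η` and composites contracted to an
identity. -/
theorem mNat_sq {a b a' b' : B} {f : a ⟶ b} {k : a ⟶ a'} {l : b ⟶ b'}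
    {f' : a' ⟶ b'} (σ : f ≫ l ⟶ k ≫ f') :
    mapSq T.T (mapSq T.T σ) ▷ T.mApp b' ≫ hpaste (T.mNat k).hom (T.mNat f').hom =
      hpaste (T.mNat f).hom (T.mNat l).hom ≫ T.mApp a ◁ mapSq T.T σ := by
  have h := T.mNat_naturality σ
  have h1 := T.mNat_comp f l
  have h2 := T.mNat_comp k f'
  rw [← cancel_epi ((T.T.map₂ (T.T.mapComp f l).hom ≫ (T.T.mapComp _ _).hom) ▷ T.mApp b'),
    ← reassoc_of% h1]
  have h3 : T.T.map₂ (T.T.mapComp f l).hom ▷ T.mApp b' ≫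
      T.T.map₂ (T.T.mapComp f l).inv ▷ T.mApp b' = 𝟙 _ := by
    rw [← comp_whiskerRight, ← T.T.map₂_comp]; simp
  simp only [mapSq, T.T.map₂_comp, comp_whiskerRight, Category.assoc, whiskerLeft_comp]
  simp only [comp_whiskerRight, Category.assoc] at h2
  rw [← h2]
  simp [reassoc_of% h, reassoc_of% h3]

theorem ηNat_sq {a b a' b' : B} {f : a ⟶ b} {k : a ⟶ a'} {l : b ⟶ b'}
    {f' : a' ⟶ b'} (σ : f ≫ l ⟶ k ≫ f') :
    σ ▷ T.ηApp b' ≫ hpaste (T.ηNat k).hom (T.ηNat f').hom =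
      hpaste (T.ηNat f).hom (T.ηNat l).hom ≫ T.ηApp a ◁ mapSq T.T σ := by
  have h := T.ηNat_naturality σ
  rw [← T.ηNat_comp, ← T.ηNat_comp, reassoc_of% h]
  simp [mapSq]

theorem mNat_counit {a b : B} {f : a ⟶ b} {g : b ⟶ a} (σ : f ≫ g ⟶ 𝟙 a) :
    hpaste (T.mNat f).hom (T.mNat g).hom ≫ T.mApp a ◁ mapCounit T.T σ =
      mapCounit T.T (mapCounit T.T σ) ▷ T.mApp a ≫ (λ_ _).hom ≫ (ρ_ _).inv := by
  have h := T.mNat_naturality σ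
  have h1 := T.mNat_comp f g
  have h2 := T.mNat_id a
  rw [← cancel_epi ((T.T.map₂ (T.T.mapComp f g).hom ≫ (T.T.mapComp _ _).hom) ▷ T.mApp a),
    ← reassoc_of% h1]
  have h3 : T.T.map₂ (T.T.mapComp f g).hom ▷ T.mApp a ≫
      T.T.map₂ (T.T.mapComp f g).inv ▷ T.mApp a = 𝟙 _ := by
    rw [← comp_whiskerRight, ← T.T.map₂_comp]; simp
  simp only [mapCounit, T.T.map₂_comp, comp_whiskerRight, Category.assoc, whiskerLeft_comp]
  simp only [comp_whiskerRight, Category.assoc] at h2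
  rw [← h2]
  simp [← reassoc_of% h, reassoc_of% h3]

theorem ηNat_counit {a b : B} {f : a ⟶ b} {g : b ⟶ a} (σ : f ≫ g ⟶ 𝟙 a) :
    hpaste (T.ηNat f).hom (T.ηNat g).hom ≫ T.ηApp a ◁ mapCounit T.T σ =
      σ ▷ T.ηApp a ≫ (λ_ _).hom ≫ (ρ_ _).inv := by
  have h := T.ηNat_naturality σ
  rw [← T.ηNat_comp, ← T.ηNat_id, reassoc_of% h]
  simp [mapCounit]

/-- The image of the identity equation under `T`, in the form required by `pasting_rightUnit`. -/
theorem map_identity (X : B) :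
    T.T.map (T.T.map (T.ηApp (T.T.obj X))) ◁ mapSq T.T (T.μ X).hom =
      𝟙 _ ⊗≫ mapCounit T.T (mapCounit T.T (T.ι X).hom) ▷ T.T.map (T.mApp X)
      ⊗≫ mapUnit T.T (T.τ (T.T.obj X)).hom ▷ T.T.map (T.mApp X) ⊗≫ 𝟙 _ := by
  have h := congrArg (fun x => (T.T.map _ ◁ (T.T.mapComp _ _).inv ≫ (T.T.mapComp _ _).inv) ≫
    T.T.map₂ x ≫ (T.T.mapComp _ _).hom ≫ T.T.map _ ◁ (T.T.mapComp _ _).hom) (T.identity X)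
  have h1 := T.T.mapComp_assoc_right_inv (T.T.map (T.ηApp (T.T.obj X))) (T.T.map (T.mApp X))
      (T.mApp X)
  have h2 := T.T.mapComp_assoc_right_hom (T.T.map (T.ηApp (T.T.obj X))) (T.mApp (T.T.obj X))
      (T.mApp X)
  calc _ = _ := ?_
    _ = _ := h
    _ = _ := ?_
  · simp [mapSq]
  · rw [h1, h2]
    simp only [Category.assoc, ← T.T.map₂_comp_assoc]
    simp only [Iso.hom_inv_id_assoc, Iso.hom_inv_id, Category.comp_id]
    simp [mapCounit, mapUnit, bicategoricalComp]


theorem τ_naturality' {X Y : B} (f : X ⟶ Y) :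
    𝟙 (T.T.map f) ⊗≫ T.T.map f ◁ (T.τ Y).hom ⊗≫ mapSq T.T (T.ηNat f).hom ▷ T.mApp Y ⊗≫
      T.T.map (T.ηApp X) ◁ (T.mNat f).hom ⊗≫ 𝟙 (T.T.map (T.ηApp X) ≫ T.mApp X ≫ T.T.map f) =
    𝟙 _ ⊗≫ (T.τ X).hom ▷ T.T.map f ⊗≫ 𝟙 _ := by
  calc _ = 𝟙 _ ⊗≫ (T.T.map f ◁ (T.τ Y).hom ≫
        vpaste (mapSq T.T (T.ηNat f).hom) (T.mNat f).hom) ⊗≫ 𝟙 _ := by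
            simp only [vpaste]; bicategory
    _ = _ := by rw [T.τ_naturality]; bicategory

theorem ι_naturality' {X Y : B} (f : X ⟶ Y) :
    𝟙 (T.T.map f ≫ T.ηApp _ ≫ T.mApp Y) ⊗≫ (T.ηNat (T.T.map f)).hom ▷ T.mApp Y ⊗≫
      T.ηApp _ ◁ (T.mNat f).hom ⊗≫ (T.ι X).hom ▷ T.T.map f ⊗≫ 𝟙 (T.T.map f) =
    𝟙 _ ⊗≫ T.T.map f ◁ (T.ι Y).hom ⊗≫ 𝟙 _ := by
  calc _ = 𝟙 _ ⊗≫ (vpaste (T.ηNat (T.T.map f)).hom (T.mNat f).hom ≫ (T.ι X).hom ▷ T.T.map f) ⊗≫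
        𝟙 _ := by simp only [vpaste]; bicategory
    _ = _ := by rw [← T.ι_naturality]; bicategory

theorem map_τ_naturality {X Y : B} (f : X ⟶ Y) :
    𝟙 (T.T.map (T.T.map f)) ⊗≫ T.T.map (T.T.map f) ◁ mapUnit T.T (T.τ Y).hom ⊗≫
      mapSq T.T (mapSq T.T (T.ηNat f).hom) ▷ T.T.map (T.mApp Y) ⊗≫
      T.T.map (T.T.map (T.ηApp X)) ◁ mapSq T.T (T.mNat f).hom ⊗≫
        𝟙 (T.T.map (T.T.map (T.ηApp X)) ≫ T.T.map (T.mApp X) ≫ T.T.map (T.T.map f)) =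
    𝟙 _ ⊗≫ mapUnit T.T (T.τ X).hom ▷ T.T.map (T.T.map f) ⊗≫ 𝟙 _ := by
  have h := congrArg (fun x => T.T.map₂ x ≫ (T.T.mapComp _ _).hom ≫ (T.T.mapComp _ _).hom ▷ _)
    (T.τ_naturality f)
  have h' : T.T.map₂ (λ_ (T.T.map f)).inv = (λ_ _).inv ≫ (T.T.mapId _).inv ▷ _ ≫
      (T.T.mapComp (𝟙 _) (T.T.map f)).inv := by
    rw [T.T.mapComp_id_left_inv]; simp
  simp only [T.T.map₂_comp, mapSq_vpaste, T.T.map₂_whisker_left, T.T.map₂_right_unitor, h',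
    T.T.map₂_whisker_right, Category.assoc, Iso.inv_hom_id_assoc, inv_hom_whiskerRight,
    Category.comp_id, cancel_epi] at h
  rw [← cancel_epi (ρ_ (T.T.map (T.T.map f))).hom,
    ← cancel_epi (T.T.map (T.T.map f) ◁ (T.T.mapId (T.T.obj Y)).hom)]
  calc _ = (T.T.map (T.T.map f) ◁ T.T.map₂ (T.τ Y).hom ≫ T.T.map (T.T.map f) ◁
      (T.T.mapComp _ _).hom ≫
      vpaste (mapSq T.T (mapSq T.T (T.ηNat f).hom)) (mapSq T.T (T.mNat f).hom)) ⊗≫ 𝟙 _ := by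
        simp only [mapUnit, vpaste, bicategoricalComp]
        simp
    _ = _ := by
      rw [h]; simp [mapUnit, bicategoricalComp]

/-- The left identity law of the free algebra. -/
theorem free_identity_left (X : B) :
    T.mApp X ◁ (T.ι X).inv ≫ vpaste (T.ηNat (T.mApp X)).hom (T.μ X).hom ≫
      (T.ι (T.T.obj X)).hom ▷ T.mApp X = (ρ_ (T.mApp X)).hom ≫ (λ_ (T.mApp X)).inv := by
  rw [← whiskerLeftIso_inv, Iso.inv_comp_eq, ← cancel_mono (λ_ (T.mApp X)).hom]
  -- After applying `T` and whiskering with `m`, this is `pasting_leftUnit`.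
  apply T.eq_of_map₂_whiskerRight
  have h := pasting_leftUnit (T.μ X) (mapSq T.T (T.μ X).hom) (T.μ (T.T.obj X)).hom
    (mapSq T.T (T.ηNat (T.mApp X)).hom) (T.mNat (T.mApp X)).hom (mapCounit T.T (T.ι X).hom)
    (mapCounit T.T (T.ι (T.T.obj X)).hom) (T.τ (T.T.obj X)).hom (T.τ _)
    (T.identity' X) (T.identity' _) (T.associativity' X) (T.τ_naturality' (T.mApp X))
  simp only [Category.assoc, Iso.inv_hom_id, Category.comp_id]
  rw [T.T.map₂_comp, mapSq_vpaste, map₂_whiskerRight_leftUnitor, whiskerLeftIso_hom,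
    map₂_whiskerLeft_rightUnitor]
  simp only [Category.assoc, Iso.inv_hom_id_assoc, comp_whiskerRight]
  congr 2
  simp only [← comp_whiskerRight_assoc, Iso.inv_hom_id, id_whiskerRight, Category.id_comp]
  simpa only [← comp_whiskerRight, Category.assoc] using h

/-- The 2-cell `τ` is compatible with the multiplications. -/
theorem map_τ (X : B) : mapUnit T.T (T.τ X).hom ▷ T.mApp X ≫
    hpaste (T.mNat (T.ηApp X)).hom (T.μ X).hom =
      (λ_ (T.mApp X)).hom ≫ (ρ_ (T.mApp X)).inv ≫ T.mApp X ◁ (T.τ X).hom := by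
  -- The equation at `X` is deduced from its whiskered instance at `TX`, which `pasting_rightUnit`
  -- supplies.
  refine pasting_rightUnit_naturality (T.τ _).hom (T.τ X) _ (mapUnit T.T (T.τ _).hom) (T.μ X).hom
    (T.μ _).hom (T.mNat (T.ηApp X)) (T.mNat (T.ηApp _)).hom (T.mNat (T.T.map (T.ηApp X))).hom
    (mapSq T.T (T.ηNat (T.ηApp X)).hom) (mapSq T.T (mapSq T.T (T.ηNat (T.ηApp X)).hom))
    (mapSq T.T (T.mNat (T.ηApp X)).hom) (T.τ_naturality' _) ?_ ?_ ?_ ?_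
  · exact T.map_τ_naturality _
  · calc _ = 𝟙 _ ⊗≫ (T.T.map (T.T.map (T.T.map (T.ηApp X))) ◁ (T.μ (T.T.obj X)).hom ≫
          vpaste (T.mNat (T.T.map (T.ηApp X))).hom (T.mNat (T.ηApp X)).hom) ⊗≫ 𝟙 _ := by
          simp only [vpaste]; bicategory
      _ = _ := by rw [T.μ_naturality]; simp only [vpaste]; bicategory
  · calc _ = 𝟙 _ ⊗≫ (hpaste (T.mNat (T.ηApp X)).hom (T.mNat (T.ηApp (T.T.obj X))).hom ≫
          T.mApp X ◁ mapSq T.T (T.ηNat (T.ηApp X)).hom) ⊗≫ 𝟙 _ := by simp only [hpaste]; bicategory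
      _ = _ := by rw [← T.mNat_sq]; simp only [hpaste]; bicategory
  · exact pasting_rightUnit (T.μ X) (mapSq T.T (T.μ X).hom) (T.μ _).hom (T.mNat (T.mApp X)).hom
      (T.mNat (T.ηApp _)).hom (mapCounit T.T (T.ι X).hom)
      (asIso (mapCounit T.T (mapCounit T.T (T.ι X).hom))) _ _ (T.identity' X) (T.map_identity X)
      (T.associativity' X) (by
        calc _ = 𝟙 _ ⊗≫ (hpaste (T.mNat (T.ηApp (T.T.obj X))).hom (T.mNat (T.mApp X)).hom ≫
              T.mApp _ ◁ mapCounit T.T (T.ι X).hom) ⊗≫ 𝟙 _ := by simp only [hpaste]; bicategory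
          _ = _ := by rw [T.mNat_counit, asIso_hom]; bicategory)

/-- Restricted along `η`, the two unit modifications agree, the naturality of `η` at its own
component exchanging `η_T` with `T η`. The triangle law `LaxAlg.sharpUnit_counit` and the identity
equation of descent data depend on this. -/
theorem unit_τ (X : B) : T.ηApp X ◁ (T.ι X).inv ≫ (α_ _ _ _).inv ≫
    (T.ηNat (T.ηApp X)).hom ▷ T.mApp X ≫ (α_ _ _ _).hom = T.ηApp X ◁ (T.τ X).hom := by
  refine pasting_unit_unit_naturality (T.ι X) (T.ι _) (T.ηNat (T.ηApp X)) (T.τ X) (T.τ _).hom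
    (T.ηNat (T.ηApp _)).hom (T.ηNat (T.T.map (T.ηApp X))).hom (mapSq T.T (T.ηNat (T.ηApp X)).hom)
    (T.mNat (T.ηApp X)).hom ?_ (T.ι_naturality' _) (T.τ_naturality' _) ?_
  · calc _ = 𝟙 _ ⊗≫ (hpaste (T.ηNat (T.ηApp X)).hom (T.ηNat (T.ηApp (T.T.obj X))).hom ≫
          T.ηApp X ◁ mapSq T.T (T.ηNat (T.ηApp X)).hom) ⊗≫ 𝟙 _ := by simp only [hpaste]; bicategory
      _ = _ := by rw [← T.ηNat_sq]; simp only [hpaste]; bicategory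
  · refine pasting_unit_unit (T.μ X).hom (T.ι X) (T.ι _) (mapCounit T.T (T.ι X).hom) (T.τ _).hom
      (T.ηNat (T.mApp X)).hom (T.ηNat (T.ηApp _)).hom (T.identity' X) ?_ ?_
    · have h := T.free_identity_left X
      rw [← whiskerLeftIso_inv, Iso.inv_comp_eq, whiskerLeftIso_hom] at h
      calc _ = 𝟙 _ ⊗≫ (vpaste (T.ηNat (T.mApp X)).hom (T.μ X).hom ≫
            (T.ι (T.T.obj X)).hom ▷ T.mApp X) ⊗≫ 𝟙 _ := by simp only [vpaste]; bicategory
        _ = _ := by rw [h]; bicategory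
    · calc _ = 𝟙 _ ⊗≫ (hpaste (T.ηNat (T.ηApp (T.T.obj X))).hom (T.ηNat (T.mApp X)).hom ≫
              T.ηApp _ ◁ mapCounit T.T (T.ι X).hom) ⊗≫ 𝟙 _ := by simp only [hpaste]; bicategory
        _ = _ := by rw [T.ηNat_counit]; bicategory

end Pseudomonad
end Coherence
end LaxCoh

namespace LaxCoh
open CategoryTheory Bicategory

/-! ### Free algebras and their local universal property. -/

section FreeAlgebras
variable {B : Type u} [Bicategory.{w, v} B] {T : Pseudomonad B}

namespace LaxAlg

variable (T) in
/-- The free algebra on an object. -/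
abbrev free (X : B) : LaxAlg T where
  carrier := T.T.obj X
  act := T.mApp X
  mult := (T.μ X).hom
  unit := (T.ι X).inv
  associativity := T.associativity X
  identity_left := T.free_identity_left X
  identity_right := by
    -- The right identity law is the identity equation of the pseudomonad, with `T ι` and `τ`
    -- cancelled against their inverses.
    rw [T.identity]
    simp only [comp_whiskerRight, Category.assoc, Iso.hom_inv_id_assoc,
      hom_inv_whiskerRight_assoc]
    rw [← comp_whiskerRight_assoc (T.T.map₂ _), ← T.T.map₂_comp]
    simp

theorem isPseudoAlg_free (X : B) : IsPseudoAlg T (free T X) :=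
  ⟨inferInstanceAs (IsIso (T.μ X).hom), inferInstanceAs (IsIso (T.ι X).inv)⟩

/-- The morphism of free algebras induced by a 1-cell. -/
def freeMap {X Y : B} (k : X ⟶ Y) : free T X ⟶ free T Y :=
  Hom.mk (y := free T X) (z := free T Y) (T.T.map k) (T.mNat k).hom (T.μ_naturality k) (by
    have h := T.ι_naturality k
    change T.T.map k ◁ (T.ι Y).inv ≫ vpaste (T.ηNat (T.T.map k)).hom (T.mNat k).hom =
      (ρ_ (T.T.map k)).hom ≫ (λ_ (T.T.map k)).inv ≫ (T.ι X).inv ▷ T.T.map k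
    rw [← whiskerRightIso_inv, ← whiskerLeftIso_inv, Iso.inv_comp_eq, ← Category.assoc,
      ← Category.assoc, Iso.eq_comp_inv, whiskerRightIso_hom, whiskerLeftIso_hom, ← h,
      Category.assoc])

/-- The 2-cell of free algebras induced by a 2-cell. -/
def freeMap₂ {X Y : B} {k l : X ⟶ Y} (x : k ⟶ l) :
    (freeMap k : free T X ⟶ free T Y) ⟶ freeMap l :=
  Hom₂.mk (T.T.map₂ x) (T.mNat_naturality x)

/-- Compatibility of `freeMap` with composition. -/
def freeComp {X Y Z : B} (k : X ⟶ Y) (l : Y ⟶ Z) :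
    (freeMap (k ≫ l) : free T X ⟶ free T Z) ≅ freeMap k ≫ freeMap l :=
  isoMk (T.T.mapComp k l) (by
    refine Eq.trans ?_ (T.mNat_comp k l).symm
    change T.T.map₂ (T.T.mapComp k l).hom ▷ T.mApp Z ≫ (T.T.mapComp _ _).hom ▷ T.mApp Z ≫
      hpaste (T.mNat k).hom (T.mNat l).hom = _
    simp)

/-- Compatibility of `freeMap` with identities. -/
def freeId (X : B) : (freeMap (𝟙 X) : free T X ⟶ free T X) ≅ 𝟙 (free T X) :=
  isoMk (T.T.mapId X) (by
    refine Eq.trans ?_ (T.mNat_id X).symm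
    change T.T.map₂ (T.T.mapId X).hom ▷ T.mApp X ≫ (T.T.mapId _).hom ▷ T.mApp X ≫
      (λ_ (T.mApp X)).hom ≫ (ρ_ (T.mApp X)).inv = _
    simp)

/-- The structure 1-cell of a lax algebra, as a lax morphism from a free algebra. -/
def actHom (z : LaxAlg T) : free T z.carrier ⟶ z :=
  Hom.mk (y := free T z.carrier) (z := z) z.act z.mult z.associativity.symm (by
    have h := z.identity_left
    change z.act ◁ z.unit ≫ vpaste (T.ηNat z.act).hom z.mult =
      (ρ_ z.act).hom ≫ (λ_ z.act).inv ≫ (T.ι z.carrier).inv ▷ z.act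
    rw [← whiskerRightIso_inv, ← Category.assoc (ρ_ z.act).hom, Iso.eq_comp_inv,
      whiskerRightIso_hom, Category.assoc, h])

/-- The structure 2-cell of a lax morphism is a `T`-transformation. -/
def cellTrans {y z : LaxAlg T} (f : y ⟶ z) :
    freeMap f.base ≫ actHom z ⟶ actHom y ≫ f :=
  Hom₂.mk f.cell (by
    have h := f.map_mult
    change T.T.map₂ f.cell ▷ z.act ≫ (T.T.mapComp y.act f.base).hom ▷ z.act ≫
      hpaste y.mult f.cell = ((T.T.mapComp (T.T.map f.base) z.act).hom ▷ z.act ≫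
        hpaste (T.mNat f.base).hom z.mult) ≫ T.mApp y.carrier ◁ f.cell
    have h1 : hpaste (T.mNat f.base).hom z.mult ≫ T.mApp y.carrier ◁ f.cell =
        (α_ _ _ _).hom ≫ (T.T.map (T.T.map f.base) ◁ z.mult ≫ vpaste (T.mNat f.base).hom f.cell) ≫
          (α_ _ _ _).hom := by
      simp only [hpaste, vpaste]; bicategory
    have h2 : T.T.map₂ f.cell ▷ z.act ≫ (T.T.mapComp y.act f.base).hom ▷ z.act ≫
      hpaste y.mult f.cell = (T.T.mapComp (T.T.map f.base) z.act).hom ▷ z.act ≫ (α_ _ _ _).hom ≫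
        (vpaste (mapSq T.T f.cell) f.cell ≫ y.mult ▷ f.base) ≫ (α_ _ _ _).hom := by
      have h3 : (T.T.mapComp (T.T.map f.base) z.act).hom ▷ z.act ≫ mapSq T.T f.cell ▷ z.act =
        T.T.map₂ f.cell ▷ z.act ≫ (T.T.mapComp y.act f.base).hom ▷ z.act := by
        simp [mapSq]
      rw [← reassoc_of% h3]
      simp only [hpaste, vpaste]; bicategory
    rw [h2, Category.assoc ((T.T.mapComp _ _).hom ▷ _), h1, h])

theorem isIso_of_isIso_base {y z : LaxAlg T} {f g : y ⟶ z} (t : f ⟶ g) (h : IsIso t.base) :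
    IsIso t :=
  (isoMk (f := f) (g := g) (@asIso _ _ _ _ t.base h) t.comm).isIso_hom

/-- The 2-cell `τ` as a `T`-transformation. -/
def tauTrans (X : B) : 𝟙 (free T X) ≅ freeMap (T.ηApp X) ≫ actHom (free T X) :=
  isoMk (T.τ X) (by
    have h := T.map_τ X
    change T.T.map₂ (T.τ X).hom ▷ T.mApp X ≫ (T.T.mapComp (T.T.map (T.ηApp X)) (T.mApp X)).hom ▷
      T.mApp X ≫ hpaste (T.mNat (T.ηApp X)).hom (T.μ X).hom =
      ((T.T.mapId (T.T.obj X)).hom ▷ T.mApp X ≫ (λ_ (T.mApp X)).hom ≫ (ρ_ (T.mApp X)).inv) ≫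
        T.mApp X ◁ (T.τ X).hom
    rw [Category.assoc, Category.assoc, ← h]
    simp [mapUnit])

/-- The extension of a 1-cell `X ⟶ z` to the free algebra. -/
def sharp {X : B} {z : LaxAlg T} (h : X ⟶ z.carrier) : free T X ⟶ z := freeMap h ≫ actHom z

/-- The extension of a 2-cell to the free algebra. -/
def sharpMap {X : B} {z : LaxAlg T} {h k : X ⟶ z.carrier} (x : h ⟶ k) :
    sharp h ⟶ sharp (z := z) k := freeMap₂ x ▷ actHom z

/-- The comparison of a morphism out of a free algebra with the extension of its restriction. -/
def sharpCounit {X : B} {z : LaxAlg T} (g : free T X ⟶ z) : sharp (T.ηApp X ≫ g.base) ⟶ g :=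
  (freeComp (T.ηApp X) g.base).hom ▷ actHom z ≫ (α_ _ _ _).hom ≫ freeMap (T.ηApp X) ◁ cellTrans g ≫
    (α_ _ _ _).inv ≫ (tauTrans X).inv ▷ g ≫ (λ_ g).hom

/-- The underlying 2-cell of `sharpCounit`. -/
def sharpCounitCell {X : B} {z : LaxAlg T} (g : free T X ⟶ z) :
    T.T.map (T.ηApp X ≫ g.base) ≫ z.act ⟶ g.base :=
  (T.T.mapComp (T.ηApp X) g.base).hom ▷ z.act ≫ (α_ _ _ _).hom ≫ T.T.map (T.ηApp X) ◁ g.cell ≫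
      (α_ (T.T.map (T.ηApp X)) (T.mApp X) g.base).inv ≫ (T.τ X).inv ▷ g.base ≫ (λ_ g.base).hom

/-- The restriction of the extension of a 1-cell. -/
def sharpUnit {X : B} {z : LaxAlg T} (h : X ⟶ z.carrier) : h ⟶ T.ηApp X ≫ T.T.map h ≫ z.act :=
  (ρ_ h).inv ≫ h ◁ z.unit ≫ (α_ _ _ _).inv ≫ (T.ηNat h).hom ▷ z.act ≫ (α_ _ _ _).hom

theorem sharpUnit_naturality {X : B} {z : LaxAlg T} {h k : X ⟶ z.carrier} (x : h ⟶ k) :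
    x ≫ sharpUnit k = sharpUnit h ≫ T.ηApp X ◁ (T.T.map₂ x ▷ z.act) := by
  have e := T.ηNat_naturality x
  calc _ = 𝟙 _ ⊗≫ (x ▷ 𝟙 _ ≫ k ◁ z.unit) ⊗≫ (T.ηNat k).hom ▷ z.act ⊗≫ 𝟙 _ := by
        simp only [sharpUnit]; bicategory
    _ = 𝟙 _ ⊗≫ h ◁ z.unit ⊗≫ (x ▷ T.ηApp _ ≫ (T.ηNat k).hom) ▷ z.act ⊗≫ 𝟙 _ := by
      rw [← whisker_exchange]; bicategory
    _ = _ := by rw [e]; simp only [sharpUnit]; bicategory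

/-- A triangle law valid for every lax morphism `g` into a lax algebra. The unit law of `g` turns
`z.unit` into the inverse of `ι`, and `unit_τ` lets it cancel against `τ`. -/
theorem sharpUnit_counit {X : B} {z : LaxAlg T} (g : free T X ⟶ z) :
    sharpUnit (T.ηApp X ≫ g.base) ≫ T.ηApp X ◁ sharpCounitCell g = 𝟙 _ := by
  have h1 := T.ηNat_comp (T.ηApp X) g.base
  have h2 : g.base ◁ z.unit ≫ vpaste (T.ηNat g.base).hom g.cell =
      (ρ_ g.base).hom ≫ (λ_ g.base).inv ≫ (T.ι X).inv ▷ g.base := g.map_unit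
  have h3 := T.unit_τ X
  let b : T.T.obj X ⟶ z.carrier := g.base
  let c : T.T.map b ≫ z.act ⟶ T.mApp X ≫ b := g.cell
  change sharpUnit (T.ηApp X ≫ b) ≫ T.ηApp X ◁ ((T.T.mapComp (T.ηApp X) b).hom ▷ z.act ≫
    (α_ _ _ _).hom ≫ T.T.map (T.ηApp X) ◁ c ≫ (α_ (T.T.map (T.ηApp X)) (T.mApp X) b).inv ≫
      (T.τ X).inv ▷ b ≫ (λ_ b).hom) = 𝟙 _
  change (T.ηNat (T.ηApp X ≫ b)).hom ≫ T.ηApp X ◁ (T.T.mapComp (T.ηApp X) b).hom =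
    hpaste (T.ηNat (T.ηApp X)).hom (T.ηNat b).hom at h1
  change b ◁ z.unit ≫ vpaste (T.ηNat b).hom c =
      (ρ_ b).hom ≫ (λ_ b).inv ≫ (T.ι X).inv ▷ b at h2
  calc _ = 𝟙 _ ⊗≫ (T.ηApp X ≫ b) ◁ z.unit ⊗≫
        ((T.ηNat (T.ηApp X ≫ b)).hom ≫ T.ηApp X ◁ (T.T.mapComp (T.ηApp X) b).hom) ▷ z.act ⊗≫
        (T.ηApp X ≫ T.T.map (T.ηApp X)) ◁ c ⊗≫ T.ηApp X ◁ (T.τ X).inv ▷ b ⊗≫ 𝟙 _ := by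
        simp only [sharpUnit]; bicategory
    _ = 𝟙 _ ⊗≫ (T.ηApp X ≫ b) ◁ z.unit ⊗≫ T.ηApp X ◁ (T.ηNat b).hom ▷ z.act ⊗≫
        ((T.ηNat (T.ηApp X)).hom ▷ (T.T.map b ≫ z.act) ≫ (T.ηApp X ≫ T.T.map (T.ηApp X)) ◁ c) ⊗≫
        T.ηApp X ◁ (T.τ X).inv ▷ b ⊗≫ 𝟙 _ := by
      rw [h1]; simp only [hpaste]; bicategory
    _ = 𝟙 _ ⊗≫ T.ηApp X ◁ (b ◁ z.unit ≫ vpaste (T.ηNat b).hom c) ⊗≫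
        (T.ηNat (T.ηApp X)).hom ▷ (T.mApp X ≫ b) ⊗≫ T.ηApp X ◁ (T.τ X).inv ▷ b ⊗≫ 𝟙 _ := by
      rw [← whisker_exchange]; simp only [vpaste]; bicategory
    _ = 𝟙 _ ⊗≫ (T.ηApp X ◁ (T.ι X).inv ≫ (α_ _ _ _).inv ≫ (T.ηNat (T.ηApp X)).hom ▷ T.mApp X ≫
        (α_ _ _ _).hom) ▷ b ⊗≫ T.ηApp X ◁ (T.τ X).inv ▷ b ⊗≫ 𝟙 _ := by
      rw [h2]; bicategory
    _ = 𝟙 _ ⊗≫ T.ηApp X ◁ ((T.τ X).hom ≫ (T.τ X).inv) ▷ b ⊗≫ 𝟙 _ := by rw [h3]; bicategory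
    _ = _ := by rw [Iso.hom_inv_id]; bicategory

theorem sharpCounit_naturality {X : B} {z : LaxAlg T} {f g : free T X ⟶ z} (t : f ⟶ g) :
    sharpMap (T.ηApp X ◁ t.base) ≫ sharpCounit g = sharpCounit f ≫ t := by
  apply hom₂_ext
  have h : T.T.map₂ t.base ▷ z.act ≫ g.cell = f.cell ≫ T.mApp X ◁ t.base := t.comm
  change T.T.map₂ (T.ηApp X ◁ t.base) ▷ z.act ≫ (sharpCounit g).base = (sharpCounit f).base ≫ t.base
  let fb : T.T.obj X ⟶ z.carrier := f.base
  let gb : T.T.obj X ⟶ z.carrier := g.base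
  let x : fb ⟶ gb := t.base
  let fc : T.T.map fb ≫ z.act ⟶ T.mApp X ≫ fb := f.cell
  let gc : T.T.map gb ≫ z.act ⟶ T.mApp X ≫ gb := g.cell
  change T.T.map₂ x ▷ z.act ≫ gc = fc ≫ T.mApp X ◁ x at h
  change T.T.map₂ (T.ηApp X ◁ x) ▷ z.act ≫ (T.T.mapComp (T.ηApp X) gb).hom ▷ z.act ≫
    (α_ _ _ _).hom ≫ T.T.map (T.ηApp X) ◁ gc ≫ (α_ (T.T.map (T.ηApp X)) (T.mApp X) gb).inv ≫
      (T.τ X).inv ▷ gb ≫ (λ_ gb).hom = ((T.T.mapComp (T.ηApp X) fb).hom ▷ z.act ≫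
    (α_ _ _ _).hom ≫ T.T.map (T.ηApp X) ◁ fc ≫ (α_ (T.T.map (T.ηApp X)) (T.mApp X) fb).inv ≫
      (T.τ X).inv ▷ fb ≫ (λ_ fb).hom) ≫ x
  calc _ = (T.T.mapComp (T.ηApp X) fb).hom ▷ z.act ⊗≫ T.T.map (T.ηApp X) ◁
      (T.T.map₂ x ▷ z.act ≫ gc) ⊗≫
        (T.τ X).inv ▷ gb ⊗≫ 𝟙 _ := by
        rw [T.T.map₂_whisker_left]; simp [bicategoricalComp]
    _ = (T.T.mapComp (T.ηApp X) fb).hom ▷ z.act ⊗≫ T.T.map (T.ηApp X) ◁ fc ⊗≫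
        ((T.T.map (T.ηApp X) ≫ T.mApp X) ◁ x ≫ (T.τ X).inv ▷ gb) ⊗≫ 𝟙 _ := by
      rw [h]; bicategory
    _ = _ := by rw [whisker_exchange]; bicategory

theorem isIso_sharpCounitCell {X : B} {z : LaxAlg T} (g : free T X ⟶ z) (hg : IsPseudoMor T g) :
    IsIso (sharpCounitCell g) := by
  have : IsIso g.cell := hg
  unfold sharpCounitCell
  infer_instance

theorem isIso_sharpCounit {X : B} {z : LaxAlg T} (g : free T X ⟶ z) (hg : IsPseudoMor T g) :
    IsIso (sharpCounit g) :=
  isIso_of_isIso_base _ (isIso_sharpCounitCell g hg)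

/-- By naturality of the comparison `sharpCounit`, a transformation preceded by the comparison at
`f` depends only on its restriction along `η`. That comparison is invertible because `f` is a
pseudomorphism; `g` may be any lax morphism. -/
theorem free_hom₂_ext {X : B} {z : LaxAlg T} {f g : free T X ⟶ z} (hf : IsPseudoMor T f)
    {s t : f ⟶ g} (h : T.ηApp X ◁ s.base = T.ηApp X ◁ t.base) : s = t := by
  have := isIso_sharpCounit f hf
  rw [← cancel_epi (sharpCounit f), ← sharpCounit_naturality, ← sharpCounit_naturality, h]

/-- In the application `sf`, `sg` are instances of `sharpUnit` and `kf`, `kg` of `sharpCounit`.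
Sections are enough here, so `z.unit` need not be invertible. -/
theorem whiskerLeft_eq_of_section {a b c : B} {e : a ⟶ b} {f g f' g' : b ⟶ c} {kf : f' ⟶ f}
    {kg : g' ⟶ g} {sf : e ≫ f ⟶ e ≫ f'} {sg : e ≫ g ⟶ e ≫ g'} {x : e ≫ f ⟶ e ≫ g} {x' : f' ⟶ g'}
    {t : f ⟶ g} (hf : sf ≫ e ◁ kf = 𝟙 _) (hg : sg ≫ e ◁ kg = 𝟙 _) (hx : x ≫ sg = sf ≫ e ◁ x')
    (ht : kf ≫ t = x' ≫ kg) : e ◁ t = x := by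
  rw [← Category.id_comp (e ◁ t), ← hf, Category.assoc, ← whiskerLeft_comp, ht, whiskerLeft_comp,
    ← reassoc_of% hx, hg, Category.comp_id]

/-- The witness is the extension of `x` to the free algebra, conjugated by the comparisons at `f`
and `g`; only the comparison at `f` has to be inverted. -/
theorem exists_free_hom₂ {X : B} {z : LaxAlg T} {f g : free T X ⟶ z} (hf : IsPseudoMor T f)
    (x : T.ηApp X ≫ f.base ⟶ T.ηApp X ≫ g.base) : ∃ t : f ⟶ g, T.ηApp X ◁ t.base = x := by
  have := isIso_sharpCounit f hf
  exact ⟨inv (sharpCounit f) ≫ sharpMap x ≫ sharpCounit g,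
    whiskerLeft_eq_of_section (sharpUnit_counit f) (sharpUnit_counit g) (sharpUnit_naturality x)
      (congrArg Hom₂.base (show sharpCounit f ≫ inv (sharpCounit f) ≫ sharpMap x ≫ sharpCounit g =
        sharpMap x ≫ sharpCounit g by simp))⟩

end LaxAlg
end FreeAlgebras
end LaxCoh

namespace LaxCoh
open CategoryTheory Bicategory

/-! ### Descent equations restricted along the unit. -/

section DescentPasting
variable {B : Type u} [Bicategory.{w, v} B]

/-- The 2-cell `f ⟶ a ≫ e ≫ f` obtained from `t : m ≫ f ⟶ ta ≫ f`. -/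
def lowPaste {y0 y1 y2 z : B} {a : y1 ⟶ y0} {ta m : y2 ⟶ y1} {e0 : y0 ⟶ y1} {e1 : y1 ⟶ y2}
    {f : y1 ⟶ z}
    (ι : e1 ≫ m ≅ 𝟙 y1) (N : a ≫ e0 ≅ e1 ≫ ta) (t : m ≫ f ⟶ ta ≫ f) : f ⟶ a ≫ e0 ≫ f :=
  (λ_ f).inv ≫ ι.inv ▷ f ≫ (α_ _ _ _).hom ≫ e1 ◁ t ≫ (α_ _ _ _).inv ≫ N.inv ▷ f ≫ (α_ _ _ _).hom

/-- Passing from `t` to `lowPaste` keeps all the information contained in `e1 ◁ t`. For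
transformations from a pseudomorphism out of a free algebra, that is everything. -/
theorem lowPaste_spec {y0 y1 y2 z : B} {a : y1 ⟶ y0} {ta m : y2 ⟶ y1} {e0 : y0 ⟶ y1} {e1 : y1 ⟶ y2}
    {f : y1 ⟶ z} (ι : e1 ≫ m ≅ 𝟙 y1) (N : a ≫ e0 ≅ e1 ≫ ta) (t : m ≫ f ⟶ ta ≫ f) :
    e1 ◁ t = 𝟙 _ ⊗≫ ι.hom ▷ f ⊗≫ lowPaste ι N t ⊗≫ N.hom ▷ f ⊗≫ 𝟙 _ := by
  calc _ = 𝟙 _ ⊗≫ (ι.hom ≫ ι.inv) ▷ f ⊗≫ e1 ◁ t ⊗≫ (N.inv ≫ N.hom) ▷ f ⊗≫ 𝟙 _ := by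
        rw [Iso.hom_inv_id, Iso.inv_hom_id]; bicategory
    _ = _ := by simp only [lowPaste]; bicategory

/-- The cells `e0`, `e1`, `e2` stand for the units at `Y`, `TY`, `T²Y`. Whiskered with `e2`, each
side of the associativity equation becomes an expression in `lowPaste ι N t`: naturality of `ι` and
the left identity law remove the inserted units, and naturality of `η` in the form `sq` carries `T`
of the multiplication constraint back to the constraint. -/
theorem descent_assoc_iff {y0 y1 y2 y3 z : B} {a : y1 ⟶ y0} {ta m : y2 ⟶ y1} {tta m1 tm : y3 ⟶ y2}
    {e0 : y0 ⟶ y1} {e1 : y1 ⟶ y2} {e2 : y2 ⟶ y3} {f : y1 ⟶ z} (ι : e1 ≫ m ≅ 𝟙 y1)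
        (ιT : e2 ≫ m1 ≅ 𝟙 y2)
    (N : a ≫ e0 ≅ e1 ≫ ta) (N1 : ta ≫ e1 ≅ e2 ≫ tta) (Nm : m ≫ e1 ≅ e2 ≫ tm)
        (ma : tta ≫ m ≅ m1 ≫ ta)
    (mult : ta ≫ a ⟶ m ≫ a) (tmult : tta ≫ ta ⟶ tm ≫ ta) (μ : tm ≫ m ≅ m1 ≫ m) (t : m ≫ f ⟶ ta ≫ f)
    (ιnat : 𝟙 (ta ≫ e1 ≫ m) ⊗≫ N1.hom ▷ m ⊗≫ e2 ◁ ma.hom ⊗≫ ιT.hom ▷ ta ⊗≫ 𝟙 ta =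
      𝟙 _ ⊗≫ ta ◁ ι.hom ⊗≫ 𝟙 _)
    (sq : mult ▷ e0 ≫ hpaste Nm.hom N.hom = hpaste N1.hom N.hom ≫ e2 ◁ tmult)
    (leftUnit : m ◁ ι.inv ≫ vpaste Nm.hom μ.hom ≫ ιT.hom ▷ m = (ρ_ m).hom ≫ (λ_ m).inv) :
    (e2 ◁ (m1 ◁ t ≫ (α_ _ _ _).inv ≫ ma.inv ▷ f ≫ (α_ _ _ _).hom ≫ tta ◁ t ≫ (α_ _ _ _).inv ≫
      tmult ▷ f) = e2 ◁ ((α_ _ _ _).inv ≫ μ.inv ▷ f ≫ (α_ _ _ _).hom ≫ tm ◁ t ≫ (α_ _ _ _).inv)) ↔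
    t ≫ ta ◁ lowPaste ι N t ≫ (α_ _ _ _).inv ≫ mult ▷ (e0 ≫ f) =
      m ◁ lowPaste ι N t ≫ (α_ _ _ _).inv := by
  let c := lowPaste ι N t
  have h1 : 𝟙 ta ⊗≫ ιT.inv ▷ ta ⊗≫ e2 ◁ ma.inv ⊗≫ 𝟙 (e2 ≫ tta ≫ m) =
      𝟙 _ ⊗≫ ta ◁ ι.inv ⊗≫ N1.hom ▷ m ⊗≫ 𝟙 _ := by
    calc _ = 𝟙 _ ⊗≫ ta ◁ (ι.inv ≫ ι.hom) ⊗≫ ιT.inv ▷ ta ⊗≫ e2 ◁ ma.inv ⊗≫ 𝟙 _ := by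
          rw [Iso.inv_hom_id]; bicategory
      _ = 𝟙 _ ⊗≫ ta ◁ ι.inv ⊗≫ (𝟙 (ta ≫ e1 ≫ m) ⊗≫ ta ◁ ι.hom ⊗≫ 𝟙 ta) ⊗≫ ιT.inv ▷ ta ⊗≫
          e2 ◁ ma.inv ⊗≫ 𝟙 _ := by bicategory
      _ = 𝟙 _ ⊗≫ ta ◁ ι.inv ⊗≫ N1.hom ▷ m ⊗≫ e2 ◁ ma.hom ⊗≫ (ιT.hom ≫ ιT.inv) ▷ ta ⊗≫
          e2 ◁ ma.inv ⊗≫ 𝟙 _ := by rw [← ιnat]; bicategory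
      _ = 𝟙 _ ⊗≫ ta ◁ ι.inv ⊗≫ N1.hom ▷ m ⊗≫ e2 ◁ (ma.hom ≫ ma.inv) ⊗≫ 𝟙 _ := by
        rw [Iso.hom_inv_id]; bicategory
      _ = _ := by rw [Iso.hom_inv_id]; bicategory
  have h2 : 𝟙 m ⊗≫ ιT.inv ▷ m ⊗≫ e2 ◁ μ.inv ⊗≫ 𝟙 (e2 ≫ tm ≫ m) =
      𝟙 _ ⊗≫ m ◁ ι.inv ⊗≫ Nm.hom ▷ m ⊗≫ 𝟙 _ := by
    calc _ = 𝟙 _ ⊗≫ ((ρ_ m).hom ≫ (λ_ m).inv) ⊗≫ ιT.inv ▷ m ⊗≫ e2 ◁ μ.inv ⊗≫ 𝟙 _ := by bicategory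
      _ = 𝟙 _ ⊗≫ m ◁ ι.inv ⊗≫ Nm.hom ▷ m ⊗≫ e2 ◁ μ.hom ⊗≫ (ιT.hom ≫ ιT.inv) ▷ m ⊗≫ e2 ◁ μ.inv ⊗≫
          𝟙 _ := by
        rw [← leftUnit]; simp only [vpaste]; bicategory
      _ = 𝟙 _ ⊗≫ m ◁ ι.inv ⊗≫ Nm.hom ▷ m ⊗≫ e2 ◁ (μ.hom ≫ μ.inv) ⊗≫ 𝟙 _ := by
        rw [Iso.hom_inv_id]; bicategory
      _ = _ := by rw [Iso.hom_inv_id]; bicategory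
  have h3 : e1 ◁ t = 𝟙 _ ⊗≫ ι.hom ▷ f ⊗≫ c ⊗≫ N.hom ▷ f ⊗≫ 𝟙 _ := lowPaste_spec ι N t
  -- The invertible `p` inserts the unit at `T²Y`, and the invertible `q` moves the units to the
  -- right by naturality, so the equations may be compared after conjugation.
  let p : m ≫ f ⟶ e2 ≫ m1 ≫ m ≫ f := (λ_ _).inv ≫ ιT.inv ▷ (m ≫ f) ≫ (α_ _ _ _).hom
  let q : e2 ≫ (tm ≫ ta) ≫ f ⟶ (m ≫ a) ≫ e0 ≫ f :=
    𝟙 _ ⊗≫ Nm.inv ▷ (ta ≫ f) ⊗≫ m ◁ N.inv ▷ f ⊗≫ 𝟙 _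
  have : IsIso q := by simp only [q, bicategoricalComp]; infer_instance
  have hl : p ≫ (e2 ◁ (m1 ◁ t ≫ (α_ _ _ _).inv ≫ ma.inv ▷ f ≫ (α_ _ _ _).hom ≫ tta ◁ t ≫
      (α_ _ _ _).inv ≫ tmult ▷ f)) ≫ q =
      t ≫ ta ◁ c ≫ (α_ _ _ _).inv ≫ mult ▷ (e0 ≫ f) := by
    calc _ = 𝟙 _ ⊗≫ (ιT.inv ▷ (m ≫ f) ≫ (e2 ≫ m1) ◁ t) ⊗≫ e2 ◁ ma.inv ▷ f ⊗≫ e2 ◁ tta ◁ t ⊗≫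
          e2 ◁ tmult ▷ f ⊗≫ Nm.inv ▷ (ta ≫ f) ⊗≫ m ◁ N.inv ▷ f ⊗≫ 𝟙 _ := by
          simp only [p, q]; bicategory
      _ = 𝟙 _ ⊗≫ t ⊗≫ (𝟙 ta ⊗≫ ιT.inv ▷ ta ⊗≫ e2 ◁ ma.inv ⊗≫ 𝟙 (e2 ≫ tta ≫ m)) ▷ f ⊗≫
          e2 ◁ tta ◁ t ⊗≫ e2 ◁ tmult ▷ f ⊗≫ Nm.inv ▷ (ta ≫ f) ⊗≫ m ◁ N.inv ▷ f ⊗≫ 𝟙 _ := by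
        rw [← whisker_exchange]; bicategory
      _ = 𝟙 _ ⊗≫ t ⊗≫ ta ◁ ι.inv ▷ f ⊗≫ (N1.hom ▷ (m ≫ f) ≫ (e2 ≫ tta) ◁ t) ⊗≫
          e2 ◁ tmult ▷ f ⊗≫ Nm.inv ▷ (ta ≫ f) ⊗≫ m ◁ N.inv ▷ f ⊗≫ 𝟙 _ := by
        rw [h1]; bicategory
      _ = 𝟙 _ ⊗≫ t ⊗≫ ta ◁ ι.inv ▷ f ⊗≫ ta ◁ e1 ◁ t ⊗≫ N1.hom ▷ (ta ≫ f) ⊗≫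
          e2 ◁ tmult ▷ f ⊗≫ Nm.inv ▷ (ta ≫ f) ⊗≫ m ◁ N.inv ▷ f ⊗≫ 𝟙 _ := by
        rw [← whisker_exchange]; bicategory
      _ = 𝟙 _ ⊗≫ t ⊗≫ ta ◁ (ι.inv ≫ ι.hom) ▷ f ⊗≫ ta ◁ c ⊗≫ ta ◁ N.hom ▷ f ⊗≫
          N1.hom ▷ (ta ≫ f) ⊗≫ e2 ◁ tmult ▷ f ⊗≫ Nm.inv ▷ (ta ≫ f) ⊗≫ m ◁ N.inv ▷ f ⊗≫ 𝟙 _ := by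
        rw [h3]; bicategory
      _ = 𝟙 _ ⊗≫ t ⊗≫ ta ◁ c ⊗≫ (hpaste N1.hom N.hom ≫ e2 ◁ tmult) ▷ f ⊗≫
          Nm.inv ▷ (ta ≫ f) ⊗≫ m ◁ N.inv ▷ f ⊗≫ 𝟙 _ := by
        rw [Iso.inv_hom_id]; simp only [hpaste]; bicategory
      _ = 𝟙 _ ⊗≫ t ⊗≫ ta ◁ c ⊗≫ mult ▷ (e0 ≫ f) ⊗≫ m ◁ N.hom ▷ f ⊗≫
          (Nm.hom ≫ Nm.inv) ▷ (ta ≫ f) ⊗≫ m ◁ N.inv ▷ f ⊗≫ 𝟙 _ := by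
        rw [← sq]; simp only [hpaste]; bicategory
      _ = 𝟙 _ ⊗≫ t ⊗≫ ta ◁ c ⊗≫ mult ▷ (e0 ≫ f) ⊗≫ m ◁ (N.hom ≫ N.inv) ▷ f ⊗≫ 𝟙 _ := by
        rw [Iso.hom_inv_id]; bicategory
      _ = _ := by rw [Iso.hom_inv_id]; bicategory
  have hr : p ≫ (e2 ◁ ((α_ _ _ _).inv ≫ μ.inv ▷ f ≫ (α_ _ _ _).hom ≫ tm ◁ t ≫
      (α_ _ _ _).inv)) ≫ q = m ◁ c ≫ (α_ _ _ _).inv := by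
    calc _ = 𝟙 _ ⊗≫ (𝟙 m ⊗≫ ιT.inv ▷ m ⊗≫ e2 ◁ μ.inv ⊗≫ 𝟙 (e2 ≫ tm ≫ m)) ▷ f ⊗≫
          (e2 ≫ tm) ◁ t ⊗≫ Nm.inv ▷ (ta ≫ f) ⊗≫ m ◁ N.inv ▷ f ⊗≫ 𝟙 _ := by
          simp only [p, q]; bicategory
      _ = 𝟙 _ ⊗≫ m ◁ ι.inv ▷ f ⊗≫ (Nm.hom ▷ (m ≫ f) ≫ (e2 ≫ tm) ◁ t) ⊗≫
          Nm.inv ▷ (ta ≫ f) ⊗≫ m ◁ N.inv ▷ f ⊗≫ 𝟙 _ := by rw [h2]; bicategory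
      _ = 𝟙 _ ⊗≫ m ◁ ι.inv ▷ f ⊗≫ (m ≫ e1) ◁ t ⊗≫ (Nm.hom ≫ Nm.inv) ▷ (ta ≫ f) ⊗≫
          m ◁ N.inv ▷ f ⊗≫ 𝟙 _ := by rw [← whisker_exchange]; bicategory
      _ = _ := by rw [Iso.hom_inv_id]; simp only [c, lowPaste]; bicategory
  rw [← cancel_mono q, ← cancel_epi p, hl, hr]

/-- Along `e0`, hypothesis `hτ` replaces `τ` by `ι`; interchange then exposes `e1 ◁ t`, which
`lowPaste_spec` evaluates. -/
theorem descent_id_iff {y0 y1 y2 z : B} {a : y1 ⟶ y0} {ta m : y2 ⟶ y1} {e0 : y0 ⟶ y1}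
    {e1 te : y1 ⟶ y2} {f : y1 ⟶ z} (ι : e1 ≫ m ≅ 𝟙 y1) (N : a ≫ e0 ≅ e1 ≫ ta)
    (Ne : e0 ≫ e1 ≅ e0 ≫ te) (τ : 𝟙 y1 ≅ te ≫ m) (unit : 𝟙 y0 ⟶ e0 ≫ a) (tunit : 𝟙 y1 ⟶ te ≫ ta)
    (t : m ≫ f ⟶ ta ≫ f)
    (hτ : e0 ◁ ι.inv ≫ (α_ _ _ _).inv ≫ Ne.hom ▷ m ≫ (α_ _ _ _).hom = e0 ◁ τ.hom)
    (sq : unit ▷ e0 ≫ hpaste Ne.hom N.hom = (λ_ e0).hom ≫ (ρ_ e0).inv ≫ e0 ◁ tunit) :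
    (e0 ◁ (τ.hom ▷ f ≫ (α_ _ _ _).hom ≫ te ◁ t) = e0 ◁ (tunit ▷ f ≫ (α_ _ _ _).hom)) ↔
      e0 ◁ lowPaste ι N t = (λ_ _).inv ≫ unit ▷ (e0 ≫ f) ≫ (α_ _ _ _).hom := by
  let q : e0 ≫ a ≫ e0 ≫ f ⟶ e0 ≫ te ≫ ta ≫ f :=
    𝟙 _ ⊗≫ e0 ◁ N.hom ▷ f ⊗≫ Ne.hom ▷ (ta ≫ f) ⊗≫ 𝟙 _
  have : IsIso q := by simp only [q, bicategoricalComp]; infer_instance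
  let p : e0 ≫ f ⟶ e0 ≫ 𝟙 _ ≫ f := e0 ◁ (λ_ f).inv
  have hl : p ≫ e0 ◁ (τ.hom ▷ f ≫ (α_ _ _ _).hom ≫ te ◁ t) = e0 ◁ lowPaste ι N t ≫ q := by
    calc _ = 𝟙 _ ⊗≫ (e0 ◁ τ.hom) ▷ f ⊗≫ (e0 ≫ te) ◁ t ⊗≫ 𝟙 _ := by simp only [p]; bicategory
      _ = 𝟙 _ ⊗≫ (e0 ◁ ι.inv) ▷ f ⊗≫ (Ne.hom ▷ (m ≫ f) ≫ (e0 ≫ te) ◁ t) ⊗≫ 𝟙 _ := by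
        rw [← hτ]; bicategory
      _ = 𝟙 _ ⊗≫ (e0 ◁ ι.inv) ▷ f ⊗≫ e0 ◁ e1 ◁ t ⊗≫ Ne.hom ▷ (ta ≫ f) ⊗≫ 𝟙 _ := by
        rw [← whisker_exchange]; bicategory
      _ = 𝟙 _ ⊗≫ e0 ◁ (ι.inv ≫ ι.hom) ▷ f ⊗≫ e0 ◁ lowPaste ι N t ⊗≫ e0 ◁ N.hom ▷ f ⊗≫
          Ne.hom ▷ (ta ≫ f) ⊗≫ 𝟙 _ := by rw [lowPaste_spec ι N t]; bicategory
      _ = _ := by rw [Iso.inv_hom_id]; simp only [q]; bicategory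
  have hr : p ≫ e0 ◁ (tunit ▷ f ≫ (α_ _ _ _).hom) =
      ((λ_ _).inv ≫ unit ▷ (e0 ≫ f) ≫ (α_ _ _ _).hom) ≫ q := by
    calc _ = 𝟙 _ ⊗≫ ((λ_ e0).hom ≫ (ρ_ e0).inv ≫ e0 ◁ tunit) ▷ f ⊗≫ 𝟙 _ := by
          simp only [p]; bicategory
      _ = _ := by rw [← sq]; simp only [hpaste, q]; bicategory
  rw [← cancel_epi p, hl, hr, cancel_mono]

/-- The cell `tC` stands for `T` of the lowered structure cell `κ ≫ lowPaste ι N t`. By naturality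
of `η`, which is `sq`, its restriction along `e1` is that structure cell up to isomorphism. The left
identity law of the target algebra and the triangle law `unitκ` cancel the remaining units. -/
theorem descent_square {y0 y1 y2 z0 z1 z2 : B} {a : y1 ⟶ y0} {ta m : y2 ⟶ y1} {e0 : y0 ⟶ y1}
    {e1 : y1 ⟶ y2} {f : y1 ⟶ z0} {tg : y1 ⟶ z1} {ttg : y2 ⟶ z2}
    {b : z1 ⟶ z0} {tb mz : z2 ⟶ z1} {ez : z0 ⟶ z1} {ez1 : z1 ⟶ z2}
    (ι : e1 ≫ m ≅ 𝟙 y1) (N : a ≫ e0 ≅ e1 ≫ ta) (t : m ≫ f ⟶ ta ≫ f) (κ : tg ≫ b ⟶ f)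
    (ιZ : ez1 ≫ mz ≅ 𝟙 z1) (Nb : b ≫ ez ≅ ez1 ≫ tb) (Ntg : tg ≫ ez1 ≅ e1 ≫ ttg)
    (Ng : (e0 ≫ f) ≫ ez ≅ e0 ≫ tg) (mg : ttg ≫ mz ≅ m ≫ tg) (mult : tb ≫ b ⟶ mz ≫ b)
    (unit : 𝟙 z0 ≅ ez ≫ b) (tC : ttg ≫ tb ⟶ ta ≫ tg)
    (idl : b ◁ unit.hom ≫ vpaste Nb.hom mult ≫ ιZ.hom ▷ b = (ρ_ b).hom ≫ (λ_ b).inv)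
    (ιnat : tg ◁ ιZ.hom ≫ (ρ_ tg).hom ≫ (λ_ tg).inv = vpaste Ntg.hom mg.hom ≫ ι.hom ▷ tg)
    (unitκ : ((ρ_ (e0 ≫ f)).inv ≫ (e0 ≫ f) ◁ unit.hom ≫ (α_ _ _ _).inv ≫ Ng.hom ▷ b ≫
      (α_ _ _ _).hom) ≫ e0 ◁ κ = 𝟙 _)
    (sq : (κ ≫ lowPaste ι N t) ▷ ez ≫ hpaste N.hom Ng.hom = hpaste Ntg.hom Nb.hom ≫ e1 ◁ tC) :
    e1 ◁ (ttg ◁ mult ≫ (α_ _ _ _).inv ≫ mg.hom ▷ b ≫ (α_ _ _ _).hom ≫ m ◁ κ ≫ t) =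
      e1 ◁ ((α_ _ _ _).inv ≫ tC ▷ b ≫ (α_ _ _ _).hom ≫ ta ◁ κ) := by
  let c := lowPaste ι N t
  -- Inserts the unit of the target algebra; it can be cancelled because that unit is invertible.
  let p : tg ≫ b ⟶ e1 ≫ ttg ≫ tb ≫ b :=
    𝟙 _ ⊗≫ (tg ≫ b) ◁ unit.hom ⊗≫ tg ◁ Nb.hom ▷ b ⊗≫ Ntg.hom ▷ (tb ≫ b) ⊗≫ 𝟙 _
  have : IsIso p := by simp only [p, bicategoricalComp]; infer_instance
  have idl' : 𝟙 b ⊗≫ b ◁ unit.hom ⊗≫ Nb.hom ▷ b ⊗≫ ez1 ◁ mult ⊗≫ 𝟙 (ez1 ≫ mz ≫ b) =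
      𝟙 _ ⊗≫ ιZ.inv ▷ b ⊗≫ 𝟙 _ := by
    calc _ = 𝟙 _ ⊗≫ b ◁ unit.hom ⊗≫ Nb.hom ▷ b ⊗≫ ez1 ◁ mult ⊗≫ (ιZ.hom ≫ ιZ.inv) ▷ b ⊗≫ 𝟙 _ := by
          rw [Iso.hom_inv_id]; bicategory
      _ = 𝟙 _ ⊗≫ (b ◁ unit.hom ≫ vpaste Nb.hom mult ≫ ιZ.hom ▷ b) ⊗≫ ιZ.inv ▷ b ⊗≫ 𝟙 _ := by
        simp only [vpaste]; bicategory
      _ = _ := by rw [idl]; bicategory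
  have ιnat' : 𝟙 tg ⊗≫ tg ◁ ιZ.inv ⊗≫ Ntg.hom ▷ mz ⊗≫ e1 ◁ mg.hom ⊗≫ 𝟙 (e1 ≫ m ≫ tg) =
      𝟙 _ ⊗≫ ι.inv ▷ tg ⊗≫ 𝟙 _ := by
    calc _ = 𝟙 _ ⊗≫ tg ◁ ιZ.inv ⊗≫ Ntg.hom ▷ mz ⊗≫ e1 ◁ mg.hom ⊗≫ (ι.hom ≫ ι.inv) ▷ tg ⊗≫ 𝟙 _ := by
          rw [Iso.hom_inv_id]; bicategory
      _ = 𝟙 _ ⊗≫ tg ◁ ιZ.inv ⊗≫ (vpaste Ntg.hom mg.hom ≫ ι.hom ▷ tg) ⊗≫ ι.inv ▷ tg ⊗≫ 𝟙 _ := by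
        simp only [vpaste]; bicategory
      _ = 𝟙 _ ⊗≫ tg ◁ (ιZ.inv ≫ ιZ.hom) ⊗≫ ι.inv ▷ tg ⊗≫ 𝟙 _ := by rw [← ιnat]; bicategory
      _ = _ := by rw [Iso.inv_hom_id]; bicategory
  rw [← cancel_epi p]
  calc _ = 𝟙 _ ⊗≫ tg ◁ (b ◁ unit.hom) ⊗≫ tg ◁ Nb.hom ▷ b ⊗≫
      (Ntg.hom ▷ (tb ≫ b) ≫ (e1 ≫ ttg) ◁ mult) ⊗≫
        e1 ◁ mg.hom ▷ b ⊗≫ e1 ◁ m ◁ κ ⊗≫ e1 ◁ t := by simp only [p]; bicategory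
    _ = 𝟙 _ ⊗≫ tg ◁ (𝟙 b ⊗≫ b ◁ unit.hom ⊗≫ Nb.hom ▷ b ⊗≫ ez1 ◁ mult ⊗≫ 𝟙 (ez1 ≫ mz ≫ b)) ⊗≫
        Ntg.hom ▷ (mz ≫ b) ⊗≫ e1 ◁ mg.hom ▷ b ⊗≫ e1 ◁ m ◁ κ ⊗≫ e1 ◁ t := by
      rw [← whisker_exchange]; bicategory
    _ = 𝟙 _ ⊗≫ (𝟙 tg ⊗≫ tg ◁ ιZ.inv ⊗≫ Ntg.hom ▷ mz ⊗≫ e1 ◁ mg.hom ⊗≫ 𝟙 (e1 ≫ m ≫ tg)) ▷ b ⊗≫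
        e1 ◁ m ◁ κ ⊗≫ e1 ◁ t := by rw [idl']; bicategory
    _ = 𝟙 _ ⊗≫ (ι.inv ▷ (tg ≫ b) ≫ (e1 ≫ m) ◁ κ) ⊗≫ e1 ◁ t := by rw [ιnat']; bicategory
    _ = 𝟙 _ ⊗≫ κ ⊗≫ ι.inv ▷ f ⊗≫ e1 ◁ t := by rw [← whisker_exchange]; bicategory
    _ = 𝟙 _ ⊗≫ κ ⊗≫ (ι.inv ≫ ι.hom) ▷ f ⊗≫ c ⊗≫ N.hom ▷ f ⊗≫ 𝟙 _ := by
      rw [lowPaste_spec ι N t]; bicategory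
    _ = 𝟙 _ ⊗≫ κ ⊗≫ c ⊗≫ a ◁ 𝟙 (e0 ≫ f) ⊗≫ N.hom ▷ f ⊗≫ 𝟙 _ := by
      rw [Iso.inv_hom_id]; bicategory
    _ = 𝟙 _ ⊗≫ ((κ ≫ c) ▷ 𝟙 _ ≫ (a ≫ e0 ≫ f) ◁ unit.hom) ⊗≫ a ◁ Ng.hom ▷ b ⊗≫
        (a ≫ e0) ◁ κ ⊗≫ N.hom ▷ f ⊗≫ 𝟙 _ := by rw [← unitκ]; bicategory
    _ = 𝟙 _ ⊗≫ (tg ≫ b) ◁ unit.hom ⊗≫ (κ ≫ c) ▷ ez ▷ b ⊗≫ a ◁ Ng.hom ▷ b ⊗≫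
        ((a ≫ e0) ◁ κ ≫ N.hom ▷ f) ⊗≫ 𝟙 _ := by rw [← whisker_exchange]; bicategory
    _ = 𝟙 _ ⊗≫ (tg ≫ b) ◁ unit.hom ⊗≫ ((κ ≫ c) ▷ ez ≫ hpaste N.hom Ng.hom) ▷ b ⊗≫
        e1 ◁ ta ◁ κ ⊗≫ 𝟙 _ := by rw [whisker_exchange]; simp only [hpaste]; bicategory
    _ = _ := by rw [sq]; simp only [hpaste, p]; bicategory

end DescentPasting
end LaxCoh

namespace LaxCoh
open CategoryTheory Bicategory

/-! ### From descent data to lax morphisms. -/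

section DescentData
variable {B : Type u} [Bicategory.{w, v} B] {T : Pseudomonad B}

theorem Pseudomonad.ηNat_unit (T : Pseudomonad B) {a b : B} {f : a ⟶ b} {g : b ⟶ a}
    (σ : 𝟙 a ⟶ f ≫ g) :
    σ ▷ T.ηApp a ≫ hpaste (T.ηNat f).hom (T.ηNat g).hom =
      (λ_ _).hom ≫ (ρ_ _).inv ≫ T.ηApp a ◁ mapUnit T.T σ := by
  have h := T.ηNat_naturality σ
  have h' := T.ηNat_id a
  rw [← T.ηNat_comp, reassoc_of% h, ← Category.assoc (λ_ _).hom, ← h']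
  simp [mapUnit]

namespace LaxAlg

/-- The 2-cell of free algebras given by the multiplication constraint of a lax algebra. -/
def multTrans (y : LaxAlg T) : freeMap (T.T.map y.act) ≫ freeMap y.act ⟶
    (freeMap (T.mApp y.carrier) ≫ freeMap y.act : free T _ ⟶ free T _) :=
  (freeComp (T.T.map y.act) y.act).inv ≫ freeMap₂ y.mult ≫ (freeComp (T.mApp _) y.act).hom

/-- The 2-cell of free algebras given by the unit constraint of a lax algebra. -/
def unitTrans (y : LaxAlg T) : 𝟙 (free T y.carrier) ⟶ freeMap (T.ηApp y.carrier) ≫ freeMap y.act :=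
  (freeId _).inv ≫ freeMap₂ y.unit ≫ (freeComp (T.ηApp _) y.act).hom

/-- Pseudonaturality of the multiplication, as an invertible 2-cell of free algebras. -/
def mNatTrans {X Y : B} (k : X ⟶ Y) : freeMap (T.T.map k) ≫ actHom (free T Y) ≅
    actHom (free T X) ≫ freeMap k :=
  isoMk (T.mNat k) (cellTrans (freeMap k)).comm

/-- Associativity of the multiplication, as an invertible 2-cell of free algebras. -/
def μTrans (X : B) : freeMap (T.mApp X) ≫ actHom (free T X) ≅
    actHom (free T (T.T.obj X)) ≫ actHom (free T X) :=
  isoMk (T.μ X) (cellTrans (actHom (free T X))).comm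

theorem isPseudoMor_freeMap {X Y : B} (k : X ⟶ Y) : IsPseudoMor T
    (freeMap k : free T X ⟶ free T Y) :=
  inferInstanceAs (IsIso (T.mNat k).hom)

theorem isPseudoMor_actHom {z : LaxAlg T} (hz : IsPseudoAlg T z) : IsPseudoMor T (actHom z) := hz.1

theorem isPseudoMor_sharp {X : B} {z : LaxAlg T} (hz : IsPseudoAlg T z) (h : X ⟶ z.carrier) :
    IsPseudoMor T (sharp h : free T X ⟶ z) :=
  isPseudoMor_comp T _ _ (isPseudoMor_freeMap h) (isPseudoMor_actHom hz)

variable {y z : LaxAlg T} {F : free T y.carrier ⟶ z}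

/-- The associativity equation for a descent datum on a morphism out of a free algebra. -/
def DescentAssoc (ϑ : actHom (free T y.carrier) ≫ F ⟶ freeMap y.act ≫ F) : Prop :=
  actHom (free T (T.T.obj y.carrier)) ◁ ϑ ≫ (α_ _ _ _).inv ≫ (mNatTrans y.act).inv ▷ F ≫
      (α_ _ _ _).hom ≫ freeMap (T.T.map y.act) ◁ ϑ ≫ (α_ _ _ _).inv ≫ multTrans y ▷ F =
    (α_ _ _ _).inv ≫ (μTrans y.carrier).inv ▷ F ≫ (α_ _ _ _).hom ≫
      freeMap (T.mApp y.carrier) ◁ ϑ ≫ (α_ _ _ _).inv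

/-- The identity equation for a descent datum on a morphism out of a free algebra. -/
def DescentId (ϑ : actHom (free T y.carrier) ≫ F ⟶ freeMap y.act ≫ F) : Prop :=
  (tauTrans y.carrier).hom ▷ F ≫ (α_ _ _ _).hom ≫ freeMap (T.ηApp y.carrier) ◁ ϑ =
    unitTrans y ▷ F ≫ (α_ _ _ _).hom

/-- The underlying 2-cell of a 2-cell between morphisms out of a free algebra. -/
def thetaBase (ϑ : actHom (free T y.carrier) ≫ F ⟶ freeMap y.act ≫ F) :
    T.mApp y.carrier ≫ F.base ⟶ T.T.map y.act ≫ F.base := ϑ.base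

/-- The 2-cell `F ⟶ y.act ≫ η ≫ F` corresponding to a descent datum. -/
def lowCell (ϑ : actHom (free T y.carrier) ≫ F ⟶ freeMap y.act ≫ F) :
    F.base ⟶ y.act ≫ T.ηApp y.carrier ≫ F.base :=
  lowPaste (T.ι y.carrier) (T.ηNat y.act) (thetaBase ϑ)

/-- Both sides of `DescentAssoc` start at a pseudomorphism out of the free algebra on `T²Y`, so they
agree once their restrictions along `η` do; `descent_assoc_iff` computes these restrictions. -/
theorem descentAssoc_iff (hF : IsPseudoMor T F)
    (ϑ : actHom (free T y.carrier) ≫ F ⟶ freeMap y.act ≫ F) :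
    DescentAssoc ϑ ↔ thetaBase ϑ ≫ T.T.map y.act ◁ lowCell ϑ ≫ (α_ _ _ _).inv ≫
      y.mult ▷ (T.ηApp y.carrier ≫ F.base) = T.mApp y.carrier ◁ lowCell ϑ ≫ (α_ _ _ _).inv := by
  have h := descent_assoc_iff (T.ι y.carrier) (T.ι (T.T.obj y.carrier)) (T.ηNat y.act)
    (T.ηNat (T.T.map y.act)) (T.ηNat (T.mApp y.carrier)) (T.mNat y.act) y.mult (mapSq T.T y.mult)
    (T.μ y.carrier) (thetaBase ϑ) (T.ι_naturality' y.act) (T.ηNat_sq y.mult)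
    (T.free_identity_left y.carrier)
  refine Iff.trans ⟨fun e => congrArg (fun s => T.ηApp _ ◁ Hom₂.base s) e, fun e => ?_⟩ h
  exact free_hom₂_ext (isPseudoMor_comp T _ _ (isPseudoMor_actHom (isPseudoAlg_free _))
    (isPseudoMor_comp T _ _ (isPseudoMor_actHom (isPseudoAlg_free _)) hF)) e

theorem descentId_iff (hF : IsPseudoMor T F)
    (ϑ : actHom (free T y.carrier) ≫ F ⟶ freeMap y.act ≫ F) :
    DescentId ϑ ↔ T.ηApp y.carrier ◁ lowCell ϑ =
      (λ_ _).inv ≫ y.unit ▷ (T.ηApp y.carrier ≫ F.base) ≫ (α_ _ _ _).hom := by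
  have h := descent_id_iff (T.ι y.carrier) (T.ηNat y.act) (T.ηNat (T.ηApp y.carrier))
    (T.τ y.carrier) y.unit (mapUnit T.T y.unit) (thetaBase ϑ) (T.unit_τ y.carrier)
    (T.ηNat_unit y.unit)
  refine Iff.trans ⟨fun e => congrArg (fun s => T.ηApp _ ◁ Hom₂.base s) e, fun e => ?_⟩ h
  exact free_hom₂_ext (isPseudoMor_comp T _ _ (isPseudoMor_id T _) hF) e

/-- The structure 2-cell of the lax morphism given by a descent datum. -/
def lowerCell (ϑ : actHom (free T y.carrier) ≫ F ⟶ freeMap y.act ≫ F) :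
    T.T.map (T.ηApp y.carrier ≫ F.base) ≫ z.act ⟶ y.act ≫ T.ηApp y.carrier ≫ F.base :=
  sharpCounitCell F ≫ lowCell ϑ

/-- The multiplication law of a lax morphism involves `T` of its structure cell; this equation
expresses that cell through `ϑ`. Both sides underlie transformations out of a free algebra, so
`descent_square` suffices. Invertibility of `z.unit` enters there, and that of `z.mult` makes their
common source a pseudomorphism. -/
theorem lowerCell_square (hz : IsPseudoAlg T z)
    (ϑ : actHom (free T y.carrier) ≫ F ⟶ freeMap y.act ≫ F) :
    T.T.map (T.T.map (T.ηApp y.carrier ≫ F.base)) ◁ z.mult ≫ (α_ _ _ _).inv ≫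
      (T.mNat (T.ηApp y.carrier ≫ F.base)).hom ▷ z.act ≫ (α_ _ _ _).hom ≫
        T.mApp y.carrier ◁ sharpCounitCell F ≫ thetaBase ϑ =
      (α_ _ _ _).inv ≫ mapSq T.T (lowerCell ϑ) ▷ z.act ≫ (α_ _ _ _).hom ≫
        T.T.map y.act ◁ sharpCounitCell F := by
  have := hz.2
  have h := descent_square (T.ι y.carrier) (T.ηNat y.act) (thetaBase ϑ) (sharpCounitCell F)
    (T.ι z.carrier) (T.ηNat z.act) (T.ηNat (T.T.map (T.ηApp y.carrier ≫ F.base)))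
    (T.ηNat (T.ηApp y.carrier ≫ F.base)) (T.mNat (T.ηApp y.carrier ≫ F.base)) z.mult
    (asIso z.unit) (mapSq T.T (lowerCell ϑ)) z.identity_left (T.ι_naturality _)
    (sharpUnit_counit F) (T.ηNat_sq (lowerCell ϑ))
  -- The two sides are assembled as `T`-transformations, which allows the comparison along `η`.
  let s : freeMap (T.T.map (T.ηApp y.carrier ≫ F.base)) ≫ freeMap z.act ≫ actHom z ⟶
      freeMap y.act ≫ F :=
    freeMap (T.T.map (T.ηApp y.carrier ≫ F.base)) ◁ cellTrans (actHom z) ≫ (α_ _ _ _).inv ≫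
      (mNatTrans (T.ηApp y.carrier ≫ F.base)).hom ▷ actHom z ≫ (α_ _ _ _).hom ≫
        actHom (free T y.carrier) ◁ sharpCounit F ≫ ϑ
  let t : freeMap (T.T.map (T.ηApp y.carrier ≫ F.base)) ≫ freeMap z.act ≫ actHom z ⟶
      freeMap y.act ≫ F :=
    (α_ _ _ _).inv ≫ ((freeComp _ _).inv ≫ freeMap₂ (lowerCell ϑ) ≫ (freeComp _ _).hom) ▷ actHom z ≫
      (α_ _ _ _).hom ≫ freeMap y.act ◁ sharpCounit F
  have e : s = t := free_hom₂_ext (isPseudoMor_comp T _ _ (isPseudoMor_freeMap _)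
    (isPseudoMor_comp T _ _ (isPseudoMor_freeMap _) (isPseudoMor_actHom hz))) h
  exact congrArg Hom₂.base e

/-- By `lowerCell_square`, both sides of the multiplication law factor through the same invertible
cell `p`. What remains is the form of `DescentAssoc` given by `descentAssoc_iff`. -/
theorem map_mult_lowerCell_iff (hz : IsPseudoAlg T z) (hF : IsPseudoMor T F)
    (ϑ : actHom (free T y.carrier) ≫ F ⟶ freeMap y.act ≫ F) :
    (T.T.map (T.T.map (T.ηApp y.carrier ≫ F.base)) ◁ z.mult ≫
        vpaste (T.mNat (T.ηApp y.carrier ≫ F.base)).hom (lowerCell ϑ) =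
      vpaste (mapSq T.T (lowerCell ϑ)) (lowerCell ϑ) ≫ y.mult ▷ (T.ηApp y.carrier ≫ F.base)) ↔
    DescentAssoc ϑ := by
  rw [descentAssoc_iff hF]
  have e := lowerCell_square hz ϑ
  have := hz.1
  have := isIso_sharpCounitCell F hF
  generalize mapSq T.T (lowerCell ϑ) = tc at *
  unfold lowerCell
  generalize thetaBase ϑ = t at *
  generalize lowCell ϑ = c at *
  generalize sharpCounitCell F = κ at *
  generalize T.mNat (T.ηApp y.carrier ≫ F.base) = n at *
  let p := T.T.map (T.T.map (T.ηApp y.carrier ≫ F.base)) ◁ z.mult ≫ (α_ _ _ _).inv ≫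
      n.hom ▷ z.act ≫ (α_ _ _ _).hom ≫ T.mApp y.carrier ◁ κ
  have hl : T.T.map (T.T.map (T.ηApp y.carrier ≫ F.base)) ◁ z.mult ≫ vpaste n.hom (κ ≫ c) =
      p ≫ T.mApp y.carrier ◁ c ≫ (α_ _ _ _).inv := by simp [p, vpaste]
  have hr : vpaste tc (κ ≫ c) ≫ y.mult ▷ (T.ηApp y.carrier ≫ F.base) =
      p ≫ t ≫ T.T.map y.act ◁ c ≫ (α_ _ _ _).inv ≫ y.mult ▷ (T.ηApp y.carrier ≫ F.base) := by
    simp only [p, vpaste, Category.assoc, whiskerLeft_comp]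
    rw [reassoc_of% e]
  rw [hl, hr, cancel_epi]
  exact eq_comm

/-- The triangle law `sharpUnit_counit` absorbs `z.unit` together with the comparison, leaving the
identity equation for `lowCell ϑ`. -/
theorem map_unit_lowerCell_iff (hF : IsPseudoMor T F)
    (ϑ : actHom (free T y.carrier) ≫ F ⟶ freeMap y.act ≫ F) :
    ((T.ηApp y.carrier ≫ F.base) ◁ z.unit ≫
        vpaste (T.ηNat (T.ηApp y.carrier ≫ F.base)).hom (lowerCell ϑ) =
      (ρ_ (T.ηApp y.carrier ≫ F.base)).hom ≫ (λ_ (T.ηApp y.carrier ≫ F.base)).inv ≫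
        y.unit ▷ (T.ηApp y.carrier ≫ F.base)) ↔ DescentId ϑ := by
  rw [descentId_iff hF]
  have e := sharpUnit_counit F
  unfold lowerCell sharpUnit at *
  generalize lowCell ϑ = c at *
  generalize sharpCounitCell F = κ at *
  generalize T.ηNat (T.ηApp y.carrier ≫ F.base) = n at *
  have hl : (T.ηApp y.carrier ≫ F.base) ◁ z.unit ≫ vpaste n.hom (κ ≫ c) =
      (ρ_ (T.ηApp y.carrier ≫ F.base)).hom ≫ T.ηApp y.carrier ◁ c ≫ (α_ _ _ _).inv := by
    rw [← Category.id_comp (T.ηApp y.carrier ◁ c ≫ _), ← e]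
    simp [vpaste]
  rw [hl, cancel_epi, Iso.comp_inv_eq]
  simp only [Category.assoc]

/-- The lax morphism given by a descent datum. -/
def lower (hz : IsPseudoAlg T z) (hF : IsPseudoMor T F)
    (ϑ : actHom (free T y.carrier) ≫ F ⟶ freeMap y.act ≫ F) (h : DescentAssoc ϑ)
        (h' : DescentId ϑ) :
    y ⟶ z :=
  Hom.mk (y := y) (z := z) (T.ηApp y.carrier ≫ F.base) (lowerCell ϑ)
    ((map_mult_lowerCell_iff hz hF ϑ).2 h) ((map_unit_lowerCell_iff hF ϑ).2 h')

end LaxAlg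
end DescentData
end LaxCoh

namespace LaxCoh
open CategoryTheory Bicategory

/-! ### Equivalence of descent data with lax morphisms. -/

section LowerFunctoriality
variable {B : Type u} [Bicategory.{w, v} B]

theorem comp_lowPaste_iff {y0 y1 y2 z : B} {a : y1 ⟶ y0} {ta m : y2 ⟶ y1} {e0 : y0 ⟶ y1}
    {e1 : y1 ⟶ y2} {f f' : y1 ⟶ z} (ι : e1 ≫ m ≅ 𝟙 y1) (N : a ≫ e0 ≅ e1 ≫ ta)
    (t : m ≫ f ⟶ ta ≫ f) (t' : m ≫ f' ⟶ ta ≫ f') (γ : f ⟶ f') :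
    γ ≫ lowPaste ι N t' = lowPaste ι N t ≫ a ◁ e0 ◁ γ ↔
      e1 ◁ (m ◁ γ ≫ t') = e1 ◁ (t ≫ ta ◁ γ) := by
  let p : f ⟶ e1 ≫ m ≫ f := (λ_ f).inv ≫ ι.inv ▷ f ≫ (α_ _ _ _).hom
  let q : e1 ≫ ta ≫ f' ⟶ a ≫ e0 ≫ f' := (α_ _ _ _).inv ≫ N.inv ▷ f' ≫ (α_ _ _ _).hom
  have hl : γ ≫ lowPaste ι N t' = p ≫ e1 ◁ (m ◁ γ ≫ t') ≫ q := by
    calc _ = 𝟙 _ ⊗≫ (𝟙 _ ◁ γ ≫ ι.inv ▷ f') ⊗≫ e1 ◁ t' ⊗≫ N.inv ▷ f' ⊗≫ 𝟙 _ := by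
          simp only [lowPaste]; bicategory
      _ = _ := by rw [whisker_exchange]; simp only [p, q]; bicategory
  have hr : lowPaste ι N t ≫ a ◁ e0 ◁ γ = p ≫ e1 ◁ (t ≫ ta ◁ γ) ≫ q := by
    calc _ = 𝟙 _ ⊗≫ ι.inv ▷ f ⊗≫ e1 ◁ t ⊗≫ (N.inv ▷ f ≫ (a ≫ e0) ◁ γ) ⊗≫ 𝟙 _ := by
          simp only [lowPaste]; bicategory
      _ = _ := by rw [← whisker_exchange]; simp only [p, q]; bicategory
  rw [hl, hr, cancel_epi, cancel_mono]

theorem lowPaste_whiskerRight {y0 y1 y2 z z' : B} {a : y1 ⟶ y0} {ta m : y2 ⟶ y1} {e0 : y0 ⟶ y1}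
    {e1 : y1 ⟶ y2} {f : y1 ⟶ z} (ι : e1 ≫ m ≅ 𝟙 y1) (N : a ≫ e0 ≅ e1 ≫ ta)
    (t : m ≫ f ⟶ ta ≫ f) (h : z ⟶ z') :
    lowPaste ι N ((α_ _ _ _).inv ≫ t ▷ h ≫ (α_ _ _ _).hom) =
      lowPaste ι N t ▷ h ≫ (α_ _ _ _).hom ≫ a ◁ (α_ _ _ _).hom := by
  simp only [lowPaste]; bicategory

theorem lowPaste_eq {y0 y1 y2 z : B} {a : y1 ⟶ y0} {ta m : y2 ⟶ y1} {e0 : y0 ⟶ y1}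
    {e1 : y1 ⟶ y2} {f : y1 ⟶ z} (ι : e1 ≫ m ≅ 𝟙 y1) (N : a ≫ e0 ≅ e1 ≫ ta)
    (t : m ≫ f ⟶ ta ≫ f) (c : f ⟶ a ≫ e0 ≫ f) (h : e1 ◁ t = (α_ _ _ _).inv ≫ ι.hom ▷ f ≫
      (λ_ _).hom ≫ c ≫ (α_ _ _ _).inv ≫ N.hom ▷ f ≫ (α_ _ _ _).hom) : lowPaste ι N t = c := by
  simp [lowPaste, h]

theorem hpaste_comp_lowPaste {x y z z' z1 z1' : B} {e : x ⟶ y} {f : y ⟶ z} {k : z ⟶ z'}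
    {a : y ⟶ x} {tg : y ⟶ z1} {tk : z1 ⟶ z1'} {b : z1 ⟶ z} {b' : z1' ⟶ z'} {g g' : y ⟶ z1'}
    {A : g ⟶ g'} {κ' : g' ≫ b' ⟶ f ≫ k} {M : g ⟶ tg ≫ tk} {kc : tk ≫ b' ⟶ b ≫ k}
    {κ : tg ≫ b ⟶ f} {c : f ⟶ a ≫ e ≫ f} {c' : f ≫ k ⟶ a ≫ e ≫ f ≫ k}
    (h : A ▷ b' ≫ κ' = M ▷ b' ≫ (α_ _ _ _).hom ≫ tg ◁ kc ≫ (α_ _ _ _).inv ≫ κ ▷ k)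
    (h' : c' = c ▷ k ≫ (α_ _ _ _).hom ≫ a ◁ (α_ _ _ _).hom) :
    A ▷ b' ≫ κ' ≫ c' = (M ▷ b' ≫ hpaste (κ ≫ c) kc) ≫ a ◁ (α_ e f k).hom := by
  rw [reassoc_of% h, h']
  simp [hpaste]

theorem whiskerLeft_comp_eq_id {x y z : B} {e : x ⟶ y} {g : x ⟶ z} {h k : y ⟶ z} {u : g ⟶ e ≫ h}
    (hu : IsIso u) {v : e ≫ h ⟶ e ≫ k} {s : h ⟶ k} {r : k ⟶ h} (h₁ : u ≫ v = u ≫ e ◁ s)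
    (h₂ : v ≫ e ◁ r = 𝟙 _) : e ◁ (s ≫ r) = e ◁ 𝟙 h := by
  rw [whiskerLeft_comp, whiskerLeft_id, ← cancel_epi u, ← reassoc_of% h₁, h₂]

variable {T : Pseudomonad B}

namespace LaxAlg

theorem sharpCounitCell_comp {X : B} {z z' : LaxAlg T} (F : free T X ⟶ z) (h : z ⟶ z') :
    T.T.map₂ (α_ (T.ηApp X) F.base h.base).hom ▷ z'.act ≫ sharpCounitCell (F ≫ h) =
      (T.T.mapComp (T.ηApp X ≫ F.base) h.base).hom ▷ z'.act ≫ (α_ _ _ _).hom ≫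
        T.T.map (T.ηApp X ≫ F.base) ◁ h.cell ≫ (α_ _ _ _).inv ≫ sharpCounitCell F ▷ h.base := by
  let e := T.ηApp X
  let te := T.T.map e
  let f : T.T.obj X ⟶ z.carrier := F.base
  let k : z.carrier ⟶ z'.carrier := h.base
  let fc : T.T.map f ≫ z.act ⟶ T.mApp X ≫ f := F.cell
  let kc : T.T.map k ≫ z'.act ⟶ z.act ≫ k := h.cell
  let t := (T.τ X).inv
  have e1 := T.T.mapComp_assoc_right_hom e f k
  change T.T.map₂ (α_ e f k).hom ▷ z'.act ≫ (T.T.mapComp e (f ≫ k)).hom ▷ z'.act ≫ (α_ _ _ _).hom ≫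
    te ◁ ((T.T.mapComp f k).hom ▷ z'.act ≫ hpaste fc kc) ≫
      (α_ te (T.mApp X) (f ≫ k)).inv ≫ t ▷ (f ≫ k) ≫ (λ_ (f ≫ k)).hom =
    (T.T.mapComp (e ≫ f) k).hom ▷ z'.act ≫ (α_ _ _ _).hom ≫
        T.T.map (e ≫ f) ◁ kc ≫ (α_ _ _ _).inv ≫ ((T.T.mapComp e f).hom ▷ z.act ≫ (α_ _ _ _).hom ≫
          te ◁ fc ≫ (α_ te (T.mApp X) f).inv ≫ t ▷ f ≫ (λ_ f).hom) ▷ k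
  calc _ = T.T.map₂ (α_ e f k).hom ▷ z'.act ⊗≫ ((T.T.mapComp e (f ≫ k)).hom ≫
        T.T.map e ◁ (T.T.mapComp f k).hom) ▷ z'.act ⊗≫ te ◁ T.T.map f ◁ kc ⊗≫ te ◁ fc ▷ k ⊗≫
        t ▷ f ▷ k ⊗≫ 𝟙 _ := by simp only [hpaste]; bicategory
    _ = (T.T.map₂ (α_ e f k).hom ≫ T.T.map₂ (α_ e f k).inv) ▷ z'.act ⊗≫
        (T.T.mapComp (e ≫ f) k).hom ▷ z'.act ⊗≫
        ((T.T.mapComp e f).hom ▷ (T.T.map k ≫ z'.act) ≫ (te ≫ T.T.map f) ◁ kc) ⊗≫ te ◁ fc ▷ k ⊗≫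
        t ▷ f ▷ k ⊗≫ 𝟙 _ := by rw [e1]; bicategory
    _ = _ := by
      rw [← whisker_exchange, ← T.T.map₂_comp, Iso.hom_inv_id, T.T.map₂_id]; bicategory

variable {y z : LaxAlg T} {F F' : free T y.carrier ⟶ z}

/-- Once the invertible comparison at `F` is cancelled, the first equation says that `γ` respects
`lowCell`. This is the second equation restricted along `η`, and restriction is faithful. -/
theorem lowerCell_naturality_iff (hF : IsPseudoMor T F)
    (ϑ : actHom (free T y.carrier) ≫ F ⟶ freeMap y.act ≫ F)
    (ϑ' : actHom (free T y.carrier) ≫ F' ⟶ freeMap y.act ≫ F') (γ : F ⟶ F') :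
    T.T.map₂ (T.ηApp y.carrier ◁ γ.base) ▷ z.act ≫ lowerCell ϑ' =
      lowerCell ϑ ≫ y.act ◁ T.ηApp y.carrier ◁ γ.base ↔
    actHom (free T y.carrier) ◁ γ ≫ ϑ' = ϑ ≫ freeMap y.act ◁ γ := by
  have e : T.T.map₂ (T.ηApp y.carrier ◁ γ.base) ▷ z.act ≫ sharpCounitCell F' =
    sharpCounitCell F ≫ γ.base := congrArg Hom₂.base (sharpCounit_naturality γ)
  have := isIso_sharpCounitCell F hF
  unfold lowerCell
  rw [reassoc_of% e, Category.assoc, cancel_epi]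
  refine (comp_lowPaste_iff (T.ι y.carrier) (T.ηNat y.act) (thetaBase ϑ) (thetaBase ϑ')
    γ.base).trans ⟨fun h => ?_, fun h => congrArg (fun s => T.ηApp _ ◁ Hom₂.base s) h⟩
  exact free_hom₂_ext (isPseudoMor_comp T _ _ (isPseudoMor_actHom (isPseudoAlg_free _)) hF) h

/-- The transformation between lax morphisms given by a compatible 2-cell of descent data. -/
def lowerMap {hz : IsPseudoAlg T z} {hF : IsPseudoMor T F} {hF' : IsPseudoMor T F'}
    {ϑ : actHom (free T y.carrier) ≫ F ⟶ freeMap y.act ≫ F} {h : DescentAssoc ϑ} {h' : DescentId ϑ}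
    {ϑ' : actHom (free T y.carrier) ≫ F' ⟶ freeMap y.act ≫ F'} {k : DescentAssoc ϑ'}
    {k' : DescentId ϑ'} (γ : F ⟶ F')
    (hγ : actHom (free T y.carrier) ◁ γ ≫ ϑ' = ϑ ≫ freeMap y.act ◁ γ) :
    lower hz hF ϑ h h' ⟶ lower hz hF' ϑ' k k' :=
  Hom₂.mk (T.ηApp y.carrier ◁ γ.base) ((lowerCell_naturality_iff hF ϑ ϑ' γ).2 hγ)

/-- Together with `lowerMap_injective`, lowering is fully faithful on descent data. -/
theorem exists_eq_lowerMap {hz : IsPseudoAlg T z} {hF : IsPseudoMor T F} {hF' : IsPseudoMor T F'}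
    {ϑ : actHom (free T y.carrier) ≫ F ⟶ freeMap y.act ≫ F} {h : DescentAssoc ϑ} {h' : DescentId ϑ}
    {ϑ' : actHom (free T y.carrier) ≫ F' ⟶ freeMap y.act ≫ F'} {k : DescentAssoc ϑ'}
    {k' : DescentId ϑ'} (s : lower hz hF ϑ h h' ⟶ lower hz hF' ϑ' k k') :
    ∃ (γ : F ⟶ F') (hγ : actHom (free T y.carrier) ◁ γ ≫ ϑ' = ϑ ≫ freeMap y.act ◁ γ),
      s = lowerMap γ hγ := by
  obtain ⟨γ, hγ⟩ := exists_free_hom₂ hF (g := F') s.base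
  refine ⟨γ, (lowerCell_naturality_iff hF ϑ ϑ' γ).1 ?_, hom₂_ext hγ.symm⟩
  rw [hγ]
  exact s.comm

theorem lowerMap_injective {hz : IsPseudoAlg T z} {hF : IsPseudoMor T F} {hF' : IsPseudoMor T F'}
    {ϑ : actHom (free T y.carrier) ≫ F ⟶ freeMap y.act ≫ F} {h : DescentAssoc ϑ} {h' : DescentId ϑ}
    {ϑ' : actHom (free T y.carrier) ≫ F' ⟶ freeMap y.act ≫ F'} {k : DescentAssoc ϑ'}
    {k' : DescentId ϑ'} {γ γ' : F ⟶ F'}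
    {hγ : actHom (free T y.carrier) ◁ γ ≫ ϑ' = ϑ ≫ freeMap y.act ◁ γ}
    {hγ' : actHom (free T y.carrier) ◁ γ' ≫ ϑ' = ϑ ≫ freeMap y.act ◁ γ'}
    (e : (lowerMap γ hγ : lower hz hF ϑ h h' ⟶ lower hz hF' ϑ' k k') = lowerMap γ' hγ') : γ = γ' :=
  free_hom₂_ext hF (congrArg Hom₂.base e)

/-- Composition of a lax morphism given by a descent datum with a pseudomorphism. -/
def lowerComp {z' : LaxAlg T} {hz : IsPseudoAlg T z} {hz' : IsPseudoAlg T z'}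
    {hF : IsPseudoMor T F} (l : z ⟶ z') {hFl : IsPseudoMor T (F ≫ l)}
    {ϑ : actHom (free T y.carrier) ≫ F ⟶ freeMap y.act ≫ F} {h : DescentAssoc ϑ} {h' : DescentId ϑ}
    {ϑ' : actHom (free T y.carrier) ≫ F ≫ l ⟶ freeMap y.act ≫ F ≫ l} {k : DescentAssoc ϑ'}
    {k' : DescentId ϑ'} (e : ϑ' = (α_ _ _ _).inv ≫ ϑ ▷ l ≫ (α_ _ _ _).hom) :
    lower hz hF ϑ h h' ≫ l ≅ lower hz' hFl ϑ' k k' :=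
  isoMk (α_ (T.ηApp y.carrier) F.base l.base) (by
    subst e
    have e1 : lowCell ((α_ _ _ _).inv ≫ ϑ ▷ l ≫ (α_ _ _ _).hom) = lowCell ϑ ▷ l.base ≫
        (α_ _ _ _).hom ≫ y.act ◁ (α_ _ _ _).hom :=
      lowPaste_whiskerRight (T.ι y.carrier) (T.ηNat y.act) (thetaBase ϑ) l.base
    have e2 := sharpCounitCell_comp F l
    exact hpaste_comp_lowPaste e2 e1)

theorem isPseudoMor_lower {hz : IsPseudoAlg T z} {hF : IsPseudoMor T F}
    {ϑ : actHom (free T y.carrier) ≫ F ⟶ freeMap y.act ≫ F} {h : DescentAssoc ϑ} {h' : DescentId ϑ}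
    (hϑ : IsIso ϑ) : IsPseudoMor T (lower hz hF ϑ h h') := by
  have := isIso_sharpCounitCell F hF
  have : IsIso (thetaBase ϑ) := ⟨(inv ϑ).base, congrArg Hom₂.base (IsIso.hom_inv_id ϑ),
    congrArg Hom₂.base (IsIso.inv_hom_id ϑ)⟩
  change IsIso (sharpCounitCell F ≫ (λ_ F.base).inv ≫ (T.ι y.carrier).inv ▷ F.base ≫
      (α_ _ _ _).hom ≫
    T.ηApp _ ◁ thetaBase ϑ ≫ (α_ _ _ _).inv ≫ (T.ηNat y.act).inv ▷ F.base ≫ (α_ _ _ _).hom)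
  infer_instance

theorem isIso_of_isIso_unit_whiskerLeft (hF : IsPseudoMor T F) (hF' : IsPseudoMor T F') (γ : F ⟶ F')
    (h : IsIso (T.ηApp y.carrier ◁ γ.base)) : IsIso γ := by
  obtain ⟨γ', h'⟩ := exists_free_hom₂ hF' (g := F) (inv (T.ηApp y.carrier ◁ γ.base))
  refine ⟨γ', free_hom₂_ext hF ?_, free_hom₂_ext hF' ?_⟩
  · change T.ηApp y.carrier ◁ (Hom₂.base γ ≫ Hom₂.base γ') = T.ηApp y.carrier ◁ 𝟙 _
    rw [whiskerLeft_comp, h', IsIso.hom_inv_id, whiskerLeft_id]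
  · change T.ηApp y.carrier ◁ (Hom₂.base γ' ≫ Hom₂.base γ) = T.ηApp y.carrier ◁ 𝟙 _
    rw [whiskerLeft_comp, h', IsIso.inv_hom_id, whiskerLeft_id]

/-- The other triangle law. Since `z.unit` is invertible, so is `sharpUnit`, and after restriction
along `η` the claim follows from the first triangle law by cancelling it. -/
theorem sharpMap_sharpUnit_counit (hz : IsPseudoAlg T z) {X : B} (f : X ⟶ z.carrier) :
    T.T.map₂ (sharpUnit f) ▷ z.act ≫ sharpCounitCell (sharp f : free T X ⟶ z) = 𝟙 _ := by
  have := hz.2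
  have hu : IsIso (sharpUnit (z := z) f) := by unfold sharpUnit; infer_instance
  have e : sharpMap (sharpUnit f) ≫ sharpCounit (sharp f : free T X ⟶ z) = 𝟙 _ := by
    apply free_hom₂_ext (isPseudoMor_sharp hz f)
    have h1 := sharpUnit_naturality (z := z) (sharpUnit (z := z) f)
    have h2 := sharpUnit_counit (sharp f : free T X ⟶ z)
    exact whiskerLeft_comp_eq_id hu h1 h2
  exact congrArg Hom₂.base e

/-- Transport of the axioms of a lax morphism along an invertible 2-cell. -/
theorem map_mult_of_iso (f : y ⟶ z) {g : y.carrier ⟶ z.carrier} (e : f.base ≅ g)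
    (c : T.T.map g ≫ z.act ⟶ y.act ≫ g)
    (h : T.T.map₂ e.hom ▷ z.act ≫ c = f.cell ≫ y.act ◁ e.hom) :
    T.T.map (T.T.map g) ◁ z.mult ≫ vpaste (T.mNat g).hom c =
      vpaste (mapSq T.T c) c ≫ y.mult ▷ g := by
  have h1 := vpaste_whisker (T.T.map₂ (T.T.map₂ e.hom)) (T.T.map₂ e.hom) e.hom
    (σ := mapSq T.T f.cell) (σ₁ := mapSq T.T c)
    (by rw [← mapSq_whisker, h]; simp [mapSq]) h
  have h2 := vpaste_whisker (T.T.map₂ (T.T.map₂ e.hom)) (T.T.map₂ e.hom) e.hom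
    (T.mNat_naturality e.hom) h
  have h3 := f.map_mult
  rw [← cancel_epi (T.T.map₂ (T.T.map₂ e.hom) ▷ (T.T.map z.act ≫ z.act)), reassoc_of% h1,
    ← whisker_exchange_assoc, h2, reassoc_of% h3, whisker_exchange]

theorem map_unit_of_iso (f : y ⟶ z) {g : y.carrier ⟶ z.carrier} (e : f.base ≅ g)
    (c : T.T.map g ≫ z.act ⟶ y.act ≫ g)
    (h : T.T.map₂ e.hom ▷ z.act ≫ c = f.cell ≫ y.act ◁ e.hom) :
    g ◁ z.unit ≫ vpaste (T.ηNat g).hom c = (ρ_ g).hom ≫ (λ_ g).inv ≫ y.unit ▷ g := by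
  have h2 := vpaste_whisker e.hom (T.T.map₂ e.hom) e.hom (T.ηNat_naturality e.hom) h
  have h3 := f.map_unit
  rw [← cancel_epi (e.hom ▷ 𝟙 _), ← whisker_exchange_assoc, h2, reassoc_of% h3, ← whisker_exchange]
  simp

/-- Essential surjectivity of lowering. The extension `F` of `f.base` restricts to `f.base` up to
the isomorphism `u`, because `z.unit` is invertible. Transporting the structure cell of `f` along
`u` prescribes `lowCell ϑ`, hence the restriction of `ϑ`, hence `ϑ`. -/
theorem exists_iso_lower (hz : IsPseudoAlg T z) (f : y ⟶ z) :
    ∃ (F : free T y.carrier ⟶ z) (hF : IsPseudoMor T F)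
      (ϑ : actHom (free T y.carrier) ≫ F ⟶ freeMap y.act ≫ F) (h : DescentAssoc ϑ)
      (h' : DescentId ϑ), Nonempty (f ≅ lower hz hF ϑ h h') ∧ (IsPseudoMor T f → IsIso ϑ) := by
  have := hz.2
  have hu : IsIso (sharpUnit (z := z) f.base) := by unfold sharpUnit; infer_instance
  let u : f.base ≅ T.ηApp y.carrier ≫ T.T.map f.base ≫ z.act := asIso (sharpUnit (z := z) f.base)
  let F : free T y.carrier ⟶ z := sharp f.base
  have hF : IsPseudoMor T F := isPseudoMor_sharp hz f.base
  have hmF : IsPseudoMor T (actHom (free T y.carrier) ≫ F) :=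
    isPseudoMor_comp T _ _ (isPseudoMor_actHom (isPseudoAlg_free _)) hF
  let c : T.T.map f.base ≫ z.act ⟶ y.act ≫ T.ηApp y.carrier ≫ T.T.map f.base ≫ z.act :=
    f.cell ≫ y.act ◁ sharpUnit f.base
  -- The restriction of the desired `ϑ` along `η`, obtained by solving `lowPaste = c`.
  let x : T.ηApp (T.T.obj y.carrier) ≫ T.mApp y.carrier ≫ T.T.map f.base ≫ z.act ⟶
      T.ηApp (T.T.obj y.carrier) ≫ T.T.map y.act ≫ T.T.map f.base ≫ z.act :=
    (α_ _ _ _).inv ≫ (T.ι y.carrier).hom ▷ _ ≫ (λ_ _).hom ≫ c ≫ (α_ _ _ _).inv ≫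
      (T.ηNat y.act).hom ▷ _ ≫ (α_ _ _ _).hom
  obtain ⟨ϑ, hϑ⟩ := exists_free_hom₂ (g := freeMap y.act ≫ F) hmF x
  have hc : lowCell ϑ = c :=
    lowPaste_eq (T.ι y.carrier) (T.ηNat y.act) (f := T.T.map f.base ≫ z.act) ϑ.base c hϑ
  have hC : T.T.map₂ (sharpUnit f.base) ▷ z.act ≫ lowerCell ϑ = f.cell ≫
      y.act ◁ sharpUnit f.base := by
    have e := sharpMap_sharpUnit_counit hz f.base
    unfold lowerCell
    rw [hc]
    exact (Category.assoc _ _ _).symm.trans ((congrArg (· ≫ c) e).trans (Category.id_comp c))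
  -- The laws of `f`, transported along `u`, are laws for `lowerCell ϑ`, which are equivalent to the
  -- descent equations.
  have h1 := map_mult_of_iso f u (lowerCell ϑ) hC
  have h2 := map_unit_of_iso f u (lowerCell ϑ) hC
  refine ⟨F, hF, ϑ, (map_mult_lowerCell_iff hz hF ϑ).1 h1, (map_unit_lowerCell_iff hF ϑ).1 h2,
    ⟨isoMk u hC⟩, fun hf => ?_⟩
  -- If `f.cell` is invertible then so is `x`, the restriction of `ϑ`.
  apply isIso_of_isIso_unit_whiskerLeft (y := free T y.carrier) hmF
      (isPseudoMor_comp T _ _ (isPseudoMor_freeMap _) hF)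
  have : IsIso f.cell := hf
  rw [hϑ]
  exact inferInstanceAs (IsIso ((α_ _ _ _).inv ≫ (T.ι y.carrier).hom ▷ _ ≫ (λ_ _).hom ≫
    (f.cell ≫ y.act ◁ sharpUnit f.base) ≫ (α_ _ _ _).inv ≫ (T.ηNat y.act).hom ▷ _ ≫ (α_ _ _ _).hom))

end LaxAlg
end LowerFunctoriality
end LaxCoh

namespace LaxCoh
open CategoryTheory Bicategory

/-! ### Pasting identities for the pseudo-comma bicategory. -/

section CommaPasting
variable {C : Type u} [Bicategory.{w, v} C]

theorem hpaste_whiskerLeft_middle {a b c a' b' c' : C} {f : a ⟶ b} {g g₁ : b ⟶ c} {h : a' ⟶ b'}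
    {k k₁ : b' ⟶ c'} {p : a ⟶ a'} {q : b ⟶ b'} {r : c ⟶ c'} (θ : f ≫ q ⟶ p ≫ h)
    {φ : g ≫ r ⟶ q ≫ k} {φ₁ : g₁ ≫ r ⟶ q ≫ k₁} {x : g ⟶ g₁} {s : k ⟶ k₁}
    (e : x ▷ r ≫ φ₁ = φ ≫ q ◁ s) :
    (f ◁ x) ▷ r ≫ hpaste θ φ₁ = hpaste θ φ ≫ p ◁ h ◁ s := by
  calc _ = 𝟙 _ ⊗≫ f ◁ (x ▷ r ≫ φ₁) ⊗≫ θ ▷ k₁ ⊗≫ 𝟙 _ := by simp only [hpaste]; bicategory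
    _ = 𝟙 _ ⊗≫ f ◁ φ ⊗≫ ((f ≫ q) ◁ s ≫ θ ▷ k₁) ⊗≫ 𝟙 _ := by rw [e]; bicategory
    _ = _ := by rw [whisker_exchange]; simp only [hpaste]; bicategory

theorem hpaste_whiskerRight_middle {a b c a' b' c' : C} {f f₁ : a ⟶ b} {g : b ⟶ c} {h h₁ : a' ⟶ b'}
    {k : b' ⟶ c'} {p : a ⟶ a'} {q : b ⟶ b'} {r : c ⟶ c'} {θ : f ≫ q ⟶ p ≫ h}
    {θ₁ : f₁ ≫ q ⟶ p ≫ h₁} (φ : g ≫ r ⟶ q ≫ k) {x : f ⟶ f₁} {s : h ⟶ h₁}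
    (e : x ▷ q ≫ θ₁ = θ ≫ p ◁ s) :
    (x ▷ g) ▷ r ≫ hpaste θ₁ φ = hpaste θ φ ≫ p ◁ s ▷ k := by
  calc _ = 𝟙 _ ⊗≫ (x ▷ (g ≫ r) ≫ f₁ ◁ φ) ⊗≫ θ₁ ▷ k ⊗≫ 𝟙 _ := by simp only [hpaste]; bicategory
    _ = 𝟙 _ ⊗≫ f ◁ φ ⊗≫ (x ▷ q ≫ θ₁) ▷ k ⊗≫ 𝟙 _ := by rw [← whisker_exchange]; bicategory
    _ = _ := by rw [e]; simp only [hpaste]; bicategory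

theorem hpaste_assoc {a b c d a' b' c' d' : C} {f : a ⟶ b} {g : b ⟶ c} {i : c ⟶ d} {h : a' ⟶ b'}
    {k : b' ⟶ c'} {l : c' ⟶ d'} {p : a ⟶ a'} {q : b ⟶ b'} {r : c ⟶ c'} {t : d ⟶ d'}
    (θ : f ≫ q ⟶ p ≫ h) (φ : g ≫ r ⟶ q ≫ k) (ψ : i ≫ t ⟶ r ≫ l) :
    (α_ f g i).hom ▷ t ≫ hpaste θ (hpaste φ ψ) = hpaste (hpaste θ φ) ψ ≫ p ◁ (α_ h k l).hom := by
  simp only [hpaste]; bicategory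

theorem hpaste_id_left {b c b' c' : C} {g : b ⟶ c} {k : b' ⟶ c'} {q : b ⟶ b'} {r : c ⟶ c'}
    (φ : g ≫ r ⟶ q ≫ k) : (λ_ g).hom ▷ r ≫ φ =
      hpaste ((λ_ q).hom ≫ (ρ_ q).inv) φ ≫ q ◁ (λ_ k).hom := by
  simp only [hpaste]; bicategory

theorem hpaste_id_right {b c b' c' : C} {g : b ⟶ c} {k : b' ⟶ c'} {q : b ⟶ b'} {r : c ⟶ c'}
    (φ : g ≫ r ⟶ q ≫ k) : (ρ_ g).hom ▷ r ≫ φ =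
      hpaste φ ((λ_ r).hom ≫ (ρ_ r).inv) ≫ q ◁ (ρ_ k).hom := by
  simp only [hpaste]; bicategory

theorem hpaste_comp_right {a b c a' b' c' : C} {f : a ⟶ b} {g : b ⟶ c} {h : a' ⟶ b'}
    {k k₁ : b' ⟶ c'} {p : a ⟶ a'} {q : b ⟶ b'} {r : c ⟶ c'} (θ : f ≫ q ⟶ p ≫ h)
    (φ : g ≫ r ⟶ q ≫ k) (s : k ⟶ k₁) : hpaste θ (φ ≫ q ◁ s) = hpaste θ φ ≫ p ◁ h ◁ s := by
  have := hpaste_whiskerLeft_middle θ (φ := φ) (φ₁ := φ ≫ q ◁ s) (x := 𝟙 _) (s := s) (by simp)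
  simpa using this

theorem hpaste_comp_left {a b c a' b' c' : C} {f : a ⟶ b} {g : b ⟶ c} {h h₁ : a' ⟶ b'}
    {k : b' ⟶ c'} {p : a ⟶ a'} {q : b ⟶ b'} {r : c ⟶ c'} (θ : f ≫ q ⟶ p ≫ h)
    (φ : g ≫ r ⟶ q ≫ k) (s : h ⟶ h₁) : hpaste (θ ≫ p ◁ s) φ = hpaste θ φ ≫ p ◁ s ▷ k := by
  have := hpaste_whiskerRight_middle φ (θ := θ) (θ₁ := θ ≫ p ◁ s) (x := 𝟙 _) (s := s) (by simp)
  simpa using this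

theorem hpaste_assoc_whisker {a b c d a' b' c' d' : C} {f : a ⟶ b} {g : b ⟶ c} {i : c ⟶ d}
    {h : a' ⟶ b'} {k : b' ⟶ c'} {l : c' ⟶ d'} {p : a ⟶ a'} {q : b ⟶ b'} {r : c ⟶ c'} {t : d ⟶ d'}
    (θ : f ≫ q ⟶ p ≫ h) (φ : g ≫ r ⟶ q ≫ k) (ψ : i ≫ t ⟶ r ≫ l) {kl : b' ⟶ d'} {hk : a' ⟶ c'}
    {n n' : a' ⟶ d'} {M₁ : k ≫ l ⟶ kl} {M₂ : h ≫ kl ⟶ n} {M₃ : h ≫ k ⟶ hk} {M₄ : hk ≫ l ⟶ n'}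
    {N : n' ⟶ n} (e : M₃ ▷ l ≫ M₄ ≫ N = (α_ h k l).hom ≫ h ◁ M₁ ≫ M₂) :
    (α_ f g i).hom ▷ t ≫ hpaste θ (hpaste φ ψ ≫ q ◁ M₁) ≫ p ◁ M₂ =
      (hpaste (hpaste θ φ ≫ p ◁ M₃) ψ ≫ p ◁ M₄) ≫ p ◁ N := by
  have e' := hpaste_assoc θ φ ψ
  rw [hpaste_comp_right, hpaste_comp_left, Category.assoc, reassoc_of% e', Category.assoc,
    Category.assoc]
  simp only [← whiskerLeft_comp]
  rw [e]

theorem hpaste_id_left_whisker {b c b' c' : C} {g : b ⟶ c} {k : b' ⟶ c'} {q : b ⟶ b'} {r : c ⟶ c'}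
    (φ : g ≫ r ⟶ q ≫ k) {j : b' ⟶ b'} {n : b' ⟶ c'} {M : 𝟙 b' ⟶ j} {N : j ≫ k ⟶ n} {N' : n ⟶ k}
    (e : M ▷ k ≫ N ≫ N' = (λ_ k).hom) : (λ_ g).hom ▷ r ≫ φ =
      (hpaste (((λ_ q).hom ≫ (ρ_ q).inv) ≫ q ◁ M) φ ≫ q ◁ N) ≫ q ◁ N' := by
  rw [hpaste_comp_left, hpaste_id_left, Category.assoc, Category.assoc]
  simp only [← whiskerLeft_comp]
  rw [e]

theorem hpaste_id_right_whisker {b c b' c' : C} {g : b ⟶ c} {k : b' ⟶ c'} {q : b ⟶ b'} {r : c ⟶ c'}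
    (φ : g ≫ r ⟶ q ≫ k) {j : c' ⟶ c'} {n : b' ⟶ c'} {M : 𝟙 c' ⟶ j} {N : k ≫ j ⟶ n} {N' : n ⟶ k}
    (e : k ◁ M ≫ N ≫ N' = (ρ_ k).hom) : (ρ_ g).hom ▷ r ≫ φ =
      (hpaste φ (((λ_ r).hom ≫ (ρ_ r).inv) ≫ r ◁ M) ≫ q ◁ N) ≫ q ◁ N' := by
  rw [hpaste_comp_right, hpaste_id_right, Category.assoc, Category.assoc]
  simp only [← whiskerLeft_comp]
  rw [e]

end CommaPasting

/-! ### The pseudo-comma bicategory of a pseudofunctor. -/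

section Comma
variable {A : Type u₁} [Bicategory.{w₁, v₁} A] {C : Type u₂} [Bicategory.{w₂, v₂} C]

/-- The objects `X ⟶ R a` of the pseudo-comma bicategory of a pseudofunctor `R`. -/
structure Comma (R : A ⥤ᵖ C) where
  /-- The object of the codomain. -/
  left : C
  /-- The object of the domain. -/
  right : A
  /-- The comparison 1-cell. -/
  arr : left ⟶ R.obj right

namespace Comma

variable {R : A ⥤ᵖ C}

/-- The 1-cells of the pseudo-comma bicategory. -/
structure Hom (p q : Comma R) where
  /-- The 1-cell of the codomain. -/
  fst : p.left ⟶ q.left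
  /-- The 1-cell of the domain. -/
  snd : p.right ⟶ q.right
  /-- The invertible comparison. -/
  sq : fst ≫ q.arr ≅ p.arr ≫ R.map snd

/-- The 2-cells of the pseudo-comma bicategory. -/
@[ext]
structure Hom₂ {p q : Comma R} (f g : Hom p q) where
  /-- The 2-cell of the codomain. -/
  fst : f.fst ⟶ g.fst
  /-- The 2-cell of the domain. -/
  snd : f.snd ⟶ g.snd
  comm : fst ▷ q.arr ≫ g.sq.hom = f.sq.hom ≫ p.arr ◁ R.map₂ snd

/-- The comparison 2-cell of a composite. -/
def compSq {p q r : Comma R} (f : Hom p q) (g : Hom q r) :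
    (f.fst ≫ g.fst) ≫ r.arr ≅ p.arr ≫ R.map (f.snd ≫ g.snd) :=
  α_ _ _ _ ≪≫ whiskerLeftIso f.fst g.sq ≪≫ (α_ _ _ _).symm ≪≫ whiskerRightIso f.sq _ ≪≫ α_ _ _ _ ≪≫
    whiskerLeftIso p.arr (R.mapComp _ _).symm

theorem compSq_hom {p q r : Comma R} (f : Hom p q) (g : Hom q r) :
    (compSq f g).hom = hpaste f.sq.hom g.sq.hom ≫ p.arr ◁ (R.mapComp _ _).inv := by
  simp [compSq, hpaste]

/-- The comparison 2-cell of an identity. -/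
def idSq (p : Comma R) : 𝟙 p.left ≫ p.arr ≅ p.arr ≫ R.map (𝟙 p.right) :=
  λ_ _ ≪≫ (ρ_ _).symm ≪≫ whiskerLeftIso p.arr (R.mapId _).symm

theorem idSq_hom (p : Comma R) :
    (idSq p).hom = ((λ_ _).hom ≫ (ρ_ _).inv) ≫ p.arr ◁ (R.mapId _).inv := by
  simp [idSq]

instance : CategoryStruct (Comma R) where
  Hom := Hom
  id p := ⟨𝟙 p.left, 𝟙 p.right, idSq p⟩
  comp f g := ⟨f.fst ≫ g.fst, f.snd ≫ g.snd, compSq f g⟩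

instance (p q : Comma R) : Category (p ⟶ q) where
  Hom f g := Hom₂ f g
  id f := ⟨𝟙 f.fst, 𝟙 f.snd, by simp⟩
  comp x y := ⟨x.fst ≫ y.fst, x.snd ≫ y.snd, by simp [y.comm, reassoc_of% x.comm]⟩
  id_comp _ := Hom₂.ext (Category.id_comp _) (Category.id_comp _)
  comp_id _ := Hom₂.ext (Category.comp_id _) (Category.comp_id _)
  assoc _ _ _ := Hom₂.ext (Category.assoc _ _ _) (Category.assoc _ _ _)

theorem hom₂_ext {p q : Comma R} {f g : p ⟶ q} {x y : f ⟶ g} (h : x.fst = y.fst)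
    (h' : x.snd = y.snd) : x = y := Hom₂.ext h h'

/-- Invertible 2-cells from invertible components. -/
def isoMk {p q : Comma R} {f g : p ⟶ q} (e : f.fst ≅ g.fst) (e' : f.snd ≅ g.snd)
    (h : e.hom ▷ q.arr ≫ g.sq.hom = f.sq.hom ≫ p.arr ◁ R.map₂ e'.hom) : f ≅ g where
  hom := ⟨e.hom, e'.hom, h⟩
  inv := ⟨e.inv, e'.inv, by
    rw [← cancel_epi (e.hom ▷ q.arr), reassoc_of% h, ← whiskerLeft_comp, ← R.map₂_comp]
    simp⟩
  hom_inv_id := hom₂_ext e.hom_inv_id e'.hom_inv_id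
  inv_hom_id := hom₂_ext e.inv_hom_id e'.inv_hom_id

theorem whiskerLeft_comm {p q r : Comma R} (f : p ⟶ q) {g h : q ⟶ r} (t : g ⟶ h) :
    (f.fst ◁ t.fst) ▷ r.arr ≫ (compSq f h).hom =
      (compSq f g).hom ≫ p.arr ◁ R.map₂ (f.snd ◁ t.snd) := by
  have e := hpaste_whiskerLeft_middle f.sq.hom t.comm
  rw [compSq_hom, compSq_hom, reassoc_of% e]
  simp

theorem whiskerRight_comm {p q r : Comma R} {f g : p ⟶ q} (t : f ⟶ g) (h : q ⟶ r) :
    (t.fst ▷ h.fst) ▷ r.arr ≫ (compSq g h).hom =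
      (compSq f h).hom ≫ p.arr ◁ R.map₂ (t.snd ▷ h.snd) := by
  have e := hpaste_whiskerRight_middle h.sq.hom t.comm
  rw [compSq_hom, compSq_hom, reassoc_of% e]
  simp

theorem associator_comm {p q r s : Comma R} (f : p ⟶ q) (g : q ⟶ r) (h : r ⟶ s) :
    (α_ f.fst g.fst h.fst).hom ▷ s.arr ≫ (compSq f (g ≫ h)).hom =
      (compSq (f ≫ g) h).hom ≫ p.arr ◁ R.map₂ (α_ f.snd g.snd h.snd).hom := by
  rw [compSq_hom, compSq_hom, show (g ≫ h).sq.hom = _ from compSq_hom g h,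
    show (f ≫ g).sq.hom = _ from compSq_hom f g]
  have e : (R.mapComp f.snd g.snd).inv ▷ R.map h.snd ≫ (R.mapComp (f.snd ≫ g.snd) h.snd).inv ≫
      R.map₂ (α_ f.snd g.snd h.snd).hom = (α_ _ _ _).hom ≫
        R.map f.snd ◁ (R.mapComp g.snd h.snd).inv ≫ (R.mapComp f.snd (g.snd ≫ h.snd)).inv := by simp
  exact hpaste_assoc_whisker f.sq.hom g.sq.hom h.sq.hom e

theorem leftUnitor_comm {p q : Comma R} (f : p ⟶ q) :
    (λ_ f.fst).hom ▷ q.arr ≫ f.sq.hom = (compSq (𝟙 p) f).hom ≫ p.arr ◁ R.map₂ (λ_ f.snd).hom := by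
  rw [compSq_hom, show (𝟙 p : p ⟶ p).sq.hom = _ from idSq_hom p]
  have e : (R.mapId p.right).inv ▷ R.map f.snd ≫ (R.mapComp (𝟙 p.right) f.snd).inv ≫
      R.map₂ (λ_ f.snd).hom = (λ_ _).hom := by simp
  exact hpaste_id_left_whisker f.sq.hom e

theorem rightUnitor_comm {p q : Comma R} (f : p ⟶ q) :
    (ρ_ f.fst).hom ▷ q.arr ≫ f.sq.hom = (compSq f (𝟙 q)).hom ≫ p.arr ◁ R.map₂ (ρ_ f.snd).hom := by
  rw [compSq_hom, show (𝟙 q : q ⟶ q).sq.hom = _ from idSq_hom q]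
  have e : R.map f.snd ◁ (R.mapId q.right).inv ≫ (R.mapComp f.snd (𝟙 q.right)).inv ≫
      R.map₂ (ρ_ f.snd).hom = (ρ_ _).hom := by simp
  exact hpaste_id_right_whisker f.sq.hom e

/-- Left whiskering in the pseudo-comma bicategory. -/
def whiskerLeft {p q r : Comma R} (f : p ⟶ q) {g h : q ⟶ r} (t : g ⟶ h) : f ≫ g ⟶ f ≫ h :=
  Hom₂.mk (f.fst ◁ t.fst) (f.snd ◁ t.snd) (whiskerLeft_comm f t)

/-- Right whiskering in the pseudo-comma bicategory. -/
def whiskerRight {p q r : Comma R} {f g : p ⟶ q} (t : f ⟶ g) (h : q ⟶ r) : f ≫ h ⟶ g ≫ h :=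
  Hom₂.mk (t.fst ▷ h.fst) (t.snd ▷ h.snd) (whiskerRight_comm t h)

instance : Bicategory (Comma R) where
  whiskerLeft f _ _ t := whiskerLeft f t
  whiskerRight t h := whiskerRight t h
  associator f g h := isoMk (α_ f.fst g.fst h.fst) (α_ f.snd g.snd h.snd) (associator_comm f g h)
  leftUnitor f := isoMk (λ_ f.fst) (λ_ f.snd) (leftUnitor_comm f)
  rightUnitor f := isoMk (ρ_ f.fst) (ρ_ f.snd) (rightUnitor_comm f)
  whiskerLeft_id _ _ := hom₂_ext (whiskerLeft_id _ _) (whiskerLeft_id _ _)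
  whiskerLeft_comp _ _ _ _ _ _ := hom₂_ext (whiskerLeft_comp _ _ _) (whiskerLeft_comp _ _ _)
  id_whiskerLeft _ := hom₂_ext (id_whiskerLeft _) (id_whiskerLeft _)
  comp_whiskerLeft _ _ _ _ _ := hom₂_ext (comp_whiskerLeft _ _ _) (comp_whiskerLeft _ _ _)
  id_whiskerRight _ _ := hom₂_ext (id_whiskerRight _ _) (id_whiskerRight _ _)
  comp_whiskerRight _ _ _ := hom₂_ext (comp_whiskerRight _ _ _) (comp_whiskerRight _ _ _)
  whiskerRight_id _ := hom₂_ext (whiskerRight_id _) (whiskerRight_id _)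
  whiskerRight_comp _ _ _ := hom₂_ext (whiskerRight_comp _ _ _) (whiskerRight_comp _ _ _)
  whisker_assoc _ _ _ _ _ := hom₂_ext (whisker_assoc _ _ _) (whisker_assoc _ _ _)
  whisker_exchange _ _ := hom₂_ext (whisker_exchange _ _) (whisker_exchange _ _)
  pentagon _ _ _ _ := hom₂_ext (pentagon _ _ _ _) (pentagon _ _ _ _)
  triangle _ _ := hom₂_ext (triangle _ _) (triangle _ _)

end Comma
end Comma
end LaxCoh

namespace LaxCoh
open CategoryTheory Bicategory

/-! ### Pasting identities for the triangle modifications. -/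

section UniversalPasting
variable {C : Type u} [Bicategory.{w, v} C]

theorem hpaste_unitors_comm {x y s t : C} {f : x ⟶ y} {p : x ⟶ s} {q : y ⟶ t} {g : s ⟶ t}
    {js : s ⟶ s} {jt : t ⟶ t} {n n' : s ⟶ t} (θ : f ≫ q ⟶ p ≫ g) (I : 𝟙 s ⟶ js) (J : 𝟙 t ⟶ jt)
    (M : js ≫ g ⟶ n) (N : g ≫ jt ⟶ n') (S : n' ⟶ n)
    (h : g ◁ J ≫ N ≫ S = (ρ_ g).hom ≫ (λ_ g).inv ≫ I ▷ g ≫ M) :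
    θ ▷ 𝟙 t ≫ hpaste (p ◁ I) ((ρ_ g).hom ≫ (λ_ g).inv) ≫ p ◁ M =
      (hpaste θ (q ◁ J) ≫ p ◁ N) ≫ p ◁ S := by
  symm
  calc _ = 𝟙 _ ⊗≫ ((f ≫ q) ◁ J ≫ θ ▷ jt) ⊗≫ p ◁ N ⊗≫ p ◁ S := by
        simp only [hpaste]; bicategory
    _ = 𝟙 _ ⊗≫ θ ▷ 𝟙 t ⊗≫ p ◁ (g ◁ J ≫ N ≫ S) := by rw [whisker_exchange]; bicategory
    _ = _ := by rw [h]; simp only [hpaste]; bicategory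

theorem hpaste_leftUnitor_comm {x s : C} {p : x ⟶ s} {g : s ⟶ x} {js : s ⟶ s} {n : s ⟶ x}
    (e : 𝟙 x ≫ 𝟙 x ≅ p ≫ g) (I : 𝟙 s ⟶ js) (M : js ≫ g ⟶ n) (S : g ⟶ n)
    (h : S = (λ_ g).inv ≫ I ▷ g ≫ M) :
    ((λ_ (𝟙 x)).inv ≫ e.hom) ▷ 𝟙 x ≫ hpaste (p ◁ I) ((ρ_ g).hom ≫ (λ_ g).inv) ≫ p ◁ M =
      e.hom ≫ p ◁ S := by
  rw [h]
  simp only [hpaste]; bicategory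

/-- Hypothesis `h` has the shape of the compatibility condition of a 2-cell of the pseudo-comma
bicategory; moving the comparison cells `sa` and `sb` to the other side yields the modification
axiom for the second triangle. -/
theorem vpaste_of_hpaste {ra rb ea eb : C} {g : ra ⟶ rb} {ua : ra ⟶ ea} {ub : rb ⟶ eb}
    {eg : ea ⟶ eb}
    {εa : ea ⟶ ra} {εb : eb ⟶ rb} {n n' : ea ⟶ rb} (θ : g ≫ ub ⟶ ua ≫ eg)
    (sa : 𝟙 ra ≫ 𝟙 ra ≅ ua ≫ εa) (sb : 𝟙 rb ≫ 𝟙 rb ≅ ub ≫ εb) (M : n ≅ εa ≫ g)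
    (N : eg ≫ εb ⟶ n') (S : n' ⟶ n)
    (h : ((ρ_ g).hom ≫ (λ_ g).inv) ▷ 𝟙 rb ≫ hpaste sa.hom ((ρ_ g).hom ≫ (λ_ g).inv) ≫ ua ◁ M.inv =
      (hpaste θ sb.hom ≫ ua ◁ N) ≫ ua ◁ S) :
    g ◁ (sb.inv ≫ (λ_ _).hom) ≫ (ρ_ g).hom ≫ (λ_ g).inv =
      vpaste θ (N ≫ S ≫ M.hom) ≫ (sa.inv ≫ (λ_ _).hom) ▷ g := by
  symm
  calc _ = 𝟙 _ ⊗≫ g ◁ (sb.inv ≫ sb.hom) ⊗≫ θ ▷ εb ⊗≫ ua ◁ N ⊗≫ ua ◁ S ⊗≫ ua ◁ M.hom ⊗≫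
        sa.inv ▷ g ⊗≫ 𝟙 _ := by rw [Iso.inv_hom_id]; simp only [vpaste]; bicategory
    _ = 𝟙 _ ⊗≫ g ◁ sb.inv ⊗≫ ((hpaste θ sb.hom ≫ ua ◁ N) ≫ ua ◁ S) ⊗≫ ua ◁ M.hom ⊗≫
        sa.inv ▷ g ⊗≫ 𝟙 _ := by simp only [hpaste]; bicategory
    _ = 𝟙 _ ⊗≫ g ◁ sb.inv ⊗≫ sa.hom ▷ g ⊗≫ ua ◁ (M.inv ≫ M.hom) ⊗≫ sa.inv ▷ g ⊗≫ 𝟙 _ := by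
      rw [← h]; simp only [hpaste]; bicategory
    _ = 𝟙 _ ⊗≫ g ◁ sb.inv ⊗≫ (sa.hom ≫ sa.inv) ▷ g ⊗≫ 𝟙 _ := by rw [Iso.inv_hom_id]; bicategory
    _ = _ := by rw [Iso.hom_inv_id]; bicategory

/-- A similar rearrangement, giving the swallowtail equation of the unit. -/
theorem triangle_of_hpaste {x r e : C} {u : x ⟶ r} {ur : r ⟶ e} {eu : r ⟶ e} {c : e ⟶ r}
    {j n : r ⟶ r} (θ : u ≫ ur ≅ u ≫ eu) (s : 𝟙 r ≫ 𝟙 r ≅ ur ≫ c) (I : 𝟙 r ⟶ j) (V : j ⟶ n)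
    (M : n ≅ eu ≫ c)
    (h : (ρ_ u).inv ▷ 𝟙 r ≫ hpaste θ.hom s.hom ≫ u ◁ M.inv = u ◁ I ≫ u ◁ V) :
    (ρ_ u).inv ≫ u ◁ (I ≫ V ≫ M.hom) ≫ (α_ _ _ _).inv ≫ θ.inv ▷ c ≫ (α_ _ _ _).hom ≫
      u ◁ (s.inv ≫ (λ_ _).hom) ≫ (ρ_ u).hom = 𝟙 u := by
  calc _ = 𝟙 _ ⊗≫ (u ◁ I ≫ u ◁ V) ⊗≫ u ◁ M.hom ⊗≫ θ.inv ▷ c ⊗≫ u ◁ s.inv ⊗≫ 𝟙 _ := by bicategory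
    _ = 𝟙 _ ⊗≫ u ◁ s.hom ⊗≫ θ.hom ▷ c ⊗≫ u ◁ (M.inv ≫ M.hom) ⊗≫ θ.inv ▷ c ⊗≫ u ◁ s.inv ⊗≫ 𝟙 _ := by
      rw [← h]; simp only [hpaste]; bicategory
    _ = 𝟙 _ ⊗≫ u ◁ s.hom ⊗≫ (θ.hom ≫ θ.inv) ▷ c ⊗≫ u ◁ s.inv ⊗≫ 𝟙 _ := by
      rw [Iso.inv_hom_id]; bicategory
    _ = 𝟙 _ ⊗≫ u ◁ (s.hom ≫ s.inv) ⊗≫ 𝟙 _ := by rw [Iso.hom_inv_id]; bicategory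
    _ = _ := by rw [Iso.hom_inv_id]; bicategory

end UniversalPasting

/-! ### Universal arrows determine a biadjunction. -/

section UniversalArrows
variable {A : Type u₁} [Bicategory.{w₁, v₁} A] {C : Type u₂} [Bicategory.{w₂, v₂} C] {R : A ⥤ᵖ C}

theorem map₂_leftUnitor_inv (R : A ⥤ᵖ C) {a b : A} (f : a ⟶ b) :
    R.map₂ (λ_ f).inv = (λ_ (R.map f)).inv ≫ (R.mapId a).inv ▷ R.map f ≫ (R.mapComp _ _).inv := by
  rw [← cancel_mono (R.map₂ (λ_ f).hom), ← R.map₂_comp]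
  simp

namespace Comma

/-- A bicategorical universal arrow to a pseudofunctor. -/
structure IsUniversal (p : Comma R) : Prop where
  bijective {a : A} (h k : p.right ⟶ a) :
    Function.Bijective (fun t : h ⟶ k => p.arr ◁ R.map₂ t)
  exists_iso {a : A} (f : p.left ⟶ R.obj a) :
    ∃ h : p.right ⟶ a, Nonempty (f ≅ p.arr ≫ R.map h)

namespace IsUniversal

variable {p q : Comma R}

/-- The compatibility condition determines `p.arr ◁ R.map₂` of the second component from the first,
because the comparison cell is invertible, and universality makes this whiskering injective. With
`exists_snd`, hom-categories out of a universal arrow project fully faithfully to those of `C`. -/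
theorem ext (hp : IsUniversal p) {f g : p ⟶ q} {s t : f ⟶ g} (h : s.fst = t.fst) : s = t := by
  refine hom₂_ext h ((hp.bijective _ _).1 ?_)
  change p.arr ◁ R.map₂ s.snd = p.arr ◁ R.map₂ t.snd
  have hs := s.comm
  rw [h] at hs
  rw [← cancel_epi f.sq.hom, ← hs]
  exact t.comm

/-- The lift of a 1-cell. -/
noncomputable def lift (hp : IsUniversal p) (q : Comma R) (f : p.left ⟶ q.left) : p ⟶ q :=
  Hom.mk f (hp.exists_iso (f ≫ q.arr)).choose (hp.exists_iso (f ≫ q.arr)).choose_spec.some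

theorem exists_snd (hp : IsUniversal p) {f g : p ⟶ q} (x : f.fst ⟶ g.fst) :
    ∃ s : f.snd ⟶ g.snd, x ▷ q.arr ≫ g.sq.hom = f.sq.hom ≫ p.arr ◁ R.map₂ s := by
  obtain ⟨s, hs⟩ := (hp.bijective f.snd g.snd).2 (f.sq.inv ≫ x ▷ q.arr ≫ g.sq.hom)
  refine ⟨s, ?_⟩
  dsimp only at hs
  rw [hs, Iso.hom_inv_id_assoc]

/-- The lift of a 2-cell. -/
noncomputable def lift₂ (hp : IsUniversal p) (f g : p ⟶ q) (x : f.fst ⟶ g.fst) : f ⟶ g :=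
  Hom₂.mk x (hp.exists_snd x).choose (hp.exists_snd x).choose_spec

/-- The lift of an invertible 2-cell. -/
noncomputable def liftIso (hp : IsUniversal p) (f g : p ⟶ q) (x : f.fst ≅ g.fst) : f ≅ g where
  hom := hp.lift₂ f g x.hom
  inv := hp.lift₂ g f x.inv
  hom_inv_id := hp.ext x.hom_inv_id
  inv_hom_id := hp.ext x.inv_hom_id

end IsUniversal

/-- The component in the domain of an invertible 2-cell. -/
def sndIso {p q : Comma R} {f g : p ⟶ q} (e : f ≅ g) : f.snd ≅ g.snd where
  hom := e.hom.snd
  inv := e.inv.snd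
  hom_inv_id := congrArg Hom₂.snd e.hom_inv_id
  inv_hom_id := congrArg Hom₂.snd e.inv_hom_id

variable (R) in
/-- The identity 1-cell of `R a`, as an object of the pseudo-comma bicategory. -/
abbrev diag (a : A) : Comma R := ⟨R.obj a, a, 𝟙 (R.obj a)⟩

/-- The 1-cell between diagonal objects given by a 1-cell. -/
def diagMap {a b : A} (g : a ⟶ b) : diag R a ⟶ diag R b :=
  Hom.mk (p := diag R a) (q := diag R b) (R.map g) g (ρ_ (R.map g) ≪≫ (λ_ (R.map g)).symm)

/-- The 2-cell between diagonal 1-cells given by a 2-cell. -/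
def diagMap₂ {a b : A} {g h : a ⟶ b} (s : g ⟶ h) : (diagMap g : diag R a ⟶ diag R b) ⟶ diagMap h :=
  Hom₂.mk (f := diagMap g) (g := diagMap h) (R.map₂ s) s (by simp [diagMap])

/-- Compatibility of `diagMap` with identities. -/
def diagId (a : A) : (diagMap (𝟙 a) : diag R a ⟶ diag R a) ⟶ 𝟙 (diag R a) :=
  Hom₂.mk (f := diagMap (𝟙 a)) (g := 𝟙 (diag R a)) (R.mapId a).hom (𝟙 (𝟙 a)) (by
    change (R.mapId a).hom ▷ 𝟙 (R.obj a) ≫ (idSq (diag R a)).hom =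
      ((ρ_ (R.map (𝟙 a))).hom ≫ (λ_ (R.map (𝟙 a))).inv) ≫ 𝟙 (R.obj a) ◁ R.map₂ (𝟙 (𝟙 a))
    rw [idSq_hom]
    simp [unitors_equal])

/-- Compatibility of `diagMap` with composition. -/
def diagComp {a b c : A} (g : a ⟶ b) (h : b ⟶ c) :
    (diagMap (g ≫ h) : diag R a ⟶ diag R c) ⟶ diagMap g ≫ diagMap h :=
  Hom₂.mk (f := diagMap (g ≫ h)) (g := diagMap g ≫ diagMap h) (R.mapComp g h).hom (𝟙 (g ≫ h)) (by
    change (R.mapComp g h).hom ▷ 𝟙 (R.obj c) ≫ (compSq (diagMap g) (diagMap h)).hom =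
      ((ρ_ (R.map (g ≫ h))).hom ≫ (λ_ (R.map (g ≫ h))).inv) ≫ 𝟙 (R.obj a) ◁ R.map₂ (𝟙 (g ≫ h))
    rw [compSq_hom]
    change (R.mapComp g h).hom ▷ 𝟙 (R.obj c) ≫ hpaste ((ρ_ (R.map g)).hom ≫ (λ_ (R.map g)).inv)
      ((ρ_ (R.map h)).hom ≫ (λ_ (R.map h)).inv) ≫ 𝟙 (R.obj a) ◁ (R.mapComp g h).inv = _
    rw [hpaste_unitors]
    simp)

variable {E₀ : C → A} (η : ∀ X, X ⟶ R.obj (E₀ X))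

/-- An object with its universal arrow. -/
abbrev arrow (X : C) : Comma R := ⟨X, E₀ X, η X⟩

variable {η} (hη : ∀ X, IsUniversal (arrow η X))

/-- The pseudofunctor to the pseudo-comma bicategory given by universal arrows. -/
noncomputable def sectionFunctor : C ⥤ᵖ Comma R where
  obj X := arrow η X
  map {X Y} f := (hη X).lift (arrow η Y) f
  map₂ {X Y f g} x := (hη X).lift₂ ((hη X).lift (arrow η Y) f) ((hη X).lift (arrow η Y) g) x
  -- The first components form the identity of `C`, so by `ext` each axiom reduces to a unit or
  -- coherence law there.
  map₂_id _ := (hη _).ext rfl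
  map₂_comp _ _ := (hη _).ext rfl
  mapId X := (hη X).liftIso ((hη X).lift (arrow η X) (𝟙 X)) (𝟙 (arrow η X)) (Iso.refl (𝟙 X))
  mapComp {X Y Z} f g := (hη X).liftIso ((hη X).lift (arrow η Z) (f ≫ g))
    ((hη X).lift (arrow η Y) f ≫ (hη Y).lift (arrow η Z) g) (Iso.refl (f ≫ g))
  map₂_whisker_left f _ _ x := (hη _).ext (by
    change f ◁ x = 𝟙 _ ≫ f ◁ x ≫ 𝟙 _
    simp)
  map₂_whisker_right x h := (hη _).ext (by
    change x ▷ h = 𝟙 _ ≫ x ▷ h ≫ 𝟙 _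
    simp)
  map₂_associator f g h := (hη _).ext (by
    change (α_ f g h).hom = 𝟙 _ ≫ 𝟙 (f ≫ g) ▷ h ≫ (α_ f g h).hom ≫ f ◁ 𝟙 (g ≫ h) ≫ 𝟙 _
    simp)
  map₂_left_unitor {X _} f := (hη _).ext (by
    change (λ_ f).hom = 𝟙 _ ≫ 𝟙 (𝟙 X) ▷ f ≫ (λ_ f).hom
    simp)
  map₂_right_unitor {_ Y} f := (hη _).ext (by
    change (ρ_ f).hom = 𝟙 _ ≫ f ◁ 𝟙 (𝟙 Y) ≫ (ρ_ f).hom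
    simp)

/-- The left biadjoint given by universal arrows. -/
noncomputable def leftBiadjoint : C ⥤ᵖ A where
  obj X := E₀ X
  map f := ((sectionFunctor hη).map f).snd
  map₂ x := ((sectionFunctor hη).map₂ x).snd
  map₂_id _ := congrArg Hom₂.snd ((sectionFunctor hη).map₂_id _)
  map₂_comp _ _ := congrArg Hom₂.snd ((sectionFunctor hη).map₂_comp _ _)
  mapId X := sndIso ((sectionFunctor hη).mapId X)
  mapComp f g := sndIso ((sectionFunctor hη).mapComp f g)
  map₂_whisker_left f _ _ x := congrArg Hom₂.snd ((sectionFunctor hη).map₂_whisker_left f x)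
  map₂_whisker_right x h := congrArg Hom₂.snd ((sectionFunctor hη).map₂_whisker_right x h)
  map₂_associator f g h := congrArg Hom₂.snd ((sectionFunctor hη).map₂_associator f g h)
  map₂_left_unitor f := congrArg Hom₂.snd ((sectionFunctor hη).map₂_left_unitor f)
  map₂_right_unitor f := congrArg Hom₂.snd ((sectionFunctor hη).map₂_right_unitor f)

/-- The action of the left biadjoint on 1-cells. -/
noncomputable def mapRight {X Y : C} (f : X ⟶ Y) : E₀ X ⟶ E₀ Y := ((sectionFunctor hη).map f).snd

/-- The comparison of the left biadjoint with identities. -/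
noncomputable def mapRightId (X : C) : mapRight hη (𝟙 X) ≅ 𝟙 (E₀ X) :=
  sndIso ((sectionFunctor hη).mapId X)

/-- The comparison of the left biadjoint with composition. -/
noncomputable def mapRightComp {X Y Z : C} (f : X ⟶ Y) (g : Y ⟶ Z) :
    mapRight hη (f ≫ g) ≅ mapRight hη f ≫ mapRight hη g :=
  sndIso ((sectionFunctor hη).mapComp f g)

/-- The comparison 2-cell of the lift of a 1-cell. -/
noncomputable def liftSq {X Y : C} (f : X ⟶ Y) : f ≫ η Y ≅ η X ≫ R.map (mapRight hη f) :=
  ((sectionFunctor hη).map f).sq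

theorem liftSq_id (X : C) : (liftSq hη (𝟙 X)).hom ≫ η X ◁ (R.map₂ (mapRightId hη X).hom ≫
    (R.mapId _).hom) = 𝟙 (𝟙 X) ▷ η X ≫ (λ_ (η X)).hom ≫ (ρ_ (η X)).inv := by
  have h : 𝟙 (𝟙 X) ▷ η X ≫ (idSq (arrow η X)).hom = (liftSq hη (𝟙 X)).hom ≫
    η X ◁ R.map₂ (mapRightId hη X).hom := ((sectionFunctor hη).mapId X).hom.comm
  rw [whiskerLeft_comp, ← reassoc_of% h, idSq_hom]
  simp

theorem liftSq_comp {X Y Z : C} (f : X ⟶ Y) (g : Y ⟶ Z) :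
    (liftSq hη (f ≫ g)).hom ≫ η X ◁ (R.map₂ (mapRightComp hη f g).hom ≫ (R.mapComp _ _).hom) =
      𝟙 (f ≫ g) ▷ η Z ≫ hpaste (liftSq hη f).hom (liftSq hη g).hom := by
  have h : 𝟙 (f ≫ g) ▷ η Z ≫ hpaste (liftSq hη f).hom (liftSq hη g).hom ≫
      η X ◁ (R.mapComp (mapRight hη f) (mapRight hη g)).inv = (liftSq hη (f ≫ g)).hom ≫
        η X ◁ R.map₂ (mapRightComp hη f g).hom :=
    (congrArg (𝟙 (f ≫ g) ▷ η Z ≫ ·)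
      (compSq_hom ((sectionFunctor hη).map f) ((sectionFunctor hη).map g)).symm).trans
        ((sectionFunctor hη).mapComp f g).hom.comm
  rw [whiskerLeft_comp, ← reassoc_of% h]
  simp

/-- The unit of the biadjunction given by universal arrows. -/
noncomputable def unitTransformation :
    Pseudofunctor.StrongTrans (Pseudofunctor.id C) ((leftBiadjoint hη).comp R) where
  app X := η X
  naturality f := liftSq hη f
  naturality_naturality x := ((sectionFunctor hη).map₂ x).comm
  naturality_id X := liftSq_id hη X
  naturality_comp f g := liftSq_comp hη f g

/-- The component of the counit, in the pseudo-comma bicategory. -/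
noncomputable def counitHom (a : A) : arrow η (R.obj a) ⟶ diag R a :=
  (hη (R.obj a)).lift (diag R a) (𝟙 (R.obj a))

/-- The pseudonaturality of the counit, in the pseudo-comma bicategory. -/
noncomputable def counitSq {a b : A} (g : a ⟶ b) :
    (sectionFunctor hη).map (R.map g) ≫ counitHom hη b ≅ counitHom hη a ≫ diagMap g :=
  (hη _).liftIso ((sectionFunctor hη).map (R.map g) ≫ counitHom hη b) (counitHom hη a ≫ diagMap g)
    (ρ_ (R.map g) ≪≫ (λ_ (R.map g)).symm)

/-- The counit of the biadjunction given by universal arrows. -/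
noncomputable def counitTransformation :
    Pseudofunctor.StrongTrans (R.comp (leftBiadjoint hη)) (Pseudofunctor.id A) where
  app a := (counitHom hη a).snd
  naturality g := sndIso (counitSq hη g)
  naturality_naturality {a b g h} s := by
    have e : (sectionFunctor hη).map₂ (R.map₂ s) ▷ counitHom hη b ≫ (counitSq hη h).hom =
        (counitSq hη g).hom ≫ counitHom hη a ◁ diagMap₂ s := by
      refine (hη _).ext ?_
      change R.map₂ s ▷ 𝟙 (R.obj b) ≫ (ρ_ (R.map h)).hom ≫ (λ_ (R.map h)).inv =
        ((ρ_ (R.map g)).hom ≫ (λ_ (R.map g)).inv) ≫ 𝟙 (R.obj a) ◁ R.map₂ s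
      simp
    exact congrArg Hom₂.snd e
  naturality_id a := by
    have e : (counitSq hη (𝟙 a)).hom ≫ counitHom hη a ◁ diagId a =
        ((sectionFunctor hη).map₂ (R.mapId a).hom ≫ ((sectionFunctor hη).mapId _).hom) ▷
          counitHom hη a ≫ (λ_ _).hom ≫ (ρ_ _).inv := by
      refine (hη _).ext ?_
      change ((ρ_ (R.map (𝟙 a))).hom ≫ (λ_ (R.map (𝟙 a))).inv) ≫ 𝟙 (R.obj a) ◁ (R.mapId a).hom =
        ((R.mapId a).hom ≫ 𝟙 (𝟙 (R.obj a))) ▷ 𝟙 (R.obj a) ≫ (λ_ (𝟙 (R.obj a))).hom ≫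
          (ρ_ (𝟙 (R.obj a))).inv
      simp [unitors_equal, unitors_inv_equal]
    exact congrArg Hom₂.snd e
  naturality_comp {a b c} g h := by
    have e : (counitSq hη (g ≫ h)).hom ≫ counitHom hη a ◁ diagComp g h =
        ((sectionFunctor hη).map₂ (R.mapComp g h).hom ≫ ((sectionFunctor hη).mapComp _ _).hom) ▷
          counitHom hη c ≫ (α_ _ _ _).hom ≫ (sectionFunctor hη).map (R.map g) ◁
              (counitSq hη h).hom ≫
            (α_ _ _ _).inv ≫ (counitSq hη g).hom ▷ diagMap h ≫ (α_ _ _ _).hom := by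
      refine (hη _).ext ?_
      change ((ρ_ (R.map (g ≫ h))).hom ≫ (λ_ (R.map (g ≫ h))).inv) ≫
          𝟙 (R.obj a) ◁ (R.mapComp g h).hom =
        ((R.mapComp g h).hom ≫ 𝟙 (R.map g ≫ R.map h)) ▷ 𝟙 (R.obj c) ≫
          hpaste ((ρ_ (R.map g)).hom ≫ (λ_ (R.map g)).inv) ((ρ_ (R.map h)).hom ≫ (λ_ (R.map h)).inv)
      rw [hpaste_unitors]
      simp
    exact congrArg Hom₂.snd e

/-- The universal arrow, as a 1-cell to a diagonal object. -/
def arrowHom (η : ∀ X, X ⟶ R.obj (E₀ X)) (X : C) : arrow η X ⟶ diag R (E₀ X) :=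
  Hom.mk (p := arrow η X) (q := diag R (E₀ X)) (η X) (𝟙 (E₀ X))
    (whiskerLeftIso (η X) (R.mapId (E₀ X)).symm)

/-- The first triangle, in the pseudo-comma bicategory. -/
noncomputable def triangleIso (X : C) :
    arrowHom η X ≅ (sectionFunctor hη).map (η X) ≫ counitHom hη (E₀ X) :=
  (hη X).liftIso (arrowHom η X) ((sectionFunctor hη).map (η X) ≫ counitHom hη (E₀ X))
      (ρ_ (η X)).symm

/-- The second triangle. -/
noncomputable def triangleCounit (a : A) :
    η (R.obj a) ≫ R.map (counitHom hη a).snd ≅ 𝟙 (R.obj a) :=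
  (counitHom hη a).sq.symm ≪≫ λ_ (𝟙 (R.obj a))

theorem arrowHom_comm {X Y : C} (f : X ⟶ Y) :
    (liftSq hη f).hom ▷ 𝟙 (R.obj (E₀ Y)) ≫ (compSq (arrowHom η X) (diagMap (mapRight hη f))).hom =
      (compSq ((sectionFunctor hη).map f) (arrowHom η Y)).hom ≫
        η X ◁ R.map₂ ((ρ_ (mapRight hη f)).hom ≫ (λ_ (mapRight hη f)).inv) := by
  refine (congrArg ((liftSq hη f).hom ▷ 𝟙 (R.obj (E₀ Y)) ≫ ·) (compSq_hom _ _)).trans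
    (Eq.trans ?_ (congrArg (· ≫ _)
      (compSq_hom ((sectionFunctor hη).map f) (arrowHom η Y)).symm))
  refine hpaste_unitors_comm (liftSq hη f).hom (R.mapId (E₀ X)).inv (R.mapId (E₀ Y)).inv
    (R.mapComp (𝟙 _) (mapRight hη f)).inv (R.mapComp (mapRight hη f) (𝟙 _)).inv
    (R.map₂ ((ρ_ (mapRight hη f)).hom ≫ (λ_ (mapRight hη f)).inv)) ?_
  rw [R.map₂_comp, R.map₂_right_unitor, map₂_leftUnitor_inv]
  simp

/-- Pseudonaturality of the universal arrows, in the pseudo-comma bicategory. -/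
noncomputable def arrowHomNat {X Y : C} (f : X ⟶ Y) : (sectionFunctor hη).map f ≫ arrowHom η Y ⟶
    arrowHom η X ≫ diagMap (mapRight hη f) :=
  Hom₂.mk (f := (sectionFunctor hη).map f ≫ arrowHom η Y)
    (g := arrowHom η X ≫ diagMap (mapRight hη f)) (liftSq hη f).hom
    ((ρ_ (mapRight hη f)).hom ≫ (λ_ (mapRight hη f)).inv) (arrowHom_comm hη f)

/-- Its second component is the modification axiom for the first triangle, whereas its first
component is a mere coherence identity. -/
theorem triangle_naturality {X Y : C} (f : X ⟶ Y) :
    (sectionFunctor hη).map f ◁ (triangleIso hη Y).hom ≫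
      vpaste (mapSq (sectionFunctor hη) (liftSq hη f).hom) (counitSq hη (mapRight hη f)).hom =
      arrowHomNat hη f ≫ (triangleIso hη X).hom ▷ diagMap (mapRight hη f) := by
  refine (hη X).ext ?_
  change f ◁ (ρ_ (η Y)).inv ≫ vpaste (𝟙 (f ≫ η Y) ≫ (liftSq hη f).hom ≫ 𝟙 _)
    ((ρ_ (R.map (mapRight hη f))).hom ≫ (λ_ (R.map (mapRight hη f))).inv) =
      (liftSq hη f).hom ≫ (ρ_ (η X)).inv ▷ R.map (mapRight hη f)
  rw [Category.id_comp, Category.comp_id]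
  simp only [vpaste]
  bicategory

/-- The modification axiom for the second triangle lives in `C`; it is the compatibility condition
of the 2-cell `counitSq`, rearranged. -/
theorem triangleCounit_naturality {a b : A} (g : a ⟶ b) :
    R.map g ◁ (triangleCounit hη b).hom ≫ (ρ_ (R.map g)).hom ≫ (λ_ (R.map g)).inv =
      vpaste (liftSq hη (R.map g)).hom (mapSq R (counitSq hη g).hom.snd) ≫
        (triangleCounit hη a).hom ▷ R.map g := by
  have h : ((ρ_ (R.map g)).hom ≫ (λ_ (R.map g)).inv) ▷ 𝟙 (R.obj b) ≫
      hpaste (counitHom hη a).sq.hom ((ρ_ (R.map g)).hom ≫ (λ_ (R.map g)).inv) ≫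
        η (R.obj a) ◁ (R.mapComp (counitHom hη a).snd g).inv =
      (hpaste (liftSq hη (R.map g)).hom (counitHom hη b).sq.hom ≫
        η (R.obj a) ◁ (R.mapComp (mapRight hη (R.map g)) (counitHom hη b).snd).inv) ≫
          η (R.obj a) ◁ R.map₂ (counitSq hη g).hom.snd :=
    (congrArg (_ ▷ 𝟙 (R.obj b) ≫ ·) (compSq_hom (counitHom hη a) (diagMap g)).symm).trans
      ((counitSq hη g).hom.comm.trans (congrArg (· ≫ η (R.obj a) ◁ R.map₂ (counitSq hη g).hom.snd)
        (compSq_hom ((sectionFunctor hη).map (R.map g)) (counitHom hη b))))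
  exact vpaste_of_hpaste (liftSq hη (R.map g)).hom (counitHom hη a).sq (counitHom hη b).sq
    (R.mapComp (counitHom hη a).snd g) (R.mapComp (mapRight hη (R.map g)) (counitHom hη b).snd).inv
      (R.map₂ (counitSq hη g).hom.snd) h

theorem triangle_unit (X : C) :
    (ρ_ (η X)).inv ≫ η X ◁ ((R.mapId _).inv ≫ R.map₂ (triangleIso hη X).hom.snd ≫
      (R.mapComp (mapRight hη (η X)) (counitHom hη (E₀ X)).snd).hom) ≫
      (α_ _ _ _).inv ≫ (liftSq hη (η X)).inv ▷ R.map (counitHom hη (E₀ X)).snd ≫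
      (α_ _ _ _).hom ≫ η X ◁ (triangleCounit hη (E₀ X)).hom ≫ (ρ_ (η X)).hom = 𝟙 (η X) := by
  have h : (ρ_ (η X)).inv ▷ 𝟙 (R.obj (E₀ X)) ≫ hpaste (liftSq hη (η X)).hom
      (counitHom hη (E₀ X)).sq.hom ≫
        η X ◁ (R.mapComp (mapRight hη (η X)) (counitHom hη (E₀ X)).snd).inv =
      η X ◁ (R.mapId (E₀ X)).inv ≫ η X ◁ R.map₂ (triangleIso hη X).hom.snd :=
    (congrArg ((ρ_ (η X)).inv ▷ 𝟙 (R.obj (E₀ X)) ≫ ·)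
      (compSq_hom ((sectionFunctor hη).map (η X)) (counitHom hη (E₀ X))).symm).trans
        (triangleIso hη X).hom.comm
  exact triangle_of_hpaste (liftSq hη (η X)) (counitHom hη (E₀ X)).sq (R.mapId (E₀ X)).inv
    (R.map₂ (triangleIso hη X).hom.snd) (R.mapComp (mapRight hη (η X)) (counitHom hη (E₀ X)).snd) h

theorem counitHom_comm (a : A) :
    (triangleCounit hη a).inv ▷ 𝟙 (R.obj a) ≫
        (compSq (arrowHom η (R.obj a)) (diagMap (counitHom hη a).snd)).hom =
      (counitHom hη a).sq.hom ≫ η (R.obj a) ◁ R.map₂ (λ_ (counitHom hη a).snd).inv := by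
  refine (congrArg ((triangleCounit hη a).inv ▷ 𝟙 (R.obj a) ≫ ·) (compSq_hom _ _)).trans ?_
  exact hpaste_leftUnitor_comm (counitHom hη a).sq (R.mapId (E₀ (R.obj a))).inv
    (R.mapComp (𝟙 (E₀ (R.obj a))) (counitHom hη a).snd).inv _ (map₂_leftUnitor_inv R _)

/-- The counit factored through the universal arrow, in the pseudo-comma bicategory. -/
noncomputable def counitFactor (a : A) :
    counitHom hη a ⟶ arrowHom η (R.obj a) ≫ diagMap (counitHom hη a).snd :=
  Hom₂.mk (f := counitHom hη a) (g := arrowHom η (R.obj a) ≫ diagMap (counitHom hη a).snd)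
    (triangleCounit hη a).inv (λ_ (counitHom hη a).snd).inv (counitHom_comm hη a)

/-- The second component is the swallowtail equation of the counit. The 2-cell `counitFactor`
supplies its initial inverse unitor; on first components it is the inverse of the second triangle
and cancels against it. -/
theorem triangle_counit (a : A) :
    counitFactor hη a ≫ (triangleIso hη (R.obj a)).hom ▷ diagMap (counitHom hη a).snd ≫
      (α_ _ _ _).hom ≫ (sectionFunctor hη).map (η (R.obj a)) ◁
          (counitSq hη (counitHom hη a).snd).inv ≫
      (α_ _ _ _).inv ≫ (((sectionFunctor hη).mapComp _ _).inv ≫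
        (sectionFunctor hη).map₂ (triangleCounit hη a).hom ≫ ((sectionFunctor hη).mapId _).hom) ▷
          counitHom hη a ≫ (λ_ (counitHom hη a)).hom = 𝟙 (counitHom hη a) := by
  refine (hη (R.obj a)).ext ?_
  let e := (counitHom hη a).snd
  change (triangleCounit hη a).inv ≫ (ρ_ (η (R.obj a))).inv ▷ R.map e ≫
      (α_ (η (R.obj a)) (𝟙 _) (R.map e)).hom ≫ η (R.obj a) ◁
          ((λ_ (R.map e)).hom ≫ (ρ_ (R.map e)).inv) ≫
      (α_ (η (R.obj a)) (R.map e) (𝟙 (R.obj a))).inv ≫ (𝟙 _ ≫ (triangleCounit hη a).hom ≫ 𝟙 _) ▷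
          𝟙 (R.obj a) ≫ (λ_ (𝟙 (R.obj a))).hom = 𝟙 (𝟙 (R.obj a))
  rw [Category.id_comp, Category.comp_id]
  calc _ = 𝟙 _ ⊗≫ ((triangleCounit hη a).inv ≫ (triangleCounit hη a).hom) ⊗≫ 𝟙 _ := by bicategory
    _ = _ := by rw [Iso.inv_hom_id]; bicategory

/-- Universal arrows determine a biadjunction. -/
noncomputable def biadjunction : Biadjunction (leftBiadjoint hη) R where
  unit := unitTransformation hη
  counit := counitTransformation hη
  v X := sndIso (triangleIso hη X)
  v_naturality f := by
    have h := congrArg Hom₂.snd (triangle_naturality hη f)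
    exact h.trans (Category.assoc _ _ _)
  w a := triangleCounit hη a
  w_naturality g := triangleCounit_naturality hη g
  swallowtail_unit X := triangle_unit hη X
  swallowtail_counit a := congrArg Hom₂.snd (triangle_counit hη a)

theorem hasLeftBiadjoint_of_isUniversal (h : ∀ X, ∃ (a : A) (u : X ⟶ R.obj a),
    IsUniversal (⟨X, a, u⟩ : Comma R)) : HasLeftBiadjoint R := by
  choose E₀ η hη using h
  exact ⟨leftBiadjoint hη, ⟨biadjunction hη⟩⟩

end Comma
end UniversalArrows
end LaxCoh

namespace LaxCoh
open CategoryTheory Bicategory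
open Quiver (Path)

/-! ### Induction on 2-cells of a presented 2-category. -/

section Presented

variable {O : Type u} [Quiver.{v} O] {c : Computad.{w} O} {R : Relations c}

/-- Induction on the 2-cells of a presented 2-category. -/
theorem Presented.cell_induction
    {P : ∀ {X Y : Presented c R} {p q : X ⟶ Y}, (p ⟶ q) → Prop}
    (gen : ∀ {a b : O} {p q : Path a b} (x : c.Cell p q),
      P (Presented.cellMk (R := R) (X := ⟨a⟩) (Y := ⟨b⟩) p q (.gen x)))
    (id : ∀ {X Y : Presented c R} (p : X ⟶ Y), P (𝟙 p))
    (comp : ∀ {X Y : Presented c R} {p q r : X ⟶ Y} (s : p ⟶ q) (t : q ⟶ r), P s → P t → P (s ≫ t))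
    (whiskerLeft : ∀ {X Y Z : Presented c R} (p : X ⟶ Y) {q r : Y ⟶ Z} (s : q ⟶ r),
      P s → P (p ◁ s))
    (whiskerRight : ∀ {X Y Z : Presented c R} {p q : X ⟶ Y} (s : p ⟶ q) (r : Y ⟶ Z),
      P s → P (s ▷ r)) {X Y : Presented c R} {p q : X ⟶ Y} (s : p ⟶ q) : P s := by
  obtain ⟨x⟩ := s
  suffices h : ∀ {a b : O} {p q : Path a b} (x : Formal c p q),
      P (Presented.cellMk (R := R) (X := ⟨a⟩) (Y := ⟨b⟩) p q x) from h x
  intro a b p q x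
  induction x with
  | gen x => exact gen x
  | id p => exact id (X := ⟨_⟩) (Y := ⟨_⟩) p
  | vcomp x y hx hy => exact comp _ _ hx hy
  | whiskerLeft p x hx => exact whiskerLeft (X := ⟨_⟩) (Y := ⟨_⟩) p _ hx
  | whiskerRight x r hx => exact whiskerRight (Y := ⟨_⟩) (Z := ⟨_⟩) _ r hx

end Presented

/-! ### Cocones weighted by arrows out of `0`, and their morphisms. -/

section Cocones
variable {K : Type u₁} [Bicategory.{w₁, v₁} K] {inv : Bool}

variable (inv) in
/-- A pseudonatural transformation from `Δ̇(0, t -)` to `K(Z, D -)`, unfolded. -/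
structure DotCocone (D : DeltaL.{v} ⥤ᵖ K) (Z : K) where
  /-- The action on 1-cells. -/
  obj {x : DeltaL.{v}} (p : (⟨.zero⟩ : Dot.{v} inv) ⟶ (dotIncl inv).obj x) : Z ⟶ D.obj x
  /-- The action on 2-cells. -/
  map {x : DeltaL.{v}} {p q : (⟨.zero⟩ : Dot.{v} inv) ⟶ (dotIncl inv).obj x} (s : p ⟶ q) :
    obj p ⟶ obj q
  map_id {x : DeltaL.{v}} (p : (⟨.zero⟩ : Dot.{v} inv) ⟶ (dotIncl inv).obj x) : map (𝟙 p) = 𝟙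
      (obj p)
  map_comp {x : DeltaL.{v}} {p q r : (⟨.zero⟩ : Dot.{v} inv) ⟶ (dotIncl inv).obj x} (s : p ⟶ q)
    (t : q ⟶ r) : map (s ≫ t) = map s ≫ map t
  /-- The pseudonaturality constraint. -/
  nat {x y : DeltaL.{v}} (f : x ⟶ y) (p : (⟨.zero⟩ : Dot.{v} inv) ⟶ (dotIncl inv).obj x) :
    obj (p ≫ (dotIncl inv).map f) ≅ obj p ≫ D.map f
  nat_whiskerRight {x y : DeltaL.{v}} (f : x ⟶ y)
    {p q : (⟨.zero⟩ : Dot.{v} inv) ⟶ (dotIncl inv).obj x} (s : p ⟶ q) :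
    map (s ▷ (dotIncl inv).map f) ≫ (nat f q).hom = (nat f p).hom ≫ map s ▷ D.map f
  nat_whiskerLeft {x y : DeltaL.{v}} {f g : x ⟶ y} (θ : f ⟶ g)
    (p : (⟨.zero⟩ : Dot.{v} inv) ⟶ (dotIncl inv).obj x) :
    map (p ◁ (dotIncl inv).map₂ θ) ≫ (nat g p).hom = (nat f p).hom ≫ obj p ◁ D.map₂ θ
  nat_id {x : DeltaL.{v}} (p : (⟨.zero⟩ : Dot.{v} inv) ⟶ (dotIncl inv).obj x) :
    (nat (𝟙 x) p).hom ≫ obj p ◁ (D.mapId x).hom ≫ (ρ_ (obj p)).hom =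
      map (p ◁ ((dotIncl inv).mapId x).hom ≫ (ρ_ p).hom)
  nat_comp {x y z : DeltaL.{v}} (f : x ⟶ y) (g : y ⟶ z)
    (p : (⟨.zero⟩ : Dot.{v} inv) ⟶ (dotIncl inv).obj x) :
    (nat (f ≫ g) p).hom ≫ obj p ◁ (D.mapComp f g).hom ≫ (α_ _ _ _).inv =
      map (p ◁ ((dotIncl inv).mapComp f g).hom ≫ (α_ _ _ _).inv) ≫
        (nat g (p ≫ (dotIncl inv).map f)).hom ≫ (nat f p).hom ▷ D.map g

theorem strict_whiskerLeft_whiskerLeft [Strict K] {a b d e : K} (t : a ⟶ b) (p : b ⟶ d)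
    {q r : d ⟶ e} (s : q ⟶ r) : t ◁ p ◁ s =
      eqToHom (Strict.assoc t p q).symm ≫ (t ≫ p) ◁ s ≫ eqToHom (Strict.assoc t p r) := by
  simp [Strict.associator_eqToIso]

theorem strict_whiskerLeft_whiskerRight [Strict K] {a b d e : K} (t : a ⟶ b) {p q : b ⟶ d}
    (s : p ⟶ q) (r : d ⟶ e) : t ◁ s ▷ r =
      eqToHom (Strict.assoc t p r).symm ≫ (t ◁ s) ▷ r ≫ eqToHom (Strict.assoc t q r) := by
  simp [Strict.associator_eqToIso]

theorem comp_inv_comp_hom {C : Type u} [Category.{v} C] {a b d e : C} (x : a ⟶ b) (y : b ⟶ d)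
    (i : e ≅ d) : (x ≫ y ≫ i.inv) ≫ i.hom = x ≫ y := by
  simp

theorem eq_of_comp_unit {a b : K} {f g : a ⟶ b} {i : b ⟶ b} {n : g ⟶ f ≫ i} (M : i ≅ 𝟙 b)
    {e : g ⟶ f} (h : n ≫ f ◁ M.hom ≫ (ρ_ f).hom = e) : n = e ≫ (ρ_ f).inv ≫ f ◁ M.inv := by
  subst h
  simp [← whiskerLeft_comp]

theorem eq_of_comp_assoc {a b d e : K} {f : a ⟶ b} {x : b ⟶ d} {y : d ⟶ e} {z : b ⟶ e}
    {k : a ⟶ e} {n : k ⟶ f ≫ z} (M : z ≅ x ≫ y) {r : k ⟶ (f ≫ x) ≫ y}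
    (h : n ≫ f ◁ M.hom ≫ (α_ f x y).inv = r) : n = r ≫ (α_ f x y).hom ≫ f ◁ M.inv := by
  subst h
  simp [← whiskerLeft_comp]

namespace DotCocone

variable {D : DeltaL.{v} ⥤ᵖ K} {Z : K}

/-- A morphism of cocones. -/
@[ext]
structure Hom (c c' : DotCocone inv D Z) where
  /-- The components. -/
  app {x : DeltaL.{v}} (p : (⟨.zero⟩ : Dot.{v} inv) ⟶ (dotIncl inv).obj x) : c.obj p ⟶ c'.obj p
  naturality {x : DeltaL.{v}} {p q : (⟨.zero⟩ : Dot.{v} inv) ⟶ (dotIncl inv).obj x} (s : p ⟶ q) :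
    c.map s ≫ app q = app p ≫ c'.map s
  comm {x y : DeltaL.{v}} (f : x ⟶ y) (p : (⟨.zero⟩ : Dot.{v} inv) ⟶ (dotIncl inv).obj x) :
    app (p ≫ (dotIncl inv).map f) ≫ (c'.nat f p).hom = (c.nat f p).hom ≫ app p ▷ D.map f

variable (c : DotCocone inv D Z)

theorem map_eqToHom {x : DeltaL.{v}} {p q : (⟨.zero⟩ : Dot.{v} inv) ⟶ (dotIncl inv).obj x}
    (h : p = q) : c.map (eqToHom h) = eqToHom (congrArg c.obj h) := by
  subst h
  exact c.map_id p

/-- A generating 1-cell of `Δ_ℓ`. -/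
abbrev edge {x y : DeltaObj} (e : DeltaArr.{v} x y) : (⟨x⟩ : DeltaL.{v}) ⟶ ⟨y⟩ := Path.nil.cons e

/-- The pseudonaturality constraint at a generating 1-cell. -/
def natEdge {x y : DeltaObj} (e : DeltaArr.{v} x y) (p : Path.{v} DotObj.zero (.up x)) :
    c.obj (x := ⟨y⟩) (p.cons (.up e)) ≅ c.obj (x := ⟨x⟩) p ≫ D.map (edge e) :=
  c.nat (x := ⟨x⟩) (y := ⟨y⟩) (edge e) p

/-- The extension of a 2-cell along paths. -/
def extend {c c' : DotCocone inv D Z} (γ : c.obj (x := ⟨.one⟩) dPath ⟶ c'.obj (x := ⟨.one⟩) dPath) :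
    ∀ {x : DeltaObj} (p : Path.{v} DotObj.zero (.up x)), c.obj (x := ⟨x⟩) p ⟶ c'.obj (x := ⟨x⟩) p
  | _, .cons .nil .d => γ
  | _, .cons p (.up e) => (c.natEdge e p).hom ≫ extend γ p ▷ D.map (edge e) ≫ (c'.natEdge e p).inv
termination_by _ p => p.length

theorem extend_d {c c' : DotCocone inv D Z}
    (γ : c.obj (x := ⟨.one⟩) dPath ⟶ c'.obj (x := ⟨.one⟩) dPath) : extend γ dPath = γ := by
  rw [extend]

theorem extend_cons {c c' : DotCocone inv D Z}
    (γ : c.obj (x := ⟨.one⟩) dPath ⟶ c'.obj (x := ⟨.one⟩) dPath) {x y : DeltaObj}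
    (p : Path.{v} DotObj.zero (.up x)) (e : DeltaArr.{v} x y) :
    extend γ (p.cons (.up e)) ≫ (c'.natEdge e p).hom =
      (c.natEdge e p).hom ≫ extend γ p ▷ D.map (edge e) := by
  rw [extend]
  exact comp_inv_comp_hom _ _ _

theorem incl_mapComp_assoc {x y z : DeltaL.{v}} (f : x ⟶ y) (g : y ⟶ z)
    (p : (⟨.zero⟩ : Dot.{v} inv) ⟶ (dotIncl inv).obj x) :
    p ◁ ((dotIncl inv).mapComp f g).hom ≫ (α_ _ _ _).inv =
      eqToHom (by rw [(dotIncl inv).map_comp, Strict.assoc]) := by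
  rw [(dotIncl inv).mapComp_eq_eqToIso, Strict.associator_eqToIso]
  simp [whiskerLeft_eqToHom]

theorem incl_mapId_unitor {x : DeltaL.{v}} (p : (⟨.zero⟩ : Dot.{v} inv) ⟶ (dotIncl inv).obj x) :
    p ◁ ((dotIncl inv).mapId x).hom ≫ (ρ_ p).hom =
      eqToHom (by rw [(dotIncl inv).map_id, Strict.comp_id]) := by
  rw [(dotIncl inv).mapId_eq_eqToIso, Strict.rightUnitor_eqToIso]
  simp [whiskerLeft_eqToHom]

theorem nat_nil {x : DeltaL.{v}} (p : (⟨.zero⟩ : Dot.{v} inv) ⟶ (dotIncl inv).obj x) :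
    (c.nat (𝟙 x) p).hom = (ρ_ (c.obj p)).inv ≫ c.obj p ◁ (D.mapId x).inv := by
  have h := c.nat_id p
  rw [incl_mapId_unitor, c.map_eqToHom] at h
  exact (eq_of_comp_unit _ h).trans (Category.id_comp _)

theorem nat_cons {x : DeltaL.{v}} {y z : DeltaObj} (f : x ⟶ ⟨y⟩) (e : DeltaArr.{v} y z)
    (p : (⟨.zero⟩ : Dot.{v} inv) ⟶ (dotIncl inv).obj x) :
    (c.nat (y := ⟨z⟩) (f ≫ edge e) p).hom =
      (c.natEdge e (p ≫ (dotIncl inv).map f)).hom ≫ (c.nat f p).hom ▷ D.map (edge e) ≫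
        (α_ _ _ _).hom ≫ c.obj p ◁ (D.mapComp f (edge e)).inv := by
  have h := c.nat_comp f (edge e) p
  rw [incl_mapComp_assoc, c.map_eqToHom] at h
  have h' : (c.nat (f ≫ edge e) p).hom ≫ c.obj p ◁ (D.mapComp f (edge e)).hom ≫ (α_ _ _ _).inv =
    (c.natEdge e (p ≫ (dotIncl inv).map f)).hom ≫ (c.nat f p).hom ▷ D.map (edge e) :=
      h.trans (Category.id_comp _)
  exact (eq_of_comp_assoc _ h').trans (Category.assoc _ _ _)

/-- The extension of a 2-cell along paths, at a 1-cell of `Δ̇`. -/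
def extendApp {c c' : DotCocone inv D Z}
    (γ : c.obj (x := ⟨.one⟩) dPath ⟶ c'.obj (x := ⟨.one⟩) dPath) {x : DeltaL.{v}}
    (p : (⟨.zero⟩ : Dot.{v} inv) ⟶ (dotIncl inv).obj x) : c.obj p ⟶ c'.obj p :=
  extend γ (x := x.vertex) p

theorem comm_unit {a b : K} {f f' : a ⟶ b} (g : f ⟶ f') {i : b ⟶ b} (M : i ≅ 𝟙 b) :
    g ≫ (ρ_ f').inv ≫ f' ◁ M.inv = ((ρ_ f).inv ≫ f ◁ M.inv) ≫ g ▷ i := by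
  simp [whisker_exchange]

theorem comm_assoc {a b d e : K} {f f' : a ⟶ b} (g : f ⟶ f') {x : b ⟶ d} {y : d ⟶ e} {z : b ⟶ e}
    (M : z ≅ x ≫ y) {l l' : a ⟶ e} {k k' : a ⟶ d} {n : l ⟶ k ≫ y} {n' : l' ⟶ k' ≫ y}
    {m : k ⟶ f ≫ x} {m' : k' ⟶ f' ≫ x} {s : k ⟶ k'} {t : l ⟶ l'} (h : s ≫ m' = m ≫ g ▷ x)
    (h' : t ≫ n' = n ≫ s ▷ y) :
    t ≫ n' ≫ m' ▷ y ≫ (α_ f' x y).hom ≫ f' ◁ M.inv =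
      (n ≫ m ▷ y ≫ (α_ f x y).hom ≫ f ◁ M.inv) ≫ g ▷ z := by
  rw [reassoc_of% h', ← comp_whiskerRight_assoc, h]
  simp [whisker_exchange]

/-- The extension is built to respect generating 1-cells; `nat_nil` and `nat_cons` propagate this
along a path. -/
theorem extendApp_nat {c c' : DotCocone inv D Z}
    (γ : c.obj (x := ⟨.one⟩) dPath ⟶ c'.obj (x := ⟨.one⟩) dPath) {x : DeltaL.{v}} {b : DeltaObj}
    (f : Path x.vertex b) (p : (⟨.zero⟩ : Dot.{v} inv) ⟶ (dotIncl inv).obj x) :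
    extendApp γ (p ≫ (dotIncl inv).map (Y := ⟨b⟩) f) ≫ (c'.nat (y := ⟨b⟩) f p).hom =
      (c.nat (y := ⟨b⟩) f p).hom ≫ extendApp γ p ▷ D.map (Y := ⟨b⟩) f := by
  induction f with
  | nil =>
    have h := comm_unit (extendApp γ p) (D.mapId x)
    rw [← nat_nil, ← nat_nil] at h
    exact h
  | @cons b d f e ih =>
    have h := comm_assoc (extendApp γ p) (D.mapComp (b := ⟨b⟩) (c := ⟨d⟩) f (edge e)) ih
      (extend_cons γ (p ≫ (dotIncl inv).map (Y := ⟨b⟩) f) e)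
    exact (congrArg (_ ≫ ·) (c'.nat_cons (y := b) f e p)).trans
      (h.trans (congrArg (· ≫ _) (c.nat_cons (y := b) f e p).symm))

/-- The naturality square of the extension at a 2-cell of `Δ̇`. -/
def Square {c c' : DotCocone inv D Z}
    (γ : c.obj (x := ⟨.one⟩) dPath ⟶ c'.obj (x := ⟨.one⟩) dPath) {x : DeltaL.{v}}
    {p q : (⟨.zero⟩ : Dot.{v} inv) ⟶ (dotIncl inv).obj x} (s : p ⟶ q) : Prop :=
  c.map s ≫ extendApp γ q = extendApp γ p ≫ c'.map s

section

variable {c c' : DotCocone inv D Z}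
  {γ : c.obj (x := ⟨.one⟩) dPath ⟶ c'.obj (x := ⟨.one⟩) dPath}

theorem square_id {x : DeltaL.{v}} (p : (⟨.zero⟩ : Dot.{v} inv) ⟶ (dotIncl inv).obj x) :
    Square γ (𝟙 p) := by
  rw [Square, c.map_id, c'.map_id]
  exact (Category.id_comp _).trans (Category.comp_id _).symm

theorem square_eqToHom {x : DeltaL.{v}} {p q : (⟨.zero⟩ : Dot.{v} inv) ⟶ (dotIncl inv).obj x}
    (h : p = q) : Square γ (eqToHom h) := by
  subst h
  exact square_id p

theorem square_of_eq {x : DeltaL.{v}} {p q : (⟨.zero⟩ : Dot.{v} inv) ⟶ (dotIncl inv).obj x}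
    {s t : p ⟶ q} (h : s = t) (ht : Square γ t) : Square γ s :=
  h ▸ ht

theorem square_comp {x : DeltaL.{v}} {p q r : (⟨.zero⟩ : Dot.{v} inv) ⟶ (dotIncl inv).obj x}
    {s : p ⟶ q} {t : q ⟶ r} (hs : Square γ s) (ht : Square γ t) : Square γ (s ≫ t) := by
  unfold Square at *
  rw [c.map_comp, c'.map_comp, Category.assoc, ht, reassoc_of% hs]

theorem square_inv {x : DeltaL.{v}} {p q : (⟨.zero⟩ : Dot.{v} inv) ⟶ (dotIncl inv).obj x}
    {s : p ⟶ q} {t : q ⟶ p} (hst : s ≫ t = 𝟙 p) (hts : t ≫ s = 𝟙 q) (hs : Square γ s) :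
    Square γ t := by
  have h1 : c.map t ≫ c.map s = 𝟙 _ := by rw [← c.map_comp, hts, c.map_id]
  have h2 : c'.map s ≫ c'.map t = 𝟙 _ := by rw [← c'.map_comp, hst, c'.map_id]
  unfold Square at *
  rw [← Category.comp_id (c.map t ≫ _), ← h2, Category.assoc, ← reassoc_of% hs, reassoc_of% h1]

theorem square_of_comm {a b : K} {p q p' q' : a ⟶ b} {u u' r r' : a ⟶ b} {g : u ⟶ r} {g' : u' ⟶ r'}
    {n : p ⟶ u} (n' : p' ≅ u') {m : q ⟶ r} (m' : q' ≅ r') {s : p ⟶ q} {s' : p' ⟶ q'}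
    {e : p ⟶ p'} {e' : q ⟶ q'} {j : u ⟶ u'} {j' : r ⟶ r'}
    (h₁ : s ≫ m = n ≫ g) (h₂ : s' ≫ m'.hom = n'.hom ≫ g') (h₃ : e ≫ n'.hom = n ≫ j)
    (h₄ : e' ≫ m'.hom = m ≫ j') (h₅ : g ≫ j' = j ≫ g') : s ≫ e' = e ≫ s' := by
  rw [← cancel_mono m'.hom, Category.assoc, Category.assoc, h₄, reassoc_of% h₁, h₂, h₅,
    reassoc_of% h₃]

theorem square_whiskerRight {x y : DeltaL.{v}} (f : x ⟶ y)
    {p q : (⟨.zero⟩ : Dot.{v} inv) ⟶ (dotIncl inv).obj x} {s : p ⟶ q} (hs : Square γ s) :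
    Square γ (s ▷ (dotIncl inv).map f) := by
  refine square_of_comm (c'.nat f p) (c'.nat f q) (c.nat_whiskerRight f s) (c'.nat_whiskerRight f s)
    (extendApp_nat γ f p) (extendApp_nat γ f q) ?_
  have h := congrArg (· ▷ D.map f) hs
  rw [comp_whiskerRight, comp_whiskerRight] at h
  exact h

/-- Naturality at 2-cells coming from `Δ_ℓ` imposes no condition on `γ`: it follows from the
pseudonaturality of both cocones and interchange. -/
theorem square_whiskerLeft {x y : DeltaL.{v}} {f g : x ⟶ y} (θ : f ⟶ g)
    (p : (⟨.zero⟩ : Dot.{v} inv) ⟶ (dotIncl inv).obj x) :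
    Square γ (p ◁ (dotIncl inv).map₂ θ) :=
  square_of_comm (c'.nat f p) (c'.nat g p) (c.nat_whiskerLeft θ p) (c'.nat_whiskerLeft θ p)
    (extendApp_nat γ f p) (extendApp_nat γ g p) (whisker_exchange _ _)

end

variable (inv) in
/-- A path out of `0`, as a 1-cell of `Δ̇` into an object of `Δ_ℓ`. -/
abbrev toHom {x : DeltaObj} (p : Path.{v} DotObj.zero (.up x)) :
    (⟨.zero⟩ : Dot.{v} inv) ⟶ (dotIncl inv).obj ⟨x⟩ := p

variable (inv) in
/-- The 2-cell `ϑ` of `Δ̇`. -/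
def thetaCell : toHom.{v} inv (dPath₁ .d1) ⟶ toHom inv (dPath₁ .d0) :=
  Quot.mk _ (theta inv)

/-- The 2-cell of `Δ̇` inverse to `ϑ`. -/
def thetaCellInv (h : inv = true) : toHom.{v} inv (dPath₁ .d0) ⟶ toHom inv (dPath₁ .d1) :=
  Quot.mk _ (Formal.gen (c := dotComputad inv) (.ϑInv h))

theorem thetaCell_inv (h : inv = true) :
    thetaCell.{v} inv ≫ thetaCellInv h = 𝟙 _ := Quot.sound (.of (.hom_inv h))

theorem thetaCellInv_comp (h : inv = true) :
    thetaCellInv.{v} h ≫ thetaCell inv = 𝟙 _ := Quot.sound (.of (.inv_hom h))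

/-- Every path in `Δ̇` between objects of `Δ_ℓ` comes from `Δ_ℓ`. -/
theorem exists_incl_map {x : DeltaObj} : ∀ {y : DeltaObj} (p : Path.{v} (DotObj.up x) (.up y)),
    ∃ f : (⟨x⟩ : DeltaL.{v}) ⟶ ⟨y⟩, Presented.path ((dotIncl inv).map f) = p
  | _, .nil => ⟨𝟙 _, rfl⟩
  | _, .cons (b := .up b) p (.up e) => by
    obtain ⟨f, hf⟩ := exists_incl_map p
    exact ⟨f ≫ edge e, congrArg
      (fun q : Quiver.Path (DotObj.up x) (DotObj.up b) => q.cons (DotArr.up e)) hf⟩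
termination_by _ p => p.length

theorem isEmpty_path_up_zero {x : DeltaObj} : IsEmpty (Path.{v} (DotObj.up x) .zero) :=
  ⟨fun p => match p with
    | .cons _ e => nomatch e⟩

theorem path_zero_zero : ∀ p : Path.{v} DotObj.zero .zero, p = .nil
  | .nil => rfl
  | .cons _ e => nomatch e

section

variable {c c' : DotCocone inv D Z}

/-- The inductive hypothesis for naturality in 2-cells of `Δ̇`. -/
def NaturalAt (γ : c.obj (x := ⟨.one⟩) dPath ⟶ c'.obj (x := ⟨.one⟩) dPath) :
    ∀ {X Y : Dot.{v} inv} {p q : X ⟶ Y}, (p ⟶ q) → Prop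
  | _, ⟨.zero⟩, p, q, s => ∃ h : p = q, s = eqToHom h
  | X, ⟨.up x⟩, _, _, s => ∀ r : (⟨.zero⟩ : Dot.{v} inv) ⟶ X, Square γ (x := ⟨x⟩) (r ◁ s)

variable {γ : c.obj (x := ⟨.one⟩) dPath ⟶ c'.obj (x := ⟨.one⟩) dPath}

theorem square_conj {x : DeltaL.{v}} {p q p' q' : (⟨.zero⟩ : Dot.{v} inv) ⟶ (dotIncl inv).obj x}
    {s : p ⟶ q} (h : p' = p) (h' : q = q') (hs : Square γ s) :
    Square γ (eqToHom h ≫ s ≫ eqToHom h') :=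
  square_comp (square_eqToHom h) (square_comp hs (square_eqToHom h'))

theorem square_nil_whiskerLeft {x : DeltaL.{v}} {r : (⟨.zero⟩ : Dot.{v} inv) ⟶ ⟨.zero⟩}
    (hr : r = 𝟙 _) {p q : (⟨.zero⟩ : Dot.{v} inv) ⟶ (dotIncl inv).obj x} {s : p ⟶ q}
    (hs : Square γ s) : Square γ (r ◁ s) := by
  subst hr
  rw [id_whiskerLeft, Strict.leftUnitor_eqToIso, Strict.leftUnitor_eqToIso]
  exact square_conj (Strict.id_comp p) (Strict.id_comp q).symm hs

/-- Induction on the formation of 2-cells. Generators from `Δ_ℓ` are covered by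
`square_whiskerLeft`, `ϑ` by hypothesis and its inverse by `square_inv`. Quantifying over all `r`
out of `0` makes the statement stable under left whiskering; 2-cells between arrows into `0` are
identities. -/
theorem naturalAt (hγ : Square γ (thetaCell inv)) {X Y : Dot.{v} inv} {p q : X ⟶ Y} (s : p ⟶ q) :
    NaturalAt γ s := by
  induction s using Presented.cell_induction with
  | gen x =>
    cases x with
    | @up x y p q g =>
      intro r
      cases g with
      | σ00 => exact square_whiskerLeft (x := ⟨_⟩) (y := ⟨_⟩) (Presented.cellMk _ _ (.gen .σ00)) r
      | σ20 => exact square_whiskerLeft (x := ⟨_⟩) (y := ⟨_⟩) (Presented.cellMk _ _ (.gen .σ20)) r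
      | σ21 => exact square_whiskerLeft (x := ⟨_⟩) (y := ⟨_⟩) (Presented.cellMk _ _ (.gen .σ21)) r
      | n0 => exact square_whiskerLeft (x := ⟨_⟩) (y := ⟨_⟩) (Presented.cellMk _ _ (.gen .n0)) r
      | n1 => exact square_whiskerLeft (x := ⟨_⟩) (y := ⟨_⟩) (Presented.cellMk _ _ (.gen .n1)) r
    | ϑ => exact fun r => square_nil_whiskerLeft (path_zero_zero r) hγ
    | ϑInv h =>
      exact fun r => square_nil_whiskerLeft (path_zero_zero r)
        (square_inv (thetaCell_inv h) (thetaCellInv_comp h) hγ)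
  | @id X Y p =>
    obtain ⟨_ | x⟩ := Y
    · exact ⟨rfl, rfl⟩
    · intro r
      exact square_of_eq (x := ⟨x⟩) (whiskerLeft_id r p) (square_id _)
  | @comp X Y p q r s t hs ht =>
    obtain ⟨_ | x⟩ := Y
    · obtain ⟨rfl, rfl⟩ := hs
      obtain ⟨rfl, rfl⟩ := ht
      exact ⟨rfl, Category.id_comp _⟩
    · intro r
      exact square_of_eq (x := ⟨x⟩) (whiskerLeft_comp r s t) (square_comp (hs r) (ht r))
  | @whiskerLeft X Y Z p q r s hs =>
    obtain ⟨_ | x⟩ := Z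
    · obtain ⟨rfl, rfl⟩ := hs
      exact ⟨rfl, whiskerLeft_id _ _⟩
    · intro t
      exact square_of_eq (x := ⟨x⟩) (strict_whiskerLeft_whiskerLeft t p s)
        (square_conj _ _ (hs (t ≫ p)))
  | @whiskerRight X Y Z p q s r hs =>
    -- If the middle object is `0` then `s` is an identity. Otherwise `r` joins objects of `Δ_ℓ`,
    -- hence comes from `Δ_ℓ`, and pseudonaturality along it applies.
    obtain ⟨_ | y⟩ := Y
    · obtain ⟨rfl, rfl⟩ := hs
      obtain ⟨_ | x⟩ := Z
      · exact ⟨rfl, id_whiskerRight _ _⟩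
      · intro t
        have e : t ◁ 𝟙 p ▷ r = 𝟙 _ := by simp
        exact e ▸ square_id _
    · obtain ⟨_ | x⟩ := Z
      · exact isEmpty_path_up_zero.elim r
      · intro t
        obtain ⟨f, hf⟩ := exists_incl_map (inv := inv) r
        obtain rfl : (dotIncl inv).map f = r := hf
        exact square_of_eq (x := ⟨x⟩) (strict_whiskerLeft_whiskerRight t s _)
          (square_conj _ _ (square_whiskerRight (x := ⟨y⟩) (y := ⟨x⟩) f (hs t)))

/-- A 2-cell compatible with `ϑ` extends to a morphism of cocones. -/
def homMk (γ : c.obj (x := ⟨.one⟩) dPath ⟶ c'.obj (x := ⟨.one⟩) dPath)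
    (hγ : Square γ (thetaCell inv)) : Hom c c' where
  app p := extendApp γ p
  naturality {x p q} s := by
    obtain ⟨x⟩ := x
    have h : Square γ (𝟙 (⟨.zero⟩ : Dot.{v} inv) ◁ s) := naturalAt hγ s (𝟙 _)
    have e : s = eqToHom (Strict.id_comp p).symm ≫ 𝟙 (⟨.zero⟩ : Dot.{v} inv) ◁ s ≫
        eqToHom (Strict.id_comp q) := by
      simp [Strict.leftUnitor_eqToIso]
    have h' := square_conj (γ := γ) (x := ⟨x⟩) (Strict.id_comp p).symm (Strict.id_comp q) h
    rw [← e] at h'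
    exact h'
  comm f p := extendApp_nat γ f p

/-- Every nonempty path out of `0` begins with `d`, and compatibility with the invertible
constraints forces the component at each further edge. -/
theorem Hom.app_eq_of_d {t t' : Hom c c'}
    (h : t.app (toHom inv dPath) = t'.app (toHom inv dPath)) :
    ∀ {x : DeltaObj} (p : Path.{v} DotObj.zero (.up x)), t.app (toHom inv p) = t'.app (toHom inv p)
  | _, .cons .nil .d => h
  | _, .cons (b := .up x) p (.up (y := y) e) => by
    have h₁ := t.comm (x := ⟨x⟩) (y := ⟨y⟩) (edge e) p
    have h₂ := t'.comm (x := ⟨x⟩) (y := ⟨y⟩) (edge e) p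
    have h₃ := Hom.app_eq_of_d h p
    exact (cancel_mono (c'.natEdge e p).hom).1 (h₁.trans
      ((congrArg (fun s => (c.natEdge e p).hom ≫ s ▷ D.map (edge e)) h₃).trans h₂.symm))
termination_by _ p => p.length

/-- A morphism of cocones is determined by its component at `d`. -/
theorem Hom.ext_of_d {t t' : Hom c c'}
    (h : t.app (toHom inv dPath) = t'.app (toHom inv dPath)) : t = t' := by
  ext x p
  obtain ⟨x⟩ := x
  exact Hom.app_eq_of_d h p

end

end DotCocone
end Cocones
end LaxCoh

namespace LaxCoh
open CategoryTheory Bicategory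
open Quiver (Path)

/-! ### Descent data underlying a cocone. -/

section Coherence

variable (K : Type u₁) [Bicategory.{w₁, v₁} K]

/-- The data of a 2-functor `Δ_ℓ ⟶ K`, given on generators. -/
structure CoherenceData where
  /-- The image of `1`. -/
  one : K
  /-- The image of `2`. -/
  two : K
  /-- The image of `3`. -/
  three : K
  /-- The image of `d⁰`. -/
  d0 : one ⟶ two
  /-- The image of `d¹`. -/
  d1 : one ⟶ two
  /-- The image of `s⁰`. -/
  s0 : two ⟶ one
  /-- The image of `∂⁰`. -/
  e0 : two ⟶ three
  /-- The image of `∂¹`. -/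
  e1 : two ⟶ three
  /-- The image of `∂²`. -/
  e2 : two ⟶ three
  /-- The image of `σ₀₀`. -/
  σ00 : d0 ≫ e0 ⟶ d0 ≫ e1
  /-- The image of `σ₂₀`. -/
  σ20 : d0 ≫ e2 ⟶ d1 ≫ e0
  /-- The image of `σ₂₁`. -/
  σ21 : d1 ≫ e2 ⟶ d1 ≫ e1
  /-- The image of `n₀`. -/
  n0 : 𝟙 one ⟶ d0 ≫ s0
  /-- The image of `n₁`. -/
  n1 : 𝟙 one ⟶ d1 ≫ s0

namespace CoherenceData

variable {K} (S : CoherenceData K)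

/-- The action on vertices. -/
def vertex : DeltaObj → K
  | .one => S.one
  | .two => S.two
  | .three => S.three

/-- The action on generating 1-cells. -/
def arrow : ∀ {x y : DeltaObj}, DeltaArr.{v} x y → (S.vertex x ⟶ S.vertex y)
  | _, _, .d0 => S.d0
  | _, _, .d1 => S.d1
  | _, _, .s0 => S.s0
  | _, _, .e0 => S.e0
  | _, _, .e1 => S.e1
  | _, _, .e2 => S.e2

/-- A 2-cell between composites of two 1-cells, as a 2-cell between images of paths. -/
def ofPath₂ {a b b' d : K} {f : a ⟶ b} {g : b ⟶ d} {f' : a ⟶ b'} {g' : b' ⟶ d}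
    (s : f ≫ g ⟶ f' ≫ g') : (𝟙 a ≫ f) ≫ g ⟶ (𝟙 a ≫ f') ≫ g' :=
  (λ_ f).hom ▷ g ≫ s ≫ (λ_ f').inv ▷ g'

/-- A 2-cell from an identity to a composite of two 1-cells, as a 2-cell between images of
paths. -/
def ofPath₀ {a b : K} {f : a ⟶ b} {g : b ⟶ a} (s : 𝟙 a ⟶ f ≫ g) : 𝟙 a ⟶ (𝟙 a ≫ f) ≫ g :=
  s ≫ (λ_ f).inv ▷ g

/-- The map of computads. -/
def toMap : deltaComputad.{v}.Map K where
  obj := S.vertex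
  map e := S.arrow e
  cell
    | .σ00 => ofPath₂ S.σ00
    | .σ20 => ofPath₂ S.σ20
    | .σ21 => ofPath₂ S.σ21
    | .n0 => ofPath₀ S.n0
    | .n1 => ofPath₀ S.n1

/-- Descent data for `F : Z ⟶ S.one`. -/
structure IsDescent {Z : K} (F : Z ⟶ S.one) (ϑ : F ≫ S.d1 ⟶ F ≫ S.d0) : Prop where
  assoc : ϑ ▷ S.e2 ≫ ((α_ _ _ _).hom ≫ F ◁ S.σ20 ≫ (α_ _ _ _).inv) ≫ ϑ ▷ S.e0 ≫
      ((α_ _ _ _).hom ≫ F ◁ S.σ00 ≫ (α_ _ _ _).inv) =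
    ((α_ _ _ _).hom ≫ F ◁ S.σ21 ≫ (α_ _ _ _).inv) ≫ ϑ ▷ S.e1
  unit : ((ρ_ F).inv ≫ F ◁ S.n1 ≫ (α_ _ _ _).inv) ≫ ϑ ▷ S.s0 =
    (ρ_ F).inv ≫ F ◁ S.n0 ≫ (α_ _ _ _).inv

variable [Strict K]

/-- The 2-functor `Δ_ℓ ⟶ K`. -/
def diagram : StrictPseudofunctor DeltaL.{v} K :=
  S.toMap.lift _ (fun _ _ h => h.elim)

end CoherenceData

namespace DotCocone

open CoherenceData

section Abstract

variable {K} {a b d e : K}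

theorem eq_conj_whiskerRight {f f' u u' : a ⟶ b} {t : f ⟶ f'} {m g : b ⟶ d} (l : m ≅ g)
    {k k' : a ⟶ d} (n : k ≅ f ≫ m) (n' : k' ≅ f' ≫ m) {s : k ⟶ k'} (i : f ≅ u) (i' : f' ≅ u')
    (h : s ≫ n'.hom = n.hom ≫ t ▷ m) :
    s = ((n ≪≫ whiskerLeftIso f l) ≪≫ whiskerRightIso i g).hom ≫ (i.inv ≫ t ≫ i'.hom) ▷ g ≫
      ((n' ≪≫ whiskerLeftIso f' l) ≪≫ whiskerRightIso i' g).inv := by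
  rw [← Iso.eq_comp_inv] at h
  subst h
  simp only [Iso.trans_hom, whiskerLeftIso_hom, whiskerRightIso_hom, comp_whiskerRight,
    Iso.trans_inv, whiskerLeftIso_inv, whiskerRightIso_inv, Category.assoc,
    hom_inv_whiskerRight_assoc, ← whisker_exchange_assoc, whiskerLeft_hom_inv_assoc]

theorem natural_conj {f f' : a ⟶ b} {t : f ⟶ f'} {m g : b ⟶ d} (l : m ≅ g)
    {k k' : a ⟶ d} (n : k ≅ f ≫ m) (n' : k' ≅ f' ≫ m) {s : k ⟶ k'}
    (h : s ≫ n'.hom = n.hom ≫ t ▷ m) :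
    s ≫ (n' ≪≫ whiskerLeftIso f' l).hom = (n ≪≫ whiskerLeftIso f l).hom ≫ t ▷ g := by
  simp [reassoc_of% h, whisker_exchange]

theorem square_iff_conj {k₁ k₁' k₀ k₀' l₁ l₁' l₀ l₀' : a ⟶ b} (n₁ : k₁ ≅ l₁) (n₁' : k₁' ≅ l₁')
    (n₀ : k₀ ≅ l₀) (n₀' : k₀' ≅ l₀') {x₁ : k₁ ⟶ k₁'} {x₀ : k₀ ⟶ k₀'} {y₁ : l₁ ⟶ l₁'}
    {y₀ : l₀ ⟶ l₀'} {m : k₁ ⟶ k₀} {m' : k₁' ⟶ k₀'} (h₁ : x₁ ≫ n₁'.hom = n₁.hom ≫ y₁)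
    (h₀ : x₀ ≫ n₀'.hom = n₀.hom ≫ y₀) :
    m ≫ x₀ = x₁ ≫ m' ↔ (n₁.inv ≫ m ≫ n₀.hom) ≫ y₀ = y₁ ≫ n₁'.inv ≫ m' ≫ n₀'.hom := by
  rw [← cancel_mono n₀'.hom, Category.assoc, Category.assoc, h₀, ← cancel_epi n₁.inv]
  simp only [Category.assoc, ← Iso.inv_comp_eq] at h₁ ⊢
  rw [← h₁]
  simp

theorem nat_comp_aux {F : a ⟶ b} {f m : b ⟶ d} {g n : d ⟶ e} {k : a ⟶ e} {o : a ⟶ d}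
    (j : k ≅ o ≫ n) (i : o ≅ F ≫ m) (l : m ≅ f) (r : n ≅ g) :
    j.hom ≫ i.hom ▷ n ≫ (α_ F m n).hom ≫ F ◁ m ◁ r.hom =
      ((j ≪≫ whiskerLeftIso o r) ≪≫ whiskerRightIso (i ≪≫ whiskerLeftIso F l) g).hom ≫
        (α_ F f g).hom ≫ F ◁ l.inv ▷ g := by
  simp only [Iso.trans_hom, whiskerLeftIso_hom, whiskerRightIso_hom, comp_whiskerRight,
    whisker_assoc, Category.assoc, Iso.inv_hom_id_assoc, ← whiskerLeft_comp, hom_inv_whiskerRight,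
    whiskerLeft_id, Category.comp_id]
  rw [whisker_exchange_assoc]
  simp

theorem eq_conj_ofPath₂ {b' : K} {F : a ⟶ b} {f : b ⟶ d} {g : d ⟶ e} {f' : b ⟶ b'} {g' : b' ⟶ e}
    {k k' : a ⟶ e} (n : k ≅ (F ≫ f) ≫ g) (n' : k' ≅ (F ≫ f') ≫ g') {r : f ≫ g ⟶ f' ≫ g'}
    {s : k ⟶ k'} (h : s ≫ n'.hom ≫ (α_ _ _ _).hom ≫ F ◁ (λ_ f').inv ▷ g' =
      (n.hom ≫ (α_ _ _ _).hom ≫ F ◁ (λ_ f).inv ▷ g) ≫ F ◁ ofPath₂ r) :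
    s = n.hom ≫ ((α_ _ _ _).hom ≫ F ◁ r ≫ (α_ _ _ _).inv) ≫ n'.inv := by
  rw [← cancel_mono (n'.hom ≫ (α_ _ _ _).hom ≫ F ◁ (λ_ f').inv ▷ g'), h]
  simp only [ofPath₂, Category.assoc, ← whiskerLeft_comp, inv_hom_whiskerRight_assoc,
    Iso.inv_hom_id_assoc]

theorem eq_conj_ofPath₀ {F : a ⟶ b} {f : b ⟶ d} {g : d ⟶ b} {k' : a ⟶ b}
    (n' : k' ≅ (F ≫ f) ≫ g) {r : 𝟙 b ⟶ f ≫ g}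
    {s : F ⟶ k'} (h : s ≫ n'.hom ≫ (α_ _ _ _).hom ≫ F ◁ (λ_ f).inv ▷ g =
      ((ρ_ F).inv ≫ F ◁ 𝟙 _) ≫ F ◁ ofPath₀ r) :
    s = ((ρ_ F).inv ≫ F ◁ r ≫ (α_ _ _ _).inv) ≫ n'.inv := by
  rw [← cancel_mono (n'.hom ≫ (α_ _ _ _).hom ≫ F ◁ (λ_ f).inv ▷ g), h]
  simp [ofPath₀]

theorem conj_comp_assoc {k₁ k₂ k₃ k₄ k₅ k₆ : a ⟶ b} {l₁ l₂ l₃ l₄ l₅ l₆ : a ⟶ b} (n₁ : k₁ ≅ l₁)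
    (n₂ : k₂ ≅ l₂) (n₃ : k₃ ≅ l₃) (n₄ : k₄ ≅ l₄) (n₅ : k₅ ≅ l₅) (n₆ : k₆ ≅ l₆)
    {x₁ : l₁ ⟶ l₂} {x₂ : l₂ ⟶ l₃} {x₃ : l₃ ⟶ l₄} {x₄ : l₄ ⟶ l₅} {y₁ : l₁ ⟶ l₆} {y₂ : l₆ ⟶ l₅}
    (h : (n₁.hom ≫ x₁ ≫ n₂.inv) ≫ (n₂.hom ≫ x₂ ≫ n₃.inv) ≫ (n₃.hom ≫ x₃ ≫ n₄.inv) ≫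
      (n₄.hom ≫ x₄ ≫ n₅.inv) = (n₁.hom ≫ y₁ ≫ n₆.inv) ≫ (n₆.hom ≫ y₂ ≫ n₅.inv)) :
    x₁ ≫ x₂ ≫ x₃ ≫ x₄ = y₁ ≫ y₂ := by
  rw [← cancel_epi n₁.hom, ← cancel_mono n₅.inv]
  simpa using h

theorem conj_comp_unit {F k₁ k₂ l₁ l₂ : a ⟶ b} (n₁ : k₁ ≅ l₁) (n₂ : k₂ ≅ l₂) {x : F ⟶ l₁}
    {y : l₁ ⟶ l₂} {z : F ⟶ l₂} (h : (x ≫ n₁.inv) ≫ (n₁.hom ≫ y ≫ n₂.inv) = z ≫ n₂.inv) :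
    x ≫ y = z := by
  rw [← cancel_mono n₂.inv]
  simpa using h

variable [Strict K]

theorem eqToIso_comp_inv {f : a ⟶ b} {g : b ⟶ d} (h : (𝟙 a ≫ f) ≫ g = (𝟙 a ≫ f) ≫ 𝟙 b ≫ g) :
    (eqToIso h).inv = (𝟙 a ≫ f) ◁ (λ_ g).hom := by
  simp [Strict.leftUnitor_eqToIso, whiskerLeft_eqToHom]

end Abstract

variable {K} [Strict K] {S : CoherenceData K} {inv : Bool} {Z : K}
  (c : DotCocone.{v} inv S.diagram.toPseudofunctor Z)

/-- The pseudonaturality constraint at a generating 1-cell. -/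
def natGen {x y : DeltaObj} (e : DeltaArr.{v} x y) (p : Path.{v} DotObj.zero (.up x)) :
    c.obj (toHom inv (p.cons (.up e))) ≅ c.obj (toHom inv p) ≫ S.arrow e :=
  c.natEdge e p ≪≫ whiskerLeftIso _ (λ_ (S.arrow e))

/-- The underlying 1-cell of the descent data of a cocone. -/
def apex : Z ⟶ S.one := c.obj (toHom inv dPath)

/-- The constraint at `d` followed by two generating 1-cells. -/
def natGen₂ {x y : DeltaObj} (f : DeltaArr.{v} .one x) (g : DeltaArr.{v} x y) :
    c.obj (toHom inv (dPath₂ f g)) ≅ (c.apex ≫ S.arrow f) ≫ S.arrow g :=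
  c.natGen g (dPath₁ f) ≪≫ whiskerRightIso (c.natGen f dPath) (S.arrow g)

/-- The underlying 2-cell of the descent data of a cocone. -/
def descent : c.apex ≫ S.d1 ⟶ c.apex ≫ S.d0 :=
  (c.natGen .d1 dPath).inv ≫ c.map (thetaCell inv) ≫ (c.natGen .d0 dPath).hom

variable (inv) in
/-- The 2-cell `g ϑ` of `Δ̇`. -/
def thetaCellThen {x : DeltaObj} (g : DeltaArr.{v} .two x) :
    toHom inv (dPath₂ .d1 g) ⟶ toHom inv (dPath₂ .d0 g) :=
  Quot.mk _ (thetaThen inv g)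

variable (inv) in
/-- The whiskering by `d` of a generating 2-cell of `Δ_ℓ`. -/
def dCell {x x' y : DeltaObj} {f : DeltaArr.{v} .one x} {g : DeltaArr.{v} x y}
    {f' : DeltaArr.{v} .one x'} {g' : DeltaArr.{v} x' y} (s : DeltaCell (path₂ f g) (path₂ f' g')) :
    toHom inv (dPath₂ f g) ⟶ toHom inv (dPath₂ f' g') :=
  toHom inv dPath ◁ (dotIncl inv).map₂ (a := ⟨.one⟩) (b := ⟨y⟩)
    (f := path₂ f g) (g := path₂ f' g') (Quot.mk _ (.gen s))

variable (inv) in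
/-- The whiskering by `d` of a generating 2-cell of `Δ_ℓ` out of an identity. -/
def dCell₀ {x : DeltaObj} {f : DeltaArr.{v} .one x} {g : DeltaArr.{v} x .one}
    (s : DeltaCell .nil (path₂ f g)) : toHom inv dPath ⟶ toHom inv (dPath₂ f g) :=
  toHom inv dPath ◁ (dotIncl inv).map₂ (a := ⟨.one⟩) (b := ⟨.one⟩)
    (f := 𝟙 _) (g := path₂ f g) (Quot.mk _ (.gen s))

/-- The image of `ϑ` followed by a generating 1-cell. -/
theorem map_thetaThen {x : DeltaObj} (g : DeltaArr.{v} .two x) :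
    c.map (thetaCellThen inv g) =
      (c.natGen₂ .d1 g).hom ≫ c.descent ▷ S.arrow g ≫ (c.natGen₂ .d0 g).inv := by
  have h : c.map (thetaCellThen inv g) ≫ (c.natEdge g (dPath₁ .d0)).hom =
        (c.natEdge g (dPath₁ .d1)).hom ≫ c.map (thetaCell inv) ▷ _ :=
    c.nat_whiskerRight (edge g) (thetaCell inv)
  exact eq_conj_whiskerRight (λ_ (S.arrow g)) (c.natEdge g (dPath₁ .d1))
    (c.natEdge g (dPath₁ .d0)) (c.natGen .d1 dPath) (c.natGen .d0 dPath) h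

theorem nat_path₂ {x y : DeltaObj} (f : DeltaArr.{v} .one x) (g : DeltaArr.{v} x y) :
    (c.nat (x := ⟨.one⟩) (y := ⟨y⟩) (path₂ f g) (toHom inv dPath)).hom =
      (c.natGen₂ f g).hom ≫ (α_ _ _ _).hom ≫ c.apex ◁ (λ_ (S.arrow f)).inv ▷ S.arrow g := by
  have h := c.nat_cons (edge f) g (toHom inv dPath)
  rw [S.diagram.mapComp_eq_eqToIso] at h
  refine h.trans ((congrArg (fun t => (c.natEdge g (dPath₁ f)).hom ≫
    (c.natEdge f dPath).hom ▷ (𝟙 _ ≫ S.arrow g) ≫ (α_ _ _ _).hom ≫ c.apex ◁ t)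
    (eqToIso_comp_inv _)).trans ?_)
  exact nat_comp_aux (c.natEdge g (dPath₁ f)) (c.natEdge f dPath) (λ_ (S.arrow f))
    (λ_ (S.arrow g))

/-- Pseudonaturality in the 2-cells of `Δ_ℓ`. The unitors caused by starting each path at an
identity are absorbed by `natGen₂`. -/
theorem map_dCell {x x' y : DeltaObj} {f : DeltaArr.{v} .one x} {g : DeltaArr.{v} x y}
    {f' : DeltaArr.{v} .one x'} {g' : DeltaArr.{v} x' y} (s : DeltaCell (path₂ f g) (path₂ f' g'))
    {r : S.arrow f ≫ S.arrow g ⟶ S.arrow f' ≫ S.arrow g'} (hr : S.toMap.cell s = ofPath₂ r) :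
    c.map (dCell inv s) =
      (c.natGen₂ f g).hom ≫ ((α_ _ _ _).hom ≫ c.apex ◁ r ≫ (α_ _ _ _).inv) ≫
        (c.natGen₂ f' g').inv := by
  have h := c.nat_whiskerLeft (x := ⟨.one⟩) (y := ⟨y⟩) (f := path₂ f g) (g := path₂ f' g')
    (Quot.mk _ (.gen s)) (toHom inv dPath)
  exact eq_conj_ofPath₂ (c.natGen₂ f g) (c.natGen₂ f' g')
    (((congrArg (_ ≫ ·) (c.nat_path₂ f' g')).symm.trans h).trans
      (congrArg₂ (fun t t' => t ≫ c.apex ◁ t') (c.nat_path₂ f g) hr))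

theorem map_dCell₀ {x : DeltaObj} {f : DeltaArr.{v} .one x} {g : DeltaArr.{v} x .one}
    (s : DeltaCell .nil (path₂ f g)) {r : 𝟙 S.one ⟶ S.arrow f ≫ S.arrow g}
    (hr : S.toMap.cell s = ofPath₀ r) :
    c.map (dCell₀ inv s) =
      ((ρ_ _).inv ≫ c.apex ◁ r ≫ (α_ _ _ _).inv) ≫ (c.natGen₂ f g).inv := by
  have h := c.nat_whiskerLeft (x := ⟨.one⟩) (y := ⟨.one⟩) (f := 𝟙 _) (g := path₂ f g)
    (Quot.mk _ (.gen s)) (toHom inv dPath)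
  exact eq_conj_ofPath₀ (c.natGen₂ f g)
    (((congrArg (_ ≫ ·) (c.nat_path₂ f g)).symm.trans h).trans
      (congrArg₂ (fun t t' => t ≫ c.apex ◁ t') (c.nat_nil (toHom inv dPath)) hr))

/-- The images under `c.map` of the two relations defining the 2-category with `0` adjoined. Each
factor becomes a whiskering of `c.descent` or of a 2-cell of `S`, conjugated by constraints that
cancel between consecutive factors. -/
theorem isDescent : S.IsDescent c.apex c.descent where
  assoc := by
    have h := congrArg (c.map (x := ⟨.three⟩) (p := toHom inv (dPath₂ .d1 .e2))
      (q := toHom inv (dPath₂ .d0 .e1))) (Quot.sound (.of .associativity))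
    have h' : c.map (thetaCellThen inv .e2 ≫ dCell inv .σ20 ≫ thetaCellThen inv .e0 ≫
        dCell inv .σ00) = c.map (dCell inv .σ21 ≫ thetaCellThen inv .e1) := h
    simp only [c.map_comp, c.map_thetaThen] at h'
    rw [c.map_dCell .σ20 rfl, c.map_dCell .σ00 rfl, c.map_dCell .σ21 rfl] at h'
    exact conj_comp_assoc _ _ _ _ _ _ h'
  unit := by
    have h := congrArg (c.map (x := ⟨.one⟩) (p := toHom inv dPath)
      (q := toHom inv (dPath₂ .d0 .s0))) (Quot.sound (.of .identity))
    have h' : c.map (dCell₀ inv .n1 ≫ thetaCellThen inv .s0) = c.map (dCell₀ inv .n0) := h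
    simp only [c.map_comp, c.map_thetaThen] at h'
    rw [c.map_dCell₀ .n1 rfl, c.map_dCell₀ .n0 rfl] at h'
    exact conj_comp_unit _ _ h'

theorem isIso_descent (h : inv = true) : IsIso c.descent := by
  have h₁ := congrArg c.map (thetaCell_inv h)
  have h₂ := congrArg c.map (thetaCellInv_comp h)
  rw [c.map_comp, c.map_id] at h₁ h₂
  have : IsIso (c.map (thetaCell inv)) := ⟨_, h₁, h₂⟩
  exact inferInstanceAs (IsIso ((c.natGen .d1 dPath).inv ≫ c.map (thetaCell inv) ≫
    (c.natGen .d0 dPath).hom))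

theorem square_theta_iff {c c' : DotCocone.{v} inv S.diagram.toPseudofunctor Z}
    (γ : c.apex ⟶ c'.apex) :
    Square γ (thetaCell inv) ↔ c.descent ≫ γ ▷ S.d0 = γ ▷ S.d1 ≫ c'.descent := by
  have h₁ := (extend_cons γ dPath .d1).trans
    (congrArg (fun t => (c.natEdge .d1 dPath).hom ≫ t ▷ _) (extend_d γ))
  have h₀ := (extend_cons γ dPath .d0).trans
    (congrArg (fun t => (c.natEdge .d0 dPath).hom ≫ t ▷ _) (extend_d γ))
  exact square_iff_conj (c.natGen .d1 dPath) (c'.natGen .d1 dPath) (c.natGen .d0 dPath)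
    (c'.natGen .d0 dPath) (natural_conj (λ_ S.d1) (c.natEdge .d1 dPath) (c'.natEdge .d1 dPath) h₁)
    (natural_conj (λ_ S.d0) (c.natEdge .d0 dPath) (c'.natEdge .d0 dPath) h₀)

/-- The component of a morphism of cocones at `d`. -/
def Hom.apex {c c' : DotCocone.{v} inv S.diagram.toPseudofunctor Z} (t : Hom c c') :
    c.apex ⟶ c'.apex := t.app (toHom inv dPath)

theorem Hom.descent_apex {c c' : DotCocone.{v} inv S.diagram.toPseudofunctor Z} (t : Hom c c') :
    c.descent ≫ t.apex ▷ S.d0 = t.apex ▷ S.d1 ≫ c'.descent :=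
  (square_iff_conj (c.natGen .d1 dPath) (c'.natGen .d1 dPath) (c.natGen .d0 dPath)
    (c'.natGen .d0 dPath)
    (natural_conj (λ_ S.d1) (c.natEdge .d1 dPath) (c'.natEdge .d1 dPath)
      (t.comm (edge .d1) (toHom inv dPath)))
    (natural_conj (λ_ S.d0) (c.natEdge .d0 dPath) (c'.natEdge .d0 dPath)
      (t.comm (edge .d0) (toHom inv dPath)))).1 (t.naturality (thetaCell inv))

/-- With `Hom.ext_of_d` and `Hom.descent_apex`, morphisms of cocones are exactly the 2-cells at `d`
compatible with the descent cells. -/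
theorem exists_hom_apex {c c' : DotCocone.{v} inv S.diagram.toPseudofunctor Z}
    (γ : c.apex ⟶ c'.apex) (h : c.descent ≫ γ ▷ S.d0 = γ ▷ S.d1 ≫ c'.descent) :
    ∃ t : Hom c c', t.apex = γ :=
  ⟨homMk γ ((square_theta_iff γ).2 h), extend_d γ⟩

end DotCocone
end Coherence
end LaxCoh

namespace LaxCoh
open CategoryTheory Bicategory
open Quiver (Path)

/-! ### Every descent datum comes from a cocone. -/

section Realization

variable {K : Type u₁} [Bicategory.{w₁, v₁} K]

namespace CoherenceData

variable (S : CoherenceData K) {Z : K} {F : Z ⟶ S.one} {ϑ : F ≫ S.d1 ⟶ F ≫ S.d0}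

/-- The action on vertices of the extension to `Δ̇`. -/
def dotVertex (Z : K) : DotObj → K
  | .zero => Z
  | .up x => S.vertex x

/-- The action on generating 1-cells of the extension to `Δ̇`. -/
def dotArrow (F : Z ⟶ S.one) : ∀ {x y : DotObj}, DotArr.{v} x y →
    (S.dotVertex Z x ⟶ S.dotVertex Z y)
  | _, _, .d => F
  | _, _, .up e => S.arrow e

/-- The map of computads extending `S` to `Δ̇`. -/
def dotToMap (F : Z ⟶ S.one) (ϑ : F ≫ S.d1 ⟶ F ≫ S.d0) (inv : Bool)
    (ϑInv : inv = true → (F ≫ S.d0 ⟶ F ≫ S.d1)) :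
    (dotComputad.{v} inv).Map K where
  obj := S.dotVertex Z
  map e := S.dotArrow F e
  cell
    | .up .σ00 => ofPath₂ S.σ00
    | .up .σ20 => ofPath₂ S.σ20
    | .up .σ21 => ofPath₂ S.σ21
    | .up .n0 => ofPath₀ S.n0
    | .up .n1 => ofPath₀ S.n1
    | .ϑ => ofPath₂ ϑ
    | .ϑInv h => ofPath₂ (ϑInv h)

section Strict

variable [Strict K] {a b d e : K}

/-- Interpreting a path inserts identity 1-cells. This lemma and the next ones replace the resulting
equalities of 1-cells by unitors and associators, to which coherence applies. -/
theorem eqToHom_conj_whiskerRight {f f' : a ⟶ b} (s : f ⟶ f') (g : b ⟶ d)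
    (h : f ≫ g = f ≫ 𝟙 b ≫ g) (h' : f' ≫ 𝟙 b ≫ g = f' ≫ g) :
    eqToHom h ≫ s ▷ (𝟙 b ≫ g) ≫ eqToHom h' = s ▷ g := by
  have e : eqToHom h = f ◁ (λ_ g).inv := by
    simp [Strict.leftUnitor_eqToIso, whiskerLeft_eqToHom]
  have e' : eqToHom h' = f' ◁ (λ_ g).hom := by
    simp [Strict.leftUnitor_eqToIso, whiskerLeft_eqToHom]
  rw [e, e', ← whisker_exchange]
  simp

theorem eqToHom_conj_whiskerLeft₂ {b' : K} (F : a ⟶ b) {f : b ⟶ d} {g : d ⟶ e} {f' : b ⟶ b'}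
    {g' : b' ⟶ e} (s : f ≫ g ⟶ f' ≫ g')
    (h : ((𝟙 a ≫ F) ≫ f) ≫ g = (𝟙 a ≫ F) ≫ (𝟙 b ≫ f) ≫ g)
    (h' : (𝟙 a ≫ F) ≫ (𝟙 b ≫ f') ≫ g' = ((𝟙 a ≫ F) ≫ f') ≫ g') :
    eqToHom h ≫ (𝟙 a ≫ F) ◁ ofPath₂ s ≫ eqToHom h' =
      (λ_ F).hom ▷ f ▷ g ≫ ((α_ _ _ _).hom ≫ F ◁ s ≫ (α_ _ _ _).inv) ≫ (λ_ F).inv ▷ f' ▷ g' := by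
  have e : eqToHom h = (α_ _ _ _).hom ≫ (𝟙 a ≫ F) ◁ (λ_ f).inv ▷ g := by
    simp [Strict.leftUnitor_eqToIso, Strict.associator_eqToIso, whiskerLeft_eqToHom,
      eqToHom_whiskerRight]
  have e' : eqToHom h' = (𝟙 a ≫ F) ◁ (λ_ f').hom ▷ g' ≫ (α_ _ _ _).inv := by
    simp [Strict.leftUnitor_eqToIso, Strict.associator_eqToIso, whiskerLeft_eqToHom,
      eqToHom_whiskerRight]
  rw [e, e', ofPath₂]
  bicategory

theorem eqToHom_conj_whiskerLeft₀ (F : a ⟶ b) {f : b ⟶ d} {g : d ⟶ b} (s : 𝟙 b ⟶ f ≫ g)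
    (h : 𝟙 a ≫ F = (𝟙 a ≫ F) ≫ 𝟙 b)
    (h' : (𝟙 a ≫ F) ≫ (𝟙 b ≫ f) ≫ g = ((𝟙 a ≫ F) ≫ f) ≫ g) :
    eqToHom h ≫ (𝟙 a ≫ F) ◁ ofPath₀ s ≫ eqToHom h' =
      (λ_ F).hom ≫ ((ρ_ _).inv ≫ F ◁ s ≫ (α_ _ _ _).inv) ≫ (λ_ F).inv ▷ f ▷ g := by
  have e : eqToHom h = (ρ_ _).inv := by
    simp [Strict.rightUnitor_eqToIso]
  have e' : eqToHom h' = (𝟙 a ≫ F) ◁ (λ_ f).hom ▷ g ≫ (α_ _ _ _).inv := by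
    simp [Strict.leftUnitor_eqToIso, Strict.associator_eqToIso, whiskerLeft_eqToHom,
      eqToHom_whiskerRight]
  rw [e, e', ofPath₀]
  bicategory

theorem eqToHom_unit {f k : a ⟶ b} {i : b ⟶ b} (h : k = f ≫ i) (h' : i = 𝟙 b) (h'' : k = f) :
    (eqToIso h).hom ≫ f ◁ (eqToIso h').hom ≫ (ρ_ f).hom = eqToHom h'' := by
  simp [Strict.rightUnitor_eqToIso, whiskerLeft_eqToHom]

theorem eqToHom_assoc {f : a ⟶ b} {x : b ⟶ d} {y : d ⟶ e} {z : b ⟶ e} {k k' : a ⟶ e} {l : a ⟶ d}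
    (h : k = f ≫ z) (h' : z = x ≫ y) (h₁ : k = k') (h₂ : k' = l ≫ y) (h₃ : l = f ≫ x) :
    (eqToIso h).hom ≫ f ◁ (eqToIso h').hom ≫ (α_ f x y).inv =
      eqToHom h₁ ≫ (eqToIso h₂).hom ≫ (eqToIso h₃).hom ▷ y := by
  simp [Strict.associator_eqToIso, whiskerLeft_eqToHom, eqToHom_whiskerRight]

theorem eqToIso_whiskerLeftIso {f : a ⟶ b} {g : b ⟶ d} (h : f ≫ g = f ≫ 𝟙 b ≫ g) :
    eqToIso h ≪≫ whiskerLeftIso f (λ_ g) = Iso.refl _ := by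
  ext
  simp [Strict.leftUnitor_eqToIso, whiskerLeft_eqToHom]

theorem ofPath₂_conj {F : a ⟶ b} {g g' : b ⟶ d} (s : F ≫ g ⟶ F ≫ g')
    (h : (𝟙 a ≫ F) ≫ g = (𝟙 a ≫ F) ≫ 𝟙 b ≫ g) (h' : (𝟙 a ≫ F) ≫ g' = (𝟙 a ≫ F) ≫ 𝟙 b ≫ g') :
    ((eqToIso h ≪≫ whiskerLeftIso _ (λ_ g)).inv ≫ ofPath₂ s ≫
      (eqToIso h' ≪≫ whiskerLeftIso _ (λ_ g')).hom) ≫ (λ_ F).hom ▷ g' = (λ_ F).hom ▷ g ≫ s := by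
  rw [eqToIso_whiskerLeftIso, eqToIso_whiskerLeftIso, ofPath₂]
  simp only [Iso.refl_hom, Iso.refl_inv, Category.id_comp, Category.comp_id, Category.assoc,
    inv_hom_whiskerRight]

end Strict

theorem conj_assoc {C : Type u} [Category.{v} C] {k₁ k₂ k₃ k₄ k₅ k₆ l₁ l₂ l₃ l₄ l₅ l₆ : C}
    (n₁ : k₁ ≅ l₁) (n₂ : k₂ ≅ l₂) (n₃ : k₃ ≅ l₃) (n₄ : k₄ ≅ l₄) (n₅ : k₅ ≅ l₅) (n₆ : k₆ ≅ l₆)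
    {x₁ : l₁ ⟶ l₂} {x₂ : l₂ ⟶ l₃} {x₃ : l₃ ⟶ l₄} {x₄ : l₄ ⟶ l₅} {y₁ : l₁ ⟶ l₆} {y₂ : l₆ ⟶ l₅}
    (h : x₁ ≫ x₂ ≫ x₃ ≫ x₄ = y₁ ≫ y₂) :
    (n₁.hom ≫ x₁ ≫ n₂.inv) ≫ (n₂.hom ≫ x₂ ≫ n₃.inv) ≫ (n₃.hom ≫ x₃ ≫ n₄.inv) ≫
      (n₄.hom ≫ x₄ ≫ n₅.inv) = (n₁.hom ≫ y₁ ≫ n₆.inv) ≫ (n₆.hom ≫ y₂ ≫ n₅.inv) := by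
  simp [reassoc_of% h]

theorem congr_comp {C : Type u} [Category.{v} C] {a b d : C} {x x' : a ⟶ b} {y y' : b ⟶ d}
    (h : x = x') (h' : y = y') : x ≫ y = x' ≫ y' := by
  rw [h, h']

theorem conj_unit {C : Type u} [Category.{v} C] {k k₁ k₂ l l₁ l₂ : C} (n : k ≅ l) (n₁ : k₁ ≅ l₁)
    (n₂ : k₂ ≅ l₂) {x : l ⟶ l₁} {y : l₁ ⟶ l₂} {z : l ⟶ l₂} (h : x ≫ y = z) :
    (n.hom ≫ x ≫ n₁.inv) ≫ (n₁.hom ≫ y ≫ n₂.inv) = n.hom ≫ z ≫ n₂.inv := by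
  simp [reassoc_of% h]

section EqConj

variable {B : Type u} [Bicategory.{w, v} B] (G : StrictPseudofunctor B K)

theorem strict_map₂_whiskerLeft {a b d : B} (p : a ⟶ b) {q r : b ⟶ d} (s : q ⟶ r) :
    G.map₂ (p ◁ s) = eqToHom (G.map_comp p q) ≫ G.map p ◁ G.map₂ s ≫
      eqToHom (G.map_comp p r).symm := by
  rw [G.map₂_whisker_left, G.mapComp_eq_eqToIso, G.mapComp_eq_eqToIso]
  rfl

theorem strict_map₂_whiskerRight {a b d : B} {p q : a ⟶ b} (s : p ⟶ q) (r : b ⟶ d) :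
    G.map₂ (s ▷ r) = eqToHom (G.map_comp p r) ≫ G.map₂ s ▷ G.map r ≫
      eqToHom (G.map_comp q r).symm := by
  rw [G.map₂_whisker_right, G.mapComp_eq_eqToIso, G.mapComp_eq_eqToIso]
  rfl

theorem strict_map₂_eqToHom {a b : B} {p q : a ⟶ b} (h : p = q) :
    G.map₂ (eqToHom h) = eqToHom (congrArg G.map h) := by
  subst h
  exact G.map₂_id _

/-- Two 2-cells agree up to identities between equal 1-cells. -/
def EqConj {a b : K} {f g f' g' : a ⟶ b} (s : f ⟶ g) (s' : f' ⟶ g') : Prop :=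
  ∃ (h : f = f') (h' : g' = g), s = eqToHom h ≫ s' ≫ eqToHom h'

theorem EqConj.symm {a b : K} {f g f' g' : a ⟶ b} {s : f ⟶ g} {s' : f' ⟶ g'} (h : EqConj s s') :
    EqConj s' s := by
  obtain ⟨rfl, rfl, rfl⟩ := h
  exact ⟨rfl, rfl, by simp⟩

theorem EqConj.trans {a b : K} {f g f' g' f'' g'' : a ⟶ b} {s : f ⟶ g} {s' : f' ⟶ g'}
    {s'' : f'' ⟶ g''} (h : EqConj s s') (h' : EqConj s' s'') : EqConj s s'' := by
  obtain ⟨rfl, rfl, rfl⟩ := h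
  obtain ⟨rfl, rfl, rfl⟩ := h'
  exact ⟨rfl, rfl, by simp⟩

theorem EqConj.refl {a b : K} {f g : a ⟶ b} (s : f ⟶ g) : EqConj s s :=
  ⟨rfl, rfl, by simp⟩

theorem EqConj.of_eq {a b : K} {f g : a ⟶ b} {s s' : f ⟶ g} (h : s = s') : EqConj s s' :=
  h ▸ .refl s

theorem EqConj.comp_eqToIso {a b : K} {f g f' g' : a ⟶ b} {s : f ⟶ g} {s' : f' ⟶ g'}
    (h : EqConj s s') (e : g = g') (e' : f = f') :
    s ≫ (eqToIso e).hom = (eqToIso e').hom ≫ s' := by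
  obtain ⟨rfl, rfl, rfl⟩ := h
  simp

theorem EqConj.id {a b : K} {f f' : a ⟶ b} (h : f = f') : EqConj (𝟙 f) (𝟙 f') := by
  subst h
  exact .refl _

theorem EqConj.comp {a b : K} {f g k f' g' k' : a ⟶ b} {s : f ⟶ g} {s' : f' ⟶ g'}
    {t : g ⟶ k} {t' : g' ⟶ k'} (h : EqConj s s') (h' : EqConj t t') :
    EqConj (s ≫ t) (s' ≫ t') := by
  obtain ⟨rfl, rfl, rfl⟩ := h
  obtain ⟨_, rfl, rfl⟩ := h'
  exact ⟨rfl, rfl, by simp⟩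

theorem EqConj.whiskerLeft {a b d : K} {p p' : a ⟶ b} (hp : p = p') {f g f' g' : b ⟶ d}
    {s : f ⟶ g} {s' : f' ⟶ g'} (h : EqConj s s') : EqConj (p ◁ s) (p' ◁ s') := by
  obtain ⟨rfl, rfl, rfl⟩ := h
  subst hp
  exact ⟨rfl, rfl, by simp⟩

theorem EqConj.whiskerRight {a b d : K} {p p' : b ⟶ d} (hp : p = p') {f g f' g' : a ⟶ b}
    {s : f ⟶ g} {s' : f' ⟶ g'} (h : EqConj s s') : EqConj (s ▷ p) (s' ▷ p') := by
  obtain ⟨rfl, rfl, rfl⟩ := h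
  subst hp
  exact ⟨rfl, rfl, by simp⟩

theorem eqConj_whiskerLeft {a b d : B} (p : a ⟶ b) {q r : b ⟶ d} (s : q ⟶ r) :
    EqConj (G.map₂ (p ◁ s)) (G.map p ◁ G.map₂ s) :=
  ⟨_, _, strict_map₂_whiskerLeft G p s⟩

theorem eqConj_whiskerRight {a b d : B} {p q : a ⟶ b} (s : p ⟶ q) (r : b ⟶ d) :
    EqConj (G.map₂ (s ▷ r)) (G.map₂ s ▷ G.map r) :=
  ⟨_, _, strict_map₂_whiskerRight G s r⟩

theorem EqConj.map₂ {a b : B} {f g f' g' : a ⟶ b} {s : f ⟶ g} {s' : f' ⟶ g'}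
    (h : ∃ (h : f = f') (h' : g' = g), s = eqToHom h ≫ s' ≫ eqToHom h') :
    EqConj (G.map₂ s) (G.map₂ s') := by
  obtain ⟨rfl, rfl, rfl⟩ := h
  exact ⟨rfl, rfl, by simp⟩

end EqConj

variable [Strict K] {S}

theorem ev_thetaThen {inv : Bool} (ϑInv : inv = true → (F ≫ S.d0 ⟶ F ≫ S.d1)) {x : DeltaObj}
    (g : DeltaArr.{v} .two x) :
    (S.dotToMap F ϑ inv ϑInv).ev (thetaThen inv g) =
      (λ_ F).hom ▷ S.d1 ▷ S.arrow g ≫ ϑ ▷ S.arrow g ≫ (λ_ F).inv ▷ S.d0 ▷ S.arrow g := by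
  exact (eqToHom_conj_whiskerRight (ofPath₂ ϑ) (S.arrow g) _ _).trans
    ((comp_whiskerRight _ _ _).trans (congrArg (_ ≫ ·) (comp_whiskerRight _ _ _)))

/-- The relations hold because they are the descent equations conjugated by unitors, and because the
chosen 2-cell is inverse to `ϑ` when an inverse is adjoined. -/
theorem ev_rel {inv : Bool} (ϑInv : inv = true → (F ≫ S.d0 ⟶ F ≫ S.d1))
    (hϑ : S.IsDescent F ϑ) (h₁ : ∀ h, ϑ ≫ ϑInv h = 𝟙 _) (h₂ : ∀ h, ϑInv h ≫ ϑ = 𝟙 _)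
    {a b : DotObj} {p q : Path a b} (x y : Formal (dotComputad.{v} inv) p q) (h : DotRel inv x y) :
    (S.dotToMap F ϑ inv ϑInv).ev x = (S.dotToMap F ϑ inv ϑInv).ev y := by
  cases h with
  | associativity =>
    have e := conj_assoc (whiskerRightIso (whiskerRightIso (λ_ F) S.d1) S.e2)
      (whiskerRightIso (whiskerRightIso (λ_ F) S.d0) S.e2)
      (whiskerRightIso (whiskerRightIso (λ_ F) S.d1) S.e0)
      (whiskerRightIso (whiskerRightIso (λ_ F) S.d0) S.e0)
      (whiskerRightIso (whiskerRightIso (λ_ F) S.d0) S.e1)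
      (whiskerRightIso (whiskerRightIso (λ_ F) S.d1) S.e1) hϑ.assoc
    exact (congr_comp (ev_thetaThen ϑInv .e2) (congr_comp (eqToHom_conj_whiskerLeft₂ F S.σ20 _ _)
      (congr_comp (ev_thetaThen ϑInv .e0) (eqToHom_conj_whiskerLeft₂ F S.σ00 _ _)))).trans
      (e.trans (congr_comp (eqToHom_conj_whiskerLeft₂ F S.σ21 _ _) (ev_thetaThen ϑInv .e1)).symm)
  | identity =>
    have e := conj_unit (λ_ F) (whiskerRightIso (whiskerRightIso (λ_ F) S.d1) S.s0)
      (whiskerRightIso (whiskerRightIso (λ_ F) S.d0) S.s0) hϑ.unit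
    exact (congr_comp (eqToHom_conj_whiskerLeft₀ F S.n1 _ _) (ev_thetaThen ϑInv .s0)).trans
      (e.trans (eqToHom_conj_whiskerLeft₀ F S.n0 _ _).symm)
  | hom_inv h =>
    refine Eq.trans (b := ofPath₂ ϑ ≫ ofPath₂ (ϑInv h)) rfl (Eq.trans ?_ (b := 𝟙 _) rfl)
    simp [ofPath₂, reassoc_of% (h₁ h)]
  | inv_hom h =>
    refine Eq.trans (b := ofPath₂ (ϑInv h) ≫ ofPath₂ ϑ) rfl (Eq.trans ?_ (b := 𝟙 _) rfl)
    simp [ofPath₂, reassoc_of% (h₂ h)]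

section

variable {inv : Bool} (ϑInv : inv = true → (F ≫ S.d0 ⟶ F ≫ S.d1))
    (hϑ : S.IsDescent F ϑ) (h₁ : ∀ h, ϑ ≫ ϑInv h = 𝟙 _) (h₂ : ∀ h, ϑInv h ≫ ϑ = 𝟙 _)

/-- The extension of the diagram to `Δ̇` given by descent data. -/
def dotDiagram : StrictPseudofunctor (Dot.{v} inv) K :=
  (S.dotToMap F ϑ inv ϑInv).lift _ (ev_rel ϑInv hϑ h₁ h₂)

theorem dotDiagram_map {x y : DeltaObj} (f : Path.{v} x y) :
    (dotDiagram ϑInv hϑ h₁ h₂).map ((dotIncl inv).map (X := ⟨x⟩) (Y := ⟨y⟩) f) =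
      S.diagram.map (X := ⟨x⟩) (Y := ⟨y⟩) f := by
  induction f with
  | nil => rfl
  | cons f e ih => exact congrArg (· ≫ S.arrow e) ih

/-- The extension agrees with the diagram on 1-cells only up to propositional equality, so 2-cells
are compared by `EqConj`, which is stable under all the operations forming them. -/
theorem dotDiagram_map₂ {x y : DeltaL.{v}} {f g : x ⟶ y} (θ : f ⟶ g) :
    EqConj ((dotDiagram ϑInv hϑ h₁ h₂).map₂ ((dotIncl inv).map₂ θ)) (S.diagram.map₂ θ) := by
  induction θ using Presented.cell_induction with
  | gen x =>
    cases x with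
    | σ00 => exact EqConj.refl (ofPath₂ S.σ00)
    | σ20 => exact EqConj.refl (ofPath₂ S.σ20)
    | σ21 => exact EqConj.refl (ofPath₂ S.σ21)
    | n0 => exact EqConj.refl (ofPath₀ S.n0)
    | n1 => exact EqConj.refl (ofPath₀ S.n1)
  | id p => exact .id (dotDiagram_map ϑInv hϑ h₁ h₂ p)
  | comp s t hs ht =>
    refine (EqConj.of_eq ?_).trans
      ((EqConj.comp hs ht).trans (EqConj.of_eq (S.diagram.map₂_comp s t).symm))
    rw [(dotIncl inv).map₂_comp]
    exact (dotDiagram ϑInv hϑ h₁ h₂).map₂_comp _ _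
  | whiskerLeft p s hs =>
    exact (EqConj.map₂ _ (eqConj_whiskerLeft (dotIncl inv) p s)).trans
      ((eqConj_whiskerLeft _ _ _).trans
        ((EqConj.whiskerLeft (dotDiagram_map ϑInv hϑ h₁ h₂ p) hs).trans
          (eqConj_whiskerLeft S.diagram p s).symm))
  | whiskerRight s r hs =>
    exact (EqConj.map₂ _ (eqConj_whiskerRight (dotIncl inv) s r)).trans
      ((eqConj_whiskerRight _ _ _).trans
        ((EqConj.whiskerRight (dotDiagram_map ϑInv hϑ h₁ h₂ r) hs).trans
          (eqConj_whiskerRight S.diagram s r).symm))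

/-- The cocone given by descent data. -/
def cocone : DotCocone.{v} inv S.diagram.toPseudofunctor Z where
  obj p := (dotDiagram ϑInv hϑ h₁ h₂).map p
  map s := (dotDiagram ϑInv hϑ h₁ h₂).map₂ s
  map_id p := (dotDiagram ϑInv hϑ h₁ h₂).map₂_id p
  map_comp s t := (dotDiagram ϑInv hϑ h₁ h₂).map₂_comp s t
  nat f p := eqToIso (((dotDiagram ϑInv hϑ h₁ h₂).map_comp p ((dotIncl inv).map f)).trans
    (congrArg ((dotDiagram ϑInv hϑ h₁ h₂).map p ≫ ·) (dotDiagram_map ϑInv hϑ h₁ h₂ f)))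
  nat_whiskerRight f _ _ s :=
    ((eqConj_whiskerRight (dotDiagram ϑInv hϑ h₁ h₂) s ((dotIncl inv).map f)).trans
      (EqConj.whiskerRight (dotDiagram_map ϑInv hϑ h₁ h₂ f) (.refl _))).comp_eqToIso _ _
  nat_whiskerLeft θ p :=
    ((eqConj_whiskerLeft (dotDiagram ϑInv hϑ h₁ h₂) p ((dotIncl inv).map₂ θ)).trans
      (EqConj.whiskerLeft rfl (dotDiagram_map₂ ϑInv hϑ h₁ h₂ θ))).comp_eqToIso _ _
  nat_id {x} p := by
    rw [DotCocone.incl_mapId_unitor, strict_map₂_eqToHom, S.diagram.mapId_eq_eqToIso]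
    exact eqToHom_unit _ _ _
  nat_comp f g p := by
    rw [DotCocone.incl_mapComp_assoc, strict_map₂_eqToHom, S.diagram.mapComp_eq_eqToIso]
    exact eqToHom_assoc _ _ _ _ _

/-- A descent datum extends the 2-functor of `S` to one with value `Z` at `0`; its action on arrows
out of `0` is the cocone. The arrow `d` is sent to `𝟙 ≫ F`, whence the unitor as comparison. -/
theorem exists_cocone (hϑ : S.IsDescent F ϑ) (h : inv = true → IsIso ϑ) :
    ∃ (c : DotCocone.{v} inv S.diagram.toPseudofunctor Z) (i : c.apex ≅ F),
      c.descent ≫ i.hom ▷ S.d0 = i.hom ▷ S.d1 ≫ ϑ := by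
  refine ⟨cocone (fun h' => have := h h'; CategoryTheory.inv ϑ) hϑ (fun h' => ?_) (fun h' => ?_),
    λ_ F, ?_⟩
  · have := h h'
    exact IsIso.hom_inv_id ϑ
  · have := h h'
    exact IsIso.inv_hom_id ϑ
  · exact ofPath₂_conj ϑ _ _

end

end CoherenceData
end Realization
end LaxCoh

namespace LaxCoh
open CategoryTheory Bicategory
open Opposite Bicategory.Opposite
open scoped Pseudofunctor.StrongTrans

/-! ### Pseudonatural transformations out of the weights as cocones. -/

section Weights

theorem op2_eqToIso {A : Type u} [Bicategory.{w, v} A] {a b : A} {f g : a ⟶ b} (h : f = g) :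
    (eqToIso h).op2 = eqToIso (congrArg Quiver.Hom.op h) := by
  subst h
  rfl

theorem eqToIso_symm {C : Type u} [Category.{v} C] {a b : C} (h : a = b) :
    (eqToIso h).symm = eqToIso h.symm := by
  subst h
  rfl

instance strict_op {A : Type u} [Bicategory.{w, v} A] [Strict A] : Strict Aᵒᵖ where
  id_comp f := congrArg Quiver.Hom.op (Strict.comp_id f.unop)
  comp_id f := congrArg Quiver.Hom.op (Strict.id_comp f.unop)
  assoc f g h := congrArg Quiver.Hom.op (Strict.assoc h.unop g.unop f.unop).symm
  leftUnitor_eqToIso f :=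
    (congrArg Iso.op2 (Strict.rightUnitor_eqToIso f.unop)).trans (op2_eqToIso _)
  rightUnitor_eqToIso f :=
    (congrArg Iso.op2 (Strict.leftUnitor_eqToIso f.unop)).trans (op2_eqToIso _)
  associator_eqToIso f g h :=
    (congrArg (fun i => (Iso.op2 i).symm) (Strict.associator_eqToIso h.unop g.unop f.unop)).trans
      ((congrArg Iso.symm (op2_eqToIso _)).trans (eqToIso_symm _))

variable {A : Type u} [Bicategory.{v, v} A]

/-- The weights `Δ̇_ℓ(0, t -)` and `Δ̇(0, j -)`. -/
abbrev dotWeight (inv : Bool) : DeltaL.{v} ⥤ᵖ Cat.{v, v} :=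
  (dotIncl inv).toPseudofunctor.comp (corep (⟨.zero⟩ : Dot.{v} inv))

variable {inv : Bool} {D : DeltaL.{v} ⥤ᵖ Aᵒᵖ} {Z : A}

theorem comp_ids {C : Type u} [Category.{v} C] {a b d e : C} (x : a ⟶ b) (y : b ⟶ d) (z : d ⟶ e) :
    x ≫ 𝟙 b ≫ y ≫ 𝟙 d ≫ z ≫ 𝟙 e = x ≫ y ≫ z := by
  simp

/-- The cocone underlying a pseudonatural transformation. -/
def toCocone (l : dotWeight inv ⟶ homInto D Z) : DotCocone inv D (op Z) where
  obj {x} p := Quiver.Hom.op ((l.app x).toFunctor.obj p)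
  map {x} _ _ s := op2 ((l.app x).toFunctor.map s)
  map_id {x} p := congrArg op2 ((l.app x).toFunctor.map_id p)
  map_comp {x} _ _ _ s t := congrArg op2 ((l.app x).toFunctor.map_comp s t)
  nat f p := Iso.op2 ((Cat.Hom.toNatIso (l.naturality f)).app p)
  nat_whiskerRight f _ _ s := congrArg op2 ((l.naturality f).hom.toNatTrans.naturality s)
  nat_whiskerLeft θ p :=
    congrArg (fun t => op2 (t.toNatTrans.app p)) (l.naturality_naturality θ)
  nat_id {x} p :=
    (congrArg (fun t => op2 (t.toNatTrans.app p)) (l.naturality_id x)).trans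
      (congrArg (fun t => op2 t) ((congrArg (_ ≫ ·) (Category.comp_id _)).trans
          (Category.comp_id _)))
  nat_comp f g p :=
    (congrArg (fun t => op2 (t.toNatTrans.app p)) (l.naturality_comp f g)).trans
      (congrArg (fun t => op2 t) (comp_ids _ _ _))

/-- The pseudonatural transformation underlying a cocone. -/
def ofCocone (c : DotCocone inv D (op Z)) : dotWeight inv ⟶ homInto D Z where
  app x := Functor.toCatHom
    { obj p := (c.obj p).unop
      map s := (c.map s).unop2
      map_id p := congrArg Hom2.unop2 (c.map_id p)
      map_comp s t := congrArg Hom2.unop2 (c.map_comp s t) }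
  naturality f := Cat.Hom.isoMk (NatIso.ofComponents (fun p => (c.nat f p).unop2)
    (fun s => congrArg Hom2.unop2 (c.nat_whiskerRight f s)))
  naturality_naturality θ := by
    ext p
    exact congrArg Hom2.unop2 (c.nat_whiskerLeft θ p)
  naturality_id x := by
    ext p
    exact (congrArg Hom2.unop2 (c.nat_id p)).trans
      ((congrArg (_ ≫ ·) (Category.comp_id _)).trans (Category.comp_id _)).symm
  naturality_comp f g := by
    ext p
    exact (congrArg Hom2.unop2 (c.nat_comp f g p)).trans (comp_ids _ _ _).symm

/-- The morphism of cocones underlying a modification. -/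
def toCoconeHom {l l' : dotWeight inv ⟶ homInto D Z} (t : l ⟶ l') :
    DotCocone.Hom (toCocone l) (toCocone l') where
  app {x} p := op2 ((t.as.app x).toNatTrans.app p)
  naturality {x} _ _ s := congrArg op2 ((t.as.app x).toNatTrans.naturality s)
  comm f p := by
    have h := congrArg (fun s => op2 (s.toNatTrans.app p)) (t.as.naturality f)
    exact h

/-- The modification underlying a morphism of cocones. -/
def ofCoconeHom {l l' : dotWeight inv ⟶ homInto D Z}
    (t : DotCocone.Hom (toCocone l) (toCocone l')) : l ⟶ l' where
  as :=
    { app x := NatTrans.toCatHom₂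
        { app p := (t.app p).unop2
          naturality _ _ s := congrArg Hom2.unop2 (t.naturality s) }
      naturality f := by
        ext p
        exact congrArg Hom2.unop2 (t.comm f p) }

end Weights

/-! ### The universal property of codescent objects in terms of descent data. -/

section Universal

variable {A : Type u} [Bicategory.{v, v} A] [Strict A] {S : CoherenceData Aᵒᵖ} {inv : Bool} {C : A}

/-- The underlying 1-cell of the descent data of a cocone. -/
def leg (l : dotWeight.{v} inv ⟶ homInto S.diagram.toPseudofunctor C) : S.one.unop ⟶ C :=
  (toCocone l).apex.unop

/-- The underlying 2-cell of the descent data of a cocone. -/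
def legCell (l : dotWeight.{v} inv ⟶ homInto S.diagram.toPseudofunctor C) :
    S.d1.unop ≫ leg l ⟶ S.d0.unop ≫ leg l :=
  (toCocone l).descent.unop2

variable {X : A}

theorem whisker_conj_aux {a b d e : A} {g m g' m' : a ⟶ b} {F : b ⟶ d} {h : d ⟶ e} {o o' : a ⟶ d}
    (n : o ≅ m ≫ F) (r : m ≅ g) (n' : o' ≅ m' ≫ F) (r' : m' ≅ g') (t : o ⟶ o')
    (N : o ≫ h ≅ m ≫ F ≫ h) (N' : o' ≫ h ≅ m' ≫ F ≫ h) (hN : N.hom = n.hom ▷ h ≫ (α_ _ _ _).hom)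
    (hN' : N'.hom = n'.hom ▷ h ≫ (α_ _ _ _).hom) :
    (N ≪≫ whiskerRightIso r (F ≫ h)).inv ≫ t ▷ h ≫ (N' ≪≫ whiskerRightIso r' (F ≫ h)).hom =
      (α_ _ _ _).inv ≫ ((n ≪≫ whiskerRightIso r F).inv ≫ t ≫
        (n' ≪≫ whiskerRightIso r' F).hom) ▷ h ≫ (α_ _ _ _).hom := by
  obtain rfl : N = whiskerRightIso n h ≪≫ α_ _ _ _ := Iso.ext hN
  obtain rfl : N' = whiskerRightIso n' h ≪≫ α_ _ _ _ := Iso.ext hN'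
  simp

theorem naturality_comp_aux {C : Type u} [Category.{v} C] {a b d : C} (x : a ⟶ b) (y : b ⟶ d) :
    𝟙 a ≫ x ≫ 𝟙 b ≫ y ≫ 𝟙 d = x ≫ y := by
  simp

theorem legCell_comp (l : dotWeight.{v} inv ⟶ homInto S.diagram.toPseudofunctor C) (h : C ⟶ X) :
    legCell (l ≫ homIntoMap _ h) = (α_ _ _ _).inv ≫ legCell l ▷ h ≫ (α_ _ _ _).hom :=
  whisker_conj_aux ((toCocone l).natEdge .d1 dPath).unop2 (ρ_ S.d1.unop)
    ((toCocone l).natEdge .d0 dPath).unop2 (ρ_ S.d0.unop)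
    ((toCocone l).map (DotCocone.thetaCell inv)).unop2
    ((toCocone (l ≫ homIntoMap _ h)).natEdge .d1 dPath).unop2
    ((toCocone (l ≫ homIntoMap _ h)).natEdge .d0 dPath).unop2
    (naturality_comp_aux _ _) (naturality_comp_aux _ _)

theorem legCell_isIso (l : dotWeight.{v} inv ⟶ homInto S.diagram.toPseudofunctor C)
    (h : inv = true) : IsIso (legCell l) := by
  have := (toCocone l).isIso_descent h
  exact inferInstanceAs (IsIso ((unopFunctor _ _).map (toCocone l).descent))

variable {l : dotWeight.{v} inv ⟶ homInto S.diagram.toPseudofunctor C}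

/-- Existence is fullness and uniqueness is faithfulness of the comparison functor, because a
modification is determined by its component at `d`, which for the image of `t` is `leg l ◁ t`. -/
theorem existsUnique_of_compatible (hl : (comparison _ _ l X).IsEquivalence) {h k : C ⟶ X}
    (γ : leg l ≫ h ⟶ leg l ≫ k)
    (hγ : legCell (l ≫ homIntoMap _ h) ≫ S.d0.unop ◁ γ =
      S.d1.unop ◁ γ ≫ legCell (l ≫ homIntoMap _ k)) :
    ∃! t : h ⟶ k, leg l ◁ t = γ := by
  obtain ⟨t, ht⟩ := DotCocone.exists_hom_apex (c := toCocone (l ≫ homIntoMap _ h))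
    (c' := toCocone (l ≫ homIntoMap _ k)) (op2 γ) (congrArg op2 hγ)
  obtain ⟨s, hs⟩ := (comparison _ _ l X).map_surjective (ofCoconeHom t)
  refine ⟨s, ?_, fun s' hs' => ?_⟩
  · have e := congrArg (fun t => (toCoconeHom t).apex.unop2) hs
    exact e.trans (congrArg Hom2.unop2 ht)
  · apply (comparison _ _ l X).map_injective
    have e : toCoconeHom ((comparison _ _ l X).map s') = toCoconeHom ((comparison _ _ l X).map s) :=
      DotCocone.Hom.ext_of_d ((congrArg op2 hs').trans
        ((congrArg (fun t => (toCoconeHom t).apex) hs).trans ht).symm)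
    exact congrArg ofCoconeHom e

theorem compatible_comp {a b d : A} {f g : a ⟶ b} {F F' F'' : b ⟶ d} {ϑ : f ≫ F ⟶ g ≫ F}
    {ϑ' : f ≫ F' ⟶ g ≫ F'} {ϑ'' : f ≫ F'' ⟶ g ≫ F''} {x : F ⟶ F'} {y : F' ⟶ F''}
    (h : ϑ ≫ g ◁ x = f ◁ x ≫ ϑ') (h' : ϑ' ≫ g ◁ y = f ◁ y ≫ ϑ'') :
    ϑ ≫ g ◁ (x ≫ y) = f ◁ (x ≫ y) ≫ ϑ'' := by
  rw [whiskerLeft_comp, whiskerLeft_comp, Category.assoc, reassoc_of% h, h']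

/-- Essential surjectivity of the comparison functor, applied to the cocone realising the descent
datum. -/
theorem exists_of_isDescent (hl : (comparison _ _ l X).IsEquivalence) (F : S.one.unop ⟶ X)
    (ϑ : S.d1.unop ≫ F ⟶ S.d0.unop ≫ F) (hϑ : S.IsDescent F.op (op2 ϑ))
    (hinv : inv = true → IsIso ϑ) :
    ∃ (h : C ⟶ X) (i : leg l ≫ h ≅ F),
      legCell (l ≫ homIntoMap _ h) ≫ S.d0.unop ◁ i.hom = S.d1.unop ◁ i.hom ≫ ϑ := by
  obtain ⟨c, i, hi⟩ := CoherenceData.exists_cocone (inv := inv) hϑ (fun h =>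
    have := hinv h
    inferInstanceAs (IsIso ((opFunctor _ _).map ϑ)))
  have := hl.essSurj
  let e := (comparison _ _ l X).objObjPreimageIso (ofCocone c)
  let i' : leg l ≫ (comparison _ _ l X).objPreimage (ofCocone c) ≅ c.apex.unop :=
    { hom := (toCoconeHom e.hom).apex.unop2
      inv := (toCoconeHom e.inv).apex.unop2
      hom_inv_id := congrArg (fun t => (toCoconeHom t).apex.unop2) e.hom_inv_id
      inv_hom_id := congrArg (fun t => (toCoconeHom t).apex.unop2) e.inv_hom_id }
  exact ⟨_, i' ≪≫ i.unop2, compatible_comp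
    (congrArg Hom2.unop2 (toCoconeHom e.hom).descent_apex) (congrArg Hom2.unop2 hi)⟩

end Universal
end LaxCoh

namespace LaxCoh
open CategoryTheory Bicategory
open Opposite Bicategory.Opposite
open scoped Pseudofunctor.StrongTrans

/-! ### The free resolution of a lax algebra and the theorem. -/

section Resolution

section Conjugation

variable {C : Type u} [Category.{v} C] {a b d e : C}

theorem conj_injective (i : a ≅ b) (j : e ≅ d) {x y : b ⟶ d}
    (h : i.hom ≫ x ≫ j.inv = i.hom ≫ y ≫ j.inv) : x = y := by simpa using h

theorem conj_eq (i : a ≅ b) (j : e ≅ d) {s : a ⟶ e} {x : b ⟶ d}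
    (h : i.inv ≫ s ≫ j.hom = x) : i.hom ≫ x ≫ j.inv = s := by
  subst h
  simp

end Conjugation

section Abstract

variable {B : Type u} [Bicategory.{w, v} B]

/-- Reversing 1-cells in `IsDescent` gives the first equation; it differs from `DescentAssoc` only
by associators. -/
theorem descent_assoc_regroup_iff {x₃ x₂ x₁ z : B} {e0 e1 e2 : x₃ ⟶ x₂} {d0 d1 : x₂ ⟶ x₁}
    {F : x₁ ⟶ z}
    (ϑ : d1 ≫ F ⟶ d0 ≫ F) (σ00 : e0 ≫ d0 ⟶ e1 ≫ d0) (σ20 : e2 ≫ d0 ⟶ e0 ≫ d1)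
    (σ21 : e2 ≫ d1 ⟶ e1 ≫ d1) :
    e2 ◁ ϑ ≫ ((α_ _ _ _).inv ≫ σ20 ▷ F ≫ (α_ _ _ _).hom) ≫ e0 ◁ ϑ ≫
        ((α_ _ _ _).inv ≫ σ00 ▷ F ≫ (α_ _ _ _).hom) =
      ((α_ _ _ _).inv ≫ σ21 ▷ F ≫ (α_ _ _ _).hom) ≫ e1 ◁ ϑ ↔
    e2 ◁ ϑ ≫ (α_ _ _ _).inv ≫ σ20 ▷ F ≫ (α_ _ _ _).hom ≫ e0 ◁ ϑ ≫ (α_ _ _ _).inv ≫ σ00 ▷ F =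
      (α_ _ _ _).inv ≫ σ21 ▷ F ≫ (α_ _ _ _).hom ≫ e1 ◁ ϑ ≫ (α_ _ _ _).inv := by
  rw [← cancel_mono (α_ e1 d0 F).inv]
  simp only [Category.assoc, Iso.hom_inv_id, Category.comp_id]

theorem descent_unit_regroup_iff {x₂ x₁ z : B} {s0 : x₁ ⟶ x₂} {d0 d1 : x₂ ⟶ x₁} {F : x₁ ⟶ z}
    (ϑ : d1 ≫ F ⟶ d0 ≫ F) (n0 : 𝟙 x₁ ⟶ s0 ≫ d0) (n1 : 𝟙 x₁ ⟶ s0 ≫ d1) :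
    ((λ_ F).inv ≫ n1 ▷ F ≫ (α_ _ _ _).hom) ≫ s0 ◁ ϑ = (λ_ F).inv ≫ n0 ▷ F ≫ (α_ _ _ _).hom ↔
      n1 ▷ F ≫ (α_ _ _ _).hom ≫ s0 ◁ ϑ = n0 ▷ F ≫ (α_ _ _ _).hom := by
  rw [Category.assoc, cancel_epi, Category.assoc]

theorem compatible_whiskerLeft {x₂ x₁ z z' : B} {d0 d1 : x₂ ⟶ x₁} {F : x₁ ⟶ z}
    (ϑ : d1 ≫ F ⟶ d0 ≫ F) {h k : z ⟶ z'} (t : h ⟶ k) :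
    d1 ◁ F ◁ t ≫ (α_ _ _ _).inv ≫ ϑ ▷ k ≫ (α_ _ _ _).hom =
      ((α_ _ _ _).inv ≫ ϑ ▷ h ≫ (α_ _ _ _).hom) ≫ d0 ◁ F ◁ t := by
  have e := whisker_exchange ϑ t
  simp only [comp_whiskerLeft, Category.assoc] at e
  rw [← Iso.eq_inv_comp] at e
  simp only [← Category.assoc] at e ⊢
  rw [e]
  simp

end Abstract

variable {B : Type u} [Bicategory.{v, v} B] {T : Pseudomonad B}

open LaxAlg LocallyFull

/-- The free pseudoalgebra. -/
def freePs (T : Pseudomonad B) (X : B) : PsTAlg T := ⟨free T X, isPseudoAlg_free X⟩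

/-- A pseudomorphism of pseudoalgebras, as a 1-cell of `Ps-T-Alg`. -/
def psHom {y z : PsTAlg T} (f : y.obj ⟶ z.obj) (hf : IsPseudoMor T f) : y ⟶ z :=
    LocallyFull.Hom.mk f hf

/-- The free map, as a 1-cell of `Ps-T-Alg`. -/
def freePsMap {X Y : B} (k : X ⟶ Y) : freePs T X ⟶ freePs T Y :=
  psHom (freeMap k) (isPseudoMor_freeMap k)

/-- The structure map of a free algebra, as a 1-cell of `Ps-T-Alg`. -/
def freePsAct (T : Pseudomonad B) (X : B) : freePs T (T.T.obj X) ⟶ freePs T X :=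
  psHom (actHom (free T X)) (isPseudoMor_actHom (isPseudoAlg_free X))

/-- The resolution of a lax algebra by free algebras. -/
def resolution (y : LaxAlg T) : CoherenceData (PsTAlg T)ᵒᵖ where
  one := op (freePs T y.carrier)
  two := op (freePs T (T.T.obj y.carrier))
  three := op (freePs T (T.T.obj (T.T.obj y.carrier)))
  d0 := (freePsMap y.act).op
  d1 := (freePsAct T y.carrier).op
  s0 := (freePsMap (T.ηApp y.carrier)).op
  e0 := (freePsMap (T.T.map y.act)).op
  e1 := (freePsMap (T.mApp y.carrier)).op
  e2 := (freePsAct T (T.T.obj y.carrier)).op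
  σ00 := op2 (mk₂ (freePsMap (T.T.map y.act) ≫ freePsMap y.act)
    (freePsMap (T.mApp y.carrier) ≫ freePsMap y.act) (multTrans y))
  -- Passing to the opposite reverses composition of 1-cells but not the direction of 2-cells, which
  -- is why the inverses of naturality and associativity occur here.
  σ20 := op2 (mk₂ (freePsAct T (T.T.obj y.carrier) ≫ freePsMap y.act)
    (freePsMap (T.T.map y.act) ≫ freePsAct T y.carrier) (mNatTrans y.act).inv)
  σ21 := op2 (mk₂ (freePsAct T (T.T.obj y.carrier) ≫ freePsAct T y.carrier)
    (freePsMap (T.mApp y.carrier) ≫ freePsAct T y.carrier) (μTrans y.carrier).inv)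
  n0 := op2 (mk₂ (𝟙 _) (freePsMap (T.ηApp y.carrier) ≫ freePsMap y.act) (unitTrans y))
  n1 := op2 (mk₂ (𝟙 _) (freePsMap (T.ηApp y.carrier) ≫ freePsAct T y.carrier)
    (tauTrans y.carrier).hom)

variable {y : LaxAlg T} {z : PsTAlg T}

/-- The underlying 2-cell of descent data. -/
def unDescent {F : freePs T y.carrier ⟶ z} (ϑ : freePsAct T y.carrier ≫ F ⟶ freePsMap y.act ≫ F) :
    actHom (free T y.carrier) ≫ un F ⟶ freeMap y.act ≫ un F := un₂ ϑ

theorem isDescent_iff {F : freePs T y.carrier ⟶ z}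
    (ϑ : freePsAct T y.carrier ≫ F ⟶ freePsMap y.act ≫ F) :
    (resolution y).IsDescent F.op (op2 ϑ) ↔
      DescentAssoc (unDescent ϑ) ∧ DescentId (unDescent ϑ) := by
  have h₁ := descent_assoc_regroup_iff (unDescent ϑ) (multTrans y) (mNatTrans y.act).inv
    (μTrans y.carrier).inv
  have h₂ := descent_unit_regroup_iff (unDescent ϑ) (unitTrans y) (tauTrans y.carrier).hom
  constructor
  · intro h
    exact ⟨h₁.1 (congrArg (fun t => un₂ (Hom2.unop2 t)) h.assoc),
      h₂.1 (congrArg (fun t => un₂ (Hom2.unop2 t)) h.unit)⟩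
  · intro h
    exact ⟨congrArg op2 (LocallyFull.hom₂_ext (h₁.2 h.1)),
      congrArg op2 (LocallyFull.hom₂_ext (h₂.2 h.2))⟩

/-- The lax morphism given by descent data in `Ps-T-Alg`. -/
def psLower (F : freePs T y.carrier ⟶ z) (ϑ : freePsAct T y.carrier ≫ F ⟶ freePsMap y.act ≫ F)
    (h : (resolution y).IsDescent F.op (op2 ϑ)) : y ⟶ z.obj :=
  lower z.property (LocallyFull.Hom.property F) (unDescent ϑ) ((isDescent_iff ϑ).1 h).1
    ((isDescent_iff ϑ).1 h).2

section

variable {F F' : freePs T y.carrier ⟶ z} {ϑ : freePsAct T y.carrier ≫ F ⟶ freePsMap y.act ≫ F}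
  {ϑ' : freePsAct T y.carrier ≫ F' ⟶ freePsMap y.act ≫ F'}
  {h : (resolution y).IsDescent F.op (op2 ϑ)} {h' : (resolution y).IsDescent F'.op (op2 ϑ')}

/-- The `T`-transformation given by a 2-cell compatible with descent data. -/
def psLowerMap (γ : F ⟶ F') (hγ : ϑ ≫ freePsMap y.act ◁ γ = freePsAct T y.carrier ◁ γ ≫ ϑ') :
    psLower F ϑ h ⟶ psLower F' ϑ' h' :=
  lowerMap (un₂ γ) (congrArg un₂ hγ.symm)

theorem exists_eq_psLowerMap (s : psLower F ϑ h ⟶ psLower F' ϑ' h') :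
    ∃ (γ : F ⟶ F') (hγ : ϑ ≫ freePsMap y.act ◁ γ = freePsAct T y.carrier ◁ γ ≫ ϑ'),
      s = psLowerMap γ hγ := by
  obtain ⟨γ, hγ, e⟩ := exists_eq_lowerMap s
  exact ⟨mk₂ F F' γ, LocallyFull.hom₂_ext hγ.symm, e⟩

theorem psLowerMap_injective {γ γ' : F ⟶ F'}
    {hγ : ϑ ≫ freePsMap y.act ◁ γ = freePsAct T y.carrier ◁ γ ≫ ϑ'}
    {hγ' : ϑ ≫ freePsMap y.act ◁ γ' = freePsAct T y.carrier ◁ γ' ≫ ϑ'}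
    (e : (psLowerMap γ hγ : psLower F ϑ h ⟶ psLower F' ϑ' h') = psLowerMap γ' hγ') : γ = γ' :=
  LocallyFull.hom₂_ext (lowerMap_injective e)

theorem compatible_inv {C : Type u} [Bicategory.{w, v} C] {a b d : C} {f g : a ⟶ b} {F F' : b ⟶ d}
    {ϑ : f ≫ F ⟶ g ≫ F} {ϑ' : f ≫ F' ⟶ g ≫ F'} (i : F ≅ F')
    (h : ϑ ≫ g ◁ i.hom = f ◁ i.hom ≫ ϑ') : ϑ' ≫ g ◁ i.inv = f ◁ i.inv ≫ ϑ := by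
  rw [← cancel_epi (f ◁ i.hom), ← reassoc_of% h]
  simp

/-- The isomorphism given by an invertible 2-cell compatible with descent data. -/
def psLowerIso (i : F ≅ F')
    (hi : ϑ ≫ freePsMap y.act ◁ i.hom = freePsAct T y.carrier ◁ i.hom ≫ ϑ') :
    psLower F ϑ h ≅ psLower F' ϑ' h' where
  hom := psLowerMap i.hom hi
  inv := psLowerMap i.inv (compatible_inv i hi)
  hom_inv_id := LaxAlg.hom₂_ext ((whiskerLeft_comp _ _ _).symm.trans
    ((congrArg (fun s => T.ηApp y.carrier ◁ Hom₂.base (un₂ s)) i.hom_inv_id).trans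
      (whiskerLeft_id _ _)))
  inv_hom_id := LaxAlg.hom₂_ext ((whiskerLeft_comp _ _ _).symm.trans
    ((congrArg (fun s => T.ηApp y.carrier ◁ Hom₂.base (un₂ s)) i.inv_hom_id).trans
      (whiskerLeft_id _ _)))

theorem isPseudoMor_psLower (hϑ : IsIso ϑ) : IsPseudoMor T (psLower F ϑ h) := by
  refine isPseudoMor_lower ?_
  exact ⟨un₂ (inv ϑ), congrArg un₂ (IsIso.hom_inv_id ϑ), congrArg un₂ (IsIso.inv_hom_id ϑ)⟩

end

/-- Compatibility of lowering with composition. -/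
def psLowerComp {z' : PsTAlg T} {F : freePs T y.carrier ⟶ z}
    {ϑ : freePsAct T y.carrier ≫ F ⟶ freePsMap y.act ≫ F}
    (h : (resolution y).IsDescent F.op (op2 ϑ)) (k : z ⟶ z')
    {ϑ' : freePsAct T y.carrier ≫ F ≫ k ⟶ freePsMap y.act ≫ F ≫ k}
    (h' : (resolution y).IsDescent (F ≫ k).op (op2 ϑ'))
    (e : ϑ' = (α_ _ _ _).inv ≫ ϑ ▷ k ≫ (α_ _ _ _).hom) :
    psLower F ϑ h ≫ un k ≅ psLower (F ≫ k) ϑ' h' :=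
  lowerComp (un k) (congrArg un₂ e)

/-- Translates whiskering of the lowered morphism into whiskering of the leg `F`, the operation
controlled by the comparison functor. -/
theorem whiskerLeft_psLower {z' : PsTAlg T} {F : freePs T y.carrier ⟶ z}
    {ϑ : freePsAct T y.carrier ≫ F ⟶ freePsMap y.act ≫ F}
    {h : (resolution y).IsDescent F.op (op2 ϑ)} {k k' : z ⟶ z'} (t : k ⟶ k')
    {ϑ₁ : freePsAct T y.carrier ≫ F ≫ k ⟶ freePsMap y.act ≫ F ≫ k}
    {h₁ : (resolution y).IsDescent (F ≫ k).op (op2 ϑ₁)}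
    {ϑ₂ : freePsAct T y.carrier ≫ F ≫ k' ⟶ freePsMap y.act ≫ F ≫ k'}
    {h₂ : (resolution y).IsDescent (F ≫ k').op (op2 ϑ₂)}
    (e₁ : ϑ₁ = (α_ _ _ _).inv ≫ ϑ ▷ k ≫ (α_ _ _ _).hom)
    (e₂ : ϑ₂ = (α_ _ _ _).inv ≫ ϑ ▷ k' ≫ (α_ _ _ _).hom)
    (hγ : ϑ₁ ≫ freePsMap y.act ◁ F ◁ t = freePsAct T y.carrier ◁ F ◁ t ≫ ϑ₂) :
    psLower F ϑ h ◁ un₂ t = (psLowerComp h k h₁ e₁).hom ≫ psLowerMap (F ◁ t) hγ ≫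
      (psLowerComp h k' h₂ e₂).inv :=
  LaxAlg.hom₂_ext (comp_whiskerLeft _ _ _)

theorem exists_iso_psLower (f : y ⟶ z.obj) :
    ∃ (F : freePs T y.carrier ⟶ z) (ϑ : freePsAct T y.carrier ≫ F ⟶ freePsMap y.act ≫ F)
      (h : (resolution y).IsDescent F.op (op2 ϑ)), Nonempty (f ≅ psLower F ϑ h) ∧
        (IsPseudoMor T f → IsIso ϑ) := by
  obtain ⟨F, hF, ϑ, h, h', e, hf⟩ := exists_iso_lower z.property f
  refine ⟨psHom F hF, mk₂ _ _ ϑ, (isDescent_iff _).2 ⟨h, h'⟩, e, fun hf' => ?_⟩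
  obtain ⟨⟨ψ, h₁, h₂⟩⟩ := hf hf'
  exact ⟨mk₂ _ _ ψ, LocallyFull.hom₂_ext h₁, LocallyFull.hom₂_ext h₂⟩

/-- The universal arrow is the lax morphism lowered from the descent datum of the universal cocone.
Through `psLowerComp` and `psLowerMap`, whiskering with it corresponds to whiskering the leg, so its
universal property is that of the comparison functor. For `inv = true` the descent cell is
invertible, and everything restricts to pseudomorphisms. -/
theorem exists_universal [Strict B] {inv : Bool} (y : LaxAlg T)
    (H : HasWeightedBicolimit (dotWeight.{v} inv) (resolution y).diagram.toPseudofunctor) :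
    ∃ (C : PsTAlg T) (U : y ⟶ C.obj), (inv = true → IsPseudoMor T U) ∧
      (∀ {a : PsTAlg T} (h k : C ⟶ a), Function.Bijective (fun t : h ⟶ k => U ◁ un₂ t)) ∧
      ∀ {a : PsTAlg T} (f : y ⟶ a.obj), (inv = true → IsPseudoMor T f) →
        ∃ h : C ⟶ a, Nonempty (f ≅ U ≫ un h) := by
  obtain ⟨C, l, hl⟩ := H
  have hd : ∀ {X : PsTAlg T} (l : dotWeight.{v} inv ⟶
      homInto (resolution y).diagram.toPseudofunctor X),
      (resolution y).IsDescent (leg l).op (op2 (legCell l)) := fun l => (toCocone l).isDescent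
  -- By interchange, any 2-cell `leg l ◁ t` is compatible with the whiskered descent cells.
  have hc : ∀ {a : PsTAlg T} {h k : C ⟶ a} (t : h ⟶ k), legCell (l ≫ homIntoMap _ h) ≫
      freePsMap y.act ◁ leg l ◁ t =
        freePsAct T y.carrier ◁ leg l ◁ t ≫ legCell (l ≫ homIntoMap _ k) := fun t =>
    (congrArg (· ≫ _) (legCell_comp l _)).trans ((compatible_whiskerLeft (legCell l) t).symm.trans
      (congrArg (_ ≫ ·) (legCell_comp l _)).symm)
  have hw : ∀ {a : PsTAlg T} {h k : C ⟶ a} (t : h ⟶ k),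
      psLower (leg l) (legCell l) (hd l) ◁ un₂ t =
        (psLowerComp (hd l) h (hd (l ≫ homIntoMap _ h)) (legCell_comp l h)).hom ≫
          psLowerMap (leg l ◁ t) (hc t) ≫
            (psLowerComp (hd l) k (hd (l ≫ homIntoMap _ k)) (legCell_comp l k)).inv := fun t =>
    whiskerLeft_psLower t _ _ _
  refine ⟨C, psLower (leg l) (legCell l) (hd l), fun h => isPseudoMor_psLower (legCell_isIso l h),
    fun {a} h k => ⟨fun t t' e => ?_, fun s => ?_⟩, fun {a} f hf => ?_⟩
  · have e' := ((hw t).symm.trans e).trans (hw t')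
    exact (existsUnique_of_compatible (hl a) (leg l ◁ t') (hc t')).unique
      (psLowerMap_injective (conj_injective _ _ e')) rfl
  -- Conjugated by the composition isomorphisms, `s` lies between lowered morphisms; it therefore
  -- comes from a compatible `γ`, which is in turn a whiskering of the leg.
  · obtain ⟨γ, hγ, e⟩ := exists_eq_psLowerMap
      ((psLowerComp (hd l) h (hd (l ≫ homIntoMap _ h)) (legCell_comp l h)).inv ≫ s ≫
        (psLowerComp (hd l) k (hd (l ≫ homIntoMap _ k)) (legCell_comp l k)).hom)
    obtain ⟨t, ht, -⟩ := existsUnique_of_compatible (hl a) γ hγ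
    subst ht
    exact ⟨t, (hw t).trans (conj_eq _ _ e)⟩
  -- Up to isomorphism `f` is lowered from a descent datum, and this datum factors through the leg.
  · obtain ⟨F, ϑ, hϑ, ⟨e⟩, hi⟩ := exists_iso_psLower f
    obtain ⟨h, i, hc⟩ := exists_of_isDescent (hl a) F ϑ hϑ (fun h => hi (hf h))
    exact ⟨h, ⟨e ≪≫ (psLowerIso (h := hd (l ≫ homIntoMap _ h)) i hc).symm ≪≫
      (psLowerComp (hd l) h (hd (l ≫ homIntoMap _ h)) (legCell_comp l h)).symm⟩⟩

theorem hasLeftBiadjoint_psToLaxLax [Strict B] (H : HasLaxCodescentObjects (PsTAlg T)) :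
    HasLeftBiadjoint (psToLaxLax T) := by
  refine Comma.hasLeftBiadjoint_of_isUniversal (fun y => ?_)
  obtain ⟨C, U, -, h, h'⟩ := exists_universal y (H (resolution y).diagram)
  -- For lax codescent objects the condition on `f` is vacuous.
  exact ⟨C, U, h, fun f => h' f (fun e => nomatch e)⟩

theorem hasLeftBiadjoint_psToLax [Strict B] (H : HasCodescentObjects (PsTAlg T)) :
    HasLeftBiadjoint (psToLax T) := by
  refine Comma.hasLeftBiadjoint_of_isUniversal (fun y => ?_)
  obtain ⟨C, U, hU, h, h'⟩ := exists_universal y.obj (H (resolution y.obj).diagram)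
  -- Here `U` is a pseudomorphism, and since the sub-2-category is locally full its universal
  -- property restricts to pseudomorphisms.
  refine ⟨C, LocallyFull.Hom.mk U (hU rfl), fun k k' => ⟨fun t t' e => ?_, fun s => ?_⟩,
      fun f => ?_⟩
  · exact (h k k').1 (congrArg un₂ e)
  · obtain ⟨t, ht⟩ := (h k k').2 (un₂ s)
    exact ⟨t, LocallyFull.hom₂_ext ht⟩
  · obtain ⟨k, ⟨e⟩⟩ := h' (un f) (fun _ => LocallyFull.Hom.property f)
    exact ⟨k, ⟨LocallyFull.isoMk _ _ e⟩⟩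

end Resolution
end LaxCoh

theorem mainTheorem6 {B : Type u} [CategoryTheory.Bicategory.{v, v} B]
    [CategoryTheory.Bicategory.Strict B] (T : LaxCoh.Pseudomonad B) :
    (LaxCoh.HasLaxCodescentObjects (LaxCoh.PsTAlg T) →
      LaxCoh.HasLeftBiadjoint (LaxCoh.psToLaxLax T)) ∧
    (LaxCoh.HasCodescentObjects (LaxCoh.PsTAlg T) →
      LaxCoh.HasLeftBiadjoint (LaxCoh.psToLax T)) :=
  ⟨LaxCoh.hasLeftBiadjoint_psToLaxLax, LaxCoh.hasLeftBiadjoint_psToLax⟩
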